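/- Let $s(N)\in(N,\infty]$ for every $N\ge 0$, and assume that $\lambda=\lim_{N\to\infty}N/s(N)$ exists (with $N/\infty=0$). Write $s=s(N)$ and $w(z)=\max\{1,|z|\}^{-s}$, where for $s=\infty$ the power $r^{-\infty}$ ($r\ge1$) is $1$ if $r=1$ and $0$ if $r>1$. **Random polynomials.** A random polynomial of degree $N$ is $z^N+\sum_{n<N}b_nz^n$, $b\in\mathbb R^N$, where $b$ has density proportional to $M(b)^{-s}$ with respect to Lebesgue measure, $M(b)$ being the Mahler measure of the polynomial. **The kernel $\mathbf K_N$.** Put $\langle f|g\rangle=\iint_{\mathbb R^2}w(x)w(y)f(x)g(y)\,\mathrm{sgn}(y-x)\,dx\,dy-2i\int_{\mathbb C}w(z)^2\overline{f(z)}g(z)\,\mathrm{sgn}(\mathrm{Im}\,z)\,d\mu_{\mathbb C}(z)$ and $U=[\langle z^m|z^n\rangle]_{0\le m,n<N}$, $\sigma=[\int_{\mathbb R}w(x)x^m\,dx]_{0\le m<N}$. If $N$ is even let $\mu=U^{-1}$ and $\nu=0$; if $N$ is odd let $\mu$ and $\nu$ be the upper left $N\times N$ block and the upper part of the last column of the inverse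 of $\begin{bmatrix}U&\sigma\\-\sigma^{\mathsf T}&0\end{bmatrix}$. Set $$\varkappa_N(u,v)=-2\,w(u)w(v)\sum_{m,n<N}\mu_{m,n}u^mv^n,\qquad \beta_N(u)=-w(u)\sum_{m<N}\nu_mu^m .$$ Let $\iota(z)=i\,\mathrm{sgn}(\mathrm{Im}\,z)$, let $\chi_{\mathbb R}$ be the characteristic function of $\mathbb R$, let $\mathrm{sgn}(u-v)$ be $0$ if $u$ or $v$ is non-real, and let $\epsilon f(u)=\frac12\int_{\mathbb R}f(t)\,\mathrm{sgn}(t-u)\,dt$ for $u\in\mathbb R$, $\epsilon f(u)=\iota(u)f(\overline u)$ for $u\notin\mathbb R$; $\epsilon$ written on the left (right) of $\varkappa_N$ acts on the first (second) variable. The matrix kernel of the Pfaffian point process of the roots is $$\mathbf K_N(u,v)=\begin{bmatrix}\varkappa_N(u,v)&\varkappa_N\epsilon(u,v)+\beta_N(u)\chi_{\mathbb R}(v)\\ \epsilon\varkappa_N(u,v)-\beta_N(v)\chi_{\mathbb R}(u)&\epsilon\varkappa_N\epsilon(u,v)+\epsilon\beta_N(u)\chi_{\mathbb R}(v)-\epsilon\beta_N(v)\chi_{\mathbb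 R}(u)+\frac12\mathrm{sgn}(u-v)\end{bmatrix}.$$ **The limit.** For an antisymmetric function $A$, with $D$ on the left (right) of $A$ denoting differentiation in the first (second) variable, and for $x,y$ real and $z,w$ non-real, let $$\mathbf K[A](x,y)=\begin{bmatrix}DAD(x,y)&-DA(x,y)\\-AD(x,y)&A(x,y)+\frac12\mathrm{sgn}(x-y)\end{bmatrix},\quad \mathbf K[A](z,y)=\begin{bmatrix}DAD(z,y)&-DA(z,y)\\ \iota(z)DAD(\overline z,y)&-\iota(z)DA(\overline z,y)\end{bmatrix},$$ $$\mathbf K[A](y,z)=-\mathbf K[A](z,y)^{\mathsf T},\quad \mathbf K[A](z,w)=\begin{bmatrix}DAD(z,w)&\iota(w)DAD(z,\overline w)\\ \iota(z)DAD(\overline z,w)&\iota(z)\iota(w)DAD(\overline z,\overline w)\end{bmatrix}.$$ For $u,v$ in the open unit disk $\mathbb D$ set $$A_{\mathbb D}(u,v)=\frac1{4\pi}\int_{\mathbb T}\frac{\big(v\sqrt{-\tau}-u\sqrt{-\overline\tau}\big)\,|d\tau|}{(1-u^2\overline\tau)^{1/2}(1-v^2\tau)^{1/2}},$$ where $\mathbb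 T$ is the unit circle and all roots are principal branches; thus $\sqrt{-\tau}$ has the Fourier series $-\frac2\pi\sum_{m\in\mathbb Z}\frac{\tau^m}{2m-1}$ on $\mathbb T$. **Theorem.** (i) $\lim_{N\to\infty}\mathbf K_N(u,v)=\mathbf K[A_{\mathbb D}](u,v)$ locally uniformly on $\mathbb D\times\mathbb D$. (ii) For every Borel set $B$ with non-empty interior and closure contained in $\mathbb D$ (in particular for every non-empty open set with closure contained in $\mathbb D$), the expected number of roots in $B$ of a random polynomial of degree $N$ converges, as $N\to\infty$, to a finite positive limit. -/

import Mathlib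

open Filter Topology MeasureTheory Polynomial
open scoped ENNReal ComplexConjugate

noncomputable section

namespace RealMahler

/-! ### The ensemble of random polynomials -/

/-- `r ^ (-s)` for `r ≥ 1` and `s ∈ (0, ∞]`; for `s = ∞` this is the indicator of `r ≤ 1`. -/
def invPow (s : ℝ≥0∞) (r : ℝ) : ℝ :=
  open Classical in if s = ⊤ then (if r ≤ 1 then 1 else 0) else r ^ (-s.toReal)

/-- The monic polynomial `z ^ N + ∑ n < N, b n * z ^ n` with real coefficients, regarded as a
complex polynomial. -/
def monicPoly {N : ℕ} (b : Fin N → ℝ) : ℂ[X] :=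
  (X ^ N + ∑ n : Fin N, C (b n) * X ^ (n : ℕ) : ℝ[X]).map (algebraMap ℝ ℂ)

/-- The unnormalised density `M(b) ^ (-s)`, `M` the Mahler measure, on coefficient vectors. -/
def density (N : ℕ) (s : ℝ≥0∞) (b : Fin N → ℝ) : ℝ≥0∞ :=
  ENNReal.ofReal (invPow s (monicPoly b).mahlerMeasure)

/-- The law of a random polynomial of degree `N`: its coefficient vector has density
`M(b) ^ (-s) / F(s)` with respect to Lebesgue measure, `F(s) = ∫ M(b) ^ (-s) db`. -/
def polyLaw (N : ℕ) (s : ℝ≥0∞) : Measure (Fin N → ℝ) :=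
  (∫⁻ b, density N s b)⁻¹ • (volume : Measure (Fin N → ℝ)).withDensity (density N s)

/-- The number of complex roots in `B` (real and non-real), with multiplicity. -/
def rootCount {N : ℕ} (B : Set ℂ) (b : Fin N → ℝ) : ℕ :=
  open Classical in Multiset.card ((monicPoly b).roots.filter (· ∈ B))

/-- The expected number of roots in `B` of a random polynomial of degree `N`. -/
def expectedRoots (N : ℕ) (s : ℝ≥0∞) (B : Set ℂ) : ℝ≥0∞ :=
  ∫⁻ b, (rootCount B b : ℝ≥0∞) ∂(polyLaw N s)

/-! ### The matrix kernel -/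

/-- The weight `max {1, |z|} ^ (-s)`. -/
def weight (s : ℝ≥0∞) (z : ℂ) : ℝ := invPow s (max 1 ‖z‖)

/-- `⟨f | g⟩_ℝ = ∬ max{1,|x|}^(-s) max{1,|y|}^(-s) f(x) g(y) sgn(y - x) dx dy`. -/
def skewReal (s : ℝ≥0∞) (f g : ℂ → ℂ) : ℂ :=
  ∫ x : ℝ, ∫ y : ℝ, (weight s x * weight s y : ℝ) * f x * g y * (Real.sign (y - x) : ℝ)

/-- `⟨f | g⟩_ℂ = -2i ∫ max{1,|z|}^(-2s) conj(f(z)) g(z) sgn(Im z) dμ_ℂ(z)`. -/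
def skewComplex (s : ℝ≥0∞) (f g : ℂ → ℂ) : ℂ :=
  -2 * Complex.I * ∫ z : ℂ, (weight s z ^ 2 : ℝ) * conj (f z) * g z * (Real.sign z.im : ℝ)

/-- The matrix `U` of the skew-symmetric form `⟨·|·⟩_ℝ + ⟨·|·⟩_ℂ` on `1, z, …, z^(N-1)`. -/
def skewGram (N : ℕ) (s : ℝ≥0∞) : Matrix (Fin N) (Fin N) ℂ :=
  Matrix.of fun m n => skewReal s (fun z => z ^ (m : ℕ)) (fun z => z ^ (n : ℕ)) +
    skewComplex s (fun z => z ^ (m : ℕ)) (fun z => z ^ (n : ℕ))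

/-- The weighted monomial `z ^ m * max{1,|z|}^(-s)`. -/
def wMon (s : ℝ≥0∞) (m : ℕ) (z : ℂ) : ℂ := z ^ m * (weight s z : ℝ)

/-- The matrix used when `N` is odd: `U` bordered by the integrals over `ℝ` of the weighted
monomials. -/
def borderedGram (N : ℕ) (s : ℝ≥0∞) : Matrix (Fin N ⊕ Unit) (Fin N ⊕ Unit) ℂ :=
  Matrix.fromBlocks (skewGram N s)
    (Matrix.of fun m _ => ∫ x : ℝ, wMon s m x)
    (Matrix.of fun _ m => -∫ x : ℝ, wMon s m x) 0

/-- The coefficients `μ_{m,n}` of the kernel: the entries of `U⁻¹` for even `N`, and of the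
`N × N` block of the inverse of the bordered matrix for odd `N`. -/
def coeff (N : ℕ) (s : ℝ≥0∞) (m n : Fin N) : ℂ :=
  if Even N then (skewGram N s)⁻¹ m n else (borderedGram N s)⁻¹ (Sum.inl m) (Sum.inl n)

/-- The border coefficients: absent for even `N`, the last column of the inverse of the bordered
matrix for odd `N`. -/
def borderCoeff (N : ℕ) (s : ℝ≥0∞) (m : Fin N) : ℂ :=
  if Even N then 0 else (borderedGram N s)⁻¹ (Sum.inl m) (Sum.inr ())

/-- `ι(z) = i sgn(Im z)`. -/
def iota (z : ℂ) : ℂ := Complex.I * (Real.sign z.im : ℝ)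

/-- The operator `ε`: `½ ∫ f(t) sgn(t - u) dt` at real `u`, and `i sgn(Im u) f(ū)` at
non-real `u`. -/
def eps (f : ℂ → ℂ) (u : ℂ) : ℂ :=
  if u.im = 0 then (1 / 2) * ∫ t : ℝ, f t * (Real.sign (t - u.re) : ℝ)
  else iota u * f (conj u)

/-- `ϰ_N(u,v) = -2 max{1,|u|}^(-s) max{1,|v|}^(-s) ∑ μ_{m,n} u^m v^n`. -/
def kappa (N : ℕ) (s : ℝ≥0∞) (u v : ℂ) : ℂ :=
  -2 * ∑ m : Fin N, ∑ n : Fin N, coeff N s m n * wMon s m u * wMon s n v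

/-- The function `-∑ ν_m z^m max{1,|z|}^(-s)`, with `ν` the border coefficients. It is zero for
even `N`. For odd `N = 2J + 1` it equals `π̃_{2J} / s_{2J}`, where `π̃_{2J}` is the last weighted
skew-orthogonal polynomial and `s_{2J}` is its integral over `ℝ`. -/
def border (N : ℕ) (s : ℝ≥0∞) (z : ℂ) : ℂ :=
  -∑ m : Fin N, borderCoeff N s m * wMon s m z

/-- The characteristic function of `ℝ`. -/
def chiReal (z : ℂ) : ℂ := if z.im = 0 then 1 else 0

/-- `sgn(u - v)`, taken to be `0` if `u` or `v` is non-real. -/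
def sgnDiff (u v : ℂ) : ℂ := if u.im = 0 ∧ v.im = 0 then (Real.sign (u.re - v.re) : ℝ) else 0

/-- The matrix kernel `K_N` of the Pfaffian point process of the roots.
For even `N` the border terms vanish and this is
`[[ϰ, ϰε], [εϰ, εϰε + ½ sgn(u - v)]]`.
For odd `N = 2J + 1`, let `π_0, …, π_{2J}` be skew-orthonormal polynomials with
`∫ π̃_{2j} = s_{2j}` and `∫ π̃_{2j+1} = 0`. In that basis the bordered matrix is explicitly
invertible, and one finds that `ϰ_N(u,v)` is
`2 ∑_{j<J} [π̃_{2j}(u) π̃_{2j+1}(v) - π̃_{2j}(v) π̃_{2j+1}(u)]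
  - 2 ∑_{j<J} (s_{2j}/s_{2J}) [π̃_{2J}(u) π̃_{2j+1}(v) - π̃_{2J}(v) π̃_{2j+1}(u)]`,
while the `(1,2)` entry has the extra term `π̃_{2J}(u) χ_ℝ(v) / s_{2J}` and the `(2,2)` entry the
extra term `(επ̃_{2J}(u) χ_ℝ(v) - επ̃_{2J}(v) χ_ℝ(u)) / s_{2J}`. -/
def kernel (N : ℕ) (s : ℝ≥0∞) (u v : ℂ) : Matrix (Fin 2) (Fin 2) ℂ :=
  !![kappa N s u v,
     eps (fun b => kappa N s u b) v + border N s u * chiReal v;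
     eps (fun a => kappa N s a v) u - border N s v * chiReal u,
     eps (fun a => eps (fun b => kappa N s a b) v) u
       + (eps (border N s) u * chiReal v - eps (border N s) v * chiReal u)
       + 1 / 2 * sgnDiff u v]

/-! ### The limiting kernel -/

/-- `DA`: derivative with respect to the first variable. -/
def derivLeft (A : ℂ → ℂ → ℂ) (u v : ℂ) : ℂ := deriv (fun a => A a v) u

/-- `AD`: derivative with respect to the second variable. -/
def derivRight (A : ℂ → ℂ → ℂ) (u v : ℂ) : ℂ := deriv (fun b => A u b) v

/-- `DAD`: derivative with respect to both variables. -/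
def derivBoth (A : ℂ → ℂ → ℂ) : ℂ → ℂ → ℂ := derivLeft (derivRight A)

/-- `K[A](z,y)` for non-real `z` and real `y`. -/
def mixedKernel (A : ℂ → ℂ → ℂ) (z y : ℂ) : Matrix (Fin 2) (Fin 2) ℂ :=
  !![derivBoth A z y, -derivLeft A z y;
     iota z * derivBoth A (conj z) y, -iota z * derivLeft A (conj z) y]

/-- The matrix kernel `K[A]` built from an antisymmetric function `A`. -/
def kernelOf (A : ℂ → ℂ → ℂ) (u v : ℂ) : Matrix (Fin 2) (Fin 2) ℂ :=
  if u.im = 0 then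
    if v.im = 0 then
      !![derivBoth A u v, -derivLeft A u v;
         -derivRight A u v, A u v + 1 / 2 * sgnDiff u v]
    else -(mixedKernel A v u).transpose
  else
    if v.im = 0 then mixedKernel A u v
    else
      !![derivBoth A u v, iota v * derivBoth A u (conj v);
         iota u * derivBoth A (conj u) v, iota u * iota v * derivBoth A (conj u) (conj v)]

/-- `√(-τ)`, principal branch. On the unit circle its Fourier series is
`-(2/π) ∑ τ^m / (2m - 1)`, see `sqrtNeg_fourier`. -/
def sqrtNeg (τ : ℂ) : ℂ := (-τ) ^ (1 / 2 : ℂ)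

/-- The point `e^{iθ}` of the unit circle. -/
def circ (θ : ℝ) : ℂ := Complex.exp (θ * Complex.I)

/-- `A_𝔻(u,v) = (4π)⁻¹ ∫_𝕋 (v √(-τ) - u √(-τ̄)) (1 - u² τ̄)^(-1/2) (1 - v² τ)^(-1/2) |dτ|`,
with principal branches. -/
def diskA (u v : ℂ) : ℂ :=
  1 / (4 * Real.pi) * ∫ θ in (0 : ℝ)..(2 * Real.pi),
    (v * sqrtNeg (circ θ) - u * sqrtNeg (conj (circ θ))) /
      ((1 - u ^ 2 * conj (circ θ)) ^ (1 / 2 : ℂ) * (1 - v ^ 2 * circ θ) ^ (1 / 2 : ℂ))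

theorem sqrtNeg_circ {θ : ℝ} (h : θ ∈ Set.Ioc 0 (2 * Real.pi)) :
    sqrtNeg (circ θ) = Complex.exp (((θ - Real.pi) / 2 : ℝ) * Complex.I) := by
  have h1 : -circ θ = Complex.exp ((θ - Real.pi : ℝ) * Complex.I) := by
    rw [circ]; push_cast
    rw [sub_mul, Complex.exp_sub, Complex.exp_pi_mul_I]; ring
  have h2 : Complex.log (Complex.exp ((θ - Real.pi : ℝ) * Complex.I))
      = (θ - Real.pi : ℝ) * Complex.I := by
    apply Complex.log_exp <;> simp <;> linarith [h.1, h.2]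
  rw [sqrtNeg, h1, Complex.cpow_def_of_ne_zero (Complex.exp_ne_zero _), h2]
  congr 1; push_cast; ring

/-- The Fourier coefficients of `√(-τ)`. -/
theorem sqrtNeg_fourier (m : ℤ) :
    1 / (2 * Real.pi) * ∫ θ in (0 : ℝ)..(2 * Real.pi), sqrtNeg (circ θ) * circ θ ^ (-m)
      = -(2 / Real.pi) / (2 * m - 1) := by
  have hm : (2 * m - 1 : ℂ) ≠ 0 := by
    have : (2 * m - 1 : ℤ) ≠ 0 := by omega
    exact_mod_cast this
  have hpi : (Real.pi : ℂ) ≠ 0 := by exact_mod_cast Real.pi_ne_zero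
  have hI := Complex.I_ne_zero
  set c : ℂ := (1 / 2 - m) * Complex.I with hc
  have hc0 : c ≠ 0 := by
    rw [hc]; refine mul_ne_zero ?_ hI
    intro h; apply hm; linear_combination -2 * h
  have h1 : ∫ θ in (0 : ℝ)..(2 * Real.pi), sqrtNeg (circ θ) * circ θ ^ (-m)
      = ∫ θ in (0 : ℝ)..(2 * Real.pi), (-Complex.I) * Complex.exp (c * θ) := by
    apply intervalIntegral.integral_congr_ae
    refine Eventually.of_forall fun θ hθ => ?_
    rw [Set.uIoc_of_le (by positivity)] at hθ
    rw [sqrtNeg_circ hθ, circ, ← Complex.exp_int_mul, ← Complex.exp_neg_pi_div_two_mul_I,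
      ← Complex.exp_add, ← Complex.exp_add]
    congr 1; rw [hc]; push_cast; ring
  have h2 : Complex.exp (c * (2 * Real.pi : ℝ)) = -1 := by
    have : c * (2 * Real.pi : ℝ) = Real.pi * Complex.I - m * (2 * Real.pi * Complex.I) := by
      rw [hc]; push_cast; ring
    rw [this, Complex.exp_sub, Complex.exp_pi_mul_I, Complex.exp_int_mul_two_pi_mul_I]; simp
  rw [h1, intervalIntegral.integral_const_mul, integral_exp_mul_complex hc0, h2]
  simp only [Complex.ofReal_zero, mul_zero, Complex.exp_zero]
  have h3 : c = -((2 * m - 1) / 2) * Complex.I := by rw [hc]; ring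
  rw [h3]
  field_simp
  ring

end RealMahler

end

/-! Put t = 1/s. The skew form pairs monomials of opposite parity only. Its real and complex parts
are untidy separately, but their sum collapses to ⟨z^(2j) | z^(2k+1)⟩ =
4/((2j+1)(1-(2k+2)t)(2k+1-2j)) (`skew_monomial`). Thus U is, up to diagonal factors, a Cauchy matrix
with nodes at the even and the odd integers. Partial fractions at 0, 2, 4, … invert it explicitly;
for odd N the border is absorbed by an extra factor 1-(x+1)t in the interpolated polynomial. The
entries of the inverse are products of the numbers cb n = binom(2n,n)/4^n.

On the unit disk the weight is 1, so ϰ_N is a polynomial there, and at real points ε is minus a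
primitive up to a constant. The constants and the border terms combine into one sequence of linear
coefficients, so that K_N = K[A_N] for a single antisymmetric polynomial A_N
(`kernel_eq_kernelSeries`). Since N t < 1, t tends to 0, and by Wallis (2n+1) cb(n)^2 tends to 2/π.
Hence the coefficient of u^m v^n in A_N tends to cb(m/2) cb(n/2)/(π(n-m)) (integer halves) for m+n
odd, and is 0 otherwise. A polynomial bound uniform in N (`norm_kernelCoeff_le`) gives convergence
of the series and of their derivatives, uniformly on smaller disks. Expanding the inverse square
roots in A_𝔻 and integrating against the Fourier series of √(-τ) produces the same coefficients
(`diskA_eq_dps`). This is (i).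

For (ii), the expected number of roots in B has to be the integral of the diagonal (1,2) entry of
K_N over the real and the non-real part of B. This is derived directly. The area formula, applied to
the map from (root, cofactor) to coefficients, turns sums over roots into integrals with Jacobian
|h(x)| for a factorisation (X-x)h, and 4|Im z||c(z)|^2 for (X-z)(X-z̄)c (`integral_sum_real_roots`,
`integral_sum_nonreal_roots`). As the density is multiplicative, the intensities are moments of
values of random polynomials of degree N-1 and N-2. To identify these with the kernel, Lagrange
interpolation of X^l at the roots of a random polynomial is integrated against the density. At real
roots a factor sgn h(x) appears, which is expanded over the roots of h through the signs of its
derivatives. The outcome is a linear system whose matrix is U, bordered if N is odd, so the moments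
are the entries of its inverse times the normalising constant (`moments_eq`).

Uniform convergence on the closure of B then passes to the integrals. The limit is finite because B
is bounded, and positive because DA_𝔻D(u,v) = (v-u)/(π(1-u²)^(1/2)(1-v²)^(1/2)(1-uv)²) makes the
limiting density strictly positive off the real axis. -/

namespace RealMahler

/-! ### Integrals of the weight -/

/-- The reciprocal of the exponent `s`, equal to `0` for `s = ∞`. -/
noncomputable def tinv (s : ℝ≥0∞) : ℝ := (s⁻¹).toReal

theorem tinv_nonneg (s : ℝ≥0∞) : 0 ≤ tinv s := ENNReal.toReal_nonneg

theorem mul_tinv_lt_one {N : ℕ} {s : ℝ≥0∞} (hs : (N : ℝ≥0∞) < s) : (N : ℝ) * tinv s < 1 := by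
  rcases eq_or_ne s ⊤ with rfl | h
  · simp [tinv]
  · have h0 : 0 < s.toReal := ENNReal.toReal_pos (pos_of_gt hs).ne' h
    have : (N : ℝ) < s.toReal := by
      simpa using (ENNReal.toReal_lt_toReal (ENNReal.natCast_ne_top N) h).2 hs
    rw [tinv, ENNReal.toReal_inv, ← div_eq_mul_inv, div_lt_one h0]
    exact this

theorem invPow_one (s : ℝ≥0∞) : invPow s 1 = 1 := by
  simp [invPow]

theorem invPow_nonneg (s : ℝ≥0∞) {r : ℝ} (hr : 0 ≤ r) : 0 ≤ invPow s r := by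
  unfold invPow; split_ifs <;> positivity

theorem weight_of_norm_le_one (s : ℝ≥0∞) {z : ℂ} (hz : ‖z‖ ≤ 1) : weight s z = 1 := by
  rw [weight, max_eq_left hz, invPow_one]

theorem weight_nonneg (s : ℝ≥0∞) (z : ℂ) : 0 ≤ weight s z :=
  invPow_nonneg s (le_trans zero_le_one (le_max_left _ _))

theorem measurable_invPow (s : ℝ≥0∞) : Measurable (invPow s) := by
  unfold invPow
  split_ifs
  · exact Measurable.ite measurableSet_Iic measurable_const measurable_const
  · fun_prop

theorem measurable_weight (s : ℝ≥0∞) : Measurable (weight s) :=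
  (measurable_invPow s).comp (by fun_prop)

theorem weight_ofReal_of_one_le (s : ℝ≥0∞) {x : ℝ} (hx : 1 ≤ x) : weight s x = invPow s x := by
  rw [weight, Complex.norm_real, Real.norm_eq_abs, abs_of_nonneg (by linarith), max_eq_right hx]

theorem weight_neg (s : ℝ≥0∞) (z : ℂ) : weight s (-z) = weight s z := by simp [weight]

theorem weight_conj (s : ℝ≥0∞) (z : ℂ) : weight s (conj z) = weight s z := by simp [weight]

/-- The hypothesis says n + 1 < s, the integrability threshold of y^(n-s). Written with 1/s, the
formula includes s = ∞, where `tinv` and the integrand both vanish. -/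
theorem integrableOn_integral_Ioi_pow_mul_invPow (s : ℝ≥0∞) (hs : s ≠ 0) (n : ℕ)
    (h : (n + 1) * tinv s < 1) {x : ℝ} (hx : 1 ≤ x) :
    IntegrableOn (fun y : ℝ => y ^ n * invPow s y) (Set.Ioi x) ∧
      ∫ y in Set.Ioi x, y ^ n * invPow s y
        = x ^ (n + 1) * invPow s x * (tinv s / (1 - (n + 1) * tinv s)) := by
  rcases eq_or_ne s ⊤ with rfl | hs'
  · have : Set.EqOn (fun y : ℝ => y ^ n * invPow ⊤ y) 0 (Set.Ioi x) := by
      intro y hy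
      have : ¬ y ≤ 1 := not_le.2 (hx.trans_lt hy)
      simp [invPow, this]
    refine ⟨(integrableOn_congr_fun this measurableSet_Ioi).2 integrableOn_zero, ?_⟩
    rw [setIntegral_congr_fun measurableSet_Ioi this]
    simp [tinv]
  · have h0 : 0 < s.toReal := ENNReal.toReal_pos hs hs'
    have ht : tinv s = s.toReal⁻¹ := by rw [tinv, ENNReal.toReal_inv]
    have hx0 : (0 : ℝ) < x := by linarith
    have h1 : (n : ℝ) + 1 < s.toReal := by
      rwa [ht, ← div_eq_mul_inv, div_lt_one h0] at h
    have : Set.EqOn (fun y : ℝ => y ^ n * invPow s y) (fun y => y ^ (n - s.toReal))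
        (Set.Ioi x) := by
      intro y hy
      have hy0 : (0 : ℝ) < y := hx0.trans hy
      simp only [invPow, if_neg hs']
      rw [sub_eq_add_neg, Real.rpow_add hy0, Real.rpow_natCast]
    refine ⟨(integrableOn_congr_fun this measurableSet_Ioi).2
      (integrableOn_Ioi_rpow_of_lt (by linarith) hx0), ?_⟩
    rw [setIntegral_congr_fun measurableSet_Ioi this, integral_Ioi_rpow_of_lt (by linarith) hx0]
    simp only [invPow, if_neg hs']
    rw [show (n : ℝ) - s.toReal + 1 = (n + 1 : ℕ) + -s.toReal by push_cast; ring,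
      Real.rpow_add hx0, Real.rpow_natCast, ht]
    have h2 : s.toReal - (n + 1) ≠ 0 := by linarith
    have h3 : ((n + 1 : ℕ) : ℝ) + -s.toReal ≠ 0 := by push_cast; linarith
    have h4 : 1 - ((n : ℝ) + 1) * s.toReal⁻¹ ≠ 0 := by
      rw [← div_eq_mul_inv, sub_ne_zero]; exact ((div_lt_one h0).2 h1).ne'
    field_simp
    push_cast
    ring

theorem integrableOn_integral_Ioi_pow_mul_invPow_sq (s : ℝ≥0∞) (hs : s ≠ 0) (n : ℕ)
    (h : (n + 1) * tinv s < 2) :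
    IntegrableOn (fun y : ℝ => y ^ n * invPow s y ^ 2) (Set.Ioi 1) ∧
      ∫ y in Set.Ioi 1, y ^ n * invPow s y ^ 2 = tinv s / (2 - (n + 1) * tinv s) := by
  rcases eq_or_ne s ⊤ with rfl | hs'
  · have : Set.EqOn (fun y : ℝ => y ^ n * invPow ⊤ y ^ 2) 0 (Set.Ioi 1) := by
      intro y hy
      have : ¬ y ≤ 1 := not_le.2 hy
      simp [invPow, this]
    refine ⟨(integrableOn_congr_fun this measurableSet_Ioi).2 integrableOn_zero, ?_⟩
    rw [setIntegral_congr_fun measurableSet_Ioi this]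
    simp [tinv]
  · have h0 : 0 < s.toReal := ENNReal.toReal_pos hs hs'
    have ht : tinv s = s.toReal⁻¹ := by rw [tinv, ENNReal.toReal_inv]
    have h1 : (n : ℝ) + 1 < 2 * s.toReal := by
      rwa [ht, ← div_eq_mul_inv, div_lt_iff₀ h0] at h
    have : Set.EqOn (fun y : ℝ => y ^ n * invPow s y ^ 2) (fun y => y ^ (n - 2 * s.toReal))
        (Set.Ioi 1) := by
      intro y hy
      have hy0 : (0 : ℝ) < y := zero_lt_one.trans hy
      simp only [invPow, if_neg hs']
      rw [sub_eq_add_neg, Real.rpow_add hy0, Real.rpow_natCast, ← Real.rpow_mul_natCast hy0.le]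
      congr 2; push_cast; ring
    refine ⟨(integrableOn_congr_fun this measurableSet_Ioi).2
      (integrableOn_Ioi_rpow_of_lt (by linarith) one_pos), ?_⟩
    rw [setIntegral_congr_fun measurableSet_Ioi this, integral_Ioi_rpow_of_lt (by linarith) one_pos,
      ht, Real.one_rpow]
    have h2 : (n : ℝ) - 2 * s.toReal + 1 ≠ 0 := by linarith
    have h4 : 2 - ((n : ℝ) + 1) * s.toReal⁻¹ ≠ 0 := by
      rw [← div_eq_mul_inv, sub_ne_zero]; exact ((div_lt_iff₀ h0).2 h1).ne'
    rw [div_eq_div_iff h2 h4]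
    field_simp
    ring

/-- The tail integral `∫_1^∞ x ^ n * w x dx`. -/
noncomputable def tail (s : ℝ≥0∞) (n : ℕ) : ℝ := tinv s / (1 - (n + 1) * tinv s)

theorem integrableOn_Ioi_pow_mul_weight (s : ℝ≥0∞) (hs : s ≠ 0) (n : ℕ)
    (h : (n + 1) * tinv s < 1) {x : ℝ} (hx : 1 ≤ x) :
    IntegrableOn (fun y : ℝ => y ^ n * weight s y) (Set.Ioi x) ∧
      ∫ y in Set.Ioi x, y ^ n * weight s y = x ^ (n + 1) * weight s x * tail s n := by
  have : Set.EqOn (fun y : ℝ => y ^ n * weight s y) (fun y => y ^ n * invPow s y) (Set.Ioi x) := by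
    intro y hy
    simp only
    rw [weight_ofReal_of_one_le s (hx.trans hy.le)]
  obtain ⟨h1, h2⟩ := integrableOn_integral_Ioi_pow_mul_invPow s hs n h hx
  exact ⟨(integrableOn_congr_fun this measurableSet_Ioi).2 h1, by
    rw [setIntegral_congr_fun measurableSet_Ioi this, h2, weight_ofReal_of_one_le s hx, tail]⟩

theorem integrableOn_Ioc_pow_mul_weight (s : ℝ≥0∞) (n : ℕ) {v : ℝ} (hv : -1 ≤ v) :
    IntegrableOn (fun y : ℝ => y ^ n * weight s y) (Set.Ioc v 1) := by
  have : Set.EqOn (fun y : ℝ => y ^ n * weight s y) (fun y => y ^ n) (Set.Ioc v 1) := by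
    intro y hy
    simp only
    rw [weight_of_norm_le_one s, mul_one]
    rw [Complex.norm_real, Real.norm_eq_abs, abs_le]
    exact ⟨hv.trans hy.1.le, hy.2⟩
  exact (integrableOn_congr_fun this measurableSet_Ioc).2
    (Continuous.integrableOn_Ioc (by fun_prop))

theorem integral_Ioc_pow_mul_weight (s : ℝ≥0∞) (n : ℕ) {v : ℝ} (hv : -1 ≤ v) (hv' : v ≤ 1) :
    ∫ y in Set.Ioc v 1, y ^ n * weight s y = (1 - v ^ (n + 1)) / (n + 1) := by
  have : Set.EqOn (fun y : ℝ => y ^ n * weight s y) (fun y => y ^ n) (Set.Ioc v 1) := by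
    intro y hy
    simp only
    rw [weight_of_norm_le_one s, mul_one]
    rw [Complex.norm_real, Real.norm_eq_abs, abs_le]
    exact ⟨hv.trans hy.1.le, hy.2⟩
  rw [setIntegral_congr_fun measurableSet_Ioc this, ← intervalIntegral.integral_of_le hv',
    integral_pow, one_pow]

theorem integrableOn_Ioi_pow_mul_weight' (s : ℝ≥0∞) (hs : s ≠ 0) (n : ℕ)
    (h : (n + 1) * tinv s < 1) {v : ℝ} (hv : -1 ≤ v) (hv' : v ≤ 1) :
    IntegrableOn (fun y : ℝ => y ^ n * weight s y) (Set.Ioi v) ∧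
      ∫ y in Set.Ioi v, y ^ n * weight s y = (1 - v ^ (n + 1)) / (n + 1) + tail s n := by
  obtain ⟨h1, h2⟩ := integrableOn_Ioi_pow_mul_weight s hs n h le_rfl
  have h3 := integrableOn_Ioc_pow_mul_weight s n hv
  rw [← Set.Ioc_union_Ioi_eq_Ioi hv']
  refine ⟨h3.union h1, ?_⟩
  rw [setIntegral_union (Set.Ioc_disjoint_Ioi le_rfl) measurableSet_Ioi h3 h1,
    integral_Ioc_pow_mul_weight s n hv hv', h2]
  simp [weight_of_norm_le_one s]

theorem neg_pow_mul_weight (s : ℝ≥0∞) (n : ℕ) (y : ℝ) :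
    (-y) ^ n * weight s ((-y : ℝ) : ℂ) = (-1) ^ n * (y ^ n * weight s y) := by
  rw [Complex.ofReal_neg, weight_neg, neg_pow]; ring

theorem integrable_pow_mul_weight (s : ℝ≥0∞) (hs : s ≠ 0) (n : ℕ)
    (h : (n + 1) * tinv s < 1) : Integrable (fun y : ℝ => y ^ n * weight s y) := by
  have h1 := (integrableOn_Ioi_pow_mul_weight' s hs n h (v := 0) (by norm_num) (by norm_num)).1
  have h2 : IntegrableOn (fun y : ℝ => y ^ n * weight s y) (Set.Iio 0) := by
    have : IntegrableOn (fun y : ℝ => (-y) ^ n * weight s ((-y : ℝ) : ℂ)) (Set.Ioi 0) := by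
      simp only [neg_pow_mul_weight]
      exact h1.const_mul _
    have h3 := this.comp_neg
    simpa using h3
  rw [← integrableOn_univ, ← Set.Iio_union_Ici (a := (0 : ℝ))]
  exact h2.union ((integrableOn_Ici_iff_integrableOn_Ioi enorm_ne_top).2 h1)

/-- The integral over `(-∞, v)` by reflection. -/
theorem integral_Iio_pow_mul_weight (s : ℝ≥0∞) (n : ℕ) (v : ℝ) :
    ∫ y in Set.Iio v, y ^ n * weight s y
      = (-1) ^ n * ∫ y in Set.Ioi (-v), y ^ n * weight s y := by
  have := integral_comp_neg_Ioi (-v) (fun y : ℝ => y ^ n * weight s y)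
  rw [neg_neg] at this
  rw [← integral_Iic_eq_integral_Iio, ← this, ← integral_const_mul]
  congr 1
  ext y
  exact neg_pow_mul_weight s n y

theorem integral_mul_sign_sub {f : ℝ → ℝ} (hf : Integrable f) (v : ℝ) :
    ∫ y, f y * Real.sign (y - v) = (∫ y in Set.Ioi v, f y) - ∫ y in Set.Iio v, f y := by
  have h1 : (∫ y in Set.Iic v, f y * Real.sign (y - v)) = - ∫ y in Set.Iio v, f y := by
    rw [integral_Iic_eq_integral_Iio, ← integral_neg]
    refine setIntegral_congr_fun measurableSet_Iio fun y hy => ?_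
    rw [Real.sign_of_neg (sub_neg.2 hy)]; ring
  have h2 : (∫ y in Set.Ioi v, f y * Real.sign (y - v)) = ∫ y in Set.Ioi v, f y := by
    refine setIntegral_congr_fun measurableSet_Ioi fun y hy => ?_
    rw [Real.sign_of_pos (sub_pos.2 hy)]; ring
  have hm : Measurable (fun y : ℝ => Real.sign (y - v)) := by
    unfold Real.sign
    exact Measurable.ite (measurableSet_lt (by fun_prop) (by fun_prop)) measurable_const
      (Measurable.ite (measurableSet_lt (by fun_prop) (by fun_prop)) measurable_const
        measurable_const)
  have hi : Integrable (fun y => f y * Real.sign (y - v)) := by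
    refine hf.mul_bdd (c := 1) hm.aestronglyMeasurable (ae_of_all _ fun y => ?_)
    rcases Real.sign_apply_eq (y - v) with h | h | h <;> rw [h] <;> simp
  rw [← integral_add_compl measurableSet_Iic hi, Set.compl_Iic, h1, h2]
  ring

/-- The inner integral `∫ y ^ n w y sgn (y - x) dy`. -/
noncomputable def inner (s : ℝ≥0∞) (n : ℕ) (x : ℝ) : ℝ :=
  ∫ y : ℝ, y ^ n * weight s y * Real.sign (y - x)

/-- Reflecting the half-line below v produces the sign (-1)^n. The constants survive only for odd n,
while the power of v is doubled in every case. -/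
theorem inner_of_abs_le (s : ℝ≥0∞) (hs : s ≠ 0) (n : ℕ)
    (h : (n + 1) * tinv s < 1) {v : ℝ} (hv : -1 ≤ v) (hv' : v ≤ 1) :
    inner s n v = (1 - (-1) ^ n) * (1 / (n + 1) + tail s n) - 2 * v ^ (n + 1) / (n + 1) := by
  rw [inner, integral_mul_sign_sub (integrable_pow_mul_weight s hs n h),
    integral_Iio_pow_mul_weight,
    (integrableOn_Ioi_pow_mul_weight' s hs n h hv hv').2,
    (integrableOn_Ioi_pow_mul_weight' s hs n h (v := -v) (by linarith) (by linarith)).2,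
    neg_pow v, pow_succ]
  have : ((-1 : ℝ) ^ n) * (-1) ^ n = 1 := by rw [← mul_pow]; simp
  have h0 : (n : ℝ) + 1 ≠ 0 := by positivity
  field_simp
  linear_combination (-v ^ (n + 1)) * this

/-- The value is twice the tail beyond x minus the whole integral, and only the tail depends on x.
-/
theorem inner_of_one_le (s : ℝ≥0∞) (hs : s ≠ 0) (n : ℕ)
    (h : (n + 1) * tinv s < 1) {x : ℝ} (hx : 1 ≤ x) :
    inner s n x = 2 * (x ^ (n + 1) * weight s x * tail s n)
      - (1 + (-1) ^ n) * (1 / (n + 1) + tail s n) := by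
  have hi := integrable_pow_mul_weight s hs n h
  have h1 := integral_add_compl (measurableSet_Iic (a := x)) hi
  have h2 := integral_add_compl (measurableSet_Iic (a := (0 : ℝ))) hi
  rw [Set.compl_Iic, integral_Iic_eq_integral_Iio] at h1 h2
  rw [integral_Iio_pow_mul_weight, neg_zero] at h2
  rw [inner, integral_mul_sign_sub hi,
    (integrableOn_Ioi_pow_mul_weight s hs n h hx).2] 
  rw [(integrableOn_Ioi_pow_mul_weight s hs n h hx).2] at h1
  rw [(integrableOn_Ioi_pow_mul_weight' s hs n h (v := 0) (by norm_num) (by norm_num)).2] at h2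
  simp only [ne_eq, Nat.add_eq_zero_iff, one_ne_zero, and_false, not_false_eq_true, zero_pow,
    sub_zero] at h2
  linear_combination h2 - h1

theorem inner_neg (s : ℝ≥0∞) (n : ℕ) (x : ℝ) : inner s n (-x) = (-1) ^ (n + 1) * inner s n x := by
  rw [inner, inner, ← integral_neg_eq_self, ← integral_const_mul]
  congr 1
  ext y
  have : -y - -x = -(y - x) := by ring
  rw [neg_pow_mul_weight, this, Real.sign_neg, pow_succ]
  ring

/-! ### The Gram matrix -/

theorem integral_eq_two_mul_of_even {f : ℝ → ℝ} (hf : ∀ x, f (-x) = f x) :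
    ∫ x, f x = 2 * ∫ x in Set.Ioi 0, f x := by
  rw [← integral_comp_abs]
  congr 1
  ext x
  rcases abs_choice x with h | h <;> rw [h]
  exact (hf x).symm

theorem integral_eq_zero_of_odd {f : ℝ → ℝ} (hf : ∀ x, f (-x) = -f x) :
    ∫ x, f x = 0 := by
  have h := integral_neg_eq_self f volume
  simp only [hf, integral_neg] at h
  linarith

theorem integral_pow_mul_weight (s : ℝ≥0∞) (hs : s ≠ 0) (n : ℕ) (h : (n + 1) * tinv s < 1) :
    ∫ y : ℝ, y ^ n * weight s y = (1 + (-1) ^ n) * (1 / (n + 1) + tail s n) := by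
  rcases Nat.even_or_odd n with hn | hn
  · rw [integral_eq_two_mul_of_even,
      (integrableOn_Ioi_pow_mul_weight' s hs n h (v := 0) (by norm_num) (by norm_num)).2,
      hn.neg_one_pow]
    · simp; norm_num
    · intro x
      rw [neg_pow_mul_weight, hn.neg_one_pow, one_mul]
  · rw [integral_eq_zero_of_odd, hn.neg_one_pow]
    · simp
    · intro x
      rw [neg_pow_mul_weight, hn.neg_one_pow]; ring

/-- The integral `∫_1^∞ x ^ (n - 1) * (w x) ^ 2 dx`. -/
noncomputable def tailSq (s : ℝ≥0∞) (n : ℕ) : ℝ := tinv s / (2 - n * tinv s)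

theorem integral_Ioi_zero_split {f g₁ g₂ : ℝ → ℝ} (h₁ : ∀ x ∈ Set.Ioc (0 : ℝ) 1, f x = g₁ x)
    (h₂ : ∀ x ∈ Set.Ioi (1 : ℝ), f x = g₂ x) (hg₁ : Continuous g₁)
    (hg₂ : IntegrableOn g₂ (Set.Ioi 1)) :
    ∫ x in Set.Ioi 0, f x = (∫ x in (0 : ℝ)..1, g₁ x) + ∫ x in Set.Ioi 1, g₂ x := by
  rw [← Set.Ioc_union_Ioi_eq_Ioi (zero_le_one' ℝ),
    setIntegral_union (Set.Ioc_disjoint_Ioi le_rfl) measurableSet_Ioi,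
    setIntegral_congr_fun measurableSet_Ioc h₁, setIntegral_congr_fun measurableSet_Ioi h₂,
    intervalIntegral.integral_of_le zero_le_one]
  · exact (integrableOn_congr_fun h₁ measurableSet_Ioc).2 hg₁.integrableOn_Ioc
  · exact (integrableOn_congr_fun h₂ measurableSet_Ioi).2 hg₂

theorem integrableOn_Ioi_pow_mul_weight_sq (s : ℝ≥0∞) (hs : s ≠ 0) (n : ℕ)
    (h : (n + 1) * tinv s < 2) :
    IntegrableOn (fun y : ℝ => y ^ n * weight s y ^ 2) (Set.Ioi 1) ∧
      ∫ y in Set.Ioi (1 : ℝ), y ^ n * weight s y ^ 2 = tailSq s (n + 1) := by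
  have : Set.EqOn (fun y : ℝ => y ^ n * weight s y ^ 2) (fun y => y ^ n * invPow s y ^ 2)
      (Set.Ioi 1) := by
    intro y hy
    simp only
    rw [weight_ofReal_of_one_le s (le_of_lt hy)]
  obtain ⟨h1, h2⟩ := integrableOn_integral_Ioi_pow_mul_invPow_sq s hs n h
  exact ⟨(integrableOn_congr_fun this measurableSet_Ioi).2 h1, by
    rw [setIntegral_congr_fun measurableSet_Ioi this, h2, tailSq]; push_cast; rfl⟩

/-- For m + n odd the integrand is even, so (0, 1] and (1, ∞) suffice. On the first the weight is 1
and `inner` a polynomial; on the second the product of two weights gives rise to `tailSq`. -/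
theorem integral_pow_mul_inner (s : ℝ≥0∞) (hs : s ≠ 0) (m n : ℕ) (hm : (m + 1) * tinv s < 1)
    (hn : (n + 1) * tinv s < 1) (hmn : Odd (m + n)) :
    ∫ x : ℝ, x ^ m * weight s x * inner s n x =
      2 * ((1 - (-1) ^ n) * (1 / (n + 1) + tail s n) / (m + 1) - 2 / ((n + 1) * (m + n + 2))
        + 2 * tail s n * tailSq s (m + n + 2)
        - (1 + (-1) ^ n) * (1 / (n + 1) + tail s n) * tail s m) := by
  have hmn2 : ((m + n + 1 : ℕ) + 1) * tinv s < 2 := by push_cast; linarith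
  obtain ⟨hi1, he1⟩ := integrableOn_Ioi_pow_mul_weight_sq s hs (m + n + 1) hmn2
  obtain ⟨hi2, he2⟩ := integrableOn_Ioi_pow_mul_weight s hs m hm le_rfl
  rw [integral_eq_two_mul_of_even, integral_Ioi_zero_split
    (g₁ := fun x => (1 - (-1) ^ n) * (1 / (n + 1) + tail s n) * x ^ m
      - 2 / (n + 1) * x ^ (m + n + 1))
    (g₂ := fun x => 2 * tail s n * (x ^ (m + n + 1) * weight s x ^ 2)
      - (1 + (-1) ^ n) * (1 / (n + 1) + tail s n) * (x ^ m * weight s x))]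
  · rw [intervalIntegral.integral_sub (Continuous.intervalIntegrable (by fun_prop) _ _)
      (Continuous.intervalIntegrable (by fun_prop) _ _),
      intervalIntegral.integral_const_mul, intervalIntegral.integral_const_mul, integral_pow,
      integral_pow, integral_sub (hi1.const_mul _) (hi2.const_mul _), integral_const_mul,
      integral_const_mul, he1, he2, weight_of_norm_le_one s (by simp)]
    have h1 : (n : ℝ) + 1 ≠ 0 := by positivity
    have h2 : (m : ℝ) + n + 2 ≠ 0 := by positivity
    have h3 : (m : ℝ) + n + 1 + 1 ≠ 0 := by positivity
    have h4 : (m : ℝ) + 1 ≠ 0 := by positivity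
    push_cast
    simp only [one_pow, ne_eq, Nat.add_eq_zero_iff, one_ne_zero, and_false, not_false_eq_true,
      zero_pow, sub_zero]
    rw [show (m : ℝ) + n + 1 + 1 = m + n + 2 by ring]
    field_simp
    ring
  · intro x hx
    rw [weight_of_norm_le_one s (by simp [abs_le]; constructor <;> linarith [hx.1, hx.2]),
      inner_of_abs_le s hs n hn (by linarith [hx.1]) hx.2]
    ring
  · intro x hx
    rw [inner_of_one_le s hs n hn (le_of_lt hx)]
    ring
  · fun_prop
  · exact (hi1.const_mul _).sub (hi2.const_mul _)
  · intro x
    rw [neg_pow_mul_weight, inner_neg]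
    have : (-1 : ℝ) ^ m * (-1) ^ (n + 1) = 1 := by
      rw [← pow_add, ← add_assoc]; exact (Odd.add_one hmn).neg_one_pow
    linear_combination (x ^ m * weight s x * inner s n x) * this

theorem integral_pow_mul_inner_of_even (s : ℝ≥0∞) (m n : ℕ) (hmn : Even (m + n)) :
    ∫ x : ℝ, x ^ m * weight s x * inner s n x = 0 := by
  apply integral_eq_zero_of_odd
  intro x
  rw [neg_pow_mul_weight, inner_neg]
  have : (-1 : ℝ) ^ m * (-1) ^ (n + 1) = -1 := by
    rw [← pow_add, ← add_assoc]; exact (Even.add_one hmn).neg_one_pow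
  linear_combination (x ^ m * weight s x * inner s n x) * this

theorem skewReal_monomial (s : ℝ≥0∞) (m n : ℕ) :
    skewReal s (fun z => z ^ m) (fun z => z ^ n)
      = ((∫ x : ℝ, x ^ m * weight s x * inner s n x : ℝ) : ℂ) := by
  rw [skewReal, ← integral_complex_ofReal]
  congr 1
  ext x
  rw [inner, Complex.ofReal_mul, ← integral_complex_ofReal, ← integral_const_mul]
  congr 1
  ext y
  push_cast
  ring

theorem integral_exp_mul_sign (k : ℤ) :
    ∫ θ in Set.Ioo (-Real.pi) Real.pi,
        Complex.exp (k * θ * Complex.I) * (Real.sign (Real.sin θ) : ℝ)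
      = if Odd k then 4 * Complex.I / k else 0 := by
  have hpi := Real.pi_pos
  have hcont : Continuous (fun θ : ℝ => Complex.exp (k * θ * Complex.I)) := by fun_prop
  have e1 : Set.EqOn (fun θ : ℝ => Complex.exp (k * θ * Complex.I) * (Real.sign (Real.sin θ) : ℝ))
      (fun θ => Complex.exp (k * θ * Complex.I)) (Set.Ioo 0 Real.pi) := by
    intro θ hθ
    simp only
    rw [Real.sign_of_pos (Real.sin_pos_of_pos_of_lt_pi hθ.1 hθ.2)]; simp
  have e2 : Set.EqOn (fun θ : ℝ => Complex.exp (k * θ * Complex.I) * (Real.sign (Real.sin θ) : ℝ))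
      (fun θ => -Complex.exp (k * θ * Complex.I)) (Set.Ioo (-Real.pi) 0) := by
    intro θ hθ
    simp only
    rw [Real.sign_of_neg (Real.sin_neg_of_neg_of_neg_pi_lt hθ.2 hθ.1)]; simp
  have i1 : IntegrableOn (fun θ : ℝ => Complex.exp (k * θ * Complex.I) *
      (Real.sign (Real.sin θ) : ℝ)) (Set.Ioo 0 Real.pi) :=
    (integrableOn_congr_fun e1 measurableSet_Ioo).2
      (hcont.integrableOn_Icc.mono_set Set.Ioo_subset_Icc_self)
  have i2 : IntegrableOn (fun θ : ℝ => Complex.exp (k * θ * Complex.I) *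
      (Real.sign (Real.sin θ) : ℝ)) (Set.Ioo (-Real.pi) 0) :=
    (integrableOn_congr_fun e2 measurableSet_Ioo).2
      (hcont.neg.integrableOn_Icc.mono_set Set.Ioo_subset_Icc_self)
  have i1' := integrableOn_Ico_iff_integrableOn_Ioo (a := 0) (b := Real.pi) enorm_ne_top |>.2 i1
  rw [← Set.Ioo_union_Ico_eq_Ioo (by linarith : -Real.pi < 0) hpi.le,
    setIntegral_union (by
      rw [Set.disjoint_left]; intro x h1 h2; exact absurd h1.2 (not_lt.2 h2.1))
      measurableSet_Ico i2 i1', integral_Ico_eq_integral_Ioo,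
    setIntegral_congr_fun measurableSet_Ioo e1, setIntegral_congr_fun measurableSet_Ioo e2,
    ← integral_Ioc_eq_integral_Ioo, ← integral_Ioc_eq_integral_Ioo,
    ← intervalIntegral.integral_of_le hpi.le, ← intervalIntegral.integral_of_le (by linarith)]
  rcases eq_or_ne k 0 with rfl | hk
  · simp
  have hc : (k * Complex.I : ℂ) ≠ 0 := mul_ne_zero (by exact_mod_cast hk) Complex.I_ne_zero
  have e3 : ∀ θ : ℝ, Complex.exp (k * θ * Complex.I) = Complex.exp ((k * Complex.I) * θ) := by
    intro θ; ring_nf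
  simp only [e3]
  rw [intervalIntegral.integral_neg, integral_exp_mul_complex hc, integral_exp_mul_complex hc]
  have e4 : Complex.exp (k * Complex.I * Real.pi) = (-1) ^ k := by
    rw [mul_assoc, mul_comm Complex.I, Complex.exp_int_mul, Complex.exp_pi_mul_I]
  have e5 : Complex.exp (k * Complex.I * (-Real.pi : ℝ)) = (-1) ^ k := by
    have : k * Complex.I * (-Real.pi : ℝ) = (-k : ℤ) * (Real.pi * Complex.I) := by push_cast; ring
    rw [this, Complex.exp_int_mul, Complex.exp_pi_mul_I, zpow_neg, ← inv_zpow]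
    norm_num
  rw [e4, e5]
  have hk' : (k : ℂ) ≠ 0 := by exact_mod_cast hk
  have hI := Complex.I_ne_zero
  split_ifs with ho
  · rw [ho.neg_one_zpow]
    simp only [Complex.ofReal_zero, mul_zero, Complex.exp_zero]
    field_simp
    rw [Complex.I_sq]; ring
  · rw [(Int.not_odd_iff_even.1 ho).neg_one_zpow]
    simp

/-- Polar coordinates separate the integral: the radial factor has exponent m + n + 1, and the
angular factor is the Fourier coefficient of the square wave sgn(sin θ), which lives on odd
frequencies n - m. -/
theorem skewComplex_monomial (s : ℝ≥0∞) (hs : s ≠ 0) (m n : ℕ) (hm : (m + 1) * tinv s < 1)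
    (hn : (n + 1) * tinv s < 1) :
    skewComplex s (fun z => z ^ m) (fun z => z ^ n)
      = if Odd (m + n) then (8 * (1 / (m + n + 2) + tailSq s (m + n + 2)) : ℝ) / ((n : ℂ) - m)
        else 0 := by
  have hmn2 : ((m + n + 1 : ℕ) + 1) * tinv s < 2 := by push_cast; linarith
  obtain ⟨hi1, he1⟩ := integrableOn_Ioi_pow_mul_weight_sq s hs (m + n + 1) hmn2
  have hrad : ∫ r in Set.Ioi (0 : ℝ), r ^ (m + n + 1) * weight s r ^ 2
      = 1 / (m + n + 2) + tailSq s (m + n + 2) := by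
    rw [integral_Ioi_zero_split (g₁ := fun r => r ^ (m + n + 1)) _ (fun _ _ => rfl)
      (by fun_prop) hi1, he1, integral_pow]
    · push_cast; simp; ring
    · intro x hx
      rw [weight_of_norm_le_one s (by simp [abs_le]; constructor <;> linarith [hx.1, hx.2])]
      ring
  rw [skewComplex, ← Complex.integral_comp_polarCoord_symm]
  have : Set.EqOn (fun p : ℝ × ℝ => p.1 • ((weight s (Complex.polarCoord.symm p) ^ 2 : ℝ) *
        conj (Complex.polarCoord.symm p ^ m) * Complex.polarCoord.symm p ^ n *
        (Real.sign (Complex.polarCoord.symm p).im : ℝ)))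
      (fun p => ((p.1 ^ (m + n + 1) * weight s p.1 ^ 2 : ℝ) : ℂ) *
        (Complex.exp (((n : ℤ) - m : ℤ) * p.2 * Complex.I) * (Real.sign (Real.sin p.2) : ℝ)))
      polarCoord.target := by
    intro p hp
    have hp0 : 0 < p.1 := hp.1
    have h1 : Complex.polarCoord.symm p = p.1 * Complex.exp (p.2 * Complex.I) := by
      rw [Complex.polarCoord_symm_apply, Complex.exp_mul_I]; push_cast; ring
    have h2 : (Complex.polarCoord.symm p).im = p.1 * Real.sin p.2 := by
      rw [Complex.polarCoord_symm_apply]; simp [Complex.sin_ofReal_re]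
    have h3 : Real.sign (p.1 * Real.sin p.2) = Real.sign (Real.sin p.2) := by
      rcases lt_trichotomy (Real.sin p.2) 0 with h | h | h
      · rw [Real.sign_of_neg h, Real.sign_of_neg (mul_neg_of_pos_of_neg hp0 h)]
      · simp [h]
      · rw [Real.sign_of_pos h, Real.sign_of_pos (mul_pos hp0 h)]
    have h4 : weight s (Complex.polarCoord.symm p) = weight s p.1 := by
      rw [h1, weight, weight, norm_mul, Complex.norm_exp_ofReal_mul_I, mul_one]
    have h5 : conj (Complex.exp (p.2 * Complex.I)) = Complex.exp (-(p.2 * Complex.I)) := by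
      rw [← Complex.exp_conj]; simp
    simp only
    rw [h2, h3, h4, h1, map_pow, map_mul, h5, Complex.conj_ofReal, Complex.real_smul, mul_pow,
      mul_pow, ← Complex.exp_nat_mul, ← Complex.exp_nat_mul]
    have h6 : Complex.exp (((n : ℤ) - m : ℤ) * p.2 * Complex.I)
        = Complex.exp (m * -(p.2 * Complex.I)) * Complex.exp (n * (p.2 * Complex.I)) := by
      rw [← Complex.exp_add]; congr 1; push_cast; ring
    rw [h6]
    push_cast
    ring
  rw [setIntegral_congr_fun (polarCoord.open_target.measurableSet) this]
  rw [show polarCoord.target = Set.Ioi (0 : ℝ) ×ˢ Set.Ioo (-Real.pi) Real.pi from rfl,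
    Measure.volume_eq_prod, setIntegral_prod_mul
      (fun r : ℝ => ((r ^ (m + n + 1) * weight s r ^ 2 : ℝ) : ℂ))
      (fun θ : ℝ => Complex.exp (((n : ℤ) - m : ℤ) * θ * Complex.I) *
        (Real.sign (Real.sin θ) : ℝ)), integral_exp_mul_sign,
    integral_complex_ofReal, hrad]
  have hodd : Odd ((n : ℤ) - m) ↔ Odd (m + n) := by
    rw [Int.odd_sub, Nat.odd_add, Int.odd_coe_nat, Int.even_coe_nat]
    have := Nat.not_odd_iff_even (n := m)
    have := Nat.not_odd_iff_even (n := n)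
    tauto
  simp only [hodd]
  split_ifs with ho
  · push_cast
    linear_combination (-8 * (1 / (m + n + 2) + (tailSq s (m + n + 2) : ℂ)) / ((n : ℂ) - m))
      * Complex.I_sq
  · simp

/-- The entry `⟨z ^ m | z ^ n⟩` for even `m` and odd `n`. -/
noncomputable def gramEntry (t : ℝ) (m n : ℕ) : ℝ :=
  4 / ((m + 1) * (1 - (n + 1) * t) * ((n : ℝ) - m))

/-- Here a = m + 1 and b = n + 1. The real and the complex contribution both carry the denominators
a + b and p + q; these cancel in the sum and leave a Cauchy entry with separate row and column
factors. -/
theorem gramEntry_aux₁ {a b t p q : ℝ} (hp : p = 1 - a * t) (hq : q = 1 - b * t) (ha : a ≠ 0)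
    (hb : b ≠ 0) (hq0 : q ≠ 0) (hpq : p + q ≠ 0) (hab : a + b ≠ 0) (hba : b - a ≠ 0) :
    2 * (2 * (1 / b + t / q) / a - 2 / (b * (a + b)) + 2 * (t / q) * (t / (p + q)))
      + 8 * (1 / (a + b) + t / (p + q)) / (b - a) = 4 / (a * q * (b - a)) := by
  field_simp
  rw [hp, hq]
  ring

theorem gramEntry_aux₂ {a b t p q : ℝ} (hp : p = 1 - a * t) (hq : q = 1 - b * t)
    (hb : b ≠ 0) (hp0 : p ≠ 0) (hq0 : q ≠ 0) (hpq : p + q ≠ 0) (hab : a + b ≠ 0)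
    (hba : b - a ≠ 0) :
    2 * (-2 / (b * (a + b)) + 2 * (t / q) * (t / (p + q)) - 2 * (1 / b + t / q) * (t / p))
      + 8 * (1 / (a + b) + t / (p + q)) / (b - a) = 4 / (b * p * (b - a)) := by
  field_simp
  rw [hp, hq]
  ring

theorem skew_monomial (s : ℝ≥0∞) (hs : s ≠ 0) (m n : ℕ) (hm : (m + 1) * tinv s < 1)
    (hn : (n + 1) * tinv s < 1) :
    skewReal s (fun z => z ^ m) (fun z => z ^ n) + skewComplex s (fun z => z ^ m) (fun z => z ^ n)
      = if Even m ∧ Odd n then (gramEntry (tinv s) m n : ℂ)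
        else if Odd m ∧ Even n then (-gramEntry (tinv s) n m : ℂ) else 0 := by
  rw [skewReal_monomial, skewComplex_monomial s hs m n hm hn]
  have h1 : (1 : ℝ) - (m + 1) * tinv s ≠ 0 := by linarith
  have h2 : (1 : ℝ) - (n + 1) * tinv s ≠ 0 := by linarith
  have h3 : (2 : ℝ) - (m + n + 2) * tinv s ≠ 0 := by linarith
  have h4 : (m : ℝ) + 1 ≠ 0 := by positivity
  have h5 : (n : ℝ) + 1 ≠ 0 := by positivity
  have h6 : (m : ℝ) + n + 2 ≠ 0 := by positivity
  rcases Nat.even_or_odd m with hme | hmo <;> rcases Nat.even_or_odd n with hne | hno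
  · have h : ¬ Odd (m + n) := Nat.not_odd_iff_even.2 (hme.add hne)
    rw [integral_pow_mul_inner_of_even s m n (hme.add hne)]
    simp [h, Nat.not_odd_iff_even.2 hme, Nat.not_odd_iff_even.2 hne]
  · have h : Odd (m + n) := hme.add_odd hno
    have hmn : (n : ℝ) - m ≠ 0 := by
      rw [sub_ne_zero]; intro e
      have : n = m := by exact_mod_cast e
      subst this; exact absurd hno (Nat.not_odd_iff_even.2 hme)
    rw [integral_pow_mul_inner s hs m n hm hn h, if_pos h, if_pos ⟨hme, hno⟩, hno.neg_one_pow]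
    rw [show ((n : ℂ) - m) = (((n : ℝ) - m : ℝ) : ℂ) by push_cast; rfl, ← Complex.ofReal_div,
      ← Complex.ofReal_add]
    congr 1
    have := gramEntry_aux₁ (a := (m : ℝ) + 1) (b := (n : ℝ) + 1) (t := tinv s) rfl rfl h4 h5 h2
      (by intro h; apply h3; linear_combination h) (by intro h; apply h6; linear_combination h)
      (by intro h; apply hmn; linear_combination h)
    rw [gramEntry, tail, tail, tailSq]
    rw [show (n : ℝ) + 1 - (m + 1) = n - m by ring,
      show (1 : ℝ) - (m + 1) * tinv s + (1 - (n + 1) * tinv s) = 2 - (m + n + 2) * tinv s by ring,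
      show (m : ℝ) + 1 + (n + 1) = m + n + 2 by ring] at this
    rw [← this]
    push_cast
    ring
  · have h : Odd (m + n) := hmo.add_even hne
    have hmn : (m : ℝ) - n ≠ 0 := by
      rw [sub_ne_zero]; intro e
      have : m = n := by exact_mod_cast e
      subst this; exact absurd hmo (Nat.not_odd_iff_even.2 hne)
    have hmn' : (n : ℝ) - m ≠ 0 := by
      rw [← neg_sub]; exact neg_ne_zero.2 hmn
    rw [integral_pow_mul_inner s hs m n hm hn h, if_pos h,
      if_neg (fun e => absurd hmo (Nat.not_odd_iff_even.2 e.1)), if_pos ⟨hmo, hne⟩,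
      hne.neg_one_pow]
    rw [show ((n : ℂ) - m) = (((n : ℝ) - m : ℝ) : ℂ) by push_cast; rfl, ← Complex.ofReal_div,
      ← Complex.ofReal_add, ← Complex.ofReal_neg]
    congr 1
    have := gramEntry_aux₂ (a := (m : ℝ) + 1) (b := (n : ℝ) + 1) (t := tinv s) rfl rfl h5 h1 h2
      (by intro h; apply h3; linear_combination h) (by intro h; apply h6; linear_combination h)
      (by intro h; apply hmn'; linear_combination h)
    rw [gramEntry, tail, tail, tailSq, show (m : ℝ) - n = -(n - m) by ring, mul_neg, div_neg,
      neg_neg]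
    rw [show (n : ℝ) + 1 - (m + 1) = n - m by ring,
      show (1 : ℝ) - (m + 1) * tinv s + (1 - (n + 1) * tinv s) = 2 - (m + n + 2) * tinv s by ring,
      show (m : ℝ) + 1 + (n + 1) = m + n + 2 by ring] at this
    rw [← this]
    push_cast
    ring
  · have h : ¬ Odd (m + n) := Nat.not_odd_iff_even.2 (hmo.add_odd hno)
    rw [integral_pow_mul_inner_of_even s m n (hmo.add_odd hno)]
    simp [h, Nat.not_even_iff_odd.2 hmo, Nat.not_even_iff_odd.2 hno]

theorem integral_wMon (s : ℝ≥0∞) (hs : s ≠ 0) (n : ℕ) (h : (n + 1) * tinv s < 1) :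
    ∫ x : ℝ, wMon s n x
      = if Even n then ((2 / ((n + 1) * (1 - (n + 1) * tinv s)) : ℝ) : ℂ) else 0 := by
  have : (fun x : ℝ => wMon s n x) = fun x : ℝ => ((x ^ n * weight s x : ℝ) : ℂ) := by
    ext x; rw [wMon]; push_cast; rfl
  rw [this, integral_complex_ofReal, integral_pow_mul_weight s hs n h, tail]
  have h2 : (1 : ℝ) - (n + 1) * tinv s ≠ 0 := by linarith
  have h5 : (n : ℝ) + 1 ≠ 0 := by positivity
  split_ifs with he
  · congr 1
    rw [he.neg_one_pow]
    field_simp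
    ring
  · rw [(Nat.not_even_iff_odd.1 he).neg_one_pow]; simp

/-- On [-1, 1] the operator ε is minus a primitive. The constant is the half-line integral for odd n
and 0 for even n; this parity is what later lets the constants cancel. -/
theorem integral_wMon_mul_sign (s : ℝ≥0∞) (hs : s ≠ 0) (n : ℕ) (h : (n + 1) * tinv s < 1)
    {v : ℝ} (hv : |v| ≤ 1) :
    1 / 2 * ∫ t : ℝ, wMon s n t * (Real.sign (t - v) : ℝ)
      = (if Odd n then ((1 / ((n + 1) * (1 - (n + 1) * tinv s)) : ℝ) : ℂ) else 0)
        - (v : ℂ) ^ (n + 1) / (n + 1) := by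
  have : (fun t : ℝ => wMon s n t * (Real.sign (t - v) : ℝ))
      = fun t : ℝ => ((t ^ n * weight s t * Real.sign (t - v) : ℝ) : ℂ) := by
    ext x; rw [wMon]; push_cast; rfl
  rw [this, integral_complex_ofReal]
  change 1 / 2 * ((inner s n v : ℝ) : ℂ) = _
  rw [inner_of_abs_le s hs n h (abs_le.1 hv).1 (abs_le.1 hv).2, tail]
  have h2 : (1 : ℝ) - (n + 1) * tinv s ≠ 0 := by linarith
  have h5 : (n : ℝ) + 1 ≠ 0 := by positivity
  rcases Nat.even_or_odd n with he | ho
  · rw [he.neg_one_pow, if_neg (Nat.not_odd_iff_even.2 he)]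
    push_cast; ring
  · rw [ho.neg_one_pow, if_pos ho]
    have : (1 - (-1)) * (1 / ((n : ℝ) + 1) + tinv s / (1 - (n + 1) * tinv s))
        = 2 * (1 / ((n + 1) * (1 - (n + 1) * tinv s))) := by field_simp; ring
    rw [this]
    push_cast; ring

theorem integrable_wMon (s : ℝ≥0∞) (hs : s ≠ 0) (n : ℕ) (h : (n + 1) * tinv s < 1) :
    Integrable (fun x : ℝ => wMon s n x) := by
  have : (fun x : ℝ => wMon s n x) = fun x : ℝ => ((x ^ n * weight s x : ℝ) : ℂ) := by
    ext x; rw [wMon]; push_cast; rfl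
  rw [this]
  exact (integrable_pow_mul_weight s hs n h).ofReal

theorem measurable_sign : Measurable Real.sign := by
  unfold Real.sign
  exact Measurable.ite measurableSet_Iio measurable_const
    (Measurable.ite measurableSet_Ioi measurable_const measurable_const)

theorem integrable_wMon_mul_sign (s : ℝ≥0∞) (hs : s ≠ 0) (n : ℕ) (h : (n + 1) * tinv s < 1)
    (v : ℝ) : Integrable (fun t : ℝ => wMon s n t * (Real.sign (t - v) : ℝ)) := by
  refine (integrable_wMon s hs n h).mul_bdd (c := 1) ?_ (ae_of_all _ fun y => ?_)
  · exact (Complex.measurable_ofReal.comp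
      (measurable_sign.comp (measurable_id.sub_const v))).aestronglyMeasurable
  · rcases Real.sign_apply_eq (y - v) with h | h | h <;> rw [h] <;> simp

/-! ### Explicit inversion of the Cauchy-type matrices -/

/-- The normalised central binomial coefficient `binom(2n, n) / 4 ^ n`. -/
noncomputable def cb (n : ℕ) : ℝ := (Nat.centralBinom n : ℝ) / 4 ^ n

theorem cb_zero : cb 0 = 1 := by simp [cb]

theorem cb_pos (n : ℕ) : 0 < cb n := by
  have := Nat.centralBinom_pos n
  unfold cb; positivity

theorem cb_succ (n : ℕ) : (2 * n + 2) * cb (n + 1) = (2 * n + 1) * cb n := by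
  have h : ((n : ℝ) + 1) * Nat.centralBinom (n + 1) = 2 * (2 * n + 1) * Nat.centralBinom n := by
    exact_mod_cast Nat.succ_mul_centralBinom_succ n
  unfold cb
  rw [pow_succ]
  field_simp
  linear_combination 2 * h

/-- The product `∏ (2j - 2i)` over `i < M`, `i ≠ j`. -/
noncomputable def nodeDiff (M j : ℕ) : ℝ := ∏ i ∈ (Finset.range M).erase j, ((2 * j : ℝ) - 2 * i)

theorem nodeDiff_ne_zero (M j : ℕ) : nodeDiff M j ≠ 0 := by
  refine Finset.prod_ne_zero_iff.2 fun i hi => ?_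
  rw [sub_ne_zero]
  intro h
  have : (j : ℝ) = i := by linarith
  exact (Finset.mem_erase.1 hi).1 (by exact_mod_cast this.symm)

theorem nodeDiff_succ {M j : ℕ} (h : j < M) :
    nodeDiff (M + 1) j = nodeDiff M j * (2 * j - 2 * M) := by
  rw [nodeDiff, nodeDiff, Finset.range_add_one, Finset.erase_insert_of_ne h.ne',
    Finset.prod_insert (by simp), mul_comm]

theorem nodeDiff_self (j : ℕ) :
    nodeDiff (j + 1) j = ∏ i ∈ Finset.range j, ((2 * j : ℝ) - 2 * i) := by
  rw [nodeDiff, Finset.range_add_one, Finset.erase_insert (by simp)]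

theorem nodeDiff_self_succ (j : ℕ) :
    nodeDiff (j + 2) (j + 1) = nodeDiff (j + 1) j * (2 * j + 2) := by
  rw [nodeDiff_self, nodeDiff_self, Finset.prod_range_succ']
  push_cast
  congr 1
  · refine Finset.prod_congr rfl fun i _ => ?_
    ring
  · ring

/-- The quotient of the two products is a quotient of double factorials on each side of 2j: the
factors below 2j give `cb j`, those above give `cb (n - j)`, and the signs cancel in pairs. -/
theorem prod_even_sub_odd {n j : ℕ} (h : j ≤ n) :
    ∏ k ∈ Finset.range n, ((2 * j : ℝ) - (2 * k + 1)) = cb j * cb (n - j) * nodeDiff (n + 1) j := by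
  induction n, h using Nat.le_induction with
  | base =>
    rw [Nat.sub_self, cb_zero, mul_one]
    induction j with
    | zero => simp [cb_zero, nodeDiff_self]
    | succ j ih =>
      rw [Finset.prod_range_succ', nodeDiff_self_succ]
      have : ∏ k ∈ Finset.range j, ((2 * (j + 1 : ℕ) : ℝ) - (2 * (k + 1 : ℕ) + 1))
          = ∏ k ∈ Finset.range j, ((2 * j : ℝ) - (2 * k + 1)) := by
        refine Finset.prod_congr rfl fun i _ => ?_
        push_cast; ring
      rw [this, ih]
      push_cast
      linear_combination (-nodeDiff (j + 1) j) * cb_succ j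
  | succ n hn ih =>
    rw [Finset.prod_range_succ, ih, nodeDiff_succ (Nat.lt_succ_of_le hn), Nat.succ_sub hn]
    have := cb_succ (n - j)
    rw [Nat.cast_sub hn] at this
    push_cast
    linear_combination (cb j * nodeDiff (n + 1) j) * this

/-- As for `prod_even_sub_odd`, with the roles of the nodes exchanged. There is one more factor
below than in the node differences, whence 2k + 1. -/
theorem prod_odd_sub_even {n k : ℕ} (h : k < n) :
    ∏ i ∈ Finset.range n, ((2 * k + 1 : ℝ) - 2 * i)
      = (2 * k + 1) * cb k * cb (n - 1 - k) * nodeDiff n k := by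
  induction n, h using Nat.le_induction with
  | base =>
    simp only [Nat.succ_eq_add_one, add_tsub_cancel_right, Nat.sub_self, cb_zero, mul_one]
    induction k with
    | zero => simp [cb_zero, nodeDiff_self]
    | succ k ih =>
      rw [Finset.prod_range_succ', nodeDiff_self_succ]
      have : ∏ i ∈ Finset.range (k + 1), ((2 * (k + 1 : ℕ) + 1 : ℝ) - 2 * (i + 1 : ℕ))
          = ∏ i ∈ Finset.range (k + 1), ((2 * k + 1 : ℝ) - 2 * i) := by
        refine Finset.prod_congr rfl fun i _ => ?_
        push_cast; ring
      rw [this, ih]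
      push_cast
      linear_combination (-nodeDiff (k + 1) k * (2 * k + 3)) * cb_succ k
  | succ n hn ih =>
    have hn' : k < n := hn
    rw [Finset.prod_range_succ, ih, nodeDiff_succ hn',
      show n + 1 - 1 - k = (n - 1 - k) + 1 by omega]
    have := cb_succ (n - 1 - k)
    rw [Nat.sub_sub, Nat.cast_sub (by omega)] at this
    rw [Nat.sub_sub]
    push_cast at this ⊢
    linear_combination ((2 * k + 1) * cb k * nodeDiff n k) * this

theorem two_mul_injOn (s : Set ℕ) : Set.InjOn (fun j : ℕ => (2 * j : ℝ)) s := by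
  intro a _ b _ h
  have : (a : ℝ) = b := by simpa using h
  exact_mod_cast this

/-- The divided difference of order M - 1 at the nodes 0, 2, …, 2M - 2. It serves as the limiting
case, x at infinity, of `sum_div_nodeDiff_div`. -/
theorem sum_div_nodeDiff (M : ℕ) {f : ℝ[X]} (hf : f.degree < M) :
    ∑ j ∈ Finset.range M, f.eval (2 * j : ℝ) / nodeDiff M j = f.coeff (M - 1) := by
  have := Lagrange.coeff_eq_sum (two_mul_injOn (Finset.range M)) (P := f) (by simpa using hf)
  simp only [Finset.card_range] at this
  rw [this]
  rfl

/-- Partial fractions of f over the nodal polynomial. Every identity for the inverse matrices below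
is this one, for a suitable f and a suitable point x. -/
theorem sum_div_nodeDiff_div (M : ℕ) {f : ℝ[X]} (hf : f.degree < M) {x : ℝ}
    (hx : ∀ j ∈ Finset.range M, x ≠ 2 * j) :
    ∑ j ∈ Finset.range M, f.eval (2 * j : ℝ) / nodeDiff M j / (x - 2 * j)
      = f.eval x / ∏ j ∈ Finset.range M, (x - 2 * j) := by
  have h1 := Lagrange.eval_interpolate_not_at_node (s := Finset.range M)
    (v := fun j : ℕ => (2 * j : ℝ)) (fun j => f.eval (2 * j : ℝ)) hx
  rw [← Lagrange.eq_interpolate (two_mul_injOn (Finset.range M)) (by simpa using hf),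
    Lagrange.eval_nodal] at h1
  have h2 : ∏ j ∈ Finset.range M, (x - 2 * j) ≠ 0 :=
    Finset.prod_ne_zero_iff.2 fun j hj => sub_ne_zero.2 (hx j hj)
  rw [eq_div_iff h2, h1, mul_comm]
  congr 1
  refine Finset.sum_congr rfl fun j _ => ?_
  rw [Lagrange.nodalWeight, nodeDiff, Finset.prod_inv_distrib]
  ring

/-- The monic polynomial with roots the odd numbers `2l + 1`, `l < n`. -/
noncomputable def oddPoly (n : ℕ) : ℝ[X] :=
  ∏ l ∈ Finset.range n, (X - C (2 * l + 1 : ℝ))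

/-- The polynomial `oddPoly n` with the root `2k + 1` removed. -/
noncomputable def oddPolyErase (n k : ℕ) : ℝ[X] :=
  ∏ l ∈ (Finset.range n).erase k, (X - C (2 * l + 1 : ℝ))

theorem eval_oddPoly (n : ℕ) (x : ℝ) :
    (oddPoly n).eval x = ∏ l ∈ Finset.range n, (x - (2 * l + 1)) := by
  simp [oddPoly, eval_prod]

theorem oddPoly_eq {n k : ℕ} (h : k < n) :
    oddPoly n = (X - C (2 * k + 1 : ℝ)) * oddPolyErase n k := by
  rw [oddPoly, oddPolyErase, Finset.mul_prod_erase _ (fun l : ℕ => (X - C (2 * l + 1 : ℝ)))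
    (Finset.mem_range.2 h)]

theorem monic_oddPoly (n : ℕ) : (oddPoly n).Monic := monic_prod_X_sub_C _ _

theorem natDegree_oddPoly (n : ℕ) : (oddPoly n).natDegree = n := by
  rw [oddPoly, natDegree_finsetProd_X_sub_C_eq_card _ (fun l : ℕ => (2 * l + 1 : ℝ)),
    Finset.card_range]

theorem degree_oddPolyErase {n k : ℕ} (h : k < n) :
    (oddPolyErase n k).degree = ((n - 1 : ℕ) : WithBot ℕ) := by
  have hm : (oddPolyErase n k).Monic := monic_prod_X_sub_C _ _
  rw [degree_eq_natDegree hm.ne_zero, oddPolyErase,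
    natDegree_finsetProd_X_sub_C_eq_card _ (fun l : ℕ => (2 * l + 1 : ℝ)),
    Finset.card_erase_of_mem (Finset.mem_range.2 h),
    Finset.card_range]

theorem eval_oddPolyErase_self (n k : ℕ) : (oddPolyErase n k).eval (2 * k + 1 : ℝ) = nodeDiff n k := by
  rw [oddPolyErase, eval_prod, nodeDiff]
  refine Finset.prod_congr rfl fun l _ => ?_
  simp

theorem eval_oddPolyErase_of_ne {n k k' : ℕ} (hk : k' < n) (h : k' ≠ k) :
    (oddPolyErase n k).eval (2 * k' + 1 : ℝ) = 0 := by
  rw [oddPolyErase, eval_prod]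
  exact Finset.prod_eq_zero (Finset.mem_erase.2 ⟨h, Finset.mem_range.2 hk⟩) (by simp)

theorem odd_sub_even_ne_zero (k j : ℕ) : (2 * k + 1 : ℝ) - 2 * j ≠ 0 := by
  rw [sub_ne_zero]
  intro h
  have : 2 * k + 1 = 2 * j := by exact_mod_cast h
  omega

theorem odd_ne_even (k j : ℕ) : (2 * k + 1 : ℝ) ≠ 2 * j := sub_ne_zero.1 (odd_sub_even_ne_zero k j)

theorem neg_one_ne_even (j : ℕ) : (-1 : ℝ) ≠ 2 * j := by
  have : (0 : ℝ) ≤ j := j.cast_nonneg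
  intro h; linarith

/-- The quotient of `oddPolyErase` by the node differences. -/
theorem eval_oddPolyErase_even {n k j : ℕ} (hk : k < n) (hj : j ≤ n) :
    (oddPolyErase n k).eval (2 * j : ℝ)
      = -(cb j * cb (n - j) * nodeDiff (n + 1) j) / (2 * k + 1 - 2 * j) := by
  have h := eval_oddPoly n (2 * j)
  rw [prod_even_sub_odd hj, oddPoly_eq hk, eval_mul] at h
  simp only [eval_sub, eval_X, eval_C] at h
  rw [eq_div_iff (odd_sub_even_ne_zero k j)]
  linear_combination -h

/-- The ratio of the two node products at `-1`. -/
theorem prod_neg_one_odd (n : ℕ) :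
    (2 * n + 1) * cb n * ∏ l ∈ Finset.range n, ((-1 : ℝ) - (2 * l + 1))
      = - ∏ j ∈ Finset.range (n + 1), ((-1 : ℝ) - 2 * j) := by
  induction n with
  | zero => simp [cb_zero]
  | succ n ih =>
    rw [Finset.prod_range_succ, Finset.prod_range_succ _ (n + 1)]
    push_cast
    have := cb_succ n
    linear_combination (-(2 * n + 3)) * ih -
      ((2 * n + 3) * ∏ l ∈ Finset.range n, ((-1 : ℝ) - (2 * l + 1))) * this

/-- The entry `⟨z ^ (2j) | z ^ (2k+1)⟩`. -/
noncomputable def cauchyEntry (t : ℝ) (j k : ℕ) : ℝ :=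
  4 / ((2 * j + 1) * (1 - (2 * k + 2) * t) * (2 * k + 1 - 2 * j))

/-- The integral of the weighted monomial of degree `2j`. -/
noncomputable def borderEntry (t : ℝ) (j : ℕ) : ℝ := 2 / ((2 * j + 1) * (1 - (2 * j + 1) * t))

/-- The entries of the inverse of the matrix `cauchyEntry`, of size `n`. -/
noncomputable def invEven (n : ℕ) (t : ℝ) (j k : ℕ) : ℝ :=
  1 / 4 * (1 - (2 * k + 2) * t) * (2 * j + 1) * (cb j * cb k * (2 * k + 1)) *
    ((2 * (n - j)) * cb (n - j) * cb (n - 1 - k)) / (2 * k + 1 - 2 * j)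

/-- The entries of the inverse of the bordered matrix, of size `n + 1`. -/
noncomputable def invOdd (n : ℕ) (t : ℝ) (j k : ℕ) : ℝ :=
  1 / 4 * (1 - (2 * j + 1) * t) * (2 * j + 1) * (cb j * cb k * (2 * k + 1)) *
    ((2 * (n - k)) * cb (n - k) * cb (n - j)) / (2 * k + 1 - 2 * j)

/-- The last row of the inverse of the bordered matrix. -/
noncomputable def invBorder (n : ℕ) (t : ℝ) (j : ℕ) : ℝ :=
  1 / 2 * (2 * j + 1) * (cb j * cb (n - j)) *
    ((∏ l ∈ Finset.range (n + 1), (1 - (2 * l + 1) * t)) /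
      ∏ k ∈ Finset.range n, (1 - (2 * k + 2) * t))

/-- The linear coefficients of the kernel, even case. -/
noncomputable def linEven (n : ℕ) (j : ℕ) : ℝ :=
  1 / 2 * cb j * (2 * (n - j) * cb (n - j) * cb n)

/-- The linear coefficients of the kernel, odd case. -/
noncomputable def linOdd (n : ℕ) (t : ℝ) (j : ℕ) : ℝ :=
  1 / 2 * cb j * cb (n - j) * ((2 * n + 1) * cb n) * (1 - (2 * j + 1) * t)

/-- With n nodes instead of n + 1 the node difference loses the factor 2j - 2n; this is the source
of 2(n - j) in `invEven` and `linEven`. -/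
theorem eval_oddPolyErase_div_of_lt {n k j : ℕ} (hk : k < n) (hj : j < n) :
    (oddPolyErase n k).eval (2 * j : ℝ) / nodeDiff n j
      = cb j * (2 * (n - j) * cb (n - j)) / (2 * k + 1 - 2 * j) := by
  have h1 := nodeDiff_ne_zero n j
  have h2 := odd_sub_even_ne_zero k j
  rw [eval_oddPolyErase_even hk hj.le, nodeDiff_succ hj]
  field_simp
  ring

theorem eval_oddPolyErase_div_of_le {n k j : ℕ} (hk : k < n) (hj : j ≤ n) :
    (oddPolyErase n k).eval (2 * j : ℝ) / nodeDiff (n + 1) j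
      = -(cb j * cb (n - j)) / (2 * k + 1 - 2 * j) := by
  have h1 := nodeDiff_ne_zero (n + 1) j
  have h2 := odd_sub_even_ne_zero k j
  rw [eval_oddPolyErase_even hk hj]
  field_simp

theorem eval_oddPoly_div_of_le {n j : ℕ} (hj : j ≤ n) :
    (oddPoly n).eval (2 * j : ℝ) / nodeDiff (n + 1) j = cb j * cb (n - j) := by
  have h1 := nodeDiff_ne_zero (n + 1) j
  rw [eval_oddPoly, prod_even_sub_odd hj]
  field_simp

theorem eval_oddPolyErase_neg_one {n k : ℕ} (hk : k < n) :
    (oddPolyErase n k).eval (-1 : ℝ) * (2 * k + 2)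
      = -∏ l ∈ Finset.range n, ((-1 : ℝ) - (2 * l + 1)) := by
  have := eval_oddPoly n (-1)
  rw [← this, oddPoly_eq hk, eval_mul]
  simp only [eval_sub, eval_X, eval_C]
  ring

theorem degree_oddPolyErase_lt {n k : ℕ} (h : k < n) : (oddPolyErase n k).degree < n := by
  rw [degree_oddPolyErase h]
  exact_mod_cast (by omega : n - 1 < n)

theorem degree_oddPoly_lt (n : ℕ) : (oddPoly n).degree < (n + 1 : ℕ) := by
  rw [degree_eq_natDegree (monic_oddPoly n).ne_zero, natDegree_oddPoly]
  exact_mod_cast n.lt_succ_self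

theorem prod_odd_sub_even_ne_zero (n k : ℕ) :
    ∏ i ∈ Finset.range n, ((2 * k + 1 : ℝ) - 2 * i) ≠ 0 :=
  Finset.prod_ne_zero_iff.2 fun i _ => odd_sub_even_ne_zero k i

theorem prod_neg_one_even_ne_zero (n : ℕ) : ∏ i ∈ Finset.range n, ((-1 : ℝ) - 2 * i) ≠ 0 :=
  Finset.prod_ne_zero_iff.2 fun i _ => sub_ne_zero.2 (neg_one_ne_even i)

/-- The factors depending on j cancel and leave the partial fractions of `oddPolyErase n k` at x =
2k' + 1. The numerator vanishes there unless k' = k, and then `prod_odd_sub_even` normalises the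
value to 1. -/
theorem invEven_mul_cauchyEntry {n : ℕ} {t : ℝ} {k k' : ℕ} (hk : k < n) (hk' : k' < n)
    (ht : 1 - (2 * k' + 2) * t ≠ 0) :
    ∑ j ∈ Finset.range n, invEven n t j k * cauchyEntry t j k' = if k = k' then 1 else 0 := by
  have h := sum_div_nodeDiff_div n (degree_oddPolyErase_lt hk) (x := 2 * k' + 1)
    fun j _ => odd_ne_even k' j
  have : ∀ j ∈ Finset.range n, invEven n t j k * cauchyEntry t j k'
      = (1 - (2 * k + 2) * t) / (1 - (2 * k' + 2) * t) * (cb k * (2 * k + 1) * cb (n - 1 - k)) *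
        ((oddPolyErase n k).eval (2 * j : ℝ) / nodeDiff n j / (2 * k' + 1 - 2 * j)) := by
    intro j hj
    rw [eval_oddPolyErase_div_of_lt hk (Finset.mem_range.1 hj), invEven, cauchyEntry]
    have h1 := odd_sub_even_ne_zero k j
    have h2 := odd_sub_even_ne_zero k' j
    have h3 : (2 * j + 1 : ℝ) ≠ 0 := by positivity
    field_simp
  rw [Finset.sum_congr rfl this, ← Finset.mul_sum, h]
  split_ifs with e
  · subst e
    rw [eval_oddPolyErase_self]
    have h5 := prod_odd_sub_even hk
    have h6 := prod_odd_sub_even_ne_zero n k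
    rw [div_self ht]
    rw [mul_div_assoc', div_eq_one_iff_eq h6, h5]
    ring
  · rw [eval_oddPolyErase_of_ne hk' (Ne.symm e)]
    simp

/-- The factor 1/(2j+1) of the Cauchy entry survives here and equals -1/(x - 2j) at x = -1, so the
partial fractions are evaluated at -1. The right-hand side is twice the constant that ε attaches to
degree 2k + 1. -/
theorem linEven_mul_cauchyEntry {n : ℕ} {t : ℝ} {k : ℕ} (hk : k < n)
    (ht : 1 - (2 * k + 2) * t ≠ 0) :
    ∑ j ∈ Finset.range n, linEven n j * cauchyEntry t j k
      = 2 / ((2 * k + 2) * (1 - (2 * k + 2) * t)) := by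
  have h := sum_div_nodeDiff_div n (degree_oddPolyErase_lt hk) (x := -1)
    fun j _ => neg_one_ne_even j
  have : ∀ j ∈ Finset.range n, linEven n j * cauchyEntry t j k
      = -(2 * cb n) / (1 - (2 * k + 2) * t) *
        ((oddPolyErase n k).eval (2 * j : ℝ) / nodeDiff n j / (-1 - 2 * j)) := by
    intro j hj
    rw [eval_oddPolyErase_div_of_lt hk (Finset.mem_range.1 hj), linEven, cauchyEntry]
    have h1 := odd_sub_even_ne_zero k j
    have h3 : (2 * j + 1 : ℝ) ≠ 0 := by positivity
    rw [show (-1 - 2 * j : ℝ) = -(2 * j + 1) by ring]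
    field_simp
    ring
  rw [Finset.sum_congr rfl this, ← Finset.mul_sum, h]
  have h4 := prod_neg_one_odd n
  rw [Finset.prod_range_succ] at h4
  have h5 := eval_oddPolyErase_neg_one hk
  have h6 := prod_neg_one_even_ne_zero n
  have h7 : (2 * n + 1 : ℝ) ≠ 0 := by positivity
  have h8 : (2 * k + 2 : ℝ) ≠ 0 := by positivity
  have h9 : cb n * ∏ l ∈ Finset.range n, ((-1 : ℝ) - (2 * l + 1))
      = ∏ x ∈ Finset.range n, (-1 - 2 * (x : ℝ)) := by
    apply mul_left_cancel₀ h7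
    linear_combination h4
  rw [div_mul_div_comm, div_eq_div_iff (mul_ne_zero ht h6) (mul_ne_zero h8 ht)]
  linear_combination (-2 * cb n * (1 - (2 * k + 2) * t)) * h5 + 2 * (1 - (2 * k + 2) * t) * h9

/-- The linear polynomial `1 - (X + 1) t`. -/
noncomputable def affPoly (t : ℝ) : ℝ[X] := C (1 - t) - C t * X

theorem eval_affPoly (t x : ℝ) : (affPoly t).eval x = 1 - (x + 1) * t := by
  simp [affPoly]; ring

theorem degree_oddPolyErase_mul_affPoly_lt {n k : ℕ} (h : k < n) (t : ℝ) :
    (oddPolyErase n k * affPoly t).degree < (n + 1 : ℕ) := by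
  have h1 : (affPoly t).degree ≤ (1 : ℕ) := by
    unfold affPoly
    compute_degree
    norm_num
  calc (oddPolyErase n k * affPoly t).degree ≤ ((n - 1 : ℕ) : WithBot ℕ) + (1 : ℕ) := by
        rw [degree_mul]
        exact add_le_add (degree_oddPolyErase h).le h1
    _ < (n + 1 : ℕ) := by exact_mod_cast (by omega : n - 1 + 1 < n + 1)

/-- The factor `affPoly t` takes the values 1 - (2j+1)t at the even nodes and 1 - (2k'+2)t at the
odd points. It raises the degree to at most n, still admissible for n + 1 nodes, and prepares the
cancellation with the border. -/
theorem invOdd_mul_cauchyEntry {n : ℕ} {t : ℝ} {k k' : ℕ} (hk : k < n) (hk' : k' < n)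
    (ht : 1 - (2 * k' + 2) * t ≠ 0) :
    ∑ j ∈ Finset.range (n + 1), invOdd n t j k * cauchyEntry t j k' = if k = k' then 1 else 0 := by
  have h := sum_div_nodeDiff_div (n + 1) (degree_oddPolyErase_mul_affPoly_lt hk t)
    (x := 2 * k' + 1) fun j _ => odd_ne_even k' j
  have : ∀ j ∈ Finset.range (n + 1), invOdd n t j k * cauchyEntry t j k'
      = -(cb k * (2 * k + 1) * (2 * (n - k) * cb (n - k))) / (1 - (2 * k' + 2) * t) *
        ((oddPolyErase n k * affPoly t).eval (2 * j : ℝ) / nodeDiff (n + 1) j /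
          (2 * k' + 1 - 2 * j)) := by
    intro j hj
    rw [eval_mul, mul_div_right_comm,
      eval_oddPolyErase_div_of_le hk (Nat.lt_succ_iff.1 (Finset.mem_range.1 hj)), eval_affPoly,
      invOdd, cauchyEntry]
    have h1 := odd_sub_even_ne_zero k j
    have h2 := odd_sub_even_ne_zero k' j
    have h3 : (2 * j + 1 : ℝ) ≠ 0 := by positivity
    field_simp
  rw [Finset.sum_congr rfl this, ← Finset.mul_sum, h, eval_mul, eval_affPoly]
  split_ifs with e
  · subst e
    rw [eval_oddPolyErase_self]
    have h5 := prod_odd_sub_even (Nat.lt_succ_of_lt hk)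
    rw [nodeDiff_succ hk, Nat.succ_eq_add_one, Nat.add_sub_cancel] at h5
    have h6 := prod_odd_sub_even_ne_zero (n + 1) k
    rw [div_mul_div_comm, div_eq_one_iff_eq (mul_ne_zero ht h6), h5]
    ring
  · rw [eval_oddPolyErase_of_ne hk' (Ne.symm e)]
    simp

/-- The border entry cancels both 2j + 1 and the affine factor. What remains is the coefficient of
X^n in a polynomial of degree n - 1. -/
theorem invOdd_mul_borderEntry {n : ℕ} {t : ℝ} {k : ℕ} (hk : k < n)
    (ht : ∀ j ≤ n, 1 - (2 * j + 1) * t ≠ 0) :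
    ∑ j ∈ Finset.range (n + 1), invOdd n t j k * borderEntry t j = 0 := by
  have h := sum_div_nodeDiff (n + 1) ((degree_oddPolyErase_lt hk).trans
    (by exact_mod_cast n.lt_succ_self))
  rw [Nat.add_sub_cancel, coeff_eq_zero_of_degree_lt (degree_oddPolyErase_lt hk)] at h
  have : ∀ j ∈ Finset.range (n + 1), invOdd n t j k * borderEntry t j
      = -(1 / 2 * (cb k * (2 * k + 1) * (2 * (n - k) * cb (n - k)))) *
        ((oddPolyErase n k).eval (2 * j : ℝ) / nodeDiff (n + 1) j) := by
    intro j hj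
    have hj' := Nat.lt_succ_iff.1 (Finset.mem_range.1 hj)
    rw [eval_oddPolyErase_div_of_le hk hj', invOdd, borderEntry]
    have h1 := odd_sub_even_ne_zero k j
    have h2 := ht j hj'
    have h3 : (2 * j + 1 : ℝ) ≠ 0 := by positivity
    field_simp
    norm_num
  rw [Finset.sum_congr rfl this, ← Finset.mul_sum, h, mul_zero]

/-- Partial fractions of the full `oddPoly n`, which vanishes at every odd point 2k + 1 with k < n.
-/
theorem invBorder_mul_cauchyEntry {n : ℕ} {t : ℝ} {k : ℕ} (hk : k < n) :
    ∑ j ∈ Finset.range (n + 1), invBorder n t j * cauchyEntry t j k = 0 := by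
  have h := sum_div_nodeDiff_div (n + 1) (degree_oddPoly_lt n) (x := 2 * k + 1)
    fun j _ => odd_ne_even k j
  have : ∀ j ∈ Finset.range (n + 1), invBorder n t j * cauchyEntry t j k
      = 2 * ((∏ l ∈ Finset.range (n + 1), (1 - (2 * l + 1) * t)) /
      ∏ k ∈ Finset.range n, (1 - (2 * k + 2) * t)) / (1 - (2 * k + 2) * t) *
        ((oddPoly n).eval (2 * j : ℝ) / nodeDiff (n + 1) j / (2 * k + 1 - 2 * j)) := by
    intro j hj
    rw [eval_oddPoly_div_of_le (Nat.lt_succ_iff.1 (Finset.mem_range.1 hj)), invBorder, cauchyEntry]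
    have h1 := odd_sub_even_ne_zero k j
    have h3 : (2 * j + 1 : ℝ) ≠ 0 := by positivity
    generalize (∏ l ∈ Finset.range (n + 1), (1 - (2 * (l : ℝ) + 1) * t)) /
      ∏ k ∈ Finset.range n, (1 - (2 * (k : ℝ) + 2) * t) = Θ
    field_simp
    ring
  rw [Finset.sum_congr rfl this, ← Finset.mul_sum, h, oddPoly_eq hk]
  simp

/-- The remaining denominators 1 - (2j+1)t are, up to the factor t, the differences x - 2j at x =
1/t - 1. The quotient of products in `invBorder` is chosen to normalise the value of the partial
fractions at that point. -/
theorem invBorder_mul_borderEntry {n : ℕ} {t : ℝ} (ht : ∀ j ≤ n, 1 - (2 * j + 1) * t ≠ 0)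
    (ht' : ∀ k < n, 1 - (2 * k + 2) * t ≠ 0) :
    ∑ j ∈ Finset.range (n + 1), invBorder n t j * borderEntry t j = 1 := by
  have : ∀ j ∈ Finset.range (n + 1), invBorder n t j * borderEntry t j
      = ((∏ l ∈ Finset.range (n + 1), (1 - (2 * l + 1) * t)) /
      ∏ k ∈ Finset.range n, (1 - (2 * k + 2) * t)) *
        ((oddPoly n).eval (2 * j : ℝ) / nodeDiff (n + 1) j / (1 - (2 * j + 1) * t)) := by
    intro j hj
    have hj' := Nat.lt_succ_iff.1 (Finset.mem_range.1 hj)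
    rw [eval_oddPoly_div_of_le hj', invBorder, borderEntry]
    have h2 := ht j hj'
    have h3 : (2 * j + 1 : ℝ) ≠ 0 := by positivity
    generalize (∏ l ∈ Finset.range (n + 1), (1 - (2 * (l : ℝ) + 1) * t)) /
      ∏ k ∈ Finset.range n, (1 - (2 * (k : ℝ) + 2) * t) = Θ
    field_simp
  rw [Finset.sum_congr rfl this, ← Finset.mul_sum]
  -- For t = 0 the point 1/t - 1 recedes to infinity, and the sum is the leading coefficient of the
  -- monic `oddPoly n`.
  rcases eq_or_ne t 0 with rfl | h0
  · have h := sum_div_nodeDiff (n + 1) (degree_oddPoly_lt n)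
    have h1 := (monic_oddPoly n).coeff_natDegree
    rw [natDegree_oddPoly] at h1
    rw [Nat.add_sub_cancel, h1] at h
    simpa using h
  · have hx : ∀ j : ℕ, (1 / t - 1) - 2 * (j : ℝ) = (1 - (2 * j + 1) * t) / t := by
      intro j; field_simp; ring
    have h := sum_div_nodeDiff_div (n + 1) (degree_oddPoly_lt n) (x := 1 / t - 1)
      fun j hj => by
        rw [← sub_ne_zero, hx]
        exact div_ne_zero (ht j (Nat.lt_succ_iff.1 (Finset.mem_range.1 hj))) h0
    simp only [hx, div_div_eq_mul_div] at h
    have h1 : ∑ j ∈ Finset.range (n + 1), (oddPoly n).eval (2 * j : ℝ) / nodeDiff (n + 1) j /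
        (1 - (2 * j + 1) * t) = 1 / t * ∑ j ∈ Finset.range (n + 1),
          (oddPoly n).eval (2 * j : ℝ) / nodeDiff (n + 1) j * t / (1 - (2 * j + 1) * t) := by
      rw [Finset.mul_sum]
      refine Finset.sum_congr rfl fun j _ => ?_
      field_simp
    rw [h1, h, eval_oddPoly, Finset.prod_div_distrib, Finset.prod_const, Finset.card_range]
    have h2 : ∏ l ∈ Finset.range n, (1 / t - 1 - (2 * (l : ℝ) + 1))
        = (∏ l ∈ Finset.range n, (1 - (2 * l + 2) * t)) / t ^ n := by
      rw [← Finset.card_range n, ← Finset.prod_const, Finset.card_range,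
        ← Finset.prod_div_distrib]
      refine Finset.prod_congr rfl fun l _ => ?_
      field_simp
      ring
    rw [h2]
    have h3 : ∏ l ∈ Finset.range (n + 1), (1 - (2 * (l : ℝ) + 1) * t) ≠ 0 :=
      Finset.prod_ne_zero_iff.2 fun j hj => ht j (Nat.lt_succ_iff.1 (Finset.mem_range.1 hj))
    have h4 : ∏ l ∈ Finset.range n, (1 - (2 * (l : ℝ) + 2) * t) ≠ 0 :=
      Finset.prod_ne_zero_iff.2 fun j hj => ht' j (Finset.mem_range.1 hj)
    generalize ∏ l ∈ Finset.range (n + 1), (1 - (2 * (l : ℝ) + 1) * t) = a at h3 ⊢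
    generalize ∏ l ∈ Finset.range n, (1 - (2 * (l : ℝ) + 2) * t) = b at h4 ⊢
    field_simp
    ring

/-- Again the partial fractions at -1, where `affPoly t` equals 1; `prod_neg_one_odd` compares the
two node products there. -/
theorem linOdd_mul_cauchyEntry {n : ℕ} {t : ℝ} {k : ℕ} (hk : k < n)
    (ht : 1 - (2 * k + 2) * t ≠ 0) :
    ∑ j ∈ Finset.range (n + 1), linOdd n t j * cauchyEntry t j k
      = 2 / ((2 * k + 2) * (1 - (2 * k + 2) * t)) := by
  have h := sum_div_nodeDiff_div (n + 1) (degree_oddPolyErase_mul_affPoly_lt hk t) (x := -1)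
    fun j _ => neg_one_ne_even j
  have : ∀ j ∈ Finset.range (n + 1), linOdd n t j * cauchyEntry t j k
      = (2 * ((2 * n + 1) * cb n)) / (1 - (2 * k + 2) * t) *
        ((oddPolyErase n k * affPoly t).eval (2 * j : ℝ) / nodeDiff (n + 1) j / (-1 - 2 * j)) := by
    intro j hj
    rw [eval_mul, mul_div_right_comm (eval (2 * (j : ℝ)) (oddPolyErase n k)),
      eval_oddPolyErase_div_of_le hk (Nat.lt_succ_iff.1 (Finset.mem_range.1 hj)), eval_affPoly,
      linOdd, cauchyEntry]
    have h1 := odd_sub_even_ne_zero k j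
    have h3 : (2 * j + 1 : ℝ) ≠ 0 := by positivity
    rw [show (-1 - 2 * j : ℝ) = -(2 * j + 1) by ring]
    field_simp
    ring
  rw [Finset.sum_congr rfl this, ← Finset.mul_sum, h, eval_mul, eval_affPoly]
  have h4 := prod_neg_one_odd n
  have h5 := eval_oddPolyErase_neg_one hk
  have h6 := prod_neg_one_even_ne_zero (n + 1)
  have h8 : (2 * k + 2 : ℝ) ≠ 0 := by positivity
  rw [div_mul_div_comm, div_eq_div_iff (mul_ne_zero ht h6) (mul_ne_zero h8 ht)]
  linear_combination (2 * ((2 * n + 1) * cb n) * (1 - (2 * k + 2) * t)) * h5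
    - 2 * (1 - (2 * k + 2) * t) * h4

/-- The affine factor cancels against the border entry, leaving `oddPoly n` itself evaluated at -1.
The value 1 is what makes the last row of the inverse enter `sum_invOdd` with coefficient 1. -/
theorem linOdd_mul_borderEntry {n : ℕ} {t : ℝ} (ht : ∀ j ≤ n, 1 - (2 * j + 1) * t ≠ 0) :
    ∑ j ∈ Finset.range (n + 1), linOdd n t j * borderEntry t j = 1 := by
  have h := sum_div_nodeDiff_div (n + 1) (degree_oddPoly_lt n) (x := -1)
    fun j _ => neg_one_ne_even j
  have : ∀ j ∈ Finset.range (n + 1), linOdd n t j * borderEntry t j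
      = -((2 * n + 1) * cb n) *
        ((oddPoly n).eval (2 * j : ℝ) / nodeDiff (n + 1) j / (-1 - 2 * j)) := by
    intro j hj
    have hj' := Nat.lt_succ_iff.1 (Finset.mem_range.1 hj)
    rw [eval_oddPoly_div_of_le hj', linOdd, borderEntry]
    have h2 := ht j hj'
    have h3 : (2 * j + 1 : ℝ) ≠ 0 := by positivity
    rw [show (-1 - 2 * j : ℝ) = -(2 * j + 1) by ring]
    field_simp
  rw [Finset.sum_congr rfl this, ← Finset.mul_sum, h, eval_oddPoly, mul_div_assoc',
    div_eq_one_iff_eq (prod_neg_one_even_ne_zero _)]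
  linear_combination -prod_neg_one_odd n

/-! ### Two-sided inverses of the Cauchy-type matrices, for both parities of N -/

theorem sum_range_parity {M : Type*} [AddCommMonoid M] (N : ℕ) (f : ℕ → M) :
    ∑ m ∈ Finset.range N, f m = ∑ j ∈ Finset.range ((N + 1) / 2), f (2 * j)
      + ∑ k ∈ Finset.range (N / 2), f (2 * k + 1) := by
  induction N with
  | zero => simp
  | succ N ih =>
    rw [Finset.sum_range_succ, ih]
    rcases Nat.even_or_odd' N with ⟨p, rfl | rfl⟩
    · rw [show (2 * p + 1) / 2 = p by omega, show 2 * p / 2 = p by omega,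
        show (2 * p + 1 + 1) / 2 = p + 1 by omega, Finset.sum_range_succ _ p, add_right_comm]
    · rw [show (2 * p + 1) / 2 = p by omega, show (2 * p + 1 + 1) / 2 = p + 1 by omega,
        show (2 * p + 1 + 1 + 1) / 2 = p + 1 by omega,
        Finset.sum_range_succ (fun k => f (2 * k + 1)), add_assoc]

theorem sum_fin_parity {M : Type*} [AddCommMonoid M] (N : ℕ) (f : ℕ → M) :
    ∑ m : Fin N, f m = ∑ j ∈ Finset.range ((N + 1) / 2), f (2 * j)
      + ∑ k ∈ Finset.range (N / 2), f (2 * k + 1) := by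
  rw [← Finset.sum_range, sum_range_parity]

theorem cauchyEntry_mul_invEven {n : ℕ} {t : ℝ} (ht : ∀ k < n, 1 - (2 * k + 2) * t ≠ 0) {j j' : ℕ}
    (hj : j < n) (hj' : j' < n) :
    ∑ k ∈ Finset.range n, cauchyEntry t j k * invEven n t j' k = if j = j' then 1 else 0 := by
  let A : Matrix (Fin n) (Fin n) ℝ := Matrix.of fun k j => invEven n t j k
  let B : Matrix (Fin n) (Fin n) ℝ := Matrix.of fun j k => cauchyEntry t j k
  have h : A * B = 1 := by
    ext k k'
    rw [Matrix.mul_apply, Matrix.one_apply]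
    have := invEven_mul_cauchyEntry k.2 k'.2 (ht k' k'.2)
    rw [Finset.sum_range] at this
    simp only [A, B, Matrix.of_apply, this, Fin.ext_iff]
  have h1 : B * A = 1 := mul_eq_one_comm.1 h
  have h2 := congrFun (congrFun h1 ⟨j, hj⟩) ⟨j', hj'⟩
  rw [Matrix.mul_apply, Matrix.one_apply] at h2
  rw [Finset.sum_range]
  simpa only [A, B, Matrix.of_apply, Fin.ext_iff] using h2

/-- With the border as an additional column the rectangular Cauchy matrix becomes square of size n +
1, so the left inverse assembled from the four preceding identities is also a right inverse. -/
theorem cauchyEntry_mul_invOdd {n : ℕ} {t : ℝ} (ht : ∀ k < n, 1 - (2 * k + 2) * t ≠ 0)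
    (ht' : ∀ j ≤ n, 1 - (2 * j + 1) * t ≠ 0) {j j' : ℕ} (hj : j < n + 1) (hj' : j' < n + 1) :
    ∑ k ∈ Finset.range n, cauchyEntry t j k * invOdd n t j' k
      + borderEntry t j * invBorder n t j' = if j = j' then 1 else 0 := by
  let A : Matrix (Fin n ⊕ Unit) (Fin (n + 1)) ℝ := Matrix.of fun k j =>
    Sum.elim (fun k : Fin n => invOdd n t j k) (fun _ => invBorder n t j) k
  let B : Matrix (Fin (n + 1)) (Fin n ⊕ Unit) ℝ := Matrix.of fun j k =>
    Sum.elim (fun k : Fin n => cauchyEntry t j k) (fun _ => borderEntry t j) k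
  have h : A * B = 1 := by
    ext k k'
    rw [Matrix.mul_apply, Matrix.one_apply]
    rcases k with k | k <;> rcases k' with k' | k'
    · have := invOdd_mul_cauchyEntry k.2 k'.2 (ht k' k'.2)
      rw [Finset.sum_range] at this
      simp [A, B, this, Fin.ext_iff]
    · have := invOdd_mul_borderEntry k.2 ht'
      rw [Finset.sum_range] at this
      simp [A, B, this]
    · have := invBorder_mul_cauchyEntry (t := t) k'.2
      rw [Finset.sum_range] at this
      simp [A, B, this]
    · have := invBorder_mul_borderEntry ht' ht
      rw [Finset.sum_range] at this
      simp [A, B, this]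
  have h1 : B * A = 1 := (Matrix.mul_eq_one_comm_of_card_eq _ _ _ (by simp)).1 h
  have h2 := congrFun (congrFun h1 ⟨j, hj⟩) ⟨j', hj'⟩
  rw [Matrix.mul_apply, Matrix.one_apply] at h2
  rw [Finset.sum_range]
  simpa [A, B, Fin.ext_iff] using h2

/-- Each constant is expanded as a row combination of Cauchy entries by `linEven_mul_cauchyEntry`;
the right inverse then isolates the coefficient `linEven n j`, so no sum over k has to be evaluated.
-/
theorem sum_invEven {n : ℕ} {t : ℝ} (ht : ∀ k < n, 1 - (2 * k + 2) * t ≠ 0) {j : ℕ} (hj : j < n) :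
    ∑ k ∈ Finset.range n, 2 / ((2 * k + 2) * (1 - (2 * k + 2) * t)) * invEven n t j k
      = linEven n j := by
  have h1 : ∀ k ∈ Finset.range n, 2 / ((2 * k + 2) * (1 - (2 * k + 2) * t)) * invEven n t j k
      = ∑ i ∈ Finset.range n, linEven n i * (cauchyEntry t i k * invEven n t j k) := by
    intro k hk
    rw [← linEven_mul_cauchyEntry (Finset.mem_range.1 hk) (ht k (Finset.mem_range.1 hk)),
      Finset.sum_mul]
    exact Finset.sum_congr rfl fun _ _ => mul_assoc _ _ _
  rw [Finset.sum_congr rfl h1, Finset.sum_comm]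
  simp only [← Finset.mul_sum]
  rw [Finset.sum_congr rfl fun i hi => by
    rw [cauchyEntry_mul_invEven ht (Finset.mem_range.1 hi) hj]]
  simp [hj]

/-- The argument of `sum_invEven`, where the border identity for `linOdd` supplies the term
`invBorder`. -/
theorem sum_invOdd {n : ℕ} {t : ℝ} (ht : ∀ k < n, 1 - (2 * k + 2) * t ≠ 0)
    (ht' : ∀ j ≤ n, 1 - (2 * j + 1) * t ≠ 0) {j : ℕ} (hj : j < n + 1) :
    ∑ k ∈ Finset.range n, 2 / ((2 * k + 2) * (1 - (2 * k + 2) * t)) * invOdd n t j k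
      + invBorder n t j = linOdd n t j := by
  have h1 : ∀ k ∈ Finset.range n, 2 / ((2 * k + 2) * (1 - (2 * k + 2) * t)) * invOdd n t j k
      = ∑ i ∈ Finset.range (n + 1), linOdd n t i * (cauchyEntry t i k * invOdd n t j k) := by
    intro k hk
    rw [← linOdd_mul_cauchyEntry (Finset.mem_range.1 hk) (ht k (Finset.mem_range.1 hk)),
      Finset.sum_mul]
    exact Finset.sum_congr rfl fun _ _ => mul_assoc _ _ _
  have h2 : invBorder n t j
      = ∑ i ∈ Finset.range (n + 1), linOdd n t i * (borderEntry t i * invBorder n t j) := by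
    simp only [← mul_assoc]
    rw [← Finset.sum_mul, linOdd_mul_borderEntry ht', one_mul]
  rw [Finset.sum_congr rfl h1, Finset.sum_comm, h2, ← Finset.sum_add_distrib]
  simp only [← Finset.mul_sum, ← mul_add]
  rw [Finset.sum_congr rfl fun i hi => by
    rw [cauchyEntry_mul_invOdd ht ht' (Finset.mem_range.1 hi) hj]]
  simp
  omega

/-- The entries of the inverse Cauchy-type matrix, for both parities of `N`. -/
noncomputable def invEntry (N : ℕ) (t : ℝ) (j k : ℕ) : ℝ :=
  if Even N then invEven (N / 2) t j k else invOdd (N / 2) t j k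

/-- The last row of the inverse, zero for even `N`. -/
noncomputable def invBorderEntry (N : ℕ) (t : ℝ) (j : ℕ) : ℝ :=
  if Even N then 0 else invBorder (N / 2) t j

/-- The linear coefficients of the kernel. -/
noncomputable def linEntry (N : ℕ) (t : ℝ) (j : ℕ) : ℝ :=
  if Even N then linEven (N / 2) j else linOdd (N / 2) t j

theorem sum_invEntry {N : ℕ} {t : ℝ} (ht : ∀ i : ℕ, i ≤ N → 1 - (i : ℝ) * t ≠ 0)
    {j : ℕ} (hj : j < (N + 1) / 2) :
    ∑ k ∈ Finset.range (N / 2), 2 / ((2 * k + 2) * (1 - (2 * k + 2) * t)) * invEntry N t j k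
      + invBorderEntry N t j = linEntry N t j := by
  unfold invEntry invBorderEntry linEntry
  rcases Nat.even_or_odd' N with ⟨p, rfl | rfl⟩
  · simp only [even_two, Even.mul_right, ↓reduceIte]
    rw [add_zero]
    refine sum_invEven (fun k hk => ?_) (by omega)
    have := ht (2 * k + 2) (by omega)
    push_cast at this; exact this
  · simp only [Nat.not_even_bit1, ↓reduceIte]
    refine sum_invOdd (fun k hk => ?_) (fun k hk => ?_) (by omega)
    · have := ht (2 * k + 2) (by omega)
      push_cast at this; exact this
    · have := ht (2 * k + 1) (by omega)
      push_cast at this; exact this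

theorem invEntry_mul_cauchyEntry {N : ℕ} {t : ℝ} (ht : ∀ i : ℕ, i ≤ N → 1 - (i : ℝ) * t ≠ 0)
    {k k' : ℕ} (hk : k < N / 2) (hk' : k' < N / 2) :
    ∑ j ∈ Finset.range ((N + 1) / 2), invEntry N t j k * cauchyEntry t j k'
      = if k = k' then 1 else 0 := by
  unfold invEntry
  have h2 := ht (2 * k' + 2) (by omega)
  push_cast at h2
  rcases Nat.even_or_odd' N with ⟨p, rfl | rfl⟩
  · simp only [even_two, Even.mul_right, ↓reduceIte]
    rw [show (2 * p + 1) / 2 = 2 * p / 2 by omega]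
    exact invEven_mul_cauchyEntry hk hk' h2
  · simp only [Nat.not_even_bit1, ↓reduceIte]
    rw [show (2 * p + 1 + 1) / 2 = (2 * p + 1) / 2 + 1 by omega]
    exact invOdd_mul_cauchyEntry hk hk' h2

theorem cauchyEntry_mul_invEntry {N : ℕ} {t : ℝ} (ht : ∀ i : ℕ, i ≤ N → 1 - (i : ℝ) * t ≠ 0)
    {j j' : ℕ} (hj : j < (N + 1) / 2) (hj' : j' < (N + 1) / 2) :
    ∑ k ∈ Finset.range (N / 2), cauchyEntry t j k * invEntry N t j' k
      + borderEntry t j * invBorderEntry N t j' = if j = j' then 1 else 0 := by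
  unfold invEntry invBorderEntry
  have h2 : ∀ k < N / 2, 1 - (2 * k + 2) * t ≠ 0 := fun k hk => by
    have := ht (2 * k + 2) (by omega)
    push_cast at this; exact this
  rcases Nat.even_or_odd' N with ⟨p, rfl | rfl⟩
  · simp only [even_two, Even.mul_right, ↓reduceIte]
    rw [mul_zero, add_zero]
    exact cauchyEntry_mul_invEven h2 (by omega) (by omega)
  · simp only [Nat.not_even_bit1, ↓reduceIte]
    refine cauchyEntry_mul_invOdd h2 (fun k hk => ?_) (by omega) (by omega)
    have := ht (2 * k + 1) (by omega)
    push_cast at this; exact this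

/-! ### The inverses of the full Gram matrix and of the bordered matrix -/

set_option linter.unusedSimpArgs false

theorem half_even (j : ℕ) : 2 * j / 2 = j := by omega

theorem half_odd (j : ℕ) : (2 * j + 1) / 2 = j := by omega

theorem not_odd_two_mul (x : ℕ) : ¬ Odd (2 * x) := Nat.not_odd_iff_even.2 (even_two_mul x)

/-- The explicit entries of the matrix `μ`. -/
noncomputable def coeffEntry (N : ℕ) (t : ℝ) (m n : ℕ) : ℝ :=
  if Odd m ∧ Even n then invEntry N t (n / 2) (m / 2)
  else if Even m ∧ Odd n then -invEntry N t (m / 2) (n / 2) else 0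

/-- The explicit entries of the last row of the inverse of the bordered matrix. -/
noncomputable def borderVec (N : ℕ) (t : ℝ) (m : ℕ) : ℝ :=
  if Even m then invBorderEntry N t (m / 2) else 0

/-- The explicit entries of the Gram matrix. -/
noncomputable def gram (t : ℝ) (m n : ℕ) : ℝ :=
  if Even m ∧ Odd n then cauchyEntry t (m / 2) (n / 2)
  else if Odd m ∧ Even n then -cauchyEntry t (n / 2) (m / 2) else 0

/-- The explicit integrals of the weighted monomials. -/
noncomputable def sigmaEntry (t : ℝ) (m : ℕ) : ℝ := if Even m then borderEntry t (m / 2) else 0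

theorem one_sub_mul_tinv_ne_zero {N : ℕ} {s : ℝ≥0∞} (hs : (N : ℝ≥0∞) < s) (i : ℕ) (hi : i ≤ N) :
    1 - (i : ℝ) * tinv s ≠ 0 := by
  have h1 := mul_tinv_lt_one hs
  have h2 : (i : ℝ) * tinv s ≤ N * tinv s :=
    mul_le_mul_of_nonneg_right (by exact_mod_cast hi) (tinv_nonneg s)
  linarith

theorem succ_mul_tinv_lt_one {N : ℕ} {s : ℝ≥0∞} (hs : (N : ℝ≥0∞) < s) {m : ℕ} (hm : m < N) :
    ((m : ℝ) + 1) * tinv s < 1 := by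
  have h1 := mul_tinv_lt_one hs
  have h2 : ((m : ℝ) + 1) * tinv s ≤ N * tinv s :=
    mul_le_mul_of_nonneg_right (by exact_mod_cast hm) (tinv_nonneg s)
  linarith

theorem skewGram_apply {N : ℕ} {s : ℝ≥0∞} (hs : (N : ℝ≥0∞) < s) (m n : Fin N) :
    skewGram N s m n = (gram (tinv s) m n : ℂ) := by
  rw [skewGram, Matrix.of_apply, skew_monomial s (pos_of_gt hs).ne' m n
    (succ_mul_tinv_lt_one hs m.2) (succ_mul_tinv_lt_one hs n.2), gram]
  have key : ∀ j k : ℕ, gramEntry (tinv s) (2 * j) (2 * k + 1) = cauchyEntry (tinv s) j k := by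
    intro j k
    rw [gramEntry, cauchyEntry]
    push_cast
    ring_nf
  rcases Nat.even_or_odd' (m : ℕ) with ⟨p, hp | hp⟩ <;>
    rcases Nat.even_or_odd' (n : ℕ) with ⟨q, hq | hq⟩ <;> rw [hp, hq]
  · simp [not_odd_two_mul]
  · rw [if_pos ⟨by simp, by simp⟩, if_pos ⟨by simp, by simp⟩, key, half_even, half_odd]
  · rw [if_neg (fun h => not_odd_two_mul _ h.2), if_pos ⟨by simp, by simp⟩,
      if_neg (fun h => not_odd_two_mul _ h.2), if_pos ⟨by simp, by simp⟩, key, half_even, half_odd]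
    push_cast
    rfl
  · simp

theorem sigma_apply {N : ℕ} {s : ℝ≥0∞} (hs : (N : ℝ≥0∞) < s) {m : ℕ} (hm : m < N) :
    ∫ x : ℝ, wMon s m x = (sigmaEntry (tinv s) m : ℂ) := by
  rw [integral_wMon s (pos_of_gt hs).ne' m (succ_mul_tinv_lt_one hs hm), sigmaEntry]
  rcases Nat.even_or_odd' m with ⟨p, rfl | rfl⟩
  · rw [if_pos (by simp), if_pos (by simp), borderEntry, show 2 * p / 2 = p by omega]
    push_cast
    rfl
  · simp

/-- Ordered by parity, U has vanishing diagonal blocks and off-diagonal blocks C and -Cᵀ. Its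
inverse therefore has the inverses of -Cᵀ and C as off-diagonal blocks; the border meets only the
even indices. -/
theorem gram_mul_coeffEntry {N : ℕ} {t : ℝ} (ht : ∀ i : ℕ, i ≤ N → 1 - (i : ℝ) * t ≠ 0)
    {m m' : ℕ} (hm : m < N) (hm' : m' < N) :
    ∑ n : Fin N, gram t m n * coeffEntry N t n m' + sigmaEntry t m * borderVec N t m'
      = if m = m' then 1 else 0 := by
  rw [sum_fin_parity N (fun n => gram t m n * coeffEntry N t n m')]
  unfold gram coeffEntry sigmaEntry borderVec
  rcases Nat.even_or_odd' m with ⟨p, rfl | rfl⟩ <;>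
    rcases Nat.even_or_odd' m' with ⟨q, rfl | rfl⟩ <;>
    simp only [even_two, Even.mul_right, odd_two_mul_add_one,
      Nat.not_even_bit1, ↓reduceIte, false_and, and_false, and_true, and_self, true_and, mul_zero,
      zero_mul, half_even, half_odd, Finset.sum_const_zero, zero_add, add_zero, not_odd_two_mul]
  · rw [cauchyEntry_mul_invEntry ht (by omega) (by omega)]
    simp
  · simp; omega
  · simp; omega
  · have := invEntry_mul_cauchyEntry ht (k := q) (k' := p) (by omega) (by omega)
    simp only [neg_mul_neg]
    rw [Finset.sum_congr rfl fun _ _ => mul_comm _ _, this]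
    simp [eq_comm]

theorem sum_gram_mul_borderVec {N : ℕ} {t : ℝ} {m : ℕ} (hm : m < N) (hN : Odd N) :
    ∑ n : Fin N, gram t m n * borderVec N t n = 0 := by
  rw [sum_fin_parity N (fun n => gram t m n * borderVec N t n)]
  unfold gram borderVec invBorderEntry
  rcases Nat.even_or_odd' m with ⟨p, rfl | rfl⟩ <;>
    simp only [even_two, Even.mul_right, odd_two_mul_add_one, Nat.not_even_iff_odd.2 hN,
      Nat.not_even_bit1, ↓reduceIte, false_and, and_false, and_true, and_self, true_and, mul_zero,
      zero_mul, half_even, half_odd, Finset.sum_const_zero, zero_add, add_zero, not_odd_two_mul]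
  have := invBorder_mul_cauchyEntry (n := N / 2) (t := t) (k := p) (by omega)
  obtain ⟨r, rfl⟩ := hN
  rw [show (2 * r + 1 + 1) / 2 = (2 * r + 1) / 2 + 1 by omega]
  simp only [neg_mul, Finset.sum_neg_distrib, neg_eq_zero]
  rw [← this]
  exact Finset.sum_congr rfl fun _ _ => mul_comm _ _

theorem sum_sigmaEntry_mul_coeffEntry {N : ℕ} {t : ℝ}
    (ht : ∀ i : ℕ, i ≤ N → 1 - (i : ℝ) * t ≠ 0) {m : ℕ} (hm : m < N) (hN : Odd N) :
    ∑ n : Fin N, sigmaEntry t n * coeffEntry N t n m = 0 := by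
  rw [sum_fin_parity N (fun n => sigmaEntry t n * coeffEntry N t n m)]
  unfold coeffEntry sigmaEntry invEntry
  rcases Nat.even_or_odd' m with ⟨p, rfl | rfl⟩ <;>
    simp only [even_two, Even.mul_right, odd_two_mul_add_one, Nat.not_even_iff_odd.2 hN,
      Nat.not_even_bit1, ↓reduceIte, false_and, and_false, and_true, and_self, true_and, mul_zero,
      zero_mul, half_even, half_odd, Finset.sum_const_zero, zero_add, add_zero, not_odd_two_mul]
  have := invOdd_mul_borderEntry (n := N / 2) (t := t) (k := p) (by omega) fun j hj => by
    have := ht (2 * j + 1) (by obtain ⟨r, rfl⟩ := hN; omega)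
    push_cast at this; exact this
  obtain ⟨r, rfl⟩ := hN
  rw [show (2 * r + 1 + 1) / 2 = (2 * r + 1) / 2 + 1 by omega]
  simp only [mul_neg, Finset.sum_neg_distrib, neg_eq_zero]
  rw [← this]
  exact Finset.sum_congr rfl fun _ _ => mul_comm _ _

theorem sum_sigmaEntry_mul_borderVec {N : ℕ} {t : ℝ}
    (ht : ∀ i : ℕ, i ≤ N → 1 - (i : ℝ) * t ≠ 0) (hN : Odd N) :
    ∑ n : Fin N, sigmaEntry t n * borderVec N t n = 1 := by
  rw [sum_fin_parity N (fun n => sigmaEntry t n * borderVec N t n)]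
  unfold sigmaEntry borderVec invBorderEntry
  simp only [even_two, Even.mul_right, Nat.not_even_iff_odd.2 hN,
      Nat.not_even_bit1, ↓reduceIte, mul_zero,
      half_even, Finset.sum_const_zero, add_zero]
  have := invBorder_mul_borderEntry (n := N / 2) (t := t) (fun j hj => by
    have := ht (2 * j + 1) (by obtain ⟨r, rfl⟩ := hN; omega)
    push_cast at this; exact this) (fun j hj => by
    have := ht (2 * j + 2) (by obtain ⟨r, rfl⟩ := hN; omega)
    push_cast at this; exact this)
  obtain ⟨r, rfl⟩ := hN
  rw [show (2 * r + 1 + 1) / 2 = (2 * r + 1) / 2 + 1 by omega]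
  rw [← this]
  exact Finset.sum_congr rfl fun _ _ => mul_comm _ _

theorem skewGram_mul_eq_one {N : ℕ} {s : ℝ≥0∞} (hs : (N : ℝ≥0∞) < s) (hN : Even N) :
    skewGram N s * Matrix.of (fun m n : Fin N => (coeffEntry N (tinv s) m n : ℂ)) = 1 := by
  ext m m'
  rw [Matrix.mul_apply, Matrix.one_apply]
  simp only [skewGram_apply hs, Matrix.of_apply]
  have h := gram_mul_coeffEntry (one_sub_mul_tinv_ne_zero hs) m.2 m'.2
  have hb : borderVec N (tinv s) m' = 0 := by
    unfold borderVec invBorderEntry; simp [hN]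
  rw [hb, mul_zero, add_zero] at h
  have h' := congrArg (fun x : ℝ => (x : ℂ)) h
  push_cast at h'
  rw [h']
  split_ifs <;> simp_all [Fin.ext_iff]

/-- The inverse of the bordered matrix. -/
noncomputable def borderedInv (N : ℕ) (t : ℝ) : Matrix (Fin N ⊕ Unit) (Fin N ⊕ Unit) ℂ :=
  Matrix.fromBlocks (Matrix.of fun m n : Fin N => (coeffEntry N t m n : ℂ))
    (Matrix.of fun m _ => (-borderVec N t m : ℂ)) (Matrix.of fun _ m => (borderVec N t m : ℂ)) 0

theorem borderedGram_mul_eq_one {N : ℕ} {s : ℝ≥0∞} (hs : (N : ℝ≥0∞) < s) (hN : Odd N) :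
    borderedGram N s * borderedInv N (tinv s) = 1 := by
  have ht := one_sub_mul_tinv_ne_zero hs
  rw [borderedGram, borderedInv, Matrix.fromBlocks_multiply, ← Matrix.fromBlocks_one]
  congr 1
  · ext m m'
    have h := gram_mul_coeffEntry ht m.2 m'.2
    have h' := congrArg (fun x : ℝ => (x : ℂ)) h
    push_cast at h'
    simp only [Matrix.add_apply, Matrix.mul_apply, skewGram_apply hs, Matrix.of_apply,
      sigma_apply hs m.2, Finset.univ_unique, Finset.sum_singleton, Matrix.one_apply]
    rw [h']
    split_ifs <;> simp_all [Fin.ext_iff]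
  · ext m m'
    have h' := congrArg (fun x : ℝ => (x : ℂ)) (sum_gram_mul_borderVec (t := tinv s) m.2 hN)
    push_cast at h'
    simp [Matrix.add_apply, Matrix.mul_apply, skewGram_apply hs, h']
  · ext m m'
    have h' := congrArg (fun x : ℝ => (x : ℂ)) (sum_sigmaEntry_mul_coeffEntry ht m'.2 hN)
    push_cast at h'
    simp only [Matrix.add_apply, Matrix.mul_apply, Matrix.of_apply, Matrix.zero_apply, zero_mul,
      Finset.sum_const_zero, add_zero]
    rw [Finset.sum_congr rfl fun x _ => by rw [sigma_apply hs x.2]]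
    simp [h']
  · ext m m'
    have h' := congrArg (fun x : ℝ => (x : ℂ)) (sum_sigmaEntry_mul_borderVec ht hN)
    push_cast at h'
    simp only [Matrix.add_apply, Matrix.mul_apply, Matrix.of_apply, Matrix.zero_apply, zero_mul,
      Finset.sum_const_zero, add_zero]
    rw [Finset.sum_congr rfl fun x _ => by rw [sigma_apply hs x.2]]
    simp [h']

theorem coeff_eq {N : ℕ} {s : ℝ≥0∞} (hs : (N : ℝ≥0∞) < s) (m n : Fin N) :
    coeff N s m n = (coeffEntry N (tinv s) m n : ℂ) := by
  unfold coeff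
  split_ifs with hN
  · rw [Matrix.inv_eq_right_inv (skewGram_mul_eq_one hs hN)]
    rfl
  · rw [Matrix.inv_eq_right_inv (borderedGram_mul_eq_one hs (Nat.not_even_iff_odd.1 hN))]
    rfl

theorem borderCoeff_eq {N : ℕ} {s : ℝ≥0∞} (hs : (N : ℝ≥0∞) < s) (m : Fin N) :
    borderCoeff N s m = (-borderVec N (tinv s) m : ℂ) := by
  unfold borderCoeff
  split_ifs with hN
  · simp [borderVec, invBorderEntry, hN]
  · rw [Matrix.inv_eq_right_inv (borderedGram_mul_eq_one hs (Nat.not_even_iff_odd.1 hN))]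
    rfl

theorem coeffEntry_antisymm (N : ℕ) (t : ℝ) (m n : ℕ) :
    coeffEntry N t n m = -coeffEntry N t m n := by
  unfold coeffEntry
  rcases Nat.even_or_odd m with h | h <;> rcases Nat.even_or_odd n with h' | h' <;>
    simp [h, h', Nat.not_odd_iff_even.2, Nat.not_even_iff_odd.2]

/-! ### Double power series of polynomial growth -/

/-- The double power series with coefficients `c`. -/
noncomputable def dps (c : ℕ × ℕ → ℂ) (u v : ℂ) : ℂ := ∑' p : ℕ × ℕ, c p * u ^ p.1 * v ^ p.2

/-- The polynomial majorant `K ((m + 1) (n + 1)) ^ q`. -/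
noncomputable def majorant (K : ℝ) (q : ℕ) (p : ℕ × ℕ) : ℝ := K * ((p.1 + 1) * (p.2 + 1)) ^ q

/-- Coefficients of the derivative in the first variable. -/
noncomputable def shiftL (c : ℕ × ℕ → ℂ) (p : ℕ × ℕ) : ℂ := (p.1 + 1) * c (p.1 + 1, p.2)

/-- Coefficients of the derivative in the second variable. -/
noncomputable def shiftR (c : ℕ × ℕ → ℂ) (p : ℕ × ℕ) : ℂ := (p.2 + 1) * c (p.1, p.2 + 1)

theorem majorant_nonneg {K : ℝ} (hK : 0 ≤ K) (q : ℕ) (p : ℕ × ℕ) : 0 ≤ majorant K q p := by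
  unfold majorant; positivity

theorem summable_majorant (K : ℝ) (q : ℕ) {r : ℝ} (hr : 0 ≤ r) (hr1 : r < 1) :
    Summable fun p : ℕ × ℕ => majorant K q p * r ^ p.1 * r ^ p.2 := by
  have h0 : Summable fun n : ℕ => ((n : ℝ) + 1) ^ q * r ^ n := by
    have h1 : Summable fun n : ℕ => (n : ℝ) ^ q * r ^ n :=
      summable_pow_mul_geometric_of_norm_lt_one q (by rwa [Real.norm_of_nonneg hr])
    rcases eq_or_lt_of_le hr with rfl | hr0
    · refine summable_of_ne_finset_zero (s := {0}) fun n hn => ?_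
      rw [zero_pow (by simpa using hn), mul_zero]
    · have h2 := ((summable_nat_add_iff 1).2 h1).mul_left r⁻¹
      refine h2.congr fun n => ?_
      push_cast
      rw [pow_succ]
      field_simp
  have := (h0.mul_of_nonneg h0 (fun n => by positivity) (fun n => by positivity)).mul_left K
  refine this.congr fun p => ?_
  unfold majorant
  rw [mul_pow]
  ring

theorem norm_term_le {c : ℕ × ℕ → ℂ} {K : ℝ} {q : ℕ} (hc : ∀ p, ‖c p‖ ≤ majorant K q p) {u v : ℂ}
    {r : ℝ} (hu : ‖u‖ ≤ r) (hv : ‖v‖ ≤ r) (p : ℕ × ℕ) :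
    ‖c p * u ^ p.1 * v ^ p.2‖ ≤ majorant K q p * r ^ p.1 * r ^ p.2 := by
  rw [norm_mul, norm_mul, norm_pow, norm_pow]
  have hr : 0 ≤ r := (norm_nonneg u).trans hu
  have h1 := (norm_nonneg _).trans (hc p)
  gcongr
  exact hc p

theorem summable_dps {c : ℕ × ℕ → ℂ} {K : ℝ} {q : ℕ} (hc : ∀ p, ‖c p‖ ≤ majorant K q p) {u v : ℂ}
    (hu : ‖u‖ < 1) (hv : ‖v‖ < 1) : Summable fun p : ℕ × ℕ => c p * u ^ p.1 * v ^ p.2 :=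
  Summable.of_norm_bounded
    (summable_majorant K q ((norm_nonneg u).trans (le_max_left _ ‖v‖)) (max_lt hu hv))
    (norm_term_le hc (le_max_left _ _) (le_max_right _ _))

/-- Polynomial growth is stable under differentiation: the index factor raises the exponent q by
one, and the shifted index costs 2^q. -/
theorem norm_shiftL_le {c : ℕ × ℕ → ℂ} {K : ℝ} {q : ℕ} (hc : ∀ p, ‖c p‖ ≤ majorant K q p)
    (p : ℕ × ℕ) : ‖shiftL c p‖ ≤ majorant (K * 2 ^ q) (q + 1) p := by
  have hK : 0 ≤ K := by simpa [majorant] using (norm_nonneg _).trans (hc (0, 0))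
  have h1 : ‖((p.1 : ℂ) + 1)‖ = p.1 + 1 := by
    rw [show ((p.1 : ℂ) + 1) = ((p.1 + 1 : ℕ) : ℂ) by push_cast; rfl, Complex.norm_natCast]
    push_cast; rfl
  rw [shiftL, norm_mul, h1]
  calc ((p.1 : ℝ) + 1) * ‖c (p.1 + 1, p.2)‖ ≤ (p.1 + 1) * majorant K q (p.1 + 1, p.2) := by
        gcongr; exact hc _
    _ ≤ ((p.1 + 1) * (p.2 + 1)) * (K * (2 * ((p.1 + 1) * (p.2 + 1))) ^ q) := by
        have h2 : (0 : ℝ) ≤ p.2 := p.2.cast_nonneg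
        have h3 : (0 : ℝ) ≤ p.1 := p.1.cast_nonneg
        have h4 : (((p.1 + 1 : ℕ) : ℝ) + 1) * (p.2 + 1) ≤ 2 * ((p.1 + 1) * (p.2 + 1)) := by
          push_cast; nlinarith
        have h5 : ((p.1 : ℝ) + 1) ≤ (p.1 + 1) * (p.2 + 1) := by nlinarith
        exact mul_le_mul h5 (mul_le_mul_of_nonneg_left (pow_le_pow_left₀ (by positivity) h4 q) hK)
          (majorant_nonneg hK q _) (by positivity)
    _ = majorant (K * 2 ^ q) (q + 1) p := by unfold majorant; rw [mul_pow]; ring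

theorem dps_swap (c : ℕ × ℕ → ℂ) (u v : ℂ) : dps c u v = dps (c ∘ Prod.swap) v u := by
  unfold dps
  rw [← (Equiv.prodComm ℕ ℕ).tsum_eq]
  refine tsum_congr fun p => ?_
  simp [mul_right_comm]

theorem majorant_swap (K : ℝ) (q : ℕ) (p : ℕ × ℕ) : majorant K q p.swap = majorant K q p := by
  simp [majorant, mul_comm]

theorem shiftR_eq (c : ℕ × ℕ → ℂ) : shiftR c = shiftL (c ∘ Prod.swap) ∘ Prod.swap := by
  ext p; simp [shiftR, shiftL]

theorem norm_swap_le {c : ℕ × ℕ → ℂ} {K : ℝ} {q : ℕ} (hc : ∀ p, ‖c p‖ ≤ majorant K q p)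
    (p : ℕ × ℕ) : ‖(c ∘ Prod.swap) p‖ ≤ majorant K q p := by
  rw [← majorant_swap]; exact hc _

theorem norm_shiftR_le {c : ℕ × ℕ → ℂ} {K : ℝ} {q : ℕ} (hc : ∀ p, ‖c p‖ ≤ majorant K q p)
    (p : ℕ × ℕ) : ‖shiftR c p‖ ≤ majorant (K * 2 ^ q) (q + 1) p := by
  rw [shiftR_eq]
  exact norm_swap_le (norm_shiftL_le (norm_swap_le hc)) p

/-- Termwise differentiation. On a disk of radius r < 1 the geometric decay dominates any polynomial
growth of the coefficients. -/
theorem hasDerivAt_dps_left {c : ℕ × ℕ → ℂ} {K : ℝ} {q : ℕ} (hc : ∀ p, ‖c p‖ ≤ majorant K q p)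
    {u v : ℂ} (hu : ‖u‖ < 1) (hv : ‖v‖ < 1) :
    HasDerivAt (fun a => dps c a v) (dps (shiftL c) u v) u := by
  obtain ⟨r, hr, hr1⟩ := exists_between (max_lt hu hv)
  have hr0 : 0 < r := (norm_nonneg u).trans_lt ((le_max_left _ _).trans_lt hr)
  have hu' : ‖u‖ < r := (le_max_left _ _).trans_lt hr
  have hv' : ‖v‖ ≤ r := ((le_max_right _ _).trans_lt hr).le
  have hinj : Function.Injective (fun p : ℕ × ℕ => (p.1 + 1, p.2)) := by
    intro p p' h; simp at h; ext <;> simp [h]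
  have key : dps (shiftL c) u v
      = ∑' p : ℕ × ℕ, c p * ((p.1 : ℂ) * u ^ (p.1 - 1)) * v ^ p.2 := by
    rw [← hinj.tsum_eq (f := fun p : ℕ × ℕ => c p * ((p.1 : ℂ) * u ^ (p.1 - 1)) * v ^ p.2)]
    · refine tsum_congr fun p => ?_
      simp only [shiftL, Nat.add_sub_cancel]
      push_cast
      ring
    · intro p hp
      rcases Nat.eq_zero_or_pos p.1 with h | h
      · simp [h] at hp
      · exact ⟨(p.1 - 1, p.2), by ext <;> simp; omega⟩
  rw [key]
  have hsum : Summable fun p : ℕ × ℕ => majorant K (q + 1) p * r ^ p.1 * r ^ p.2 * r⁻¹ :=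
    (summable_majorant K (q + 1) hr0.le hr1).mul_right _
  refine hasDerivAt_tsum_of_isPreconnected hsum Metric.isOpen_ball
    (convex_ball (0 : ℂ) r).isPreconnected (g := fun p a => c p * a ^ p.1 * v ^ p.2)
    (g' := fun p a => c p * ((p.1 : ℂ) * a ^ (p.1 - 1)) * v ^ p.2) (y₀ := u) ?_ ?_
    (by simpa using hu') (summable_dps hc hu hv) (by simpa using hu')
  · intro p a _
    exact ((hasDerivAt_pow p.1 a).const_mul _).mul_const _
  · intro p a ha
    have ha' : ‖a‖ ≤ r := by simpa using (Metric.mem_ball.1 ha).le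
    have hK : 0 ≤ K := by simpa [majorant] using (norm_nonneg _).trans (hc (0, 0))
    rcases Nat.eq_zero_or_pos p.1 with h | h
    · have := majorant_nonneg hK (q + 1) p
      simp only [h, Nat.cast_zero, zero_mul, mul_zero, norm_zero]
      positivity
    · obtain ⟨m, hm⟩ : ∃ m, p.1 = m + 1 := ⟨p.1 - 1, by omega⟩
      have h2 : (p.1 : ℝ) * majorant K q p ≤ majorant K (q + 1) p := by
        have h2 : (0 : ℝ) ≤ p.2 := p.2.cast_nonneg
        have h3 : (0 : ℝ) ≤ p.1 := p.1.cast_nonneg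
        have h5 : (p.1 : ℝ) ≤ (p.1 + 1) * (p.2 + 1) := by nlinarith
        calc (p.1 : ℝ) * majorant K q p ≤ ((p.1 + 1) * (p.2 + 1)) * majorant K q p :=
              mul_le_mul_of_nonneg_right h5 (majorant_nonneg hK q p)
          _ = majorant K (q + 1) p := by unfold majorant; ring
      rw [norm_mul, norm_mul, norm_mul, norm_pow, norm_pow, Complex.norm_natCast]
      calc ‖c p‖ * (p.1 * ‖a‖ ^ (p.1 - 1)) * ‖v‖ ^ p.2
          ≤ majorant K q p * (p.1 * r ^ (p.1 - 1)) * r ^ p.2 := by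
            have := majorant_nonneg hK q p
            gcongr
            exact hc p
        _ = (p.1 * majorant K q p) * r ^ p.1 * r ^ p.2 * r⁻¹ := by
            rw [hm, Nat.add_sub_cancel, pow_succ]; field_simp
        _ ≤ majorant K (q + 1) p * r ^ p.1 * r ^ p.2 * r⁻¹ := by gcongr

theorem hasDerivAt_dps_right {c : ℕ × ℕ → ℂ} {K : ℝ} {q : ℕ} (hc : ∀ p, ‖c p‖ ≤ majorant K q p)
    {u v : ℂ} (hu : ‖u‖ < 1) (hv : ‖v‖ < 1) :
    HasDerivAt (fun b => dps c u b) (dps (shiftR c) u v) v := by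
  have h := hasDerivAt_dps_left (norm_swap_le hc) hv hu
  have e : shiftR c ∘ Prod.swap = shiftL (c ∘ Prod.swap) := by ext p; simp [shiftR, shiftL]
  rw [dps_swap (shiftR c), e]
  exact h.congr_of_eventuallyEq (Eventually.of_forall fun b => dps_swap c u b)

theorem dps_eq_sum {c : ℕ × ℕ → ℂ} {M M' : ℕ} (hc : ∀ p, ¬ (p.1 < M ∧ p.2 < M') → c p = 0)
    (u v : ℂ) : dps c u v
      = ∑ m ∈ Finset.range M, ∑ n ∈ Finset.range M', c (m, n) * u ^ m * v ^ n := by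
  unfold dps
  rw [tsum_eq_sum (s := Finset.range M ×ˢ Finset.range M'), Finset.sum_product]
  intro p hp
  rw [hc p (by simpa using hp)]
  simp

/-- On the polydisk of radius r the difference is bounded by the sum of ‖c N p - d p‖ r^(p.1 + p.2),
independently of u and v. Dominated convergence for series sends this sum to 0. -/
theorem exists_dps_uniform {c : ℕ → ℕ × ℕ → ℂ} {d : ℕ × ℕ → ℂ} {K : ℝ} {q : ℕ}
    (hc : ∀ᶠ N in atTop, ∀ p, ‖c N p‖ ≤ majorant K q p)
    (hlim : ∀ p, Tendsto (fun N => c N p) atTop (𝓝 (d p))) {r : ℝ} (hr : 0 ≤ r) (hr1 : r < 1)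
    {ε : ℝ} (hε : 0 < ε) :
    ∀ᶠ N in atTop, ∀ u v : ℂ, ‖u‖ ≤ r → ‖v‖ ≤ r → ‖dps (c N) u v - dps d u v‖ < ε := by
  have hd : ∀ p, ‖d p‖ ≤ majorant K q p := fun p =>
    le_of_tendsto (hlim p).norm (hc.mono fun N h => h p)
  have h0 : Tendsto (fun N => ∑' p : ℕ × ℕ, ‖c N p - d p‖ * r ^ p.1 * r ^ p.2) atTop
      (𝓝 (∑' p : ℕ × ℕ, (0 : ℝ))) := by
    refine tendsto_tsum_of_dominated_convergence
      (bound := fun p => majorant (2 * K) q p * r ^ p.1 * r ^ p.2)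
      (summable_majorant _ q hr hr1) (fun p => ?_) ?_
    · have := ((hlim p).sub_const (d p)).norm
      simpa using (this.mul_const (r ^ p.1)).mul_const (r ^ p.2)
    · filter_upwards [hc] with N hN p
      rw [Real.norm_of_nonneg (by positivity)]
      gcongr
      calc ‖c N p - d p‖ ≤ ‖c N p‖ + ‖d p‖ := norm_sub_le _ _
        _ ≤ majorant K q p + majorant K q p := add_le_add (hN p) (hd p)
        _ = majorant (2 * K) q p := by unfold majorant; ring
  rw [tsum_zero] at h0
  filter_upwards [h0.eventually (gt_mem_nhds hε), hc] with N hN hcN u v hu hv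
  have hu1 := hu.trans_lt hr1
  have hv1 := hv.trans_lt hr1
  refine lt_of_le_of_lt ?_ hN
  unfold dps
  rw [← (summable_dps hcN hu1 hv1).tsum_sub (summable_dps hd hu1 hv1)]
  have hcd : ∀ p, ‖c N p - d p‖ ≤ majorant (2 * K) q p := fun p => by
    calc ‖c N p - d p‖ ≤ ‖c N p‖ + ‖d p‖ := norm_sub_le _ _
        _ ≤ majorant K q p + majorant K q p := add_le_add (hcN p) (hd p)
        _ = majorant (2 * K) q p := by unfold majorant; ring
  refine tsum_of_norm_bounded (Summable.hasSum ?_) fun p => ?_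
  · refine Summable.of_nonneg_of_le (fun p => by positivity) (fun p => ?_)
      (summable_majorant (2 * K) q hr hr1)
    gcongr
    exact hcd p
  · rw [← sub_mul, ← sub_mul, norm_mul, norm_mul, norm_pow, norm_pow]
    gcongr

/-- The matrix kernel `K[A]` of a double power series. -/
noncomputable def kernelSeries (c : ℕ × ℕ → ℂ) (u v : ℂ) : Matrix (Fin 2) (Fin 2) ℂ :=
  !![dps (shiftL (shiftR c)) u v,
     if v.im = 0 then -dps (shiftL c) u v else iota v * dps (shiftL (shiftR c)) u (conj v);
     if u.im = 0 then -dps (shiftR c) u v else iota u * dps (shiftL (shiftR c)) (conj u) v,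
     if u.im = 0 then
       if v.im = 0 then dps c u v + 1 / 2 * sgnDiff u v
       else -(iota v * dps (shiftR c) u (conj v))
     else if v.im = 0 then -(iota u * dps (shiftL c) (conj u) v)
       else iota u * iota v * dps (shiftL (shiftR c)) (conj u) (conj v)]

theorem norm_iota_le (z : ℂ) : ‖iota z‖ ≤ 1 := by
  rw [iota, norm_mul, Complex.norm_I, one_mul, Complex.norm_real]
  rcases Real.sign_apply_eq z.im with h | h | h <;> rw [h] <;> simp

section
variable {A : ℂ → ℂ → ℂ} {c : ℕ × ℕ → ℂ} {K : ℝ} {q : ℕ}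

theorem eventually_norm_lt_one {u : ℂ} (hu : ‖u‖ < 1) : ∀ᶠ a in 𝓝 u, ‖a‖ < 1 :=
  continuous_norm.continuousAt.eventually (gt_mem_nhds hu)

theorem derivLeft_eq_dps (hc : ∀ p, ‖c p‖ ≤ majorant K q p)
    (hA : ∀ u v, ‖u‖ < 1 → ‖v‖ < 1 → A u v = dps c u v) {u v : ℂ} (hu : ‖u‖ < 1) (hv : ‖v‖ < 1) :
    derivLeft A u v = dps (shiftL c) u v := by
  rw [derivLeft, ← (hasDerivAt_dps_left hc hu hv).deriv]
  exact EventuallyEq.deriv_eq ((eventually_norm_lt_one hu).mono fun a ha => hA a v ha hv)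

theorem derivRight_eq_dps (hc : ∀ p, ‖c p‖ ≤ majorant K q p)
    (hA : ∀ u v, ‖u‖ < 1 → ‖v‖ < 1 → A u v = dps c u v) {u v : ℂ} (hu : ‖u‖ < 1) (hv : ‖v‖ < 1) :
    derivRight A u v = dps (shiftR c) u v := by
  rw [derivRight, ← (hasDerivAt_dps_right hc hu hv).deriv]
  exact EventuallyEq.deriv_eq ((eventually_norm_lt_one hv).mono fun a ha => hA u a hu ha)

theorem derivBoth_eq_dps (hc : ∀ p, ‖c p‖ ≤ majorant K q p)
    (hA : ∀ u v, ‖u‖ < 1 → ‖v‖ < 1 → A u v = dps c u v) {u v : ℂ} (hu : ‖u‖ < 1) (hv : ‖v‖ < 1) :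
    derivBoth A u v = dps (shiftL (shiftR c)) u v :=
  derivLeft_eq_dps (norm_shiftR_le hc) (fun _ _ h h' => derivRight_eq_dps hc hA h h') hu hv

theorem dps_neg_swap (hc : ∀ p : ℕ × ℕ, c p.swap = -c p) (u v : ℂ) : dps c u v = -dps c v u := by
  rw [dps_swap]
  unfold dps
  rw [← tsum_neg]
  refine tsum_congr fun p => ?_
  simp [hc]

theorem dps_shiftL_eq (hc : ∀ p : ℕ × ℕ, c p.swap = -c p) (u v : ℂ) :
    dps (shiftL c) u v = -dps (shiftR c) v u := by
  rw [dps_swap]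
  unfold dps
  rw [← tsum_neg]
  refine tsum_congr fun p => ?_
  have := hc (p.1, p.2 + 1)
  simp only [Prod.swap_prod_mk] at this
  simp [shiftL, shiftR, this]

theorem shift_swap (hc : ∀ p : ℕ × ℕ, c p.swap = -c p) (p : ℕ × ℕ) :
    shiftL (shiftR c) p.swap = -shiftL (shiftR c) p := by
  have := hc (p.1 + 1, p.2 + 1)
  simp only [Prod.swap_prod_mk] at this
  simp only [shiftL, shiftR, Prod.fst_swap, Prod.snd_swap, this]
  ring

/-- Only the case of real u and non-real v needs antisymmetry of the coefficients, since `kernelOf`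
defines it by transposing the opposite case. -/
theorem kernelOf_eq_kernelSeries (hc : ∀ p, ‖c p‖ ≤ majorant K q p)
    (hcs : ∀ p : ℕ × ℕ, c p.swap = -c p)
    (hA : ∀ u v, ‖u‖ < 1 → ‖v‖ < 1 → A u v = dps c u v) {u v : ℂ} (hu : ‖u‖ < 1) (hv : ‖v‖ < 1) :
    kernelOf A u v = kernelSeries c u v := by
  have hu' : ‖conj u‖ < 1 := by simpa using hu
  have hv' : ‖conj v‖ < 1 := by simpa using hv
  unfold kernelOf kernelSeries mixedKernel
  split_ifs with h1 h2 h2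
  · rw [derivBoth_eq_dps hc hA hu hv, derivLeft_eq_dps hc hA hu hv, derivRight_eq_dps hc hA hu hv,
      hA u v hu hv]
  · rw [derivBoth_eq_dps hc hA hv hu, derivLeft_eq_dps hc hA hv hu, derivBoth_eq_dps hc hA hv' hu,
      derivLeft_eq_dps hc hA hv' hu, dps_neg_swap (shift_swap hcs) v, dps_shiftL_eq hcs,
      dps_neg_swap (shift_swap hcs) (conj v), dps_shiftL_eq hcs]
    ext i j
    fin_cases i <;> fin_cases j <;> simp
  · rw [derivBoth_eq_dps hc hA hu hv, derivLeft_eq_dps hc hA hu hv, derivBoth_eq_dps hc hA hu' hv,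
      derivLeft_eq_dps hc hA hu' hv]
    ext i j
    fin_cases i <;> fin_cases j <;> simp
  · rw [derivBoth_eq_dps hc hA hu hv, derivBoth_eq_dps hc hA hu' hv, derivBoth_eq_dps hc hA hu hv',
      derivBoth_eq_dps hc hA hu' hv']

end

theorem tendsto_shiftL {c : ℕ → ℕ × ℕ → ℂ} {d : ℕ × ℕ → ℂ}
    (h : ∀ p, Tendsto (fun N => c N p) atTop (𝓝 (d p))) (p : ℕ × ℕ) :
    Tendsto (fun N => shiftL (c N) p) atTop (𝓝 (shiftL d p)) := (h _).const_mul _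

theorem tendsto_shiftR {c : ℕ → ℕ × ℕ → ℂ} {d : ℕ × ℕ → ℂ}
    (h : ∀ p, Tendsto (fun N => c N p) atTop (𝓝 (d p))) (p : ℕ × ℕ) :
    Tendsto (fun N => shiftR (c N) p) atTop (𝓝 (shiftR d p)) := (h _).const_mul _

/-- The kernels jump across the real axis and at u = v, but the case distinction, ι and the sign
term are the same for `c N` and for `d`. Differences of entries therefore reduce to differences of
the four power series, and |ι| ≤ 1. -/
theorem kernelSeries_uniform {c : ℕ → ℕ × ℕ → ℂ} {d : ℕ × ℕ → ℂ} {K : ℝ} {q : ℕ}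
    (hc : ∀ᶠ N in atTop, ∀ p, ‖c N p‖ ≤ majorant K q p)
    (hlim : ∀ p, Tendsto (fun N => c N p) atTop (𝓝 (d p))) {r : ℝ} (hr : 0 ≤ r) (hr1 : r < 1)
    {ε : ℝ} (hε : 0 < ε) :
    ∀ᶠ N in atTop, ∀ u v : ℂ, ‖u‖ ≤ r → ‖v‖ ≤ r → ∀ i j,
      ‖kernelSeries (c N) u v i j - kernelSeries d u v i j‖ < ε := by
  have hL : ∀ᶠ N in atTop, ∀ p, ‖shiftL (c N) p‖ ≤ majorant (K * 2 ^ q) (q + 1) p :=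
    hc.mono fun N h => norm_shiftL_le h
  have hR : ∀ᶠ N in atTop, ∀ p, ‖shiftR (c N) p‖ ≤ majorant (K * 2 ^ q) (q + 1) p :=
    hc.mono fun N h => norm_shiftR_le h
  have hLR := hR.mono fun N h => norm_shiftL_le h
  have hmul : ∀ z x : ℂ, ‖x‖ < ε → ‖iota z * x‖ < ε := fun z x hx =>
    lt_of_le_of_lt (by
      rw [norm_mul]
      exact mul_le_of_le_one_left (norm_nonneg _) (norm_iota_le z)) hx
  filter_upwards [exists_dps_uniform hc hlim hr hr1 hε,
    exists_dps_uniform hL (tendsto_shiftL hlim) hr hr1 hε,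
    exists_dps_uniform hR (tendsto_shiftR hlim) hr hr1 hε,
    exists_dps_uniform hLR (tendsto_shiftL (tendsto_shiftR hlim)) hr hr1 hε]
    with N h0 h1 h2 h3 u v hu hv i j
  have hu' : ‖conj u‖ ≤ r := by simpa using hu
  have hv' : ‖conj v‖ ≤ r := by simpa using hv
  unfold kernelSeries
  fin_cases i <;> fin_cases j
  · simpa using h3 u v hu hv
  · by_cases hv0 : v.im = 0
    · have := h1 u v hu hv
      rw [norm_sub_rev] at this
      simpa [hv0, neg_add_eq_sub] using this
    · simpa [hv0, mul_sub] using hmul v _ (h3 u _ hu hv')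
  · by_cases hu0 : u.im = 0
    · have := h2 u v hu hv
      rw [norm_sub_rev] at this
      simpa [hu0, neg_add_eq_sub] using this
    · simpa [hu0, mul_sub] using hmul u _ (h3 _ v hu' hv)
  · by_cases hu0 : u.im = 0 <;> by_cases hv0 : v.im = 0
    · simpa [hu0, hv0] using h0 u v hu hv
    · have := hmul v _ (h2 u _ hu hv')
      rw [mul_sub, norm_sub_rev] at this
      simpa [hu0, hv0, neg_add_eq_sub] using this
    · have := hmul u _ (h1 _ v hu' hv)
      rw [mul_sub, norm_sub_rev] at this
      simpa [hu0, hv0, neg_add_eq_sub] using this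
    · have := hmul u _ (hmul v _ (h3 _ _ hu' hv'))
      simpa [hu0, hv0, mul_sub, mul_assoc] using this

theorem tendstoLocallyUniformlyOn_of_kernelSeries
    {F : ℕ → ℂ × ℂ → Matrix (Fin 2) (Fin 2) ℂ} {G : ℂ × ℂ → Matrix (Fin 2) (Fin 2) ℂ}
    {c : ℕ → ℕ × ℕ → ℂ} {d : ℕ × ℕ → ℂ} {K : ℝ} {q : ℕ}
    (hc : ∀ᶠ N in atTop, ∀ p, ‖c N p‖ ≤ majorant K q p)
    (hlim : ∀ p, Tendsto (fun N => c N p) atTop (𝓝 (d p)))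
    (hF : ∀ N u v, ‖u‖ < 1 → ‖v‖ < 1 → F N (u, v) = kernelSeries (c N) u v)
    (hG : ∀ u v, ‖u‖ < 1 → ‖v‖ < 1 → G (u, v) = kernelSeries d u v) :
    TendstoLocallyUniformlyOn F G atTop (Metric.ball (0 : ℂ) 1 ×ˢ Metric.ball (0 : ℂ) 1) := by
  intro U hU x hx
  obtain ⟨ε, hε, hεU⟩ : ∃ ε > 0, ∀ a b : Matrix (Fin 2) (Fin 2) ℂ,
      (∀ i j, ‖b i j - a i j‖ < ε) → (a, b) ∈ U := by
    -- Matrices carry the product uniformity, which here is that of the sup metric.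
    have hU' : U ∈ uniformity (Fin 2 → Fin 2 → ℂ) := hU
    obtain ⟨ε, hε, h⟩ := Metric.mem_uniformity_dist.1 hU'
    refine ⟨ε, hε, fun a b hab => h ?_⟩
    refine (dist_pi_lt_iff hε).2 fun i => (dist_pi_lt_iff hε).2 fun j => ?_
    rw [dist_comm, dist_eq_norm]
    exact hab i j
  have hx1 : ‖x.1‖ < 1 := by simpa using hx.1
  have hx2 : ‖x.2‖ < 1 := by simpa using hx.2
  obtain ⟨r, hr, hr1⟩ := exists_between (max_lt hx1 hx2)
  have hr0 : 0 ≤ r := (norm_nonneg x.1).trans ((le_max_left _ _).trans hr.le)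
  refine ⟨Metric.ball 0 r ×ˢ Metric.ball 0 r, mem_nhdsWithin_of_mem_nhds (prod_mem_nhds ?_ ?_), ?_⟩
  · exact Metric.isOpen_ball.mem_nhds (by simpa using (le_max_left _ _).trans_lt hr)
  · exact Metric.isOpen_ball.mem_nhds (by simpa using (le_max_right _ _).trans_lt hr)
  · filter_upwards [kernelSeries_uniform hc hlim hr0 hr1 hε] with N hN y hy
    have hy1 : ‖y.1‖ < r := by simpa using hy.1
    have hy2 : ‖y.2‖ < r := by simpa using hy.2
    have e : y = (y.1, y.2) := rfl
    rw [e, hF N _ _ (hy1.trans hr1) (hy2.trans hr1), hG _ _ (hy1.trans hr1) (hy2.trans hr1)]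
    exact hεU _ _ (hN _ _ hy1.le hy2.le)

/-! ### The kernel as a double power series -/

/-- The coefficients of `ϰ_N` on the disk. -/
noncomputable def kappaCoeff (N : ℕ) (t : ℝ) (m n : ℕ) : ℝ :=
  if m < N ∧ n < N then -2 * coeffEntry N t m n else 0

/-- The linear coefficients of the `(1,2)` entry of the kernel at the origin. -/
noncomputable def linCoeff (N : ℕ) (t : ℝ) (m : ℕ) : ℝ :=
  if m < N ∧ Even m then linEntry N t (m / 2) else 0

/-- The double sequence assembled from bilinear coefficients `k` and linear coefficients `l`. -/
noncomputable def assemble (k : ℕ → ℕ → ℝ) (l : ℕ → ℝ) : ℕ × ℕ → ℂ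
  | (0, 0) => 0
  | (m + 1, 0) => ((-l m / (m + 1) : ℝ) : ℂ)
  | (0, n + 1) => ((l n / (n + 1) : ℝ) : ℂ)
  | (m + 1, n + 1) => ((k m n / ((m + 1) * (n + 1)) : ℝ) : ℂ)

theorem assemble_swap {k : ℕ → ℕ → ℝ} (l : ℕ → ℝ) (hk : ∀ m n, k n m = -k m n) (p : ℕ × ℕ) :
    assemble k l p.swap = -assemble k l p := by
  obtain ⟨_ | m, _ | n⟩ := p
  · simp [assemble]
  · simp [assemble, neg_div]
  · simp [assemble, neg_div]
  · simp only [assemble, Prod.swap_prod_mk]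
    rw [hk, ← Complex.ofReal_neg, mul_comm ((n : ℝ) + 1), neg_div]

theorem shiftR_assemble_zero (k : ℕ → ℕ → ℝ) (l : ℕ → ℝ) (n : ℕ) :
    shiftR (assemble k l) (0, n) = (l n : ℂ) := by
  have h : (n : ℂ) + 1 ≠ 0 := Nat.cast_add_one_ne_zero n
  simp only [shiftR, assemble]
  push_cast
  field_simp

theorem shiftR_assemble_succ (k : ℕ → ℕ → ℝ) (l : ℕ → ℝ) (m n : ℕ) :
    shiftR (assemble k l) (m + 1, n) = (k m n : ℂ) / (m + 1) := by
  have h : (m : ℂ) + 1 ≠ 0 := Nat.cast_add_one_ne_zero m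
  have h' : (n : ℂ) + 1 ≠ 0 := Nat.cast_add_one_ne_zero n
  simp only [shiftR, assemble]
  push_cast
  field_simp

theorem shiftL_shiftR_assemble (k : ℕ → ℕ → ℝ) (l : ℕ → ℝ) (p : ℕ × ℕ) :
    shiftL (shiftR (assemble k l)) p = k p.1 p.2 := by
  obtain ⟨m, n⟩ := p
  have h : (m : ℂ) + 1 ≠ 0 := Nat.cast_add_one_ne_zero m
  rw [shiftL, shiftR_assemble_succ]
  field_simp

theorem assemble_eq_zero {N : ℕ} {k : ℕ → ℕ → ℝ} {l : ℕ → ℝ}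
    (hk : ∀ m n, ¬ (m < N ∧ n < N) → k m n = 0)
    (hl : ∀ m, ¬ m < N → l m = 0) (p : ℕ × ℕ) (hp : ¬ (p.1 < N + 1 ∧ p.2 < N + 1)) :
    assemble k l p = 0 := by
  obtain ⟨_ | m, _ | n⟩ := p
  · simp at hp
  · simp only [assemble]; rw [hl n (by simp at hp; omega)]; simp
  · simp only [assemble]; rw [hl m (by simp at hp; omega)]; simp
  · simp only [assemble]; rw [hk m n (by simp at hp; omega)]; simp

theorem dps_shiftL_shiftR_assemble {N : ℕ} {k : ℕ → ℕ → ℝ} {l : ℕ → ℝ}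
    (hk : ∀ m n, ¬ (m < N ∧ n < N) → k m n = 0) (u v : ℂ) :
    dps (shiftL (shiftR (assemble k l))) u v = ∑ m : Fin N, ∑ n : Fin N, k m n * u ^ (m : ℕ) * v ^ (n : ℕ) := by
  rw [dps_eq_sum (M := N) (M' := N)]
  · simp only [shiftL_shiftR_assemble, Finset.sum_range]
  · intro p hp
    rw [shiftL_shiftR_assemble, hk _ _ hp, Complex.ofReal_zero]

theorem dps_shiftR_assemble {N : ℕ} {k : ℕ → ℕ → ℝ} {l : ℕ → ℝ}
    (hk : ∀ m n, ¬ (m < N ∧ n < N) → k m n = 0)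
    (hl : ∀ m, ¬ m < N → l m = 0) (u v : ℂ) :
    dps (shiftR (assemble k l)) u v = ∑ n : Fin N, l n * v ^ (n : ℕ)
      + ∑ m : Fin N, ∑ n : Fin N, k m n / (m + 1) * u ^ (m + 1 : ℕ) * v ^ (n : ℕ) := by
  rw [dps_eq_sum (M := N + 1) (M' := N)]
  · rw [Finset.sum_range_succ', add_comm]
    simp only [shiftR_assemble_zero, shiftR_assemble_succ, Finset.sum_range]
    simp
  · rintro ⟨_ | m, n⟩ hp
    · rw [shiftR_assemble_zero, hl n (by simp at hp; omega), Complex.ofReal_zero]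
    · rw [shiftR_assemble_succ, hk m n (by simp at hp; omega)]; simp

theorem dps_assemble {N : ℕ} {k : ℕ → ℕ → ℝ} {l : ℕ → ℝ}
    (hk : ∀ m n, ¬ (m < N ∧ n < N) → k m n = 0)
    (hl : ∀ m, ¬ m < N → l m = 0) (u v : ℂ) :
    dps (assemble k l) u v = ∑ n : Fin N, l n / (n + 1) * (v ^ (n + 1 : ℕ) - u ^ (n + 1 : ℕ))
      + ∑ m : Fin N, ∑ n : Fin N,
        k m n / ((m + 1) * (n + 1)) * u ^ (m + 1 : ℕ) * v ^ (n + 1 : ℕ) := by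
  rw [dps_eq_sum (assemble_eq_zero hk hl)]
  rw [Finset.sum_range_succ']
  simp only [Finset.sum_range_succ' _ N]
  simp only [assemble, Finset.sum_range, Finset.sum_add_distrib, mul_sub, Finset.sum_sub_distrib]
  push_cast
  simp only [neg_div, neg_mul, Finset.sum_neg_distrib, pow_zero, mul_one]
  ring

/-- The constant `∫_0^∞ w x ^ n dx` for odd `n`, and `0` for even `n`. -/
noncomputable def oddConst (t : ℝ) (n : ℕ) : ℝ :=
  if Odd n then 1 / ((n + 1) * (1 - (n + 1) * t)) else 0

/-- The constants produced by ε at a real second variable and the border term of the (1,2) entry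
merge into one linear coefficient. For odd m every term vanishes by parity; for even m this is
`sum_invEntry`. -/
theorem sum_coeffEntry_mul_oddConst {N : ℕ} {t : ℝ}
    (ht : ∀ i : ℕ, i ≤ N → 1 - (i : ℝ) * t ≠ 0) {m : ℕ} (hm : m < N) :
    -2 * ∑ n : Fin N, coeffEntry N t m n * oddConst t n + borderVec N t m = linCoeff N t m := by
  rw [sum_fin_parity N (fun n => coeffEntry N t m n * oddConst t n)]
  unfold coeffEntry oddConst borderVec linCoeff
  rcases Nat.even_or_odd' m with ⟨p, rfl | rfl⟩ <;>
    simp only [even_two, Even.mul_right, odd_two_mul_add_one, hm, 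
      Nat.not_even_bit1, ↓reduceIte, and_false, and_true, and_self, mul_zero,
      zero_mul, half_even, half_odd, Finset.sum_const_zero, zero_add, add_zero, not_odd_two_mul]
  rw [← sum_invEntry ht (by omega), Finset.mul_sum]
  congr 1
  refine Finset.sum_congr rfl fun k _ => ?_
  push_cast
  rw [show (2 * (k : ℝ) + 1 + 1) = 2 * k + 2 by ring]
  ring

theorem eps_sum {N : ℕ} {s : ℝ≥0∞} (hs : (N : ℝ≥0∞) < s) (a : Fin N → ℂ) (v : ℂ) :
    eps (fun b => ∑ n : Fin N, a n * wMon s n b) v = ∑ n : Fin N, a n * eps (wMon s n) v := by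
  unfold eps
  split_ifs with h
  · simp only [Finset.sum_mul, mul_assoc]
    rw [integral_finsetSum, Finset.mul_sum]
    · refine Finset.sum_congr rfl fun n _ => ?_
      rw [integral_const_mul]; ring
    · intro n _
      exact (integrable_wMon_mul_sign s (pos_of_gt hs).ne' n
        (succ_mul_tinv_lt_one hs n.2) _).const_mul _
  · rw [Finset.mul_sum]
    exact Finset.sum_congr rfl fun n _ => by ring

theorem eps_wMon_of_im_eq_zero {N : ℕ} {s : ℝ≥0∞} (hs : (N : ℝ≥0∞) < s) (n : Fin N) {v : ℂ}
    (hv : ‖v‖ < 1) (h : v.im = 0) :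
    eps (wMon s n) v = oddConst (tinv s) n - v ^ ((n : ℕ) + 1) / ((n : ℂ) + 1) := by
  have hre : (v.re : ℂ) = v := by apply Complex.ext <;> simp [h]
  rw [eps, if_pos h, integral_wMon_mul_sign s (pos_of_gt hs).ne' n
    (succ_mul_tinv_lt_one hs n.2) ((Complex.abs_re_le_norm v).trans hv.le), hre, oddConst]
  split_ifs <;> simp

theorem wMon_of_norm_lt_one (s : ℝ≥0∞) (n : ℕ) {v : ℂ} (hv : ‖v‖ < 1) : wMon s n v = v ^ n := by
  rw [wMon, weight_of_norm_le_one s hv.le]; simp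

theorem eps_wMon_of_im_ne_zero (s : ℝ≥0∞) (n : ℕ) {v : ℂ} (hv : ‖v‖ < 1) (h : ¬ v.im = 0) :
    eps (wMon s n) v = iota v * conj v ^ n := by
  rw [eps, if_neg h, wMon_of_norm_lt_one s n (by simpa using hv)]

theorem kappa_eq {N : ℕ} {s : ℝ≥0∞} (hs : (N : ℝ≥0∞) < s) (u v : ℂ) :
    kappa N s u v = ∑ m : Fin N, ∑ n : Fin N,
      (kappaCoeff N (tinv s) m n : ℂ) * wMon s m u * wMon s n v := by
  rw [kappa, Finset.mul_sum]
  refine Finset.sum_congr rfl fun m _ => ?_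
  rw [Finset.mul_sum]
  refine Finset.sum_congr rfl fun n _ => ?_
  rw [coeff_eq hs, kappaCoeff, if_pos ⟨m.2, n.2⟩]
  push_cast
  ring

theorem border_eq {N : ℕ} {s : ℝ≥0∞} (hs : (N : ℝ≥0∞) < s) (u : ℂ) :
    border N s u = ∑ m : Fin N, (borderVec N (tinv s) m : ℂ) * wMon s m u := by
  rw [border, ← Finset.sum_neg_distrib]
  refine Finset.sum_congr rfl fun m _ => ?_
  rw [borderCoeff_eq hs]
  ring

theorem kappaCoeff_swap (N : ℕ) (t : ℝ) (m n : ℕ) : kappaCoeff N t n m = -kappaCoeff N t m n := by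
  unfold kappaCoeff
  by_cases h : m < N ∧ n < N
  · rw [if_pos h, if_pos h.symm, coeffEntry_antisymm]; ring
  · rw [if_neg h, if_neg fun h' => h h'.symm, neg_zero]

theorem kappaCoeff_eq_zero (N : ℕ) (t : ℝ) (m n : ℕ) (h : ¬ (m < N ∧ n < N)) :
    kappaCoeff N t m n = 0 := if_neg h

theorem linCoeff_eq_zero (N : ℕ) (t : ℝ) (m : ℕ) (h : ¬ m < N) : linCoeff N t m = 0 :=
  if_neg fun h' => h h'.1

theorem sum_kappaCoeff_mul_oddConst {N : ℕ} {t : ℝ}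
    (ht : ∀ i : ℕ, i ≤ N → 1 - (i : ℝ) * t ≠ 0) {m : ℕ} (hm : m < N) :
    ∑ n : Fin N, (kappaCoeff N t m n : ℂ) * oddConst t n
      = linCoeff N t m - borderVec N t m := by
  rw [← sum_coeffEntry_mul_oddConst ht hm]
  push_cast
  rw [add_sub_cancel_right, Finset.mul_sum]
  refine Finset.sum_congr rfl fun n _ => ?_
  rw [kappaCoeff, if_pos ⟨hm, n.2⟩]
  push_cast
  ring

/-- The coefficients of the double power series of the kernel on the disk. -/
noncomputable def kernelCoeff (N : ℕ) (t : ℝ) : ℕ × ℕ → ℂ :=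
  assemble (kappaCoeff N t) (linCoeff N t)

/-- The coefficient of `wMon s m` in the `(1,2)` entry of the kernel, as a function of the second
variable. -/
noncomputable def rowCoeff (N : ℕ) (s : ℝ≥0∞) (v : ℂ) (m : ℕ) : ℂ :=
  ∑ n : Fin N, (kappaCoeff N (tinv s) m n : ℂ) * eps (wMon s n) v
    + borderVec N (tinv s) m * chiReal v

theorem eps_kappa_add_border {N : ℕ} {s : ℝ≥0∞} (hs : (N : ℝ≥0∞) < s) (u v : ℂ) :
    eps (fun b => kappa N s u b) v + border N s u * chiReal v
      = ∑ m : Fin N, rowCoeff N s v m * wMon s m u := by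
  have : (fun b => kappa N s u b) = fun b => ∑ n : Fin N,
      (∑ m : Fin N, (kappaCoeff N (tinv s) m n : ℂ) * wMon s m u) * wMon s n b := by
    ext b
    rw [kappa_eq hs, Finset.sum_comm]
    exact Finset.sum_congr rfl fun n _ => by rw [Finset.sum_mul]
  rw [this, eps_sum hs, border_eq hs, Finset.sum_mul]
  simp only [Finset.sum_mul, rowCoeff, add_mul, Finset.sum_add_distrib]
  congr 1
  · rw [Finset.sum_comm]
    exact Finset.sum_congr rfl fun m _ => Finset.sum_congr rfl fun n _ => by ring
  · exact Finset.sum_congr rfl fun m _ => by ring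

/-- Applying ε to each monomial leaves a constant and minus a primitive; the constants together with
the border give `linCoeff`. -/
theorem rowCoeff_of_im_eq_zero {N : ℕ} {s : ℝ≥0∞} (hs : (N : ℝ≥0∞) < s) {v : ℂ} (hv : ‖v‖ < 1)
    (h : v.im = 0) (m : Fin N) :
    rowCoeff N s v m = linCoeff N (tinv s) m - ∑ n : Fin N,
      (kappaCoeff N (tinv s) m n : ℂ) * (v ^ ((n : ℕ) + 1) / ((n : ℂ) + 1)) := by
  rw [rowCoeff, chiReal, if_pos h]
  simp only [eps_wMon_of_im_eq_zero hs _ hv h, mul_sub, Finset.sum_sub_distrib]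
  rw [sum_kappaCoeff_mul_oddConst (one_sub_mul_tinv_ne_zero hs) m.2]
  ring

theorem rowCoeff_of_im_ne_zero {N : ℕ} {s : ℝ≥0∞} {v : ℂ} (hv : ‖v‖ < 1)
    (h : ¬ v.im = 0) (m : Fin N) :
    rowCoeff N s v m = iota v * ∑ n : Fin N,
      (kappaCoeff N (tinv s) m n : ℂ) * conj v ^ (n : ℕ) := by
  rw [rowCoeff, chiReal, if_neg h, mul_zero, add_zero, Finset.mul_sum]
  exact Finset.sum_congr rfl fun n _ => by rw [eps_wMon_of_im_ne_zero s n hv h]; ring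

theorem kernelCoeff_swap (N : ℕ) (t : ℝ) (p : ℕ × ℕ) :
    kernelCoeff N t p.swap = -kernelCoeff N t p :=
  assemble_swap _ (kappaCoeff_swap N t) p

/-- For real v the entry is minus the first derivative of the assembled series: its part constant in
v is the polynomial with coefficients `linCoeff`, and the rest is minus the primitive of ϰ_N in v.
For non-real v, ε merely conjugates v and multiplies by ι(v). -/
theorem kernel_zero_one {N : ℕ} {s : ℝ≥0∞} (hs : (N : ℝ≥0∞) < s) {u v : ℂ} (hu : ‖u‖ < 1)
    (hv : ‖v‖ < 1) :
    eps (fun b => kappa N s u b) v + border N s u * chiReal v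
      = if v.im = 0 then -dps (shiftL (kernelCoeff N (tinv s))) u v
        else iota v * dps (shiftL (shiftR (kernelCoeff N (tinv s)))) u (conj v) := by
  rw [eps_kappa_add_border hs]
  simp only [wMon_of_norm_lt_one s _ hu]
  split_ifs with h
  · rw [dps_shiftL_eq (kernelCoeff_swap N _), neg_neg, kernelCoeff,
      dps_shiftR_assemble (kappaCoeff_eq_zero N _) (linCoeff_eq_zero N _), Finset.sum_comm,
      ← Finset.sum_add_distrib]
    refine Finset.sum_congr rfl fun m _ => ?_
    rw [rowCoeff_of_im_eq_zero hs hv h, sub_mul, sub_eq_add_neg, Finset.sum_mul,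
      ← Finset.sum_neg_distrib]
    congr 1
    refine Finset.sum_congr rfl fun n _ => ?_
    rw [kappaCoeff_swap N _ m n]
    push_cast
    ring
  · rw [kernelCoeff, dps_shiftL_shiftR_assemble (kappaCoeff_eq_zero N _), Finset.mul_sum]
    refine Finset.sum_congr rfl fun m _ => ?_
    rw [rowCoeff_of_im_ne_zero hv h, mul_assoc, Finset.sum_mul]
    congr 1
    exact Finset.sum_congr rfl fun n _ => by ring

theorem kappa_swap {N : ℕ} {s : ℝ≥0∞} (hs : (N : ℝ≥0∞) < s) (u v : ℂ) :
    kappa N s v u = -kappa N s u v := by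
  rw [kappa_eq hs, kappa_eq hs, Finset.sum_comm, ← Finset.sum_neg_distrib]
  refine Finset.sum_congr rfl fun m _ => ?_
  rw [← Finset.sum_neg_distrib]
  refine Finset.sum_congr rfl fun n _ => ?_
  rw [kappaCoeff_swap]
  push_cast
  ring

theorem eps_neg (f : ℂ → ℂ) (u : ℂ) : eps (fun a => -f a) u = -eps f u := by
  unfold eps
  split_ifs
  · simp only [neg_mul, integral_neg, mul_neg]
  · ring

/-- One of the two border terms completes the row coefficients of the (1,2) entry to `rowCoeff`; the
other remains separate. -/
theorem eps_eps_kappa {N : ℕ} {s : ℝ≥0∞} (hs : (N : ℝ≥0∞) < s) (u v : ℂ) :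
    eps (fun a => eps (fun b => kappa N s a b) v) u
       + (eps (border N s) u * chiReal v - eps (border N s) v * chiReal u)
      = ∑ m : Fin N, rowCoeff N s v m * eps (wMon s m) u
        - (∑ m : Fin N, (borderVec N (tinv s) m : ℂ) * eps (wMon s m) v) * chiReal u := by
  have h1 : eps (border N s) = fun u => ∑ m : Fin N,
      (borderVec N (tinv s) m : ℂ) * eps (wMon s m) u := by
    ext u
    rw [← eps_sum hs]
    congr 1
    ext b
    exact border_eq hs b
  have h2 : (fun a => eps (fun b => kappa N s a b) v)
      = fun a => ∑ m : Fin N, (rowCoeff N s v m - borderVec N (tinv s) m * chiReal v) *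
        wMon s m a := by
    ext a
    have := eps_kappa_add_border hs a v
    rw [border_eq hs] at this
    simp only [sub_mul, Finset.sum_sub_distrib]
    rw [← this, Finset.sum_mul]
    rw [eq_sub_iff_add_eq, add_right_inj]
    exact Finset.sum_congr rfl fun n _ => by ring
  rw [h2, eps_sum hs, h1]
  simp only [sub_mul, Finset.sum_sub_distrib, Finset.sum_mul]
  have h3 : ∑ m : Fin N, (borderVec N (tinv s) m : ℂ) * chiReal v * eps (wMon s m) u
      = ∑ m : Fin N, (borderVec N (tinv s) m : ℂ) * eps (wMon s m) u * chiReal v :=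
    Finset.sum_congr rfl fun n _ => by ring
  rw [h3]
  ring

/-- The linear coefficients live on even degrees and the constants of ε on odd ones. -/
theorem linCoeff_mul_oddConst (N : ℕ) (t : ℝ) (m : ℕ) : linCoeff N t m * oddConst t m = 0 := by
  unfold linCoeff oddConst
  rcases Nat.even_or_odd m with h | h
  · simp [Nat.not_odd_iff_even.2 h]
  · simp [Nat.not_even_iff_odd.2 h]

theorem borderVec_mul_oddConst (N : ℕ) (t : ℝ) (m : ℕ) : borderVec N t m * oddConst t m = 0 := by
  unfold borderVec oddConst
  rcases Nat.even_or_odd m with h | h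
  · simp [Nat.not_odd_iff_even.2 h]
  · simp [Nat.not_even_iff_odd.2 h]

/-- Applying ε in u as well creates new constants. By `hcol` these turn into a linear term in v
whose border part cancels the remaining border term; constants without any variable vanish by
parity. What is left is the primitive of ϰ_N in both variables plus the linear terms. -/
theorem kernel_one_one_real {N : ℕ} {s : ℝ≥0∞} (hs : (N : ℝ≥0∞) < s) {u v : ℂ} (hu : ‖u‖ < 1)
    (hv : ‖v‖ < 1) (hu0 : u.im = 0) :
    ∑ m : Fin N, rowCoeff N s v m * eps (wMon s m) u
        - (∑ m : Fin N, (borderVec N (tinv s) m : ℂ) * eps (wMon s m) v) * chiReal u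
      = if v.im = 0 then dps (kernelCoeff N (tinv s)) u v
        else -(iota v * dps (shiftR (kernelCoeff N (tinv s))) u (conj v)) := by
  have ht := one_sub_mul_tinv_ne_zero hs
  have hlo : ∀ m : ℕ, (linCoeff N (tinv s) m : ℂ) * oddConst (tinv s) m = 0 := fun m => by
    exact_mod_cast linCoeff_mul_oddConst N (tinv s) m
  have hbo : ∀ m : ℕ, (borderVec N (tinv s) m : ℂ) * oddConst (tinv s) m = 0 := fun m => by
    exact_mod_cast borderVec_mul_oddConst N (tinv s) m
  -- The column sums follow from the row sums by antisymmetry, with the opposite sign.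
  have hcol : ∀ n : Fin N, ∑ m : Fin N, (kappaCoeff N (tinv s) m n : ℂ) * oddConst (tinv s) m
      = borderVec N (tinv s) n - linCoeff N (tinv s) n := by
    intro n
    rw [← neg_sub, ← sum_kappaCoeff_mul_oddConst ht n.2, ← Finset.sum_neg_distrib]
    refine Finset.sum_congr rfl fun m _ => ?_
    rw [kappaCoeff_swap]
    push_cast
    ring
  rw [chiReal, if_pos hu0, mul_one]
  simp only [eps_wMon_of_im_eq_zero hs _ hu hu0]
  split_ifs with h
  · simp only [eps_wMon_of_im_eq_zero hs _ hv h, rowCoeff_of_im_eq_zero hs hv h]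
    rw [kernelCoeff, dps_assemble (kappaCoeff_eq_zero N _) (linCoeff_eq_zero N _)]
    have h1 : ∀ m : Fin N, ((linCoeff N (tinv s) m : ℂ) - ∑ n : Fin N,
        (kappaCoeff N (tinv s) m n : ℂ) * (v ^ ((n : ℕ) + 1) / ((n : ℂ) + 1))) *
        (oddConst (tinv s) m - u ^ ((m : ℕ) + 1) / ((m : ℂ) + 1))
        = -(linCoeff N (tinv s) m : ℂ) * (u ^ ((m : ℕ) + 1) / ((m : ℂ) + 1))
          - ∑ n : Fin N, (kappaCoeff N (tinv s) m n : ℂ) * oddConst (tinv s) m *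
            (v ^ ((n : ℕ) + 1) / ((n : ℂ) + 1))
          + ∑ n : Fin N, (kappaCoeff N (tinv s) m n : ℂ) / (((m : ℂ) + 1) * ((n : ℂ) + 1)) *
            u ^ ((m : ℕ) + 1) * v ^ ((n : ℕ) + 1) := by
      intro m
      have e1 : ∑ n : Fin N, (kappaCoeff N (tinv s) m n : ℂ) * oddConst (tinv s) m *
            (v ^ ((n : ℕ) + 1) / ((n : ℂ) + 1)) = (∑ n : Fin N,
        (kappaCoeff N (tinv s) m n : ℂ) * (v ^ ((n : ℕ) + 1) / ((n : ℂ) + 1))) *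
          oddConst (tinv s) m := by
        rw [Finset.sum_mul]
        exact Finset.sum_congr rfl fun n _ => by ring
      have e2 : ∑ n : Fin N, (kappaCoeff N (tinv s) m n : ℂ) / (((m : ℂ) + 1) * ((n : ℂ) + 1)) *
            u ^ ((m : ℕ) + 1) * v ^ ((n : ℕ) + 1) = (∑ n : Fin N,
        (kappaCoeff N (tinv s) m n : ℂ) * (v ^ ((n : ℕ) + 1) / ((n : ℂ) + 1))) *
          (u ^ ((m : ℕ) + 1) / ((m : ℂ) + 1)) := by
        rw [Finset.sum_mul]
        exact Finset.sum_congr rfl fun n _ => by field_simp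
      rw [e1, e2]
      linear_combination hlo m
    simp only [h1, Finset.sum_add_distrib, Finset.sum_sub_distrib]
    rw [Finset.sum_comm (f := fun (m n : Fin N) => (kappaCoeff N (tinv s) m n : ℂ) *
      oddConst (tinv s) m * (v ^ ((n : ℕ) + 1) / ((n : ℂ) + 1)))]
    simp only [← Finset.sum_mul, hcol]
    have h2 : ∀ m : Fin N, (borderVec N (tinv s) m : ℂ) *
        (oddConst (tinv s) m - v ^ ((m : ℕ) + 1) / ((m : ℂ) + 1))
        = -((borderVec N (tinv s) m : ℂ) * (v ^ ((m : ℕ) + 1) / ((m : ℂ) + 1))) := by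
      intro m
      linear_combination hbo m
    simp only [h2]
    have h3 : ∑ m : Fin N, (-(linCoeff N (tinv s) m : ℂ) * (u ^ ((m : ℕ) + 1) / ((m : ℂ) + 1)))
        - ∑ m : Fin N, ((borderVec N (tinv s) m : ℂ) - linCoeff N (tinv s) m) *
          (v ^ ((m : ℕ) + 1) / ((m : ℂ) + 1))
        - ∑ m : Fin N, -((borderVec N (tinv s) m : ℂ) * (v ^ ((m : ℕ) + 1) / ((m : ℂ) + 1)))
        = ∑ n : Fin N, (linCoeff N (tinv s) n : ℂ) / ((n : ℂ) + 1) *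
          (v ^ ((n : ℕ) + 1) - u ^ ((n : ℕ) + 1)) := by
      rw [← Finset.sum_sub_distrib, ← Finset.sum_sub_distrib]
      exact Finset.sum_congr rfl fun n _ => by ring
    rw [← h3]
    ring
  · simp only [eps_wMon_of_im_ne_zero s _ hv h, rowCoeff_of_im_ne_zero hv h]
    rw [kernelCoeff, dps_shiftR_assemble (kappaCoeff_eq_zero N _) (linCoeff_eq_zero N _)]
    have h1 : ∀ m : Fin N, (iota v * ∑ n : Fin N,
        (kappaCoeff N (tinv s) m n : ℂ) * conj v ^ (n : ℕ)) *
        (oddConst (tinv s) m - u ^ ((m : ℕ) + 1) / ((m : ℂ) + 1))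
        = iota v * ∑ n : Fin N, (kappaCoeff N (tinv s) m n : ℂ) * oddConst (tinv s) m *
            conj v ^ (n : ℕ)
          - iota v * ∑ n : Fin N, (kappaCoeff N (tinv s) m n : ℂ) / ((m : ℂ) + 1) *
            u ^ ((m : ℕ) + 1) * conj v ^ (n : ℕ) := by
      intro m
      rw [mul_sub, mul_assoc, mul_assoc, Finset.sum_mul, Finset.sum_mul]
      congr 2
      · exact Finset.sum_congr rfl fun n _ => by ring
      · exact Finset.sum_congr rfl fun n _ => by field_simp
    simp only [h1, Finset.sum_sub_distrib, ← Finset.mul_sum]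
    rw [Finset.sum_comm (f := fun (m n : Fin N) => (kappaCoeff N (tinv s) m n : ℂ) *
      oddConst (tinv s) m * conj v ^ (n : ℕ))]
    simp only [← Finset.sum_mul, hcol, sub_mul, Finset.sum_sub_distrib]
    have h2 : ∑ m : Fin N, (borderVec N (tinv s) m : ℂ) * (iota v * conj v ^ (m : ℕ))
        = iota v * ∑ m : Fin N, (borderVec N (tinv s) m : ℂ) * conj v ^ (m : ℕ) := by
      rw [Finset.mul_sum]
      exact Finset.sum_congr rfl fun n _ => by ring
    rw [h2]
    ring

/-- At finite N the kernel on the disk is already K[A] for one antisymmetric polynomial A, so that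
the convergence of kernels reduces to that of its coefficients. The (2,1) entry comes from the (1,2)
entry by antisymmetry. -/
theorem kernel_eq_kernelSeries {N : ℕ} {s : ℝ≥0∞} (hs : (N : ℝ≥0∞) < s) {u v : ℂ} (hu : ‖u‖ < 1)
    (hv : ‖v‖ < 1) : kernel N s u v = kernelSeries (kernelCoeff N (tinv s)) u v := by
  have hu' : ‖conj u‖ < 1 := by simpa using hu
  have hv' : ‖conj v‖ < 1 := by simpa using hv
  have h11 : ∀ u v : ℂ, ‖u‖ < 1 → ‖v‖ < 1 →
      kappa N s u v = dps (shiftL (shiftR (kernelCoeff N (tinv s)))) u v := by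
    intro u v hu hv
    rw [kappa_eq hs, kernelCoeff, dps_shiftL_shiftR_assemble (kappaCoeff_eq_zero N _)]
    simp only [wMon_of_norm_lt_one s _ hu, wMon_of_norm_lt_one s _ hv]
  have h12 := kernel_zero_one hs hu hv
  have h21 : eps (fun a => kappa N s a v) u - border N s v * chiReal u
      = if u.im = 0 then -dps (shiftR (kernelCoeff N (tinv s))) u v
        else iota u * dps (shiftL (shiftR (kernelCoeff N (tinv s)))) (conj u) v := by
    have := kernel_zero_one hs hv hu
    have e : (fun a => kappa N s a v) = fun a => -kappa N s v a := by
      ext a; rw [← kappa_swap hs]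
    rw [e, eps_neg, ← neg_add', this]
    split_ifs
    · rw [dps_shiftL_eq (kernelCoeff_swap N _), neg_neg]
    · rw [dps_neg_swap (shift_swap (kernelCoeff_swap N _))]; ring
  have : ∑ m : Fin N, rowCoeff N s v m * eps (wMon s m) u
      - (∑ m : Fin N, (borderVec N (tinv s) m : ℂ) * eps (wMon s m) v) * chiReal u
      + 1 / 2 * sgnDiff u v
    = if u.im = 0 then
     if v.im = 0 then dps (kernelCoeff N (tinv s)) u v + 1 / 2 * sgnDiff u v
     else -(iota v * dps (shiftR (kernelCoeff N (tinv s))) u (conj v))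
   else if v.im = 0 then -(iota u * dps (shiftL (kernelCoeff N (tinv s))) (conj u) v)
     else iota u * iota v * dps (shiftL (shiftR (kernelCoeff N (tinv s)))) (conj u) (conj v) := by
    by_cases hu0 : u.im = 0
    · rw [kernel_one_one_real hs hu hv hu0]
      by_cases hv0 : v.im = 0
      · simp [hu0, hv0]
      · simp [hu0, hv0, sgnDiff]
    -- For non-real u the lower row is ι(u) times the upper row at the conjugate point.
    · have h3 : ∑ m : Fin N, rowCoeff N s v m * eps (wMon s m) u
          = iota u * ∑ m : Fin N, rowCoeff N s v m * wMon s m (conj u) := by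
        rw [Finset.mul_sum]
        refine Finset.sum_congr rfl fun m _ => ?_
        rw [eps, if_neg hu0]; ring
      rw [h3, ← eps_kappa_add_border hs, kernel_zero_one hs hu' hv]
      by_cases hv0 : v.im = 0
      · simp [hu0, hv0, sgnDiff, chiReal]
      · simp [hu0, hv0, sgnDiff, chiReal, mul_assoc]
  rw [kernel, kernelSeries, h11 u v hu hv, h12, h21, eps_eps_kappa hs, this]

/-! ### Asymptotics of the normalised central binomial coefficients -/

/-- The Wallis product is exactly the reciprocal of (2n+1) cb(n)², which brings in the constant 2/π.
-/
theorem cb_sq_mul_W (n : ℕ) : cb n ^ 2 * (2 * n + 1) * Real.Wallis.W n = 1 := by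
  induction n with
  | zero => simp [cb_zero, Real.Wallis.W]
  | succ n ih =>
    rw [Real.Wallis.W_succ]
    have h := cb_succ n
    have h1 : cb (n + 1) = (2 * n + 1) * cb n / (2 * n + 2) := by
      rw [← h]; field_simp
    rw [h1]
    push_cast
    have h3 : (2 * (n : ℝ) + 3) ≠ 0 := by positivity
    refine Eq.trans ?_ ih
    field_simp
    ring

theorem cb_le_one (n : ℕ) : cb n ≤ 1 := by
  induction n with
  | zero => simp [cb_zero]
  | succ n ih =>
    have h := cb_succ n
    have hp := cb_pos n
    have hn : (0 : ℝ) ≤ n := n.cast_nonneg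
    nlinarith

/-- Induction, resting on (2n+1)(2n+3) ≤ (2n+2)². -/
theorem succ_mul_cb_sq_le_one (n : ℕ) : (2 * n + 1) * cb n ^ 2 ≤ 1 := by
  induction n with
  | zero => simp [cb_zero]
  | succ n ih =>
    have h := cb_succ n
    have hp := cb_pos n
    have hn : (0 : ℝ) ≤ n := n.cast_nonneg
    have h1 : ((2 * n + 2) * cb (n + 1)) ^ 2 = (2 * n + 1) * ((2 * n + 1) * cb n ^ 2) := by
      rw [h]; ring
    have h2 : ((2 * n + 2) * cb (n + 1)) ^ 2 ≤ 2 * n + 1 := by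
      rw [h1]; nlinarith
    push_cast
    have h3 : (2 * ((n : ℝ) + 1) + 1) * cb (n + 1) ^ 2 * (2 * n + 2) ^ 2 ≤ (2 * n + 2) ^ 2 := by
      nlinarith
    exact le_of_mul_le_mul_right (by linarith) (by positivity : (0 : ℝ) < (2 * n + 2) ^ 2)

/-- The product is the geometric mean of x cb(m)² ≤ 1 and x cb(l)² ≤ 1 + d. The slack d accounts for
a shift between the indices. -/
theorem mul_cb_mul_cb_le {x d : ℝ} {m l : ℕ} (hx0 : 0 ≤ x) (hd : 0 ≤ d) (hx : x * cb m ^ 2 ≤ 1)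
    (hx' : x ≤ 2 * l + 1 + d) : x * cb m * cb l ≤ 1 + d := by
  have h1 := cb_pos m
  have h2 := cb_pos l
  have h3 := succ_mul_cb_sq_le_one l
  have h4 := cb_le_one l
  have h5 : cb l ^ 2 ≤ 1 := by nlinarith
  have h6 : x * cb l ^ 2 ≤ 1 + d := by nlinarith [mul_le_mul_of_nonneg_right hx' (sq_nonneg (cb l))]
  have h7 : (x * cb m * cb l) ^ 2 ≤ (1 + d) ^ 2 := by
    have : (x * cb m * cb l) ^ 2 = (x * cb m ^ 2) * (x * cb l ^ 2) := by ring
    rw [this]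
    have : 0 ≤ x * cb l ^ 2 := by positivity
    nlinarith
  exact le_of_sq_le_sq h7 (by linarith) 

theorem tendsto_mul_cb_sq :
    Tendsto (fun n : ℕ => (2 * n + 1) * cb n ^ 2) atTop (𝓝 (2 / Real.pi)) := by
  have h := Real.Wallis.tendsto_W_nhds_pi_div_two.inv₀ (by positivity)
  rw [inv_div] at h
  refine h.congr fun n => ?_
  have := cb_sq_mul_W n
  have h1 := (Real.Wallis.W_pos n).ne'
  field_simp
  linarith

theorem tendsto_cb_sub_one_div : Tendsto (fun n : ℕ => cb (n - 1) / cb n) atTop (𝓝 1) := by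
  have h : Tendsto (fun n : ℕ => 1 + 1 / (2 * (n : ℝ) - 1)) atTop (𝓝 (1 + 0)) := by
    refine tendsto_const_nhds.add ?_
    simp only [one_div]
    refine tendsto_inv_atTop_zero.comp ?_
    exact tendsto_atTop_add_const_right _ _
      ((tendsto_natCast_atTop_atTop).const_mul_atTop (by norm_num))
  rw [add_zero] at h
  refine h.congr' ?_
  filter_upwards [eventually_ge_atTop 1] with n hn
  obtain ⟨m, rfl⟩ := Nat.exists_eq_add_of_le' hn
  have h1 := cb_succ m
  have h2 := (cb_pos (m + 1)).ne'
  have h3 : (2 * ((m : ℝ) + 1) - 1) ≠ 0 := by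
    have : (0 : ℝ) ≤ m := m.cast_nonneg
    linarith
  rw [Nat.add_sub_cancel]
  push_cast
  field_simp
  linarith

theorem tendsto_cb_sub_div (i : ℕ) : Tendsto (fun n : ℕ => cb (n - i) / cb n) atTop (𝓝 1) := by
  induction i with
  | zero =>
    refine tendsto_const_nhds.congr fun n => ?_
    rw [Nat.sub_zero, div_self (cb_pos n).ne']
  | succ i ih =>
    have h := (ih.comp (tendsto_sub_atTop_nat 1)).mul tendsto_cb_sub_one_div
    rw [one_mul] at h
    refine h.congr fun n => ?_
    have h1 := (cb_pos (n - 1)).ne'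
    have h2 := (cb_pos n).ne'
    simp only [Function.comp]
    rw [show n - (i + 1) = n - 1 - i by omega]
    field_simp

/-- Fixed shifts of the index and of the linear factor do not affect the Wallis limit, since
consecutive values of `cb` have ratio tending to 1. -/
theorem tendsto_mul_cb_mul_cb (c : ℝ) (i l : ℕ) :
    Tendsto (fun n : ℕ => (2 * n + c) * cb (n - i) * cb (n - l)) atTop (𝓝 (2 / Real.pi)) := by
  have h0 : Tendsto (fun n : ℕ => 1 + (c - 1) / (2 * (n : ℝ) + 1)) atTop (𝓝 (1 + 0)) := by
    refine tendsto_const_nhds.add (Tendsto.div_atTop tendsto_const_nhds ?_)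
    exact tendsto_atTop_add_const_right _ _
      ((tendsto_natCast_atTop_atTop).const_mul_atTop (by norm_num))
  have h := ((h0.mul tendsto_mul_cb_sq).mul (tendsto_cb_sub_div i)).mul (tendsto_cb_sub_div l)
  simp only [add_zero, one_mul, mul_one] at h
  refine h.congr fun n => ?_
  have h2 := (cb_pos n).ne'
  have : (2 * (n : ℝ) + 1) ≠ 0 := by positivity
  field_simp
  ring

theorem tendsto_half : Tendsto (fun N : ℕ => N / 2) atTop atTop :=
  Nat.tendsto_div_const_atTop two_ne_zero

section Limits
variable {t : ℕ → ℝ}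

theorem tendsto_zero_of_mul_lt_one (ht0 : ∀ N, 0 ≤ t N) (ht1 : ∀ N, N * t N < 1) :
    Tendsto t atTop (𝓝 0) := by
  refine squeeze_zero' (Eventually.of_forall ht0) ?_ tendsto_inv_atTop_nhds_zero_nat
  filter_upwards [eventually_gt_atTop 0] with N hN
  have : (0 : ℝ) < N := by exact_mod_cast hN
  rw [← one_div, le_div_iff₀ this]
  linarith [ht1 N]

theorem tendsto_one_sub_mul (ht : Tendsto t atTop (𝓝 0)) (a : ℝ) :
    Tendsto (fun N => 1 - a * t N) atTop (𝓝 1) := by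
  simpa using tendsto_const_nhds.sub (ht.const_mul a)

/-- The formulas for even and odd N have the same limit: both contain a product of the form (2n + c)
cb(n - i) cb(n - l) and one factor 1 - a t tending to 1. -/
theorem tendsto_invEntry (ht : Tendsto t atTop (𝓝 0)) (j k : ℕ) :
    Tendsto (fun N => invEntry N (t N) j k) atTop
      (𝓝 (1 / 4 * (2 * j + 1) * (cb j * cb k * (2 * k + 1)) * (2 / Real.pi)
        / (2 * k + 1 - 2 * j))) := by
  unfold invEntry
  refine Tendsto.if' ?_ ?_
  · unfold invEven
    refine Tendsto.div_const ?_ _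
    have h1 := (tendsto_mul_cb_mul_cb (-2 * j) j (1 + k)).comp tendsto_half
    have h2 := (tendsto_one_sub_mul ht (2 * k + 2)).mul h1
    have h3 := h2.const_mul (1 / 4 * (2 * (j : ℝ) + 1) * (cb j * cb k * (2 * k + 1)))
    rw [one_mul] at h3
    refine h3.congr fun N => ?_
    simp only [Function.comp, Nat.sub_sub]
    ring
  · unfold invOdd
    refine Tendsto.div_const ?_ _
    have h1 := (tendsto_mul_cb_mul_cb (-2 * k) k j).comp tendsto_half
    have h2 := (tendsto_one_sub_mul ht (2 * j + 1)).mul h1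
    have h3 := h2.const_mul (1 / 4 * (2 * (j : ℝ) + 1) * (cb j * cb k * (2 * k + 1)))
    rw [one_mul] at h3
    refine h3.congr fun N => ?_
    simp only [Function.comp]
    ring

theorem tendsto_linEntry (ht : Tendsto t atTop (𝓝 0)) (j : ℕ) :
    Tendsto (fun N => linEntry N (t N) j) atTop (𝓝 (1 / 2 * cb j * (2 / Real.pi))) := by
  unfold linEntry
  refine Tendsto.if' ?_ ?_
  · unfold linEven
    have h1 := (tendsto_mul_cb_mul_cb (-2 * j) j 0).comp tendsto_half
    refine (h1.const_mul (1 / 2 * cb j)).congr fun N => ?_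
    simp only [Function.comp, Nat.sub_zero]
    ring
  · unfold linOdd
    have h1 := (tendsto_mul_cb_mul_cb 1 j 0).comp tendsto_half
    have h2 := (h1.const_mul (1 / 2 * cb j)).mul (tendsto_one_sub_mul ht (2 * j + 1))
    rw [mul_one] at h2
    refine h2.congr fun N => ?_
    simp only [Function.comp, Nat.sub_zero]
    ring

/-- The coefficients of the limiting double series. -/
noncomputable def diskCoeff (p : ℕ × ℕ) : ℂ :=
  if Odd (p.1 + p.2) then
    ((1 / Real.pi * (cb (p.1 / 2) * cb (p.2 / 2)) / ((p.2 : ℝ) - p.1) : ℝ) : ℂ) else 0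

theorem diskCoeff_swap (p : ℕ × ℕ) : diskCoeff p.swap = -diskCoeff p := by
  unfold diskCoeff
  simp only [Prod.fst_swap, Prod.snd_swap, add_comm p.2]
  split_ifs
  · rw [← Complex.ofReal_neg, ← div_neg, neg_sub, mul_comm (cb _)]
  · simp

theorem tendsto_kappaCoeff_odd (ht : Tendsto t atTop (𝓝 0)) (j k : ℕ) :
    Tendsto (fun N => kappaCoeff N (t N) (2 * j + 1) (2 * k)) atTop
      (𝓝 (-2 * (1 / 4 * (2 * k + 1) * (cb k * cb j * (2 * j + 1)) * (2 / Real.pi)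
        / (2 * j + 1 - 2 * k)))) := by
  refine ((tendsto_invEntry ht k j).const_mul (-2)).congr' ?_
  filter_upwards [eventually_gt_atTop (2 * j + 1), eventually_gt_atTop (2 * k)] with N h1 h2
  rw [kappaCoeff, if_pos ⟨h1, h2⟩, coeffEntry, if_pos ⟨by simp, by simp⟩, half_even, half_odd]

theorem tendsto_linCoeff_even (ht : Tendsto t atTop (𝓝 0)) (j : ℕ) :
    Tendsto (fun N => linCoeff N (t N) (2 * j)) atTop (𝓝 (1 / 2 * cb j * (2 / Real.pi))) := by
  refine (tendsto_linEntry ht j).congr' ?_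
  filter_upwards [eventually_gt_atTop (2 * j)] with N h1
  rw [linCoeff, if_pos ⟨h1, by simp⟩, half_even]

theorem kappaCoeff_eq_zero_of_even (N : ℕ) (t : ℝ) {m n : ℕ} (h : Even (m + n)) :
    kappaCoeff N t m n = 0 := by
  unfold kappaCoeff coeffEntry
  rw [Nat.even_add] at h
  split_ifs with h1 h2 h3
  · exact absurd h2.1 (Nat.not_odd_iff_even.2 (h.2 h2.2))
  · exact absurd h3.2 (Nat.not_odd_iff_even.2 (h.1 h3.1))
  · simp
  · rfl

theorem kernelCoeff_eq_zero_of_even (N : ℕ) (t : ℝ) {p : ℕ × ℕ} (h : Even (p.1 + p.2)) :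
    kernelCoeff N t p = 0 := by
  obtain ⟨m, n⟩ := p
  unfold kernelCoeff
  rcases m with _ | m <;> rcases n with _ | n
  · rfl
  · have : ¬ Even n := by
      intro h'; simp [Nat.even_add_one] at h; exact Nat.not_even_iff_odd.2 h h'
    simp [assemble, linCoeff, this]
  · have : ¬ Even m := by
      intro h'; simp [Nat.even_add_one] at h; exact Nat.not_even_iff_odd.2 h h'
    simp [assemble, linCoeff, this]
  · have h' : Even (m + n) := by
      have e : m + 1 + (n + 1) = m + n + 2 := by ring
      simp only [e] at h
      simpa [Nat.even_add] using h
    simp [assemble, kappaCoeff_eq_zero_of_even N t h']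

/-- The coefficients with first index 0 come from the linear terms, the others from ϰ_N after
division by the indices. That both follow the same formula is due to the recursion for `cb`. -/
theorem tendsto_kernelCoeff_even_odd (ht : Tendsto t atTop (𝓝 0)) (j k : ℕ) :
    Tendsto (fun N => kernelCoeff N (t N) (2 * j, 2 * k + 1)) atTop
      (𝓝 (diskCoeff (2 * j, 2 * k + 1))) := by
  have hk : (2 * (k : ℝ) + 1) ≠ 0 := by positivity
  have hpi := Real.pi_ne_zero
  rw [diskCoeff, if_pos (by simp [parity_simps])]
  simp only [half_even, half_odd]
  rcases j with _ | j
  · refine Tendsto.congr (fun N => rfl) (f₁ := fun N =>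
      ((linCoeff N (t N) (2 * k) / ((2 * k : ℕ) + 1) : ℝ) : ℂ)) ?_
    refine (Complex.continuous_ofReal.tendsto _).comp ?_
    convert (tendsto_linCoeff_even ht k).div_const (((2 * k : ℕ) : ℝ) + 1) using 2
    rw [cb_zero]
    push_cast
    field_simp
    ring
  · refine Tendsto.congr (fun N => rfl) (f₁ := fun N =>
      ((kappaCoeff N (t N) (2 * j + 1) (2 * k) / (((2 * j + 1 : ℕ) + 1) * ((2 * k : ℕ) + 1)) : ℝ)
        : ℂ)) ?_
    refine (Complex.continuous_ofReal.tendsto _).comp ?_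
    convert (tendsto_kappaCoeff_odd ht j k).div_const
      ((((2 * j + 1 : ℕ) : ℝ) + 1) * ((2 * k : ℕ) + 1)) using 2
    have h1 := cb_succ j
    have h2 : (2 * (j : ℝ) + 1 - 2 * k) ≠ 0 := by
      have : ((2 * j + 1 - 2 * k : ℤ) : ℝ) ≠ 0 := by
        have : (2 * j + 1 - 2 * k : ℤ) ≠ 0 := by omega
        exact_mod_cast this
      push_cast at this
      exact this
    have h3 : (2 * (k : ℝ) + 1 - 2 * (j + 1)) ≠ 0 := by
      intro h; apply h2; linarith
    have h4 : (2 * (j : ℝ) + 1 + 1) ≠ 0 := by positivity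
    -- Dividing by the new first index 2j + 2 shifts `cb j` to `cb (j + 1)`.
    have h5 : cb (j + 1) = (2 * j + 1) * cb j / (2 * j + 1 + 1) := by
      rw [← h1]; field_simp; ring
    rw [h5]
    push_cast
    field_simp
    ring

theorem tendsto_kernelCoeff (ht : Tendsto t atTop (𝓝 0)) (p : ℕ × ℕ) :
    Tendsto (fun N => kernelCoeff N (t N) p) atTop (𝓝 (diskCoeff p)) := by
  obtain ⟨m, n⟩ := p
  by_cases h : Even (m + n)
  · rw [diskCoeff, if_neg (Nat.not_odd_iff_even.2 h)]
    refine tendsto_const_nhds.congr fun N => ?_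
    rw [kernelCoeff_eq_zero_of_even N _ h]
  · rcases Nat.even_or_odd' m with ⟨j, rfl | rfl⟩
    · rcases Nat.even_or_odd' n with ⟨k, rfl | rfl⟩
      · exact absurd (by simp [parity_simps]) h
      · exact tendsto_kernelCoeff_even_odd ht j k
    · rcases Nat.even_or_odd' n with ⟨k, rfl | rfl⟩
      · have := (tendsto_kernelCoeff_even_odd ht k j).neg
        rw [← diskCoeff_swap] at this
        exact this.congr fun N => by rw [← kernelCoeff_swap]; rfl
      · exact absurd (by simp [parity_simps]) h

end Limits

/-! ### Uniform bounds for the coefficients -/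

theorem abs_one_div_odd_sub_even_le (j k : ℕ) : |1 / (2 * (k : ℝ) + 1 - 2 * j)| ≤ 1 := by
  have h : (1 : ℝ) ≤ |2 * (k : ℝ) + 1 - 2 * j| := by
    have : (1 : ℤ) ≤ |2 * (k : ℤ) + 1 - 2 * j| := Int.one_le_abs (by omega)
    exact_mod_cast this
  rw [abs_div, abs_one, div_le_one (by linarith)]
  exact h

theorem two_mul_mul_cb_sq_le_one (n : ℕ) : 2 * (n : ℝ) * cb n ^ 2 ≤ 1 := by
  nlinarith [succ_mul_cb_sq_le_one n, sq_nonneg (cb n)]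

/-- The bound has to be uniform in N. The factor 1 - a t lies in [0, 1], the Cauchy denominator is
an odd integer, and the product of the two N-dependent values of `cb` is controlled by
`mul_cb_mul_cb_le`. -/
theorem abs_invEntry_le {N : ℕ} {t : ℝ} (ht0 : 0 ≤ t) (ht1 : N * t < 1) {j k : ℕ} (hj : 2 * j < N)
    (hk : 2 * k + 1 < N) :
    |invEntry N t j k| ≤ 1 / 4 * ((2 * j + 1) * (2 * k + 1)) * (2 * j + 2 * k + 2) := by
  have key : ∀ f g e : ℝ, 0 ≤ f → f ≤ 1 → 0 ≤ g → g ≤ 2 * j + 2 * k + 2 → |e| ≤ 1 →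
      |1 / 4 * f * (2 * j + 1) * (cb j * cb k * (2 * k + 1)) * g * e|
        ≤ 1 / 4 * ((2 * j + 1) * (2 * k + 1)) * (2 * j + 2 * k + 2) := by
    intro f g e hf0 hf1 hg0 hg1 he
    have h1 := (cb_pos j).le
    have h2 := (cb_pos k).le
    have h3 := cb_le_one j
    have h4 := cb_le_one k
    have h5 : cb j * cb k ≤ 1 := by nlinarith
    rw [abs_mul, abs_of_nonneg (by positivity)]
    calc 1 / 4 * f * (2 * j + 1) * (cb j * cb k * (2 * k + 1)) * g * |e|
        ≤ 1 / 4 * 1 * (2 * j + 1) * (1 * (2 * k + 1)) * (2 * j + 2 * k + 2) * 1 := by gcongr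
      _ = _ := by ring
  have hfac : ∀ i : ℕ, i ≤ N → 0 ≤ 1 - (i : ℝ) * t ∧ 1 - (i : ℝ) * t ≤ 1 := by
    intro i hi
    have : (i : ℝ) * t ≤ N * t := mul_le_mul_of_nonneg_right (by exact_mod_cast hi) ht0
    exact ⟨by linarith, by nlinarith [(i.cast_nonneg : (0 : ℝ) ≤ i)]⟩
  unfold invEntry
  split_ifs with hN
  · have h := hfac (2 * k + 2) (by omega)
    push_cast at h
    rw [invEven, div_eq_mul_one_div]
    have hjn : ((N / 2 : ℕ) : ℝ) - j = ((N / 2 - j : ℕ) : ℝ) := by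
      rw [Nat.cast_sub (by omega)]
    refine key _ _ _ h.1 h.2 ?_ ?_ (abs_one_div_odd_sub_even_le j k)
    · rw [hjn]
      have := (cb_pos (N / 2 - j)).le
      have := (cb_pos (N / 2 - 1 - k)).le
      positivity
    · rw [hjn]
      -- The slack 2k + 1 suffices because 2(N/2 - 1 - k) + 1 + (2k + 1) = 2(N/2).
      have := mul_cb_mul_cb_le (x := 2 * ((N / 2 - j : ℕ) : ℝ)) (d := 2 * k + 1)
        (m := N / 2 - j) (l := N / 2 - 1 - k) (by positivity) (by positivity)
        (two_mul_mul_cb_sq_le_one _) (by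
          have : 2 * (N / 2 - j) ≤ 2 * (N / 2 - 1 - k) + 1 + (2 * k + 1) := by omega
          exact_mod_cast this)
      have : (0 : ℝ) ≤ j := j.cast_nonneg
      linarith
  · have h := hfac (2 * j + 1) (by omega)
    push_cast at h
    rw [invOdd, div_eq_mul_one_div]
    have hjn : ((N / 2 : ℕ) : ℝ) - k = ((N / 2 - k : ℕ) : ℝ) := by
      rw [Nat.cast_sub (by omega)]
    refine key _ _ _ h.1 h.2 ?_ ?_ (abs_one_div_odd_sub_even_le j k)
    · rw [hjn]
      have := (cb_pos (N / 2 - k)).le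
      have := (cb_pos (N / 2 - j)).le
      positivity
    · rw [hjn]
      have := mul_cb_mul_cb_le (x := 2 * ((N / 2 - k : ℕ) : ℝ)) (d := 2 * j)
        (m := N / 2 - k) (l := N / 2 - j) (by positivity) (by positivity)
        (two_mul_mul_cb_sq_le_one _) (by
          have : 2 * (N / 2 - k) ≤ 2 * (N / 2 - j) + 1 + 2 * j := by omega
          exact_mod_cast this)
      have : (0 : ℝ) ≤ k := k.cast_nonneg
      linarith

theorem abs_linEntry_le {N : ℕ} {t : ℝ} (ht0 : 0 ≤ t) (ht1 : N * t < 1) {j : ℕ} (hj : 2 * j < N) :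
    |linEntry N t j| ≤ 2 * j + 1 := by
  have h1 := (cb_pos j).le
  have h3 := cb_le_one j
  unfold linEntry
  split_ifs with hN
  · have hjn : ((N / 2 : ℕ) : ℝ) - j = ((N / 2 - j : ℕ) : ℝ) := by
      rw [Nat.cast_sub (by omega)]
    have h4 := mul_cb_mul_cb_le (x := 2 * ((N / 2 - j : ℕ) : ℝ)) (d := 0)
        (m := N / 2 - j) (l := N / 2) (by positivity) le_rfl
        (two_mul_mul_cb_sq_le_one _) (by
          have : 2 * (N / 2 - j) ≤ 2 * (N / 2) + 1 := by omega
          rw [add_zero]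
          exact_mod_cast this)
    have h5 := (cb_pos (N / 2 - j)).le
    have h6 := (cb_pos (N / 2)).le
    rw [linEven, hjn, abs_of_nonneg (by positivity)]
    have : (0 : ℝ) ≤ 2 * ((N / 2 - j : ℕ) : ℝ) * cb (N / 2 - j) * cb (N / 2) := by positivity
    have : (0 : ℝ) ≤ j := j.cast_nonneg
    nlinarith
  · have h4 := mul_cb_mul_cb_le (x := 2 * ((N / 2 : ℕ) : ℝ) + 1) (d := 2 * j)
        (m := N / 2) (l := N / 2 - j) (by positivity) (by positivity)
        (succ_mul_cb_sq_le_one _) (by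
          have : 2 * (N / 2) + 1 ≤ 2 * (N / 2 - j) + 1 + 2 * j := by omega
          exact_mod_cast this)
    have h5 := (cb_pos (N / 2 - j)).le
    have h6 := (cb_pos (N / 2)).le
    have h7 : (2 * (j : ℝ) + 1) * t ≤ N * t :=
      mul_le_mul_of_nonneg_right (by exact_mod_cast hj) ht0
    have h8 : (0 : ℝ) ≤ (2 * j + 1) * t := by positivity
    have h9 : (0 : ℝ) ≤ 1 - (2 * j + 1) * t := by linarith
    rw [linOdd, abs_of_nonneg (by positivity)]
    calc 1 / 2 * cb j * cb (N / 2 - j) * ((2 * ((N / 2 : ℕ) : ℝ) + 1) * cb (N / 2)) *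
          (1 - (2 * j + 1) * t)
        = 1 / 2 * cb j * ((2 * ((N / 2 : ℕ) : ℝ) + 1) * cb (N / 2) * cb (N / 2 - j)) *
          (1 - (2 * j + 1) * t) := by ring
      _ ≤ 1 / 2 * 1 * (1 + 2 * j) * 1 := by gcongr; linarith
      _ ≤ 2 * j + 1 := by nlinarith [(j.cast_nonneg : (0 : ℝ) ≤ j)]

theorem abs_coeffEntry_le {N : ℕ} {t : ℝ} (ht0 : 0 ≤ t) (ht1 : N * t < 1) {m n : ℕ} (hm : m < N)
    (hn : n < N) : |coeffEntry N t m n| ≤ 1 / 4 * ((m + 1) * (n + 1)) * (m + n + 2) := by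
  unfold coeffEntry
  split_ifs with h1 h2
  · obtain ⟨⟨k, rfl⟩, ⟨j, rfl⟩⟩ := h1
    rw [← two_mul j, half_even, half_odd]
    refine (abs_invEntry_le ht0 ht1 (by omega) hm).trans ?_
    push_cast
    have : (0 : ℝ) ≤ j := j.cast_nonneg
    have : (0 : ℝ) ≤ k := k.cast_nonneg
    calc (1 : ℝ) / 4 * ((2 * j + 1) * (2 * k + 1)) * (2 * j + 2 * k + 2)
        ≤ 1 / 4 * ((2 * j + 1) * (2 * k + 2)) * (2 * j + 2 * k + 3) := by gcongr <;> norm_num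
      _ = _ := by ring
  · obtain ⟨⟨j, rfl⟩, ⟨k, rfl⟩⟩ := h2
    rw [← two_mul j, half_even, half_odd, abs_neg]
    refine (abs_invEntry_le ht0 ht1 (by omega) hn).trans ?_
    push_cast
    have : (0 : ℝ) ≤ j := j.cast_nonneg
    have : (0 : ℝ) ≤ k := k.cast_nonneg
    calc (1 : ℝ) / 4 * ((2 * j + 1) * (2 * k + 1)) * (2 * j + 2 * k + 2)
        ≤ 1 / 4 * ((2 * j + 1) * (2 * k + 2)) * (2 * j + 2 * k + 3) := by gcongr <;> norm_num
      _ = _ := by ring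
  · rw [abs_zero]; positivity

/-- Dividing by the indices absorbs the factor (m+1)(n+1) of the bound for `coeffEntry`, which
leaves a majorant of exponent 1 independent of N. -/
theorem norm_kernelCoeff_le {N : ℕ} {t : ℝ} (ht0 : 0 ≤ t) (ht1 : N * t < 1) (p : ℕ × ℕ) :
    ‖kernelCoeff N t p‖ ≤ majorant 1 1 p := by
  have hlin : ∀ m, |linCoeff N t m / (m + 1)| ≤ 1 := by
    intro m
    rw [abs_div, abs_of_pos (by positivity : (0 : ℝ) < (m : ℝ) + 1),
      div_le_one (by positivity), linCoeff]
    split_ifs with h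
    · obtain ⟨h1, j, rfl⟩ := h
      rw [← two_mul, half_even]
      refine (abs_linEntry_le ht0 ht1 (by omega)).trans (le_of_eq (by push_cast; ring))
    · rw [abs_zero]; positivity
  have h0 : (0 : ℝ) ≤ p.1 := p.1.cast_nonneg
  have h0' : (0 : ℝ) ≤ p.2 := p.2.cast_nonneg
  have hone : (1 : ℝ) ≤ majorant 1 1 p := by
    unfold majorant; nlinarith
  obtain ⟨m, n⟩ := p
  unfold kernelCoeff
  rcases m with _ | m <;> rcases n with _ | n
  · simp [assemble, majorant]
  · rw [assemble, Complex.norm_real, Real.norm_eq_abs]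
    exact (hlin n).trans hone
  · rw [assemble, Complex.norm_real, Real.norm_eq_abs, neg_div, abs_neg]
    exact (hlin m).trans hone
  · rw [assemble, Complex.norm_real, Real.norm_eq_abs, abs_div,
      abs_of_pos (by positivity : (0 : ℝ) < ((m : ℝ) + 1) * (n + 1)), div_le_iff₀ (by positivity)]
    have hm : (0 : ℝ) ≤ m := m.cast_nonneg
    have hn : (0 : ℝ) ≤ n := n.cast_nonneg
    rw [kappaCoeff]
    split_ifs with h
    · rw [abs_mul, abs_neg, abs_two]
      refine (mul_le_mul_of_nonneg_left (abs_coeffEntry_le ht0 ht1 h.1 h.2) zero_le_two).trans ?_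
      rw [majorant]
      push_cast
      have : 1 / 2 * ((m : ℝ) + n + 2) ≤ (m + 1 + 1) * (n + 1 + 1) := by nlinarith
      calc 2 * (1 / 4 * (((m : ℝ) + 1) * (n + 1)) * (m + n + 2))
          = (1 / 2 * ((m : ℝ) + n + 2)) * ((m + 1) * (n + 1)) := by ring
        _ ≤ ((m + 1 + 1) * (n + 1 + 1)) * ((m + 1) * (n + 1)) := by gcongr
        _ = _ := by ring
    · rw [abs_zero]
      exact mul_nonneg (zero_le_one.trans hone) (by positivity)

/-- The uniform bound passes to the limit; the sequence t = 0 is admissible for every N and realises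
this limit. -/
theorem norm_diskCoeff_le (p : ℕ × ℕ) : ‖diskCoeff p‖ ≤ majorant 1 1 p := by
  refine le_of_tendsto (tendsto_kernelCoeff (t := fun _ => 0) tendsto_const_nhds p).norm
    (Eventually.of_forall fun N => norm_kernelCoeff_le le_rfl (by simp) p)

/-! ### The power series of `(1 - x) ^ (-1/2)` and of `A_𝔻` -/

/-- The generalised binomial coefficient is the rising factorial of 1/2 over n!, and this obeys the
recursion of `cb`. -/
theorem choose_half (n : ℕ) : Ring.choose ((1 / 2 : ℂ) + n - 1) n = cb n := by
  have h1 : Ring.choose ((1 / 2 : ℂ) + n - 1) n = Ring.multichoose (1 / 2 : ℂ) n := by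
    rw [Ring.choose]; congr 1; ring
  have h2 := Ring.factorial_nsmul_multichoose_eq_ascPochhammer (1 / 2 : ℂ) n
  rw [Polynomial.ascPochhammer_smeval_eq_eval] at h2
  have h3 : ∀ n : ℕ, (ascPochhammer ℂ n).eval (1 / 2 : ℂ) = n.factorial * (cb n : ℂ) := by
    intro n
    induction n with
    | zero => simp [cb_zero]
    | succ n ih =>
      rw [ascPochhammer_succ_eval, ih, Nat.factorial_succ]
      have h : ((2 * n + 2 : ℂ)) * cb (n + 1) = (2 * n + 1) * cb n := by exact_mod_cast cb_succ n
      push_cast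
      linear_combination (-(n.factorial : ℂ) / 2) * h
  rw [h3, nsmul_eq_mul] at h2
  rw [h1]
  exact mul_left_cancel₀ (by exact_mod_cast n.factorial_ne_zero) h2

theorem hasSum_cb {x : ℂ} (hx : ‖x‖ < 1) :
    HasSum (fun n : ℕ => (cb n : ℂ) * x ^ n) (1 / (1 - x) ^ (1 / 2 : ℂ)) := by
  have hx' : x ∈ Metric.eball (0 : ℂ) 1 := by
    rw [Metric.mem_eball, edist_zero_right, ← ofReal_norm, ← ENNReal.ofReal_one]
    exact (ENNReal.ofReal_lt_ofReal_iff one_pos).2 hx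
  have h := (Complex.one_div_one_sub_cpow_hasFPowerSeriesOnBall_zero (1 / 2)).hasSum hx'
  rw [zero_add] at h
  have e : (fun n : ℕ => (cb n : ℂ) * x ^ n) = fun n => (FormalMultilinearSeries.ofScalars ℂ
      fun n ↦ Ring.choose ((1 / 2 : ℂ) + n - 1) n) n fun _ => x := by
    ext n
    rw [FormalMultilinearSeries.ofScalars_apply_eq, choose_half, smul_eq_mul]
  rw [e]
  exact h

theorem hasSum_of_eq {ι : Type*} {f g : ι → ℂ} {a : ℂ} (h : HasSum f a) (e : ∀ i, f i = g i) :
    HasSum g a := by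
  rwa [← funext e]

theorem circ_ne_zero (θ : ℝ) : circ θ ≠ 0 := Complex.exp_ne_zero _

theorem norm_circ (θ : ℝ) : ‖circ θ‖ = 1 := by rw [circ, Complex.norm_exp_ofReal_mul_I]

theorem conj_circ (θ : ℝ) : conj (circ θ) = (circ θ)⁻¹ := by
  rw [circ, ← Complex.exp_conj, ← Complex.exp_neg]
  simp

theorem circ_two_pi_sub (θ : ℝ) : circ (2 * Real.pi - θ) = (circ θ)⁻¹ := by
  rw [circ, circ, ← Complex.exp_neg]
  push_cast
  rw [sub_mul, Complex.exp_sub, Complex.exp_two_pi_mul_I, Complex.exp_neg, one_div]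

theorem integral_sqrtNeg_mul_zpow (m : ℤ) :
    ∫ θ in (0 : ℝ)..(2 * Real.pi), sqrtNeg (circ θ) * circ θ ^ m = 4 / (2 * m + 1) := by
  have h := sqrtNeg_fourier (-m)
  have hpi : (Real.pi : ℂ) ≠ 0 := by exact_mod_cast Real.pi_ne_zero
  have h1 : (2 * m + 1 : ℂ) ≠ 0 := by
    have : (2 * m + 1 : ℤ) ≠ 0 := by omega
    exact_mod_cast this
  have h2 : (2 * (-m : ℤ) - 1 : ℂ) = -(2 * m + 1) := by push_cast; ring
  rw [neg_neg, h2] at h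
  field_simp at h
  field_simp
  linear_combination h

/-- The substitution θ ↦ 2π - θ conjugates the point of the circle and reverses the frequency. -/
theorem integral_sqrtNeg_conj_mul_zpow (m : ℤ) :
    ∫ θ in (0 : ℝ)..(2 * Real.pi), sqrtNeg (conj (circ θ)) * circ θ ^ m = 4 / (1 - 2 * m) := by
  have h := integral_sqrtNeg_mul_zpow (-m)
  have h1 := intervalIntegral.integral_comp_sub_left (a := 0) (b := 2 * Real.pi)
    (fun θ => sqrtNeg (circ θ) * circ θ ^ (-m)) (2 * Real.pi)
  rw [sub_self, sub_zero, h] at h1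
  simp only [circ_two_pi_sub] at h1
  simp only [conj_circ]
  rw [show (1 - 2 * (m : ℂ)) = 2 * (-m : ℤ) + 1 by push_cast; ring, ← h1]
  congr 1
  ext θ
  simp

theorem measurable_sqrtNeg_circ : Measurable fun θ : ℝ => sqrtNeg (circ θ) := by
  unfold sqrtNeg circ
  fun_prop

theorem norm_sqrtNeg {z : ℂ} (hz : ‖z‖ = 1) : ‖sqrtNeg z‖ = 1 := by
  have h0 : -z ≠ 0 := by
    intro h; rw [neg_eq_zero.1 h] at hz; simp at hz
  have : (1 / 2 : ℂ) = ((1 / 2 : ℝ) : ℂ) := by push_cast; rfl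
  rw [sqrtNeg, this, Complex.norm_cpow_real, norm_neg, hz, Real.one_rpow]

theorem measurable_sqrtNeg_conj_circ : Measurable fun θ : ℝ => sqrtNeg (conj (circ θ)) := by
  have hm3 : Measurable circ := by unfold circ; fun_prop
  unfold sqrtNeg
  exact ((Complex.continuous_conj.measurable.comp hm3).neg).pow_const _

/-- The terms of the expansion of the integrand of `diskA`. -/
noncomputable def diskTerm (u v : ℂ) (p : ℕ × ℕ) (θ : ℝ) : ℂ :=
  (v * sqrtNeg (circ θ) - u * sqrtNeg (conj (circ θ))) *
    ((cb p.1 * (u ^ 2 * conj (circ θ)) ^ p.1) * (cb p.2 * (v ^ 2 * circ θ) ^ p.2))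

theorem measurable_diskTerm (u v : ℂ) (p : ℕ × ℕ) : Measurable (diskTerm u v p) := by
  have hm3 : Measurable circ := by unfold circ; fun_prop
  have hmc : Measurable fun θ : ℝ => conj (circ θ) := Complex.continuous_conj.measurable.comp hm3
  exact ((measurable_sqrtNeg_circ.const_mul _).sub (measurable_sqrtNeg_conj_circ.const_mul _)).mul
    ((((hmc.const_mul _).pow_const _).const_mul _).mul
      (((hm3.const_mul _).pow_const _).const_mul _))

theorem norm_diskTerm_le {u v : ℂ} (hu : ‖u‖ < 1) (hv : ‖v‖ < 1) (p : ℕ × ℕ) (θ : ℝ) :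
    ‖diskTerm u v p θ‖ ≤ 2 * ((‖u‖ ^ 2) ^ p.1 * (‖v‖ ^ 2) ^ p.2) := by
  have h1 : ‖v * sqrtNeg (circ θ) - u * sqrtNeg (conj (circ θ))‖ ≤ 2 := by
    refine (norm_sub_le _ _).trans ?_
    rw [norm_mul, norm_mul, norm_sqrtNeg (norm_circ θ),
      norm_sqrtNeg (by rw [RCLike.norm_conj, norm_circ])]
    linarith
  have h2 : ∀ n, ‖(cb n : ℂ)‖ ≤ 1 := fun n => by
    rw [Complex.norm_real, Real.norm_of_nonneg (cb_pos n).le]; exact cb_le_one n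
  have e1 : ‖(u ^ 2 * conj (circ θ)) ^ p.1‖ = (‖u‖ ^ 2) ^ p.1 := by
    rw [norm_pow, norm_mul, norm_pow, RCLike.norm_conj, norm_circ, mul_one]
  have e2 : ‖(v ^ 2 * circ θ) ^ p.2‖ = (‖v‖ ^ 2) ^ p.2 := by
    rw [norm_pow, norm_mul, norm_pow, norm_circ, mul_one]
  rw [diskTerm, norm_mul, norm_mul, norm_mul, norm_mul, e1, e2]
  calc _ ≤ 2 * ((1 * (‖u‖ ^ 2) ^ p.1) * (1 * (‖v‖ ^ 2) ^ p.2)) := by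
        gcongr
        exacts [h2 _, h2 _]
    _ = _ := by ring

theorem hasSum_prod_mul {f g : ℕ → ℂ} {a b : ℂ} (hf : HasSum f a) (hg : HasSum g b) :
    HasSum (fun p : ℕ × ℕ => f p.1 * g p.2) (a * b) := by
  have h : Summable fun p : ℕ × ℕ => f p.1 * g p.2 :=
    summable_mul_of_summable_norm hf.summable.norm hg.summable.norm
  exact hf.mul hg h

theorem hasSum_cb_mul_cb {x y : ℂ} (hx : ‖x‖ < 1) (hy : ‖y‖ < 1) :
    HasSum (fun p : ℕ × ℕ => ((cb p.1 : ℂ) * x ^ p.1) * ((cb p.2 : ℂ) * y ^ p.2))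
      (1 / (1 - x) ^ (1 / 2 : ℂ) * (1 / (1 - y) ^ (1 / 2 : ℂ))) := by
  have h := hasSum_prod_mul (f := fun n => (cb n : ℂ) * x ^ n) (g := fun n => (cb n : ℂ) * y ^ n)
    (hasSum_cb hx) (hasSum_cb hy)
  exact h

theorem hasSum_diskTerm {u v : ℂ} (hu : ‖u‖ ^ 2 < 1) (hv : ‖v‖ ^ 2 < 1) (θ : ℝ) :
    HasSum (fun p => diskTerm u v p θ) ((v * sqrtNeg (circ θ) - u * sqrtNeg (conj (circ θ))) /
      ((1 - u ^ 2 * conj (circ θ)) ^ (1 / 2 : ℂ) * (1 - v ^ 2 * circ θ) ^ (1 / 2 : ℂ))) := by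
  have b1 : ‖u ^ 2 * conj (circ θ)‖ < 1 := by
    rwa [norm_mul, norm_pow, RCLike.norm_conj, norm_circ, mul_one]
  have b2 : ‖v ^ 2 * circ θ‖ < 1 := by rwa [norm_mul, norm_pow, norm_circ, mul_one]
  rw [div_eq_mul_one_div, ← one_div_mul_one_div]
  exact (hasSum_cb_mul_cb b1 b2).mul_left _

theorem integral_diskTerm (u v : ℂ) (p : ℕ × ℕ) :
    ∫ θ in (0 : ℝ)..(2 * Real.pi), diskTerm u v p θ =
      (cb p.1 * cb p.2 : ℂ) * u ^ (2 * p.1) * v ^ (2 * p.2) *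
      (v * (4 / (2 * p.2 - 2 * p.1 + 1)) - u * (4 / (2 * p.1 - 2 * p.2 + 1))) := by
  have hm1 := measurable_sqrtNeg_circ
  have hm2 := measurable_sqrtNeg_conj_circ
  have hm3 : Measurable circ := by unfold circ; fun_prop
  have hsplit : ∀ θ, diskTerm u v p θ = ((cb p.1 * cb p.2 : ℂ) * u ^ (2 * p.1) * v ^ (2 * p.2)) *
      (v * (sqrtNeg (circ θ) * circ θ ^ ((p.2 : ℤ) - p.1))
        - u * (sqrtNeg (conj (circ θ)) * circ θ ^ ((p.2 : ℤ) - p.1))) := by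
    intro θ
    have h0 := circ_ne_zero θ
    rw [diskTerm, zpow_sub₀ h0, zpow_natCast, zpow_natCast, mul_pow, mul_pow, ← pow_mul, ← pow_mul]
    have : conj (circ θ) ^ p.1 = (circ θ ^ p.1)⁻¹ := by rw [conj_circ, inv_pow]
    rw [this]
    field_simp
  have hint : ∀ f : ℝ → ℂ, Measurable f → (∀ θ, ‖f θ‖ ≤ 1) →
      IntervalIntegrable f volume 0 (2 * Real.pi) := by
    intro f hf hf1
    refine (intervalIntegrable_const (c := (1 : ℝ))).mono_fun hf.aestronglyMeasurable ?_
    exact Eventually.of_forall fun θ => by simpa using hf1 θ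
  have i1 : IntervalIntegrable (fun θ => v * (sqrtNeg (circ θ) * circ θ ^ ((p.2 : ℤ) - p.1)))
      volume 0 (2 * Real.pi) := by
    refine (hint _ (hm1.mul (hm3.pow_const _)) fun θ => ?_).const_mul _
    rw [Pi.mul_apply, norm_mul, norm_zpow, norm_sqrtNeg (norm_circ θ), norm_circ, one_zpow, one_mul]
  have i2 : IntervalIntegrable (fun θ => u * (sqrtNeg (conj (circ θ)) * circ θ ^ ((p.2 : ℤ) - p.1)))
      volume 0 (2 * Real.pi) := by
    refine (hint _ (hm2.mul (hm3.pow_const _)) fun θ => ?_).const_mul _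
    rw [Pi.mul_apply, norm_mul, norm_zpow, norm_sqrtNeg (by rw [RCLike.norm_conj, norm_circ]), norm_circ,
      one_zpow, one_mul]
  simp only [hsplit]
  rw [intervalIntegral.integral_const_mul, intervalIntegral.integral_sub i1 i2,
    intervalIntegral.integral_const_mul, intervalIntegral.integral_const_mul,
    integral_sqrtNeg_mul_zpow, integral_sqrtNeg_conj_mul_zpow]
  have e1 : (2 * ((p.2 : ℤ) - p.1 : ℤ) + 1 : ℂ) = 2 * p.2 - 2 * p.1 + 1 := by push_cast; ring
  have e2 : (1 - 2 * ((p.2 : ℤ) - p.1 : ℤ) : ℂ) = 2 * p.1 - 2 * p.2 + 1 := by push_cast; ring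
  rw [e1, e2]

/-- Both inverse square roots are expanded into their binomial series and integrated termwise. The
square roots of -τ have modulus 1, so the terms are dominated by a double geometric series in ‖u‖²
and ‖v‖². -/
theorem hasSum_diskA_pair {u v : ℂ} (hu : ‖u‖ < 1) (hv : ‖v‖ < 1) :
    HasSum (fun p : ℕ × ℕ => (cb p.1 * cb p.2 : ℂ) * u ^ (2 * p.1) * v ^ (2 * p.2) *
      (v / (2 * p.2 - 2 * p.1 + 1) - u / (2 * p.1 - 2 * p.2 + 1)) / Real.pi) (diskA u v) := by
  have hu2 : ‖u‖ ^ 2 < 1 := by nlinarith [norm_nonneg u]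
  have hv2 : ‖v‖ ^ 2 < 1 := by nlinarith [norm_nonneg v]
  have hpi : (Real.pi : ℂ) ≠ 0 := by exact_mod_cast Real.pi_ne_zero
  have hsum : Summable fun p : ℕ × ℕ => 2 * ((‖u‖ ^ 2) ^ p.1 * (‖v‖ ^ 2) ^ p.2) :=
    ((summable_geometric_of_lt_one (by positivity) hu2).mul_of_nonneg
      (summable_geometric_of_lt_one (by positivity) hv2) (fun _ => by positivity)
      (fun _ => by positivity)).mul_left 2
  have key := intervalIntegral.hasSum_integral_of_dominated_convergence (a := 0)
    (b := 2 * Real.pi) (μ := volume) (F := diskTerm u v)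
    (fun p _ => 2 * ((‖u‖ ^ 2) ^ p.1 * (‖v‖ ^ 2) ^ p.2))
    (fun p => (measurable_diskTerm u v p).aestronglyMeasurable)
    (fun p => Eventually.of_forall fun θ _ => norm_diskTerm_le hu hv p θ)
    (Eventually.of_forall fun θ _ => hsum)
    intervalIntegrable_const
    (Eventually.of_forall fun θ _ => hasSum_diskTerm hu2 hv2 θ)
  have h2 := key.mul_left (1 / (4 * Real.pi : ℂ))
  rw [← diskA] at h2
  refine hasSum_of_eq h2 fun p => ?_
  rw [integral_diskTerm]
  have h1 : (2 * (p.2 : ℂ) - 2 * p.1 + 1) ≠ 0 := by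
    have : (2 * p.2 - 2 * p.1 + 1 : ℤ) ≠ 0 := by omega
    exact_mod_cast this
  have h2 : (2 * (p.1 : ℂ) - 2 * p.2 + 1) ≠ 0 := by
    have : (2 * p.1 - 2 * p.2 + 1 : ℤ) ≠ 0 := by omega
    exact_mod_cast this
  field_simp

/-- The summand with v carries the monomials of bidegree (even, odd), that with u those of bidegree
(odd, even). Splitting the double series by the parity of the first index matches the two. -/
theorem diskA_eq_dps {u v : ℂ} (hu : ‖u‖ < 1) (hv : ‖v‖ < 1) : diskA u v = dps diskCoeff u v := by
  have hS : Summable fun p : ℕ × ℕ => ‖diskCoeff p * u ^ p.1 * v ^ p.2‖ :=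
    (summable_majorant 1 1 ((norm_nonneg u).trans (le_max_left _ ‖v‖)) (max_lt hu hv)).of_nonneg_of_le
      (fun _ => norm_nonneg _) (norm_term_le norm_diskCoeff_le (le_max_left _ _) (le_max_right _ _))
  set f : ℕ × ℕ → ℂ := fun p => diskCoeff p * u ^ p.1 * v ^ p.2 with hf
  set g : ℕ × ℕ → ℕ × ℕ := fun p => (2 * p.1, 2 * p.2 + 1) with hg
  set g' : ℕ × ℕ → ℕ × ℕ := fun p => (2 * p.1 + 1, 2 * p.2) with hg'
  have hgi : g.Injective := by
    rintro ⟨a, b⟩ ⟨c, d⟩ h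
    simp only [hg, Prod.mk.injEq] at h
    ext <;> simp <;> omega
  have hgi' : g'.Injective := by
    rintro ⟨a, b⟩ ⟨c, d⟩ h
    simp only [hg', Prod.mk.injEq] at h
    ext <;> simp <;> omega
  have hsplit : f = fun p => (if Even p.1 then f p else 0) + (if Odd p.1 then f p else 0) := by
    ext p
    rcases Nat.even_or_odd p.1 with h | h
    · simp [h, Nat.not_odd_iff_even.2 h]
    · simp [h, Nat.not_even_iff_odd.2 h]
  have hz : ∀ p : ℕ × ℕ, Even (p.1 + p.2) → f p = 0 := by
    intro p hp
    simp [hf, diskCoeff, Nat.not_odd_iff_even.2 hp]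
  have s1 : Summable (f ∘ g) := hS.of_norm.comp_injective hgi
  have s2 : Summable (f ∘ g') := hS.of_norm.comp_injective hgi'
  have t1 : HasSum (fun p => if Even p.1 then f p else 0) (∑' p, (f ∘ g) p) := by
    refine (hgi.hasSum_iff ?_).1 ?_
    · rintro ⟨m, n⟩ h
      split_ifs with he
      · refine hz _ ?_
        by_contra hodd
        obtain ⟨j, rfl⟩ := he
        have : Odd n := by
          by_contra h'
          exact hodd (by simp [parity_simps, Nat.not_odd_iff_even.1 h'])
        obtain ⟨k, rfl⟩ := this
        exact h ⟨(j, k), by simp [hg, two_mul]⟩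
      · rfl
    · convert s1.hasSum using 1
      ext p
      simp [hg]
  have t2 : HasSum (fun p => if Odd p.1 then f p else 0) (∑' p, (f ∘ g') p) := by
    refine (hgi'.hasSum_iff ?_).1 ?_
    · rintro ⟨m, n⟩ h
      split_ifs with he
      · refine hz _ ?_
        by_contra hodd
        obtain ⟨j, rfl⟩ := he
        have : Even n := by
          by_contra h'
          exact hodd (by simp [parity_simps, Nat.not_even_iff_odd.1 h'])
        obtain ⟨k, rfl⟩ := this
        exact h ⟨(j, k), by simp [hg', two_mul]⟩
      · rfl
    · convert s2.hasSum using 1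
      ext p
      simp [hg']
  have h1 := t1.add t2
  rw [← hsplit] at h1
  rw [dps, h1.tsum_eq, ← s1.tsum_add s2]
  rw [← (hasSum_diskA_pair hu hv).tsum_eq]
  refine tsum_congr fun p => ?_
  simp only [hf, hg, hg', Function.comp, diskCoeff, half_even, half_odd]
  rw [if_pos (by simp [parity_simps]), if_pos (by simp [parity_simps])]
  have h1 : (2 * (p.2 : ℂ) - 2 * p.1 + 1) ≠ 0 := by
    have : (2 * p.2 - 2 * p.1 + 1 : ℤ) ≠ 0 := by omega
    exact_mod_cast this
  have h2 : (2 * (p.1 : ℂ) - 2 * p.2 + 1) ≠ 0 := by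
    have : (2 * p.1 - 2 * p.2 + 1 : ℤ) ≠ 0 := by omega
    exact_mod_cast this
  have h3 : (2 * (p.2 : ℂ) + 1 - 2 * p.1) ≠ 0 := by
    intro h; apply h1; rw [← h]; ring
  have h4 : (2 * (p.2 : ℂ) - (2 * p.1 + 1)) ≠ 0 := by
    intro h; apply h2; linear_combination -h
  have hpi : (Real.pi : ℂ) ≠ 0 := by exact_mod_cast Real.pi_ne_zero
  have e3 : (2 * (p.2 : ℂ) - 2 * p.1 + 1) = 2 * p.2 + 1 - 2 * p.1 := by ring
  have e4 : (2 * (p.1 : ℂ) - 2 * p.2 + 1) = -(2 * p.2 - (2 * p.1 + 1)) := by ring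
  rw [e3, e4]
  push_cast
  rw [pow_succ, pow_succ]
  field_simp
  ring

/-! ### Convergence of the kernels -/

theorem tendsto_kernel {s : ℕ → ℝ≥0∞} (hs : ∀ N : ℕ, (N : ℝ≥0∞) < s N) :
    TendstoLocallyUniformlyOn (fun (N : ℕ) (p : ℂ × ℂ) => kernel N (s N) p.1 p.2)
      (fun p : ℂ × ℂ => kernelOf diskA p.1 p.2) atTop
      (Metric.ball (0 : ℂ) 1 ×ˢ Metric.ball (0 : ℂ) 1) := by
  have h0 : ∀ N, 0 ≤ tinv (s N) := fun N => tinv_nonneg _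
  have h1 : ∀ N : ℕ, N * tinv (s N) < 1 := fun N => mul_tinv_lt_one (hs N)
  exact tendstoLocallyUniformlyOn_of_kernelSeries (K := 1) (q := 1)
    (c := fun N => kernelCoeff N (tinv (s N))) (d := diskCoeff)
    (Eventually.of_forall fun N => norm_kernelCoeff_le (h0 N) (h1 N))
    (tendsto_kernelCoeff (tendsto_zero_of_mul_lt_one h0 h1))
    (fun N u v hu hv => kernel_eq_kernelSeries (hs N) hu hv)
    (fun u v hu hv => kernelOf_eq_kernelSeries norm_diskCoeff_le diskCoeff_swap
      (fun u v hu hv => diskA_eq_dps hu hv) hu hv)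

/-! ### A closed form of the limiting kernel -/

/-- The function `(1 - u ^ 2) ^ (-1/2)` on the unit disk. -/
noncomputable def invSqrt (u : ℂ) : ℂ := 1 / (1 - u ^ 2) ^ (1 / 2 : ℂ)

theorem norm_sq_lt_one {u : ℂ} (hu : ‖u‖ < 1) : ‖u ^ 2‖ < 1 := by
  rw [norm_pow]; nlinarith [norm_nonneg u]

theorem one_sub_sq_mem_slitPlane {u : ℂ} (hu : ‖u‖ < 1) : 1 - u ^ 2 ∈ Complex.slitPlane := by
  refine Or.inl ?_
  have h := (Complex.abs_re_le_norm (u ^ 2)).trans_lt (norm_sq_lt_one hu)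
  simp only [Complex.sub_re, Complex.one_re]
  linarith [(abs_lt.1 h).2]

theorem one_sub_sq_ne_zero {u : ℂ} (hu : ‖u‖ < 1) : 1 - u ^ 2 ≠ 0 :=
  Complex.slitPlane_ne_zero (one_sub_sq_mem_slitPlane hu)

theorem invSqrt_ne_zero {u : ℂ} (hu : ‖u‖ < 1) : invSqrt u ≠ 0 := by
  unfold invSqrt
  refine one_div_ne_zero ?_
  rw [Complex.cpow_def_of_ne_zero (one_sub_sq_ne_zero hu)]
  exact Complex.exp_ne_zero _

theorem invSqrt_eq (u : ℂ) : invSqrt u = (1 - u ^ 2) ^ (-(1 / 2) : ℂ) := by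
  rw [invSqrt, Complex.cpow_neg, one_div]

theorem hasDerivAt_invSqrt {u : ℂ} (hu : ‖u‖ < 1) :
    HasDerivAt invSqrt (u * invSqrt u / (1 - u ^ 2)) u := by
  have h0 := one_sub_sq_ne_zero hu
  have h1 : HasDerivAt (fun u : ℂ => 1 - u ^ 2) (-(2 * u)) u := by
    simpa using (hasDerivAt_pow 2 u).const_sub 1
  have h2 := h1.cpow_const (c := (1 / 2 : ℂ)) (one_sub_sq_mem_slitPlane hu)
  have h3 : (1 - u ^ 2) ^ (1 / 2 : ℂ) ≠ 0 := by
    rw [Complex.cpow_def_of_ne_zero h0]; exact Complex.exp_ne_zero _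
  have h4 := h2.inv h3
  have e : invSqrt = fun u => ((1 - u ^ 2) ^ (1 / 2 : ℂ))⁻¹ := by ext u; rw [invSqrt, one_div]
  rw [e]
  refine h4.congr_deriv ?_
  rw [Complex.cpow_sub _ _ h0, Complex.cpow_one]
  field_simp

/-- The series of (1-x)^(1/2), kept as a product so that `invSqrt` is the only root in use. The
coefficient is cb(n) - cb(n-1) = -cb(n)/(2n-1). -/
theorem hasSum_cb_mul_one_sub {x : ℂ} (hx : ‖x‖ < 1) :
    HasSum (fun n : ℕ => (-cb n / (2 * n - 1) : ℂ) * x ^ n)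
      ((1 - x) * (1 / (1 - x) ^ (1 / 2 : ℂ))) := by
  have h := hasSum_cb hx
  have h2 : HasSum (fun n : ℕ => if n = 0 then 0 else (cb (n - 1) : ℂ) * x ^ n)
      (x * (1 / (1 - x) ^ (1 / 2 : ℂ))) := by
    refine (Nat.succ_injective.hasSum_iff ?_).1 ?_
    · intro n hn
      rcases n with _ | n
      · simp
      · exact absurd ⟨n, rfl⟩ hn
    · refine hasSum_of_eq (h.mul_left x) fun n => ?_
      simp [pow_succ]
      ring
  rw [sub_mul, one_mul]
  refine hasSum_of_eq (h.sub h2) fun n => ?_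
  rcases n with _ | n
  · simp [cb_zero]
  · have h1 : (2 * n + 2 : ℂ) * cb (n + 1) = (2 * n + 1) * cb n := by exact_mod_cast cb_succ n
    have h2 : (2 * (n : ℂ) + 1) ≠ 0 := by
      have : ((2 * n + 1 : ℕ) : ℂ) ≠ 0 := by exact_mod_cast Nat.succ_ne_zero (2 * n)
      push_cast at this
      exact this
    have h3 : (2 * ((n + 1 : ℕ) : ℂ) - 1) = 2 * n + 1 := by push_cast; ring
    rw [if_neg (Nat.succ_ne_zero n), h3, Nat.add_sub_cancel]
    field_simp
    linear_combination x ^ (n + 1) * h1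

theorem mul_dps (e : ℕ × ℕ → ℂ) (u v : ℂ) :
    u * v * dps e u v
      = dps (fun p => if p.1 = 0 ∨ p.2 = 0 then 0 else e (p.1 - 1, p.2 - 1)) u v := by
  have hi : (fun p : ℕ × ℕ => (p.1 + 1, p.2 + 1)).Injective := by
    rintro ⟨a, b⟩ ⟨c, d⟩ h
    simpa using h
  rw [dps, dps, ← tsum_mul_left, ← hi.tsum_eq (f := fun p : ℕ × ℕ =>
    (if p.1 = 0 ∨ p.2 = 0 then 0 else e (p.1 - 1, p.2 - 1)) * u ^ p.1 * v ^ p.2)]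
  · refine tsum_congr fun p => ?_
    simp [pow_succ]
    ring
  · rintro ⟨m, n⟩ h
    rcases m with _ | m
    · simp at h
    rcases n with _ | n
    · simp at h
    exact ⟨(m, n), rfl⟩

/-- Multiplication of the v-derivative by 1 - uv removes the Cauchy denominator: the coefficients of
bidegree (2j, 2k) become products of one-variable coefficients. -/
theorem shiftR_diskCoeff_sub (j k : ℕ) :
    shiftR diskCoeff (2 * j, 2 * k)
      - (if 2 * j = 0 ∨ 2 * k = 0 then 0 else shiftR diskCoeff (2 * j - 1, 2 * k - 1))
      = 1 / Real.pi * ((-cb j / (2 * j - 1)) * cb k) := by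
  have hpi : (Real.pi : ℂ) ≠ 0 := by exact_mod_cast Real.pi_ne_zero
  have h1 : ∀ n m : ℕ, (2 * (n : ℂ) + 1 - 2 * m) ≠ 0 := fun n m => by
    have : (2 * n + 1 - 2 * m : ℤ) ≠ 0 := by omega
    exact_mod_cast this
  have h2 : (2 * (j : ℂ) - 1) ≠ 0 := by
    have : (2 * j - 1 : ℤ) ≠ 0 := by omega
    exact_mod_cast this
  have e0 : shiftR diskCoeff (2 * j, 2 * k)
      = 1 / Real.pi * ((2 * k + 1) * cb j * cb k / (2 * k + 1 - 2 * j)) := by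
    rw [shiftR, diskCoeff, if_pos (by simp [parity_simps]), half_even, half_odd]
    push_cast
    have := h1 k j
    field_simp
  rw [e0]
  rcases j with _ | j
  · simp [cb_zero]
    have := h1 k 0
    simp at this
    field_simp
  rcases k with _ | k
  · simp
    have := h1 0 (j + 1)
    push_cast at this h2
    simp only [mul_zero, zero_add] at this
    rw [show (1 - 2 * ((j : ℂ) + 1)) = -(2 * (j + 1) - 1) by ring]
    field_simp
  rw [if_neg (by omega), show (2 * (j + 1) - 1, 2 * (k + 1) - 1) = (2 * j + 1, 2 * k + 1) from rfl,
    shiftR, diskCoeff, if_pos (by simp [parity_simps])]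
  simp only [half_odd, show 2 * k + 1 + 1 = 2 * (k + 1) by ring, half_even]
  have a1 : (2 * k + 2 : ℂ) * cb (k + 1) = (2 * k + 1) * cb k := by exact_mod_cast cb_succ k
  have a2 : (2 * j + 2 : ℂ) * cb (j + 1) = (2 * j + 1) * cb j := by exact_mod_cast cb_succ j
  have n1 := h1 (k + 1) (j + 1)
  have n2 : (2 * (j : ℂ) + 1) ≠ 0 := by
    have : ((2 * j + 1 : ℕ) : ℂ) ≠ 0 := by exact_mod_cast Nat.succ_ne_zero (2 * j)
    push_cast at this
    exact this
  have n3 : (2 * ((k : ℂ) + 1) - (2 * j + 1)) ≠ 0 := by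
    have := h1 k j
    intro h; apply this; linear_combination h
  push_cast at n1 n3 ⊢
  rw [show (2 * ((j : ℂ) + 1) - 1) = 2 * j + 1 by ring,
    show (2 * ((k : ℂ) + 1) - (2 * j + 1)) = 2 * ((k : ℂ) + 1) + 1 - 2 * (j + 1) by ring]
  field_simp
  linear_combination (2 * (k : ℂ) + 2) * cb (k + 1) * a2

/-- After multiplication by 1 - uv only bidegrees (even, even) survive, and there the double series
factors into those of (1-u²)^(1/2) and (1-v²)^(-1/2). -/
theorem derivRight_diskA {u v : ℂ} (hu : ‖u‖ < 1) (hv : ‖v‖ < 1) :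
    derivRight diskA u v
      = 1 / Real.pi * ((1 - u ^ 2) * invSqrt u * invSqrt v / (1 - u * v)) := by
  have hc := norm_shiftR_le norm_diskCoeff_le
  have huv : 1 - u * v ≠ 0 := by
    intro h
    have h1 : ‖u * v‖ = 1 := by rw [← sub_eq_zero.1 h, norm_one]
    rw [norm_mul] at h1
    nlinarith [norm_nonneg u, norm_nonneg v]
  have key : (1 - u * v) * dps (shiftR diskCoeff) u v
      = 1 / Real.pi * ((1 - u ^ 2) * invSqrt u * invSqrt v) := by
    have hs := summable_dps hc hu hv
    have hs' : Summable fun p : ℕ × ℕ => (if p.1 = 0 ∨ p.2 = 0 then 0 else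
        shiftR diskCoeff (p.1 - 1, p.2 - 1)) * u ^ p.1 * v ^ p.2 := by
      have hi : (fun p : ℕ × ℕ => (p.1 + 1, p.2 + 1)).Injective := by
        rintro ⟨a, b⟩ ⟨c, d⟩ h
        simpa using h
      refine (hi.summable_iff ?_).1 ?_
      · rintro ⟨m, n⟩ h
        rcases m with _ | m
        · simp
        rcases n with _ | n
        · simp
        exact absurd ⟨(m, n), rfl⟩ h
      · refine (hs.mul_left (u * v)).congr fun p => ?_
        simp [pow_succ]
        ring
    rw [sub_mul, one_mul, mul_dps, dps, dps, ← hs.tsum_sub hs']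
    have hg : (fun p : ℕ × ℕ => (2 * p.1, 2 * p.2)).Injective := by
      rintro ⟨a, b⟩ ⟨c, d⟩ h
      simp only [Prod.mk.injEq] at h
      ext <;> simp <;> omega
    rw [← hg.tsum_eq]
    · have hprod := hasSum_prod_mul (f := fun n => (-cb n / (2 * n - 1) : ℂ) * (u ^ 2) ^ n)
        (g := fun n => (cb n : ℂ) * (v ^ 2) ^ n) (hasSum_cb_mul_one_sub (norm_sq_lt_one hu))
        (hasSum_cb (norm_sq_lt_one hv))
      rw [invSqrt, invSqrt, ← (hprod.mul_left (1 / Real.pi : ℂ)).tsum_eq]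
      refine tsum_congr fun p => ?_
      rw [← sub_mul, ← sub_mul, shiftR_diskCoeff_sub, pow_mul, pow_mul]
      ring
    · rintro ⟨m, n⟩ h
      by_contra hr
      apply h
      rcases Nat.even_or_odd' m with ⟨j, rfl | rfl⟩ <;> rcases Nat.even_or_odd' n with ⟨k, rfl | rfl⟩
      · exact absurd ⟨(j, k), rfl⟩ hr
      · rcases j with _ | j
        · simp [shiftR, diskCoeff, parity_simps]
        · simp [shiftR, diskCoeff, parity_simps, show 2 * (j + 1) - 1 = 2 * j + 1 by omega]
      · rcases k with _ | k
        · simp [shiftR, diskCoeff, parity_simps]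
        · simp [shiftR, diskCoeff, parity_simps, show 2 * (k + 1) - 1 = 2 * k + 1 by omega]
      · have a1 : (2 * k + 2 : ℂ) * cb (k + 1) = (2 * k + 1) * cb k := by exact_mod_cast cb_succ k
        have n3 : (2 * (k : ℂ) + 1 - 2 * j) ≠ 0 := by
          have : (2 * k + 1 - 2 * j : ℤ) ≠ 0 := by omega
          exact_mod_cast this
        have n4 : (2 * (k : ℂ) + 1 + 1 - (2 * j + 1)) ≠ 0 := by
          intro h; apply n3; linear_combination h
        have hpi : (Real.pi : ℂ) ≠ 0 := by exact_mod_cast Real.pi_ne_zero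
        -- The coefficients of bidegree (odd, odd) repeat those one step down the diagonal and
        -- therefore cancel.
        have : shiftR diskCoeff (2 * j + 1, 2 * k + 1) = shiftR diskCoeff (2 * j, 2 * k) := by
          rw [shiftR, shiftR, diskCoeff, diskCoeff, if_pos (by simp [parity_simps]),
            if_pos (by simp [parity_simps])]
          simp only [half_odd, show 2 * k + 1 + 1 = 2 * (k + 1) by ring, half_even]
          push_cast
          rw [show (2 * ((k : ℂ) + 1) - (2 * j + 1)) = 2 * k + 1 - 2 * j by ring]
          field_simp
          linear_combination (cb j : ℂ) * a1
        simp [this]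
  rw [derivRight_eq_dps norm_diskCoeff_le (fun u v hu hv => diskA_eq_dps hu hv) hu hv]
  field_simp at key ⊢
  linear_combination key

theorem derivBoth_diskA {u v : ℂ} (hu : ‖u‖ < 1) (hv : ‖v‖ < 1) :
    derivBoth diskA u v
      = 1 / Real.pi * (invSqrt u * invSqrt v * (v - u) / (1 - u * v) ^ 2) := by
  have huv : 1 - u * v ≠ 0 := by
    intro h
    have h1 : ‖u * v‖ = 1 := by rw [← sub_eq_zero.1 h, norm_one]
    rw [norm_mul] at h1
    nlinarith [norm_nonneg u, norm_nonneg v]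
  have h0 := one_sub_sq_ne_zero hu
  have hev : (fun a => derivRight diskA a v) =ᶠ[𝓝 u] fun a =>
      1 / Real.pi * ((1 - a ^ 2) * invSqrt a * invSqrt v / (1 - a * v)) := by
    filter_upwards [Metric.isOpen_ball.mem_nhds (show u ∈ Metric.ball (0 : ℂ) 1 by simpa using hu)]
      with a ha
    exact derivRight_diskA (by simpa using ha) hv
  rw [derivBoth, derivLeft, hev.deriv_eq]
  have h1 : HasDerivAt (fun u : ℂ => 1 - u ^ 2) (-(2 * u)) u := by
    simpa using (hasDerivAt_pow 2 u).const_sub 1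
  have h2 : HasDerivAt (fun u : ℂ => 1 - u * v) (-v) u := by
    simpa using ((hasDerivAt_id u).mul_const v).const_sub 1
  have h3 := ((((h1.mul (hasDerivAt_invSqrt hu)).mul_const (invSqrt v)).div h2 huv).const_mul
    (1 / Real.pi : ℂ))
  refine h3.deriv.trans ?_
  simp only [Pi.mul_apply]
  field_simp
  ring

/-- By the closed form and the symmetry of `invSqrt` under conjugation, the density at z is 2|Im z|
|invSqrt z|² / (π(1-|z|²)²). -/
theorem kernelOf_diskA_pos {z : ℂ} (hz : ‖z‖ < 1) (h : z.im ≠ 0) :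
    0 < (kernelOf diskA z z 0 1).re := by
  have hz' : ‖conj z‖ < 1 := by simpa using hz
  have e : kernelOf diskA z z 0 1 = iota z * derivBoth diskA z (conj z) := by
    rw [kernelOf, if_neg h, if_neg h]; simp
  have hn : z * conj z = (‖z‖ ^ 2 : ℝ) := by rw [Complex.mul_conj, Complex.normSq_eq_norm_sq]
  have hc : conj (-(1 / 2) : ℂ) = -(1 / 2) := by
    have := Complex.conj_ofReal (-(1 / 2))
    push_cast at this
    exact this
  have hq : invSqrt (conj z) = conj (invSqrt z) := by
    rw [invSqrt_eq, invSqrt_eq, show (1 - conj z ^ 2) = conj (1 - z ^ 2) by simp,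
      Complex.conj_cpow _ _ (Complex.slitPlane_arg_ne_pi (one_sub_sq_mem_slitPlane hz)), hc]
  have hd : conj z - z = -(2 * z.im * Complex.I) := by
    apply Complex.ext <;> simp; ring
  rw [e, derivBoth_diskA hz hz', hq, hn, hd, Complex.mul_conj (invSqrt z)]
  have hpos : (0 : ℝ) < 1 - ‖z‖ ^ 2 := by nlinarith [norm_nonneg z]
  have hp : 0 < Complex.normSq (invSqrt z) := Complex.normSq_pos.2 (invSqrt_ne_zero hz)
  have e2 : iota z * (1 / Real.pi * (Complex.normSq (invSqrt z) * -(2 * z.im * Complex.I) /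
      (1 - ((‖z‖ ^ 2 : ℝ) : ℂ)) ^ 2))
      = ((2 * (Real.sign z.im * z.im) * Complex.normSq (invSqrt z) / (Real.pi * (1 - ‖z‖ ^ 2) ^ 2)
        : ℝ) : ℂ) := by
    have hI : Complex.I * Complex.I = -1 := Complex.I_mul_I
    rw [iota]
    push_cast
    have a1 : (1 - (‖z‖ : ℂ) ^ 2) ≠ 0 := by
      have := hpos.ne'
      exact_mod_cast this
    have hpi : (Real.pi : ℂ) ≠ 0 := by exact_mod_cast Real.pi_ne_zero
    field_simp
    linear_combination (-(Real.sign z.im : ℂ) * z.im * Complex.normSq (invSqrt z)) * hI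
  rw [e2, Complex.ofReal_re]
  have hs : 0 < Real.sign z.im * z.im := by
    rcases lt_or_gt_of_ne h with h | h
    · rw [Real.sign_of_neg h]; linarith
    · rw [Real.sign_of_pos h]; linarith
  have := Real.pi_pos
  positivity

/-! ### The area formula -/

theorem integrable_of_hasSum {α : Type*} [MeasurableSpace α] {μ : Measure α} {F : ℕ → α → ℂ}
    {G : α → ℂ} (hF : ∀ n, Integrable (F n) μ) (hs : Summable fun n => ∫ y, ‖F n y‖ ∂μ)
    (hG : ∀ y, HasSum (fun n => F n y) (G y)) :
    Integrable G μ ∧ HasSum (fun n => ∫ y, F n y ∂μ) (∫ y, G y ∂μ) := by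
  have hGe : G = fun y => ∑' n, F n y := funext fun y => (hG y).tsum_eq.symm
  refine ⟨⟨?_, ?_⟩, ?_⟩
  · refine aestronglyMeasurable_of_tendsto_ae atTop
      (f := fun n y => ∑ i ∈ Finset.range n, F i y) (fun n => ?_)
      (Eventually.of_forall fun y => (hG y).tendsto_sum_nat)
    exact Finset.aestronglyMeasurable_fun_sum _ fun i _ => (hF i).aestronglyMeasurable
  · have h1 : ∀ y, ‖G y‖ₑ ≤ ∑' n, ‖F n y‖ₑ := fun y => by
      rw [← (hG y).tsum_eq]
      exact enorm_tsum_le_tsum_enorm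
    refine (lintegral_mono h1).trans_lt ?_
    rw [lintegral_tsum fun n => (hF n).aestronglyMeasurable.enorm]
    have h2 : ∀ n, ∫⁻ y, ‖F n y‖ₑ ∂μ = ENNReal.ofReal (∫ y, ‖F n y‖ ∂μ) := fun n => by
      rw [ofReal_integral_norm_eq_lintegral_enorm (hF n)]
    simp only [h2]
    rw [← ENNReal.ofReal_tsum_of_nonneg (fun n => integral_nonneg fun y => norm_nonneg _) hs]
    exact ENNReal.ofReal_lt_top
  · rw [hGe]
    exact hasSum_integral_of_summable_integral_norm hF hs

/-- The transfer of a function along an injective map. -/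
noncomputable def fibreSum {E : Type*} (f : E → E) (D : Set E) (φ : E → ℂ) (y : E) : ℂ :=
  ∑' x, (D ∩ f ⁻¹' {y}).indicator φ x

theorem fibreSum_apply {E : Type*} {f : E → E} {D : Set E} (hD : Set.InjOn f D) (φ : E → ℂ) {x : E}
    (hx : x ∈ D) : fibreSum f D φ (f x) = φ x := by
  rw [fibreSum, tsum_eq_single x]
  · exact Set.indicator_of_mem (show x ∈ D ∩ f ⁻¹' {f x} from ⟨hx, rfl⟩) φ
  · intro y hy
    exact Set.indicator_of_notMem (fun h => hy (hD h.1 hx h.2)) φ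

theorem fibreSum_eq_zero {E : Type*} {f : E → E} {D : Set E} (φ : E → ℂ) {y : E}
    (hy : y ∉ f '' D) : fibreSum f D φ y = 0 := by
  have : D ∩ f ⁻¹' {y} = ∅ := by
    ext x
    simp only [Set.mem_inter_iff, Set.mem_preimage, Set.mem_singleton_iff, Set.mem_empty_iff_false,
      iff_false, not_and]
    exact fun h1 h2 => hy ⟨x, h1, h2⟩
  simp [fibreSum, this]

section Area
variable {E : Type*} [NormedAddCommGroup E] [NormedSpace ℝ E] [FiniteDimensional ℝ E]
  [MeasurableSpace E] [BorelSpace E] (μ : Measure E) [μ.IsAddHaarMeasure]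

/-- Near a point with invertible derivative A the map is so close to A that it is injective;
countably many such pieces cover S and can be taken disjoint and measurable. -/
theorem exists_injOn_partition {f : E → E} {f' : E → E →L[ℝ] E} {S : Set E} (hS : MeasurableSet S)
    (hf : ∀ x ∈ S, HasFDerivWithinAt f (f' x) S x) (hdet : ∀ x ∈ S, (f' x).det ≠ 0) :
    ∃ t : ℕ → Set E, Pairwise (Function.onFun Disjoint t) ∧ (∀ n, MeasurableSet (t n)) ∧
      (⋃ n, t n) = S ∧ ∀ n, Set.InjOn f (t n) := by
  have hr : ∀ A : E →L[ℝ] E, ∃ r : NNReal, r ≠ 0 ∧ (A.det ≠ 0 → ∀ s : Set E,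
      ApproximatesLinearOn f A s r → Set.InjOn f s) := by
    intro A
    by_cases hA : A.det = 0
    -- A dummy radius: no derivative on S is singular.
    · exact ⟨1, one_ne_zero, fun h => absurd hA h⟩
    · set e := A.toContinuousLinearEquivOfDetNeZero hA with he
      rcases subsingleton_or_nontrivial E with hE | hE
      · exact ⟨1, one_ne_zero, fun _ s _ => Set.injOn_of_subsingleton f s⟩
      · have hpos : 0 < ‖(e.symm : E →L[ℝ] E)‖₊⁻¹ := by
          refine inv_pos.2 ?_
          exact e.nnnorm_symm_pos
        -- Any error below ‖A⁻¹‖⁻¹ forces injectivity; half of it gives the strict inequality.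
        refine ⟨‖(e.symm : E →L[ℝ] E)‖₊⁻¹ / 2, (half_pos hpos).ne', fun _ s hs => ?_⟩
        refine ApproximatesLinearOn.injOn (f' := e) (c := ‖(e.symm : E →L[ℝ] E)‖₊⁻¹ / 2) ?_
          (Or.inr (half_lt_self hpos))
        rw [he, ContinuousLinearMap.coe_toContinuousLinearEquivOfDetNeZero]
        exact hs
  choose r hr0 hr1 using hr
  rcases S.eq_empty_or_nonempty with rfl | hne
  · exact ⟨fun _ => ∅, fun _ _ _ => by simp [Function.onFun], fun _ => MeasurableSet.empty,
      by simp, fun _ => by simp⟩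
  obtain ⟨t, A, h1, h2, h3, h4, h5⟩ :=
    exists_partition_approximatesLinearOn_of_hasFDerivWithinAt f S f' hf r hr0
  refine ⟨fun n => S ∩ t n, fun i j hij => ?_, fun n => hS.inter (h2 n), ?_, fun n => ?_⟩
  · exact (h1 hij).mono Set.inter_subset_right Set.inter_subset_right
  · rw [← Set.inter_iUnion, Set.inter_eq_left.2 h3]
  · obtain ⟨y, hy, hAy⟩ := h5 hne n
    exact hr1 (A n) (by rw [hAy]; exact hdet y hy) _ (h4 n)

theorem integrable_fibreSum {f : E → E} {f' : E → E →L[ℝ] E} {D : Set E} (hD : MeasurableSet D)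
    (hf : ∀ x ∈ D, HasFDerivWithinAt f (f' x) D x) (hinj : Set.InjOn f D) {φ : E → ℂ}
    (hφ : IntegrableOn (fun x => |(f' x).det| • φ x) D μ) :
    Integrable (fibreSum f D φ) μ ∧
      ∫ y, fibreSum f D φ y ∂μ = ∫ x in D, |(f' x).det| • φ x ∂μ ∧
      ∫ y, ‖fibreSum f D φ y‖ ∂μ = ∫ x in D, ‖|(f' x).det| • φ x‖ ∂μ := by
  have hz : ∀ y, y ∉ f '' D → fibreSum f D φ y = 0 := fun y hy => fibreSum_eq_zero φ hy
  refine ⟨?_, ?_, ?_⟩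
  · refine IntegrableOn.integrable_of_forall_notMem_eq_zero (s := f '' D) ?_ hz
    rw [integrableOn_image_iff_integrableOn_abs_det_fderiv_smul μ hD hf hinj]
    refine hφ.congr_fun (fun x hx => ?_) hD
    rw [fibreSum_apply hinj φ hx]
  · rw [← setIntegral_eq_integral_of_forall_compl_eq_zero hz,
      integral_image_eq_integral_abs_det_fderiv_smul μ hD hf hinj]
    refine setIntegral_congr_fun hD fun x hx => ?_
    rw [fibreSum_apply hinj φ hx]
  · rw [← setIntegral_eq_integral_of_forall_compl_eq_zero (s := f '' D)
        (fun y hy => by rw [hz y hy, norm_zero]),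
      integral_image_eq_integral_abs_det_fderiv_smul μ hD hf hinj]
    refine setIntegral_congr_fun hD fun x hx => ?_
    rw [fibreSum_apply hinj φ hx, norm_smul, Real.norm_eq_abs, abs_abs, smul_eq_mul]

/-- The change of variables formula holds on each piece of injectivity. Over a point y the pieces
together contain each preimage exactly once, so adding the pieces gives the sum over the fibre; the
integrability of φ against the Jacobian justifies the exchange. -/
theorem area_formula {f : E → E} {f' : E → E →L[ℝ] E} {S : Set E} (hS : MeasurableSet S)
    (hf : ∀ x ∈ S, HasFDerivWithinAt f (f' x) S x) (hdet : ∀ x ∈ S, (f' x).det ≠ 0)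
    (hfin : ∀ y, (S ∩ f ⁻¹' {y}).Finite) {φ : E → ℂ}
    (hφ : IntegrableOn (fun x => |(f' x).det| • φ x) S μ) :
    Integrable (fun y => ∑ x ∈ (hfin y).toFinset, φ x) μ ∧
      ∫ y, ∑ x ∈ (hfin y).toFinset, φ x ∂μ = ∫ x in S, |(f' x).det| • φ x ∂μ := by
  obtain ⟨t, h1, h2, h3, h4⟩ := exists_injOn_partition hS hf hdet
  have hsub : ∀ n, t n ⊆ S := fun n => h3 ▸ Set.subset_iUnion t n
  have hft : ∀ n, ∀ x ∈ t n, HasFDerivWithinAt f (f' x) (t n) x := fun n x hx =>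
    (hf x (hsub n hx)).mono (hsub n)
  have key := fun n => integrable_fibreSum μ (h2 n) (hft n) (h4 n) (hφ.mono_set (hsub n))
  have hφ' : IntegrableOn (fun x => |(f' x).det| • φ x) (⋃ n, t n) μ := by rwa [h3]
  have hsum := hasSum_integral_iUnion h2 h1 hφ'
  have hsum' := hasSum_integral_iUnion h2 h1 hφ'.norm
  have hG : ∀ y, HasSum (fun n => fibreSum f (t n) φ y) (∑ x ∈ (hfin y).toFinset, φ x) := by
    intro y
    have e : ∀ n, fibreSum f (t n) φ y = ∑ x ∈ (hfin y).toFinset, (t n).indicator φ x := by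
      intro n
      rw [fibreSum, tsum_eq_sum (s := (hfin y).toFinset)]
      · refine Finset.sum_congr rfl fun x hx => ?_
        rw [Set.Finite.mem_toFinset] at hx
        by_cases hxt : x ∈ t n
        · rw [Set.indicator_of_mem hxt, Set.indicator_of_mem (show x ∈ t n ∩ f ⁻¹' {y} from
            ⟨hxt, hx.2⟩)]
        · rw [Set.indicator_of_notMem hxt, Set.indicator_of_notMem fun h => hxt h.1]
      · intro x hx
        refine Set.indicator_of_notMem (fun h => hx ?_) _
        rw [Set.Finite.mem_toFinset]
        exact ⟨hsub n h.1, h.2⟩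
    simp only [e]
    refine hasSum_sum fun x hx => ?_
    rw [Set.Finite.mem_toFinset] at hx
    obtain ⟨n, hn⟩ : ∃ n, x ∈ t n := by
      have := hx.1
      rw [← h3] at this
      exact Set.mem_iUnion.1 this
    have := hasSum_single (f := fun n => (t n).indicator φ x) n fun m hm =>
      Set.indicator_of_notMem (fun h => Set.disjoint_left.1 (h1 hm) h hn) φ
    rwa [Set.indicator_of_mem hn] at this
  have hs : Summable fun n => ∫ y, ‖fibreSum f (t n) φ y‖ ∂μ := by
    simp only [fun n => (key n).2.2]
    exact hsum'.summable
  obtain ⟨hI, hI2⟩ := integrable_of_hasSum (fun n => (key n).1) hs hG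
  refine ⟨hI, ?_⟩
  simp only [fun n => (key n).2.1] at hI2
  rw [h3] at hsum
  exact hI2.unique hsum

end Area

/-! ### Fibred maps -/

section Fibred
variable {Θ V : Type*} [NormedAddCommGroup Θ] [NormedSpace ℝ Θ] [FiniteDimensional ℝ Θ]
  [NormedAddCommGroup V] [NormedSpace ℝ V] [FiniteDimensional ℝ V]

/-- A shear S is invertible, and doubling the first coordinate conjugates S into S². Hence det S² =
det S, and det S = 1. -/
theorem det_shear (L : V →ₗ[ℝ] Θ) :
    LinearMap.det ((LinearMap.fst ℝ Θ V + L ∘ₗ LinearMap.snd ℝ Θ V).prod (LinearMap.snd ℝ Θ V))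
      = 1 := by
  set S := (LinearMap.fst ℝ Θ V + L ∘ₗ LinearMap.snd ℝ Θ V).prod (LinearMap.snd ℝ Θ V) with hS
  set T := (LinearMap.fst ℝ Θ V + (-L) ∘ₗ LinearMap.snd ℝ Θ V).prod (LinearMap.snd ℝ Θ V) with hT
  have h1 : S ∘ₗ T = LinearMap.id := by
    ext <;> simp [hS, hT]
  have h2 : LinearMap.det S ≠ 0 := by
    intro h
    have := congrArg LinearMap.det h1
    rw [LinearMap.det_comp, h, zero_mul, LinearMap.det_id] at this
    exact zero_ne_one this
  have h3 : LinearMap.det (S ∘ₗ S) = LinearMap.det S := by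
    let e : (Θ × V) ≃ₗ[ℝ] (Θ × V) :=
      LinearEquiv.prodCongr (LinearEquiv.smulOfNeZero ℝ Θ (2 : ℝ) two_ne_zero) (LinearEquiv.refl ℝ V)
    rw [← LinearMap.det_conj S e]
    congr 1
    refine LinearMap.ext fun p => ?_
    have he : e.symm p = ((2 : ℝ)⁻¹ • p.1, p.2) := by
      rw [LinearEquiv.symm_apply_eq]
      ext <;> simp [e, smul_smul]
    simp only [LinearMap.comp_apply, LinearEquiv.coe_coe, he]
    simp [hS, e, two_smul, smul_smul]
    abel
  rw [LinearMap.det_comp] at h3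
  exact mul_left_cancel₀ h2 (by rw [h3, mul_one])

theorem det_fibred {T : Θ × V →L[ℝ] Θ × V} {A : Θ →L[ℝ] Θ} (h1 : ∀ p, (T p).2 = p.2)
    (h2 : ∀ θ, (T (θ, 0)).1 = A θ) : T.det = A.det := by
  let L : V →ₗ[ℝ] Θ := LinearMap.fst ℝ Θ V ∘ₗ (T : Θ × V →ₗ[ℝ] Θ × V) ∘ₗ LinearMap.inr ℝ Θ V
  have e : (T : Θ × V →ₗ[ℝ] Θ × V) =
      ((LinearMap.fst ℝ Θ V + L ∘ₗ LinearMap.snd ℝ Θ V).prod (LinearMap.snd ℝ Θ V)) ∘ₗ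
        ((A : Θ →ₗ[ℝ] Θ).prodMap LinearMap.id) := by
    refine LinearMap.ext fun p => ?_
    have hp : p = (p.1, 0) + (0, p.2) := by simp
    refine Prod.ext ?_ ?_
    · conv_lhs => rw [hp]
      simp only [ContinuousLinearMap.coe_coe, map_add, Prod.fst_add, h2]
      simp [L]
    · simp [h1]
  rw [ContinuousLinearMap.det, e, LinearMap.det_comp, det_shear, one_mul, LinearMap.det_prodMap,
    LinearMap.det_id, mul_one]

/-- For a map that fixes the second coordinate the Jacobian is that of the partial map in the first
coordinate. Only this partial derivative then has to be computed for roots. -/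
theorem fibred_derivative {G : Θ × V → Θ} {p : Θ × V} {A : Θ →L[ℝ] Θ}
    (hG : DifferentiableAt ℝ G p) (hA : HasFDerivAt (fun θ => G (θ, p.2)) A p.1) :
    ∃ T : Θ × V →L[ℝ] Θ × V, HasFDerivAt (fun q : Θ × V => (G q, q.2)) T p ∧ T.det = A.det := by
  refine ⟨(fderiv ℝ G p).prod (ContinuousLinearMap.snd ℝ Θ V),
    hG.hasFDerivAt.prodMk hasFDerivAt_snd, det_fibred (fun _ => rfl) fun θ => ?_⟩
  have h1 : HasFDerivAt (fun θ : Θ => (θ, p.2)) (ContinuousLinearMap.inl ℝ Θ V) p.1 :=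
    hasFDerivAt_prodMk_left _ _
  have h2 := hG.hasFDerivAt.comp p.1 h1
  have h3 := hA.unique h2
  rw [h3]
  rfl

variable [MeasurableSpace Θ] [BorelSpace Θ] [MeasurableSpace V] [BorelSpace V]
  (μ : Measure (Θ × V)) [μ.IsAddHaarMeasure]

theorem fibred_area_formula {G : Θ × V → Θ} {A : Θ × V → Θ →L[ℝ] Θ} {S : Set (Θ × V)}
    (hS : MeasurableSet S) (hG : ∀ p ∈ S, DifferentiableAt ℝ G p)
    (hA : ∀ p ∈ S, HasFDerivAt (fun θ => G (θ, p.2)) (A p) p.1)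
    (hdet : ∀ p ∈ S, (A p).det ≠ 0)
    (hfin : ∀ y : Θ × V, (S ∩ (fun q : Θ × V => (G q, q.2)) ⁻¹' {y}).Finite) {φ : Θ × V → ℂ}
    (hφ : IntegrableOn (fun p => |(A p).det| • φ p) S μ) :
    Integrable (fun y => ∑ x ∈ (hfin y).toFinset, φ x) μ ∧
      ∫ y, ∑ x ∈ (hfin y).toFinset, φ x ∂μ = ∫ p in S, |(A p).det| • φ p ∂μ := by
  have h := fun p : S => fibred_derivative (hG p p.2) (hA p p.2)
  choose T hT1 hT2 using h
  classical
  let T' : Θ × V → Θ × V →L[ℝ] Θ × V := fun p => if hp : p ∈ S then T ⟨p, hp⟩ else 0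
  have hT' : ∀ p (hp : p ∈ S), T' p = T ⟨p, hp⟩ := fun p hp => dif_pos hp
  have hd : ∀ p ∈ S, (T' p).det = (A p).det := fun p hp => by rw [hT' p hp, hT2]
  obtain ⟨h1, h2⟩ := area_formula μ (f := fun q : Θ × V => (G q, q.2)) (f' := T') hS
    (fun p hp => by rw [hT' p hp]; exact (hT1 ⟨p, hp⟩).hasFDerivWithinAt)
    (fun p hp => by rw [hd p hp]; exact hdet p hp) hfin
    (hφ.congr_fun (fun p hp => by simp only; rw [hd p hp]) hS)
  refine ⟨h1, h2.trans (setIntegral_congr_fun hS fun p hp => ?_)⟩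
  rw [hd p hp]

theorem fibred_sard {G : Θ × V → Θ} {A : Θ × V → Θ →L[ℝ] Θ} {S : Set (Θ × V)}
    (hG : ∀ p ∈ S, DifferentiableAt ℝ G p)
    (hA : ∀ p ∈ S, HasFDerivAt (fun θ => G (θ, p.2)) (A p) p.1)
    (hdet : ∀ p ∈ S, (A p).det = 0) : μ ((fun q : Θ × V => (G q, q.2)) '' S) = 0 := by
  have h := fun p : S => fibred_derivative (hG p p.2) (hA p p.2)
  choose T hT1 hT2 using h
  classical
  let T' : Θ × V → Θ × V →L[ℝ] Θ × V := fun p => if hp : p ∈ S then T ⟨p, hp⟩ else 0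
  have hT' : ∀ p (hp : p ∈ S), T' p = T ⟨p, hp⟩ := fun p hp => dif_pos hp
  exact addHaar_image_eq_zero_of_det_fderivWithin_eq_zero μ (f' := T')
    (fun p hp => by rw [hT' p hp]; exact (hT1 ⟨p, hp⟩).hasFDerivWithinAt)
    (fun p hp => by rw [hT' p hp, hT2]; exact hdet p hp)

end Fibred

/-! ### Root formulas -/

section RootIntegral
variable {Θ V W : Type*} [NormedAddCommGroup Θ] [NormedSpace ℝ Θ] [FiniteDimensional ℝ Θ]
  [NormedAddCommGroup V] [NormedSpace ℝ V] [FiniteDimensional ℝ V]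
  [MeasureSpace Θ] [BorelSpace Θ] [MeasureSpace V] [BorelSpace V] [MeasureSpace W]
  [(volume : Measure (Θ × V)).IsAddHaarMeasure]

/-- A coefficient vector splits into its lowest coefficients in Θ and the upper ones in V. A root θ
and the upper coefficients v determine the lowest ones, G(θ, v), so the roots of b form a fibre of
(θ, v) ↦ (G(θ, v), v) and the area formula applies. The map T then replaces v by the coefficients of
the cofactor, preserving volume. -/
theorem root_integral (ε : W ≃ᵐ Θ × V) (hε : MeasurePreserving ε volume volume)
    {T : Θ × V → Θ × V} (hT : MeasurePreserving T volume volume) (hTe : MeasurableEmbedding T)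
    {G : Θ × V → Θ} {A : Θ × V → Θ →L[ℝ] Θ} {S : Set (Θ × V)}
    (hG : ∀ p ∈ S, DifferentiableAt ℝ G p)
    (hA : ∀ p ∈ S, HasFDerivAt (fun θ => G (θ, p.2)) (A p) p.1)
    (hdet : MeasurableSet (S ∩ {p | (A p).det ≠ 0}))
    {R : W → Finset Θ}
    (hR : ∀ b θ, θ ∈ R b ↔ (θ, (ε b).2) ∈ S ∧ G (θ, (ε b).2) = (ε b).1) {ψ : Θ → W → ℂ}
    {Φ : Θ × V → ℂ}
    (hΦ : ∀ p, T p ∈ S → Φ p = |(A (T p)).det| • ψ (T p).1 (ε.symm (G (T p), (T p).2)))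
    (hΦ0 : ∀ p, T p ∉ S → Φ p = 0) (hψ : Integrable Φ) :
    Integrable (fun b => ∑ θ ∈ R b, ψ θ b) ∧ ∫ b, ∑ θ ∈ R b, ψ θ b = ∫ p, Φ p := by
  set S₁ := S ∩ {p | (A p).det ≠ 0} with hS₁
  set φ : Θ × V → ℂ := fun p => ψ p.1 (ε.symm (G p, p.2)) with hφ
  have hfin : ∀ y : Θ × V, (S₁ ∩ (fun q : Θ × V => (G q, q.2)) ⁻¹' {y}).Finite := by
    intro y
    refine ((R (ε.symm y)).finite_toSet.image fun θ => (θ, y.2)).subset ?_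
    rintro ⟨θ, v⟩ ⟨⟨h1, -⟩, h2⟩
    have h3 : (G (θ, v), v) = y := h2
    have h4 : v = y.2 := by rw [← h3]
    refine ⟨θ, ?_, by rw [h4]⟩
    rw [Finset.mem_coe, hR, ε.apply_symm_apply, ← h4]
    exact ⟨h1, by rw [← h3]⟩
  -- At critical points the Jacobian is 0, so removing them does not change Φ.
  have hind : Φ = (S₁.indicator fun p => |(A p).det| • φ p) ∘ T := by
    ext p
    by_cases h1 : T p ∈ S
    · rw [hΦ p h1]
      by_cases h2 : (A (T p)).det = 0
      · rw [h2, Function.comp, Set.indicator_of_notMem fun h => h.2 h2]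
        simp
      · rw [Function.comp, Set.indicator_of_mem (show T p ∈ S₁ from ⟨h1, h2⟩)]
    · rw [hΦ0 p h1, Function.comp, Set.indicator_of_notMem fun h => h1 h.1]
  have hint : IntegrableOn (fun p => |(A p).det| • φ p) S₁ := by
    rw [← integrable_indicator_iff hdet, ← hT.integrable_comp_emb hTe, ← hind]
    exact hψ
  obtain ⟨h1, h2⟩ := fibred_area_formula (volume : Measure (Θ × V)) hdet
    (fun p hp => hG p hp.1) (fun p hp => hA p hp.1) (fun p hp => hp.2) hfin hint
  have h0 := fibred_sard (volume : Measure (Θ × V)) (S := S ∩ {p | (A p).det = 0})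
    (fun p hp => hG p hp.1) (fun p hp => hA p hp.1) (fun p hp => hp.2)
  have hae : (fun b => ∑ θ ∈ R b, ψ θ b) =ᵐ[volume]
      (fun y => ∑ x ∈ (hfin y).toFinset, φ x) ∘ ε := by
    -- By Sard, almost every b has no critical root, and for such b the regular fibre contains all
    -- of its roots.
    have h3 : ∀ᵐ b : W, ε b ∉ (fun q : Θ × V => (G q, q.2)) '' (S ∩ {p | (A p).det = 0}) := by
      have := hε.quasiMeasurePreserving.ae (p := fun y => y ∉
        (fun q : Θ × V => (G q, q.2)) '' (S ∩ {p | (A p).det = 0})) (measure_eq_zero_iff_ae_notMem.1 h0)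
      exact this
    filter_upwards [h3] with b hb
    simp only [Function.comp]
    refine Finset.sum_bij (fun θ _ => (θ, (ε b).2)) ?_ ?_ ?_ ?_
    · intro θ hθ
      rw [hR] at hθ
      rw [Set.Finite.mem_toFinset]
      refine ⟨⟨hθ.1, fun h => hb ⟨_, ⟨hθ.1, h⟩, ?_⟩⟩, ?_⟩
      · simp only [hθ.2]
      · simp only [Set.mem_preimage, hθ.2, Set.mem_singleton_iff]
    · intro θ _ θ' _ h
      exact (Prod.ext_iff.1 h).1
    · rintro ⟨θ, v⟩ hθ
      rw [Set.Finite.mem_toFinset] at hθ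
      have h3 : (G (θ, v), v) = ε b := hθ.2
      have h4 : v = (ε b).2 := by rw [← h3]
      refine ⟨θ, ?_, by rw [h4]⟩
      rw [hR, ← h4]
      exact ⟨hθ.1.1, by rw [← h3]⟩
    · intro θ hθ
      rw [hR] at hθ
      simp only [hφ, hθ.2]
      rw [ε.symm_apply_apply]
  refine ⟨((hε.integrable_comp_emb ε.measurableEmbedding).2 h1).congr hae.symm, ?_⟩
  rw [integral_congr_ae hae]
  refine (hε.integral_comp ε.measurableEmbedding
    (fun y => ∑ x ∈ (hfin y).toFinset, φ x)).trans ?_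
  rw [h2, ← integral_indicator hdet, hind,
    ← hT.integral_comp hTe]
  rfl

end RootIntegral

/-! ### Coefficient vectors of monic polynomials -/

/-- The monic real polynomial with the given lower coefficients. -/
noncomputable def polyR {d : ℕ} (c : Fin d → ℝ) : ℝ[X] := X ^ d + ∑ n : Fin d, C (c n) * X ^ (n : ℕ)

theorem monicPoly_eq {d : ℕ} (c : Fin d → ℝ) : monicPoly c = (polyR c).map (algebraMap ℝ ℂ) := rfl

theorem degree_lower_lt {d : ℕ} (c : Fin d → ℝ) :
    (∑ n : Fin d, C (c n) * X ^ (n : ℕ)).degree < (d : WithBot ℕ) := by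
  refine (degree_sum_le _ _).trans_lt ((Finset.sup_lt_iff (by exact WithBot.bot_lt_coe d)).2 ?_)
  intro n _
  exact (degree_C_mul_X_pow_le _ _).trans_lt (by exact_mod_cast n.2)

theorem monic_polyR {d : ℕ} (c : Fin d → ℝ) : (polyR c).Monic :=
  monic_X_pow_add (degree_lower_lt c)

theorem natDegree_polyR {d : ℕ} (c : Fin d → ℝ) : (polyR c).natDegree = d := by
  rw [polyR, natDegree_add_eq_left_of_degree_lt, natDegree_X_pow]
  rw [degree_X_pow]
  exact degree_lower_lt c

theorem coeff_mul_polyR {d : ℕ} (q : ℝ[X]) (c : Fin d → ℝ) (n : ℕ) :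
    (q * polyR c).coeff n = ∑ j : Fin d, (if (j : ℕ) ≤ n then q.coeff (n - j) else 0) * c j
      + if d ≤ n then q.coeff (n - d) else 0 := by
  rw [polyR, mul_add, Finset.mul_sum, coeff_add, finsetSum_coeff, coeff_mul_X_pow', add_comm]
  congr 1
  refine Finset.sum_congr rfl fun j _ => ?_
  rw [← mul_assoc, coeff_mul_X_pow']
  split_ifs
  · rw [coeff_mul_C]
  · rw [zero_mul]

theorem coeff_polyR {d : ℕ} (c : Fin d → ℝ) (i : Fin d) : (polyR c).coeff i = c i := by
  rw [← one_mul (polyR c), coeff_mul_polyR, if_neg (by omega), add_zero, Finset.sum_eq_single i]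
  · simp
  · intro j _ hj
    split_ifs with h
    · rw [coeff_one, if_neg, zero_mul]
      intro h'
      exact hj (Fin.ext (by omega))
    · rw [zero_mul]
  · simp

theorem polyR_coeff {d : ℕ} {p : ℝ[X]} (hp : p.Monic) (hd : p.natDegree = d) :
    polyR (fun i : Fin d => p.coeff i) = p := by
  conv_rhs => rw [hp.as_sum, hd]
  rw [polyR, Finset.sum_range]

theorem polyR_eq_X_mul_add {d : ℕ} (b : Fin (d + 1) → ℝ) :
    polyR b = X * polyR (Fin.tail b) + C (b 0) := by
  rw [polyR, polyR, Fin.sum_univ_succ, mul_add, Finset.mul_sum]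
  simp only [Fin.val_zero, pow_zero, mul_one, Fin.val_succ, Fin.tail]
  rw [pow_succ', add_assoc, add_comm (C (b 0))]
  congr 2
  refine Finset.sum_congr rfl fun i _ => ?_
  rw [pow_succ']
  ring

/-- The lower coefficients of `q` times a monic polynomial. -/
noncomputable def mulVec (e : ℕ) (q : ℝ[X]) {d : ℕ} (c : Fin d → ℝ) : Fin (d + e) → ℝ :=
  fun i => (q * polyR c).coeff i

theorem polyR_mulVec {e : ℕ} {q : ℝ[X]} (hq : q.Monic) (he : q.natDegree = e) {d : ℕ}
    (c : Fin d → ℝ) : polyR (mulVec e q c) = q * polyR c := by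
  refine polyR_coeff (hq.mul (monic_polyR c)) ?_
  rw [hq.natDegree_mul (monic_polyR c), he, natDegree_polyR, add_comm]

/-- The upper coefficients of `q` times a monic polynomial. -/
noncomputable def upperVec (e : ℕ) (q : ℝ[X]) {d : ℕ} (c : Fin d → ℝ) : Fin d → ℝ :=
  fun i => (q * polyR c).coeff (i + e)

/-- The matrix of the linear part of `upperVec`. -/
noncomputable def upperMatrix (e : ℕ) (q : ℝ[X]) (d : ℕ) : Matrix (Fin d) (Fin d) ℝ :=
  Matrix.of fun i j => if (j : ℕ) ≤ i + e then q.coeff (i + e - j) else 0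

theorem upperVec_eq (e : ℕ) (q : ℝ[X]) {d : ℕ} (c : Fin d → ℝ) :
    upperVec e q c = (upperMatrix e q d).toLin' c
      + fun i : Fin d => if d ≤ i + e then q.coeff (i + e - d) else 0 := by
  ext i
  rw [upperVec, coeff_mul_polyR, Pi.add_apply, Matrix.toLin'_apply]
  rfl

/-- Entries below the diagonal are coefficients of q beyond its degree e; on the diagonal stands the
leading coefficient 1. -/
theorem det_upperMatrix {e : ℕ} {q : ℝ[X]} (hq : q.Monic) (he : q.natDegree = e) (d : ℕ) :
    (upperMatrix e q d).det = 1 := by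
  rw [Matrix.det_of_isUpperTriangular]
  · refine Finset.prod_eq_one fun i _ => ?_
    rw [upperMatrix, Matrix.of_apply, if_pos (by omega), Nat.add_sub_cancel_left, ← he]
    exact hq
  · intro i j hij
    have hij' : (j : ℕ) < i := hij
    rw [upperMatrix, Matrix.of_apply, if_pos (by omega)]
    exact coeff_eq_zero_of_natDegree_lt (by omega)

theorem map_upperVec {e : ℕ} {q : ℝ[X]} (hq : q.Monic) (he : q.natDegree = e) (d : ℕ) :
    Measure.map (upperVec e q : (Fin d → ℝ) → Fin d → ℝ) volume = volume := by
  have h1 := Real.map_matrix_volume_pi_eq_smul_volume_pi (M := upperMatrix e q d)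
    (by rw [det_upperMatrix hq he]; exact one_ne_zero)
  rw [det_upperMatrix hq he, inv_one, abs_one, ENNReal.ofReal_one, one_smul] at h1
  have h2 : (upperVec e q : (Fin d → ℝ) → Fin d → ℝ) =
      (fun c => c + fun i : Fin d => if d ≤ i + e then q.coeff (i + e - d) else 0) ∘
        (upperMatrix e q d).toLin' := by
    ext1 c
    exact upperVec_eq e q c
  rw [h2, ← Measure.map_map (measurable_add_const _)
    (LinearMap.continuous_of_finiteDimensional _).measurable, h1, map_add_right_eq_self]

theorem upperVec_injective {e : ℕ} {q : ℝ[X]} (hq : q.Monic) (he : q.natDegree = e) (d : ℕ) :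
    Function.Injective (upperVec e q : (Fin d → ℝ) → Fin d → ℝ) := by
  intro c c' h
  rw [upperVec_eq, upperVec_eq, add_left_inj, Matrix.toLin'_apply, Matrix.toLin'_apply] at h
  refine Matrix.mulVec_injective_of_isUnit ?_ h
  rw [Matrix.isUnit_iff_isUnit_det, det_upperMatrix hq he]
  exact isUnit_one

theorem continuous_upperVec {Θ : Type*} [TopologicalSpace Θ] {q : Θ → ℝ[X]} {e : ℕ}
    (hc : ∀ k, Continuous fun θ => (q θ).coeff k) (d : ℕ) :
    Continuous fun p : Θ × (Fin d → ℝ) => upperVec e (q p.1) p.2 := by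
  refine continuous_pi fun i => ?_
  simp only [upperVec, coeff_mul_polyR]
  refine Continuous.add (continuous_finsetSum _ fun j _ => ?_) ?_
  · split_ifs
    · exact ((hc _).comp continuous_fst).mul ((continuous_apply j).comp continuous_snd)
    · simp only [zero_mul]; exact continuous_const
  · split_ifs
    · exact (hc _).comp continuous_fst
    · exact continuous_const

section UpperMap
variable {Θ : Type*} [NormedAddCommGroup Θ] [NormedSpace ℝ Θ] [FiniteDimensional ℝ Θ]
  [MeasureSpace Θ] [BorelSpace Θ] [SigmaFinite (volume : Measure Θ)]
  {q : Θ → ℝ[X]} {e : ℕ}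

theorem measurePreserving_upperVec (hc : ∀ k, Continuous fun θ => (q θ).coeff k)
    (hq : ∀ θ, (q θ).Monic) (he : ∀ θ, (q θ).natDegree = e) (d : ℕ) :
    MeasurePreserving (fun p : Θ × (Fin d → ℝ) => (p.1, upperVec e (q p.1) p.2)) volume volume :=
  MeasurePreserving.skew_product (g := fun θ c => upperVec e (q θ) c)
    (MeasurePreserving.id (volume : Measure Θ)) (continuous_upperVec hc d).measurable
    (Eventually.of_forall fun θ => map_upperVec (hq θ) (he θ) d)

/-- A continuous injection between Polish spaces is a measurable embedding. -/
theorem measurableEmbedding_upperVec (hc : ∀ k, Continuous fun θ => (q θ).coeff k)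
    (hq : ∀ θ, (q θ).Monic) (he : ∀ θ, (q θ).natDegree = e) (d : ℕ) :
    MeasurableEmbedding (fun p : Θ × (Fin d → ℝ) => (p.1, upperVec e (q p.1) p.2)) := by
  have : CompleteSpace Θ := FiniteDimensional.complete ℝ Θ
  have : ProperSpace Θ := FiniteDimensional.proper ℝ Θ
  refine Continuous.measurableEmbedding (continuous_fst.prodMk (continuous_upperVec hc d)) ?_
  rintro ⟨θ, c⟩ ⟨θ', c'⟩ h
  obtain ⟨h1, h2⟩ := Prod.ext_iff.1 h
  simp only at h1 h2
  subst h1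
  rw [upperVec_injective (hq θ) (he θ) d h2]

end UpperMap

/-! ### The formula for real roots -/

instance isAddHaarMeasure_prod_pi {Θ : Type*} [NormedAddCommGroup Θ] [NormedSpace ℝ Θ]
    [FiniteDimensional ℝ Θ] [MeasureSpace Θ] [BorelSpace Θ]
    [h : (volume : Measure Θ).IsAddHaarMeasure] (d : ℕ) :
    (volume : Measure (Θ × (Fin d → ℝ))).IsAddHaarMeasure := by
  have : ProperSpace Θ := FiniteDimensional.proper ℝ Θ
  exact Measure.prod.instIsAddHaarMeasure (volume : Measure Θ) (volume : Measure (Fin d → ℝ))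

theorem eval_polyR {d : ℕ} (c : Fin d → ℝ) (x : ℝ) :
    (polyR c).eval x = x ^ d + ∑ i : Fin d, c i * x ^ (i : ℕ) := by
  simp [polyR, eval_finsetSum]

/-- The value of the monic polynomial with lower coefficients `c` at a complex number. -/
noncomputable def ev {d : ℕ} (c : Fin d → ℝ) (z : ℂ) : ℂ := (monicPoly c).eval z

theorem ev_eq {d : ℕ} (c : Fin d → ℝ) (z : ℂ) :
    ev c z = z ^ d + ∑ i : Fin d, (c i : ℂ) * z ^ (i : ℕ) := by
  simp [ev, monicPoly, Polynomial.map_sum, eval_finsetSum]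

theorem ev_ofReal {d : ℕ} (c : Fin d → ℝ) (x : ℝ) : ev c x = ((polyR c).eval x : ℝ) := by
  rw [ev_eq, eval_polyR]; push_cast; rfl

theorem ev_conj {d : ℕ} (c : Fin d → ℝ) (z : ℂ) : ev c (conj z) = conj (ev c z) := by
  rw [ev_eq, ev_eq]; simp [map_sum]

/-- The linear factor with root `x`. -/
noncomputable def linFactor (x : ℝ) : ℝ[X] := X - C x

theorem monic_linFactor (x : ℝ) : (linFactor x).Monic := monic_X_sub_C x

theorem natDegree_linFactor (x : ℝ) : (linFactor x).natDegree = 1 := natDegree_X_sub_C x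

theorem continuous_coeff_linFactor (k : ℕ) : Continuous fun x => (linFactor x).coeff k := by
  simp only [linFactor, coeff_sub, coeff_C]
  refine continuous_const.sub ?_
  split_ifs
  · exact continuous_id
  · exact continuous_const

theorem tail_mulVec_one (x : ℝ) {d : ℕ} (h : Fin d → ℝ) :
    Fin.tail (mulVec 1 (linFactor x) h) = upperVec 1 (linFactor x) h := rfl

/-- The constant coefficient is determined by a root x and the other coefficients, with derivative
-b'(x) in x. For b = (X - x)h this is -h(x), which gives the Jacobian |h(x)|. -/
theorem integral_sum_real_roots {d : ℕ} {ψ : ℝ → (Fin (d + 1) → ℝ) → ℂ}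
    (hψ : Integrable fun p : ℝ × (Fin d → ℝ) =>
      |(polyR p.2).eval p.1| • ψ p.1 (mulVec 1 (linFactor p.1) p.2)) :
    Integrable (fun b : Fin (d + 1) → ℝ => ∑ x ∈ (polyR b).roots.toFinset, ψ x b) ∧
      ∫ b : Fin (d + 1) → ℝ, ∑ x ∈ (polyR b).roots.toFinset, ψ x b =
        ∫ p : ℝ × (Fin d → ℝ), |(polyR p.2).eval p.1| • ψ p.1 (mulVec 1 (linFactor p.1) p.2) := by
  set ε := MeasurableEquiv.piFinSuccAbove (fun _ : Fin (d + 1) => ℝ) 0 with hε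
  have hε1 : ∀ b, ε b = (b 0, Fin.tail b) := fun b => rfl
  set G : ℝ × (Fin d → ℝ) → ℝ := fun p => -(p.1 * (polyR p.2).eval p.1) with hG
  set D : ℝ × (Fin d → ℝ) → ℝ := fun p => -(derivative (X * polyR p.2)).eval p.1 with hD
  have hGb : ∀ (b : Fin (d + 1) → ℝ) (x : ℝ), G (x, Fin.tail b) = b 0 ↔ (polyR b).eval x = 0 := by
    intro b x
    rw [polyR_eq_X_mul_add b]
    simp only [hG, eval_add, eval_mul, eval_X, eval_C]
    constructor <;> intro h <;> linarith
  have hT : ∀ p : ℝ × (Fin d → ℝ), (polyR (mulVec 1 (linFactor p.1) p.2)) = linFactor p.1 * polyR p.2 :=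
    fun p => polyR_mulVec (monic_linFactor _) (natDegree_linFactor _) _
  have hcont : Continuous fun p : ℝ × (Fin d → ℝ) => (derivative (X * polyR p.2)).eval p.1 := by
    have : ∀ p : ℝ × (Fin d → ℝ), (derivative (X * polyR p.2)).eval p.1
        = p.1 ^ d + ∑ i : Fin d, p.2 i * p.1 ^ (i : ℕ) + p.1 * (d * p.1 ^ (d - 1) +
          ∑ i : Fin d, p.2 i * ((i : ℕ) * p.1 ^ ((i : ℕ) - 1))) := by
      intro p
      rw [derivative_mul, derivative_X, one_mul, eval_add, eval_mul, eval_X, eval_polyR]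
      simp [polyR, eval_finsetSum, derivative_X_pow]
    simp only [this]
    fun_prop
  refine root_integral ε (volume_preserving_piFinSuccAbove (fun _ => ℝ) 0)
    (T := fun p => (p.1, upperVec 1 (linFactor p.1) p.2))
    (measurePreserving_upperVec continuous_coeff_linFactor monic_linFactor natDegree_linFactor d)
    (measurableEmbedding_upperVec continuous_coeff_linFactor monic_linFactor natDegree_linFactor d)
    (G := G) (A := fun p => ContinuousLinearMap.toSpanSingleton ℝ (D p)) (S := Set.univ)
    (fun p _ => ?_) (fun p _ => ?_) ?_ (fun b x => ?_) (fun p _ => ?_)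
    (fun p h => absurd (Set.mem_univ _) h) hψ
  · simp only [hG, eval_polyR]
    fun_prop
  · have h1 : HasDerivAt (fun x => (X * polyR p.2).eval x) ((derivative (X * polyR p.2)).eval p.1)
        p.1 := Polynomial.hasDerivAt _ _
    have h2 := h1.neg.hasFDerivAt
    have e : (fun θ => G (θ, p.2)) = -fun x => (X * polyR p.2).eval x := by
      ext x; simp [hG]
    rw [e]
    exact h2
  · rw [Set.univ_inter]
    have : {p : ℝ × (Fin d → ℝ) | (ContinuousLinearMap.toSpanSingleton ℝ (D p)).det ≠ 0}
        = {p | D p ≠ 0} := by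
      ext p
      simp [ContinuousLinearMap.det, LinearMap.det_ring]
    rw [this]
    exact (measurableSet_singleton (0 : ℝ)).compl.preimage hcont.neg.measurable
  · rw [Multiset.mem_toFinset, mem_roots (monic_polyR b).ne_zero, IsRoot.def]
    simp only [Set.mem_univ, true_and]
    rw [hε1]
    exact (hGb b x).symm
  · have hb : ε.symm (G (p.1, upperVec 1 (linFactor p.1) p.2), upperVec 1 (linFactor p.1) p.2)
        = mulVec 1 (linFactor p.1) p.2 := by
      rw [MeasurableEquiv.symm_apply_eq, hε1, tail_mulVec_one]
      refine Prod.ext ?_ rfl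
      rw [← tail_mulVec_one]
      refine (hGb _ _).2 ?_
      rw [hT]
      simp [linFactor]
    have hd : (derivative (X * polyR (upperVec 1 (linFactor p.1) p.2))).eval p.1
        = (polyR p.2).eval p.1 := by
      have h1 := hT p
      rw [polyR_eq_X_mul_add, tail_mulVec_one] at h1
      have h2 := congrArg (fun q => (derivative q).eval p.1) h1
      simp only [derivative_add, derivative_C, add_zero] at h2
      rw [h2, derivative_mul]
      simp [linFactor]
    simp only
    rw [hb]
    congr 1
    simp only [ContinuousLinearMap.det, LinearMap.det_ring, hD, hd]
    simp

/-! ### The formula for non-real roots -/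

/-- The real quadratic factor with roots `z` and its conjugate. -/
noncomputable def quadFactor (z : ℂ) : ℝ[X] := X ^ 2 - C (2 * z.re) * X + C (Complex.normSq z)

theorem quadFactor_eq (z : ℂ) :
    quadFactor z = X ^ 2 + (C (-(2 * z.re)) * X + C (Complex.normSq z)) := by
  rw [quadFactor, C_neg]; ring

theorem degree_lin_lt (a b : ℝ) : (C a * X + C b).degree < ((2 : ℕ) : WithBot ℕ) := by
  refine (degree_linear_le).trans_lt ?_
  exact_mod_cast one_lt_two

theorem monic_quadFactor (z : ℂ) : (quadFactor z).Monic := by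
  rw [quadFactor_eq]
  exact monic_X_pow_add (degree_lin_lt _ _)

theorem natDegree_quadFactor (z : ℂ) : (quadFactor z).natDegree = 2 := by
  rw [quadFactor_eq, natDegree_add_eq_left_of_degree_lt, natDegree_X_pow]
  rw [degree_X_pow]
  exact degree_lin_lt _ _

theorem map_quadFactor (z : ℂ) :
    (quadFactor z).map (algebraMap ℝ ℂ) = (X - C z) * (X - C (conj z)) := by
  have h1 : (C (algebraMap ℝ ℂ (2 * z.re)) : ℂ[X]) = C z + C (conj z) := by
    rw [← C_add, Complex.add_conj]; simp
  have h2 : (C (algebraMap ℝ ℂ (Complex.normSq z)) : ℂ[X]) = C z * C (conj z) := by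
    rw [← C_mul, Complex.mul_conj]; simp
  rw [quadFactor, Polynomial.map_add, Polynomial.map_sub, Polynomial.map_mul, map_C, map_C, h1, h2]
  simp only [Polynomial.map_pow, map_X]
  ring

theorem continuous_coeff_quadFactor (k : ℕ) : Continuous fun z => (quadFactor z).coeff k := by
  simp only [quadFactor, coeff_add, coeff_sub, coeff_C_mul, coeff_C]
  refine (continuous_const.sub ((continuous_const.mul Complex.continuous_re).mul
    continuous_const)).add ?_
  split_ifs
  · exact Complex.continuous_normSq
  · exact continuous_const

theorem tail_mulVec_two (z : ℂ) {d : ℕ} (c : Fin d → ℝ) :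
    Fin.tail (Fin.tail (mulVec 2 (quadFactor z) c)) = upperVec 2 (quadFactor z) c := rfl

theorem ev_eq_tail {d : ℕ} (b : Fin (d + 2) → ℝ) (z : ℂ) :
    ev b z = z ^ 2 * ev (Fin.tail (Fin.tail b)) z + b 1 * z + b 0 := by
  rw [ev, ev, monicPoly_eq, monicPoly_eq, polyR_eq_X_mul_add b, polyR_eq_X_mul_add (Fin.tail b)]
  simp only [Polynomial.map_add, Polynomial.map_mul, map_X, map_C, eval_add, eval_mul, eval_X,
    eval_C, Complex.coe_algebraMap, Fin.tail]
  have : (Fin.succ (0 : Fin (d + 1))) = (1 : Fin (d + 2)) := rfl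
  rw [this]
  ring

/-- Splitting off the two lowest coefficients as a complex number. -/
noncomputable def splitTwo (d : ℕ) : (Fin (d + 2) → ℝ) ≃ᵐ ℂ × (Fin d → ℝ) :=
  (MeasurableEquiv.piFinSuccAbove (fun _ : Fin (d + 2) => ℝ) 0).trans
    (((MeasurableEquiv.refl ℝ).prodCongr
      (MeasurableEquiv.piFinSuccAbove (fun _ : Fin (d + 1) => ℝ) 0)).trans
    (MeasurableEquiv.prodAssoc.symm.trans
      (Complex.measurableEquivRealProd.symm.prodCongr (MeasurableEquiv.refl (Fin d → ℝ)))))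

theorem splitTwo_apply {d : ℕ} (b : Fin (d + 2) → ℝ) :
    splitTwo d b = (⟨b 0, b 1⟩, Fin.tail (Fin.tail b)) := rfl

theorem measurePreserving_splitTwo (d : ℕ) :
    MeasurePreserving (splitTwo d) volume volume := by
  unfold splitTwo
  refine (volume_preserving_piFinSuccAbove (fun _ : Fin (d + 2) => ℝ) 0).trans ?_
  refine MeasurePreserving.trans (μb := volume) ((MeasurePreserving.id volume).prod
    (volume_preserving_piFinSuccAbove (fun _ : Fin (d + 1) => ℝ) 0)) ?_
  refine MeasurePreserving.trans (μb := volume) ?_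
    ((Complex.volume_preserving_equiv_real_prod.symm _).prod (MeasurePreserving.id volume))
  exact (measurePreserving_prodAssoc (volume : Measure ℝ) (volume : Measure ℝ)
    (volume : Measure (Fin d → ℝ))).symm _

/-- The linear map `τ ↦ Re τ + Im τ * z`. -/
noncomputable def evalLin (z : ℂ) : ℂ →L[ℝ] ℂ :=
  Complex.ofRealCLM ∘L Complex.reCLM + (Complex.ofRealCLM ∘L Complex.imCLM).smulRight z

theorem evalLin_apply (z τ : ℂ) : evalLin z τ = τ.re + τ.im * z := rfl

theorem det_evalLin (z : ℂ) : (evalLin z).det = z.im := by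
  rw [ContinuousLinearMap.det, ← LinearMap.det_toMatrix Complex.basisOneI, Matrix.det_fin_two]
  simp [LinearMap.toMatrix_apply, evalLin_apply]

theorem det_mulLeft (c : ℂ) : LinearMap.det (LinearMap.mulLeft ℝ c) = Complex.normSq c := by
  rw [← LinearMap.det_toMatrix Complex.basisOneI, Matrix.det_fin_two]
  simp [LinearMap.toMatrix_apply, Complex.normSq_apply]

/-- The map sending a root and the upper coefficients to the two lowest coefficients. -/
noncomputable def lowCoeff {d : ℕ} (p : ℂ × (Fin d → ℝ)) : ℂ :=
  ((-(p.1 ^ 2 * ev p.2 p.1).re + p.1.re * ((p.1 ^ 2 * ev p.2 p.1).im / p.1.im) : ℝ) : ℂ)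
    + ((-((p.1 ^ 2 * ev p.2 p.1).im / p.1.im) : ℝ) : ℂ) * Complex.I

theorem lowCoeff_re {d : ℕ} (p : ℂ × (Fin d → ℝ)) : (lowCoeff p).re =
    -(p.1 ^ 2 * ev p.2 p.1).re + p.1.re * ((p.1 ^ 2 * ev p.2 p.1).im / p.1.im) := by
  rw [lowCoeff, Complex.add_re, Complex.re_ofReal_mul, Complex.ofReal_re, Complex.I_re]; ring

theorem lowCoeff_im {d : ℕ} (p : ℂ × (Fin d → ℝ)) : (lowCoeff p).im =
    -((p.1 ^ 2 * ev p.2 p.1).im / p.1.im) := by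
  rw [lowCoeff, Complex.add_im, Complex.im_ofReal_mul, Complex.ofReal_im, Complex.I_im]; ring

theorem evalLin_lowCoeff {d : ℕ} {p : ℂ × (Fin d → ℝ)} (hp : p.1.im ≠ 0) :
    evalLin p.1 (lowCoeff p) = -(p.1 ^ 2 * ev p.2 p.1) := by
  rw [evalLin_apply, lowCoeff_re, lowCoeff_im]
  apply Complex.ext
  · simp
    ring
  · simp
    field_simp
    ring

/-- For non-real z the real-linear map (b₀, b₁) ↦ b₀ + b₁z is injective, so the complex equation ev
b z = 0 fixes both low coefficients. -/
theorem lowCoeff_eq_iff {d : ℕ} (b : Fin (d + 2) → ℝ) {z : ℂ} (hz : z.im ≠ 0) :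
    lowCoeff (z, Fin.tail (Fin.tail b)) = ⟨b 0, b 1⟩ ↔ ev b z = 0 := by
  have h1 := evalLin_lowCoeff (p := (z, Fin.tail (Fin.tail b))) hz
  have h2 : evalLin z ⟨b 0, b 1⟩ = b 0 + b 1 * z := rfl
  have h3 := ev_eq_tail b z
  constructor
  · intro h
    rw [h] at h1
    simp only at h1
    rw [h2] at h1
    rw [h3]
    linear_combination h1
  · intro h
    have h4 : evalLin z (lowCoeff (z, Fin.tail (Fin.tail b))) = evalLin z ⟨b 0, b 1⟩ := by
      rw [h1, h2]
      rw [h3] at h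
      linear_combination -h
    have hinj : Function.Injective (evalLin z) := by
      have := ((evalLin z).toContinuousLinearEquivOfDetNeZero
        (by rw [det_evalLin]; exact hz)).injective
      exact this
    exact hinj h4

theorem hasDerivAt_sq_mul_ev {d : ℕ} (v : Fin d → ℝ) (z : ℂ) :
    HasDerivAt (fun θ => θ ^ 2 * ev v θ)
      ((derivative (X ^ 2 * monicPoly v)).eval z) z := by
  have h := Polynomial.hasDerivAt (X ^ 2 * monicPoly v) z
  have e : (fun θ => θ ^ 2 * ev v θ) = fun θ => (X ^ 2 * monicPoly v).eval θ := by
    ext θ; simp [ev]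
  rw [e]
  exact h

theorem differentiableAt_lowCoeff {d : ℕ} {p : ℂ × (Fin d → ℝ)} (hp : p.1.im ≠ 0) :
    DifferentiableAt ℝ (lowCoeff : ℂ × (Fin d → ℝ) → ℂ) p := by
  have hre : Differentiable ℝ Complex.re := Complex.reCLM.differentiable
  have him : Differentiable ℝ Complex.im := Complex.imCLM.differentiable
  have hof : Differentiable ℝ Complex.ofReal := Complex.ofRealCLM.differentiable
  have hf : Differentiable ℝ fun p : ℂ × (Fin d → ℝ) => p.1 ^ 2 * ev p.2 p.1 := by
    simp only [ev_eq]
    refine (differentiable_fst.pow 2).mul ((differentiable_fst.pow d).add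
      (Differentiable.fun_sum fun i _ => ?_))
    refine Differentiable.mul ?_ (differentiable_fst.pow _)
    exact hof.comp (by fun_prop)
  have h1 : DifferentiableAt ℝ (fun p : ℂ × (Fin d → ℝ) =>
      (p.1 ^ 2 * ev p.2 p.1).im / p.1.im) p := by
    have ha : DifferentiableAt ℝ (fun p : ℂ × (Fin d → ℝ) => (p.1 ^ 2 * ev p.2 p.1).im) p :=
      (him.comp hf) p
    have hb : DifferentiableAt ℝ (fun p : ℂ × (Fin d → ℝ) => p.1.im) p :=
      (him.comp differentiable_fst) p
    simp only [div_eq_mul_inv]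
    exact ha.mul (hb.inv hp)
  have h2 : DifferentiableAt ℝ (fun p : ℂ × (Fin d → ℝ) =>
      -(p.1 ^ 2 * ev p.2 p.1).re + p.1.re * ((p.1 ^ 2 * ev p.2 p.1).im / p.1.im)) p :=
    ((hre.comp hf) p).neg.add (((hre.comp differentiable_fst) p).mul h1)
  exact ((hof _).comp p h2).add ((((hof _).comp p h1.neg)).mul_const _)

/-- The derivative at `z` of the polynomial with root `z` and upper coefficients `v`. -/
noncomputable def derivAtRoot {d : ℕ} (p : ℂ × (Fin d → ℝ)) : ℂ :=
  (derivative (X ^ 2 * monicPoly p.2)).eval p.1 + (lowCoeff p).im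

theorem differentiableAt_lowCoeff_left {d : ℕ} {z : ℂ} (hz : z.im ≠ 0) (v : Fin d → ℝ) :
    DifferentiableAt ℝ (fun θ : ℂ => lowCoeff (θ, v)) z := by
  have hpm : DifferentiableAt ℝ (fun θ : ℂ => ((θ, v) : ℂ × (Fin d → ℝ))) z :=
    differentiableAt_id.prodMk (differentiableAt_const v)
  exact DifferentiableAt.comp (g := lowCoeff) z (differentiableAt_lowCoeff (p := (z, v)) hz) hpm

theorem measurable_derivAtRoot {d : ℕ} :
    Measurable (derivAtRoot : ℂ × (Fin d → ℝ) → ℂ) := by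
  have e : ∀ p : ℂ × (Fin d → ℝ), (derivative (X ^ 2 * monicPoly p.2)).eval p.1
      = 2 * p.1 * (p.1 ^ d + ∑ i : Fin d, (p.2 i : ℂ) * p.1 ^ (i : ℕ)) + p.1 ^ 2 *
        (d * p.1 ^ (d - 1) + ∑ i : Fin d, (p.2 i : ℂ) * ((i : ℕ) * p.1 ^ ((i : ℕ) - 1))) := by
    intro p
    rw [derivative_mul, eval_add, eval_mul, eval_mul, ← ev, ev_eq]
    simp [monicPoly, Polynomial.map_sum, eval_finsetSum, derivative_X_pow]
    left; left; norm_num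
  unfold derivAtRoot
  simp only [e, lowCoeff_im, ev_eq]
  fun_prop

/-- Differentiating b₀(θ) + b₁(θ)θ = -θ² ev v θ in θ, the term b₁ moves to the right and completes
the derivative at the root: `evalLin z` composed with the wanted derivative is multiplication by
-`derivAtRoot`. Determinants give Im z · det A = |p'(z)|². -/
theorem abs_det_fderiv_lowCoeff {d : ℕ} {p : ℂ × (Fin d → ℝ)} (hp : p.1.im ≠ 0) :
    |(fderiv ℝ (fun θ => lowCoeff (θ, p.2)) p.1).det|
      = ‖derivAtRoot p‖ ^ 2 / |p.1.im| := by
  obtain ⟨z, v⟩ := p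
  simp only at hp ⊢
  have hd : HasFDerivAt (fun θ => lowCoeff (θ, v)) (fderiv ℝ (fun θ => lowCoeff (θ, v)) z) z := by
    refine DifferentiableAt.hasFDerivAt ?_
    exact differentiableAt_lowCoeff_left hp v
  set A := fderiv ℝ (fun θ => lowCoeff (θ, v)) z with hA
  have h1 : HasFDerivAt (fun θ => ((lowCoeff (θ, v)).re : ℂ) + ((lowCoeff (θ, v)).im : ℂ) * θ)
      (Complex.ofRealCLM ∘L Complex.reCLM ∘L A + (((lowCoeff (z, v)).im : ℂ) •
        ContinuousLinearMap.id ℝ ℂ + (Complex.ofRealCLM ∘L Complex.imCLM ∘L A).smulRight z)) z := by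
    have a1 : HasFDerivAt (fun θ => ((lowCoeff (θ, v)).re : ℂ))
        (Complex.ofRealCLM ∘L Complex.reCLM ∘L A) z :=
      Complex.ofRealCLM.hasFDerivAt.comp z (Complex.reCLM.hasFDerivAt.comp z hd)
    have a2 : HasFDerivAt (fun θ => ((lowCoeff (θ, v)).im : ℂ))
        (Complex.ofRealCLM ∘L Complex.imCLM ∘L A) z :=
      Complex.ofRealCLM.hasFDerivAt.comp z (Complex.imCLM.hasFDerivAt.comp z hd)
    exact a1.add (a2.smul (hasFDerivAt_id z))
  have h2 : HasFDerivAt (fun θ => -(θ ^ 2 * ev v θ)) (ContinuousLinearMap.restrictScalars ℝ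
      (ContinuousLinearMap.toSpanSingleton ℂ (-(derivative (X ^ 2 * monicPoly v)).eval z))) z :=
    (hasDerivAt_sq_mul_ev v z).fun_neg.hasFDerivAt.restrictScalars ℝ
  have h3 : (fun θ => ((lowCoeff (θ, v)).re : ℂ) + ((lowCoeff (θ, v)).im : ℂ) * θ) =ᶠ[𝓝 z]
      fun θ => -(θ ^ 2 * ev v θ) := by
    have : ∀ᶠ θ in 𝓝 z, θ.im ≠ 0 := Complex.continuous_im.continuousAt.eventually_ne hp
    filter_upwards [this] with θ hθ
    exact evalLin_lowCoeff (p := (θ, v)) hθ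
  have h4 := h1.unique (h2.congr_of_eventuallyEq h3)
  have h5 : (evalLin z : ℂ →ₗ[ℝ] ℂ) ∘ₗ (A : ℂ →ₗ[ℝ] ℂ) = LinearMap.mulLeft ℝ (-derivAtRoot (z, v)) := by
    refine LinearMap.ext fun w => ?_
    have h6 := congrArg (fun L : ℂ →L[ℝ] ℂ => L w) h4
    simp only [ContinuousLinearMap.add_apply, ContinuousLinearMap.comp_apply,
      ContinuousLinearMap.smulRight_apply, ContinuousLinearMap.smul_apply,
      ContinuousLinearMap.coe_restrictScalars', ContinuousLinearMap.toSpanSingleton_apply,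
      ContinuousLinearMap.id_apply, Complex.ofRealCLM_apply, Complex.reCLM_apply,
      Complex.imCLM_apply, smul_eq_mul] at h6
    simp only [LinearMap.comp_apply, ContinuousLinearMap.coe_coe, evalLin_apply,
      LinearMap.mulLeft_apply, derivAtRoot]
    linear_combination h6
  have h6 := congrArg LinearMap.det h5
  rw [LinearMap.det_comp, det_mulLeft, Complex.normSq_neg, Complex.normSq_eq_norm_sq] at h6
  have h7 : LinearMap.det (evalLin z : ℂ →ₗ[ℝ] ℂ) = z.im := det_evalLin z
  have h8 : LinearMap.det (A : ℂ →ₗ[ℝ] ℂ) = A.det := rfl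
  rw [h7, h8] at h6
  rw [eq_div_iff (abs_ne_zero.2 hp), ← abs_mul, mul_comm, h6, abs_of_nonneg (by positivity)]

/-- The non-real roots. -/
noncomputable def nonrealRoots {d : ℕ} (b : Fin d → ℝ) : Finset ℂ :=
  (monicPoly b).roots.toFinset.filter fun z => z.im ≠ 0

theorem monicPoly_ne_zero {d : ℕ} (b : Fin d → ℝ) : monicPoly b ≠ 0 := by
  rw [monicPoly_eq]
  exact ((monic_polyR b).map _).ne_zero

theorem mem_nonrealRoots {d : ℕ} {b : Fin d → ℝ} {z : ℂ} :
    z ∈ nonrealRoots b ↔ ev b z = 0 ∧ z.im ≠ 0 := by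
  rw [nonrealRoots, Finset.mem_filter, Multiset.mem_toFinset, mem_roots (monicPoly_ne_zero b),
    IsRoot.def, ev]

theorem ev_mulVec_two (z w : ℂ) {d : ℕ} (c : Fin d → ℝ) :
    ev (mulVec 2 (quadFactor z) c) w = (w - z) * (w - conj z) * ev c w := by
  rw [ev, monicPoly_eq, polyR_mulVec (monic_quadFactor z) (natDegree_quadFactor z),
    Polynomial.map_mul, map_quadFactor]
  simp [ev, monicPoly_eq]

theorem derivAtRoot_upperVec {d : ℕ} {z : ℂ} (hz : z.im ≠ 0) (c : Fin d → ℝ) :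
    lowCoeff (z, upperVec 2 (quadFactor z) c)
        = ⟨mulVec 2 (quadFactor z) c 0, mulVec 2 (quadFactor z) c 1⟩ ∧
      derivAtRoot (z, upperVec 2 (quadFactor z) c) = (z - conj z) * ev c z := by
  have h1 : lowCoeff (z, upperVec 2 (quadFactor z) c)
        = ⟨mulVec 2 (quadFactor z) c 0, mulVec 2 (quadFactor z) c 1⟩ := by
    rw [← tail_mulVec_two, lowCoeff_eq_iff _ hz, ev_mulVec_two]
    ring
  refine ⟨h1, ?_⟩
  set b := mulVec 2 (quadFactor z) c with hb
  have h2 : HasDerivAt (fun w => ev b w) (derivAtRoot (z, upperVec 2 (quadFactor z) c)) z := by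
    have e : (fun w => ev b w) = fun w => w ^ 2 * ev (upperVec 2 (quadFactor z) c) w
        + b 1 * w + b 0 := by
      ext w; rw [ev_eq_tail b w, hb, tail_mulVec_two]
    rw [e, derivAtRoot, h1]
    have := ((hasDerivAt_sq_mul_ev (upperVec 2 (quadFactor z) c) z).add
      ((hasDerivAt_id z).const_mul (b 1 : ℂ))).add_const (b 0 : ℂ)
    simpa using this
  have h3 : HasDerivAt (fun w => ev b w) ((z - conj z) * ev c z) z := by
    have e : (fun w => ev b w) = fun w => ((X - C z) * ((X - C (conj z)) * monicPoly c)).eval w := by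
      ext w; rw [hb, ev_mulVec_two]; simp [ev]; ring
    rw [e]
    have := Polynomial.hasDerivAt ((X - C z) * ((X - C (conj z)) * monicPoly c)) z
    rw [derivative_mul, derivative_X_sub_C] at this
    simpa [ev] using this
  exact h2.unique h3

/-- At a root p'(z) = (z - z̄)c(z), so the Jacobian |p'(z)|²/|Im z| equals 4|Im z||c(z)|². Both
roots of a conjugate pair are counted, each through its own z. -/
theorem integral_sum_nonreal_roots {d : ℕ} {ψ : ℂ → (Fin (d + 2) → ℝ) → ℂ}
    (hψ : Integrable fun p : ℂ × (Fin d → ℝ) =>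
      (4 * |p.1.im| * ‖ev p.2 p.1‖ ^ 2) • ψ p.1 (mulVec 2 (quadFactor p.1) p.2)) :
    Integrable (fun b : Fin (d + 2) → ℝ => ∑ z ∈ nonrealRoots b, ψ z b) ∧
      ∫ b : Fin (d + 2) → ℝ, ∑ z ∈ nonrealRoots b, ψ z b =
        ∫ p : ℂ × (Fin d → ℝ),
          (4 * |p.1.im| * ‖ev p.2 p.1‖ ^ 2) • ψ p.1 (mulVec 2 (quadFactor p.1) p.2) := by
  have hSm : MeasurableSet {p : ℂ × (Fin d → ℝ) | p.1.im ≠ 0} :=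
    (measurableSet_singleton (0 : ℝ)).compl.preimage (Complex.measurable_im.comp measurable_fst)
  refine root_integral (splitTwo d) (measurePreserving_splitTwo d)
    (T := fun p => (p.1, upperVec 2 (quadFactor p.1) p.2))
    (measurePreserving_upperVec continuous_coeff_quadFactor monic_quadFactor natDegree_quadFactor d)
    (measurableEmbedding_upperVec continuous_coeff_quadFactor monic_quadFactor
      natDegree_quadFactor d)
    (G := lowCoeff) (A := fun p => fderiv ℝ (fun θ => lowCoeff (θ, p.2)) p.1)
    (S := {p | p.1.im ≠ 0})
    (fun p hp => differentiableAt_lowCoeff hp) (fun p hp => ?_) ?_ (fun b z => ?_) (fun p hp => ?_)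
    (fun p hp => ?_) hψ
  · refine DifferentiableAt.hasFDerivAt ?_
    exact differentiableAt_lowCoeff_left hp p.2
  · have : ({p : ℂ × (Fin d → ℝ) | p.1.im ≠ 0} ∩
        {p | (fderiv ℝ (fun θ => lowCoeff (θ, p.2)) p.1).det ≠ 0})
        = {p | p.1.im ≠ 0} ∩ {p | derivAtRoot p ≠ 0} := by
      ext p
      refine and_congr_right fun hp => ?_
      have h := abs_det_fderiv_lowCoeff hp
      simp only [Set.mem_setOf_eq]
      rw [← abs_ne_zero, h]
      have : |p.1.im| ≠ 0 := abs_ne_zero.2 hp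
      simp [this]
    rw [this]
    exact hSm.inter ((measurableSet_singleton (0 : ℂ)).compl.preimage measurable_derivAtRoot)
  · rw [mem_nonrealRoots, and_comm]
    refine and_congr_right fun hz => ?_
    rw [splitTwo_apply]
    exact (lowCoeff_eq_iff b hz).symm
  · have hp' : p.1.im ≠ 0 := hp
    obtain ⟨h1, h2⟩ := derivAtRoot_upperVec hp' p.2
    have hb : (splitTwo d).symm (lowCoeff (p.1, upperVec 2 (quadFactor p.1) p.2),
        upperVec 2 (quadFactor p.1) p.2) = mulVec 2 (quadFactor p.1) p.2 := by
      rw [MeasurableEquiv.symm_apply_eq, splitTwo_apply, tail_mulVec_two, h1]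
    simp only
    rw [hb, abs_det_fderiv_lowCoeff (p := (p.1, upperVec 2 (quadFactor p.1) p.2)) hp', h2]
    congr 1
    have h3 : ‖p.1 - conj p.1‖ = 2 * |p.1.im| := by
      rw [Complex.sub_conj]
      simp
    rw [norm_mul, h3]
    have h4 : |p.1.im| ≠ 0 := abs_ne_zero.2 hp'
    field_simp
    ring
  · have : p.1.im = 0 := not_not.1 hp
    simp [this]

/-! ### The density of the random polynomials -/

/-- The unnormalised density as a real number. -/
noncomputable def dens (s : ℝ≥0∞) {d : ℕ} (c : Fin d → ℝ) : ℝ :=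
  invPow s (monicPoly c).mahlerMeasure

theorem invPow_mul (s : ℝ≥0∞) {a b : ℝ} (ha : 1 ≤ a) (hb : 1 ≤ b) :
    invPow s (a * b) = invPow s a * invPow s b := by
  unfold invPow
  by_cases h : s = ⊤
  · simp only [if_pos h]
    have h1 : a * b ≤ 1 ↔ a ≤ 1 ∧ b ≤ 1 :=
      ⟨fun h => ⟨by nlinarith, by nlinarith⟩, fun h => by nlinarith [h.1, h.2]⟩
    by_cases ha' : a ≤ 1 <;> by_cases hb' : b ≤ 1 <;> simp [h1, ha', hb']
  · simp only [if_neg h]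
    exact Real.mul_rpow (by positivity) (by positivity)

theorem monic_monicPoly {d : ℕ} (c : Fin d → ℝ) : (monicPoly c).Monic := by
  rw [monicPoly_eq]
  exact (monic_polyR c).map _

theorem natDegree_monicPoly {d : ℕ} (c : Fin d → ℝ) : (monicPoly c).natDegree = d := by
  rw [monicPoly_eq, (monic_polyR c).natDegree_map, natDegree_polyR]

theorem one_le_mahlerMeasure {d : ℕ} (c : Fin d → ℝ) : 1 ≤ (monicPoly c).mahlerMeasure := by
  refine one_le_mahlerMeasure_of_one_le_norm_leadingCoeff ?_
  rw [(monic_monicPoly c).leadingCoeff, norm_one]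

theorem dens_nonneg (s : ℝ≥0∞) {d : ℕ} (c : Fin d → ℝ) : 0 ≤ dens s c :=
  invPow_nonneg s (zero_le_one.trans (one_le_mahlerMeasure c))

/-- Multiplicativity of the Mahler measure makes the density of a product split into the weight of
the root and the density of the cofactor. -/
theorem dens_mulVec_one (s : ℝ≥0∞) (x : ℝ) {d : ℕ} (h : Fin d → ℝ) :
    dens s (mulVec 1 (linFactor x) h) = weight s x * dens s h := by
  rw [dens, monicPoly_eq, polyR_mulVec (monic_linFactor x) (natDegree_linFactor x),
    Polynomial.map_mul, mahlerMeasure_mul, linFactor, Polynomial.map_sub, map_X, map_C,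
    mahlerMeasure_X_sub_C, ← monicPoly_eq, invPow_mul s (le_max_left _ _) (one_le_mahlerMeasure h)]
  rfl

theorem dens_mulVec_two (s : ℝ≥0∞) (z : ℂ) {d : ℕ} (c : Fin d → ℝ) :
    dens s (mulVec 2 (quadFactor z) c) = weight s z ^ 2 * dens s c := by
  have h1 := le_max_left 1 ‖z‖
  rw [dens, monicPoly_eq, polyR_mulVec (monic_quadFactor z) (natDegree_quadFactor z),
    Polynomial.map_mul, mahlerMeasure_mul, map_quadFactor, mahlerMeasure_mul,
    mahlerMeasure_X_sub_C, mahlerMeasure_X_sub_C, RCLike.norm_conj, ← monicPoly_eq,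
    invPow_mul s (by nlinarith) (one_le_mahlerMeasure c), invPow_mul s h1 h1, weight, sq]
  rfl

theorem measurable_dens (s : ℝ≥0∞) (d : ℕ) : Measurable (dens s : (Fin d → ℝ) → ℝ) := by
  refine (measurable_invPow s).comp ?_
  have e : (fun c : Fin d → ℝ => (monicPoly c).mahlerMeasure) = fun c =>
      Real.exp ((2 * Real.pi)⁻¹ * ∫ θ in (0 : ℝ)..(2 * Real.pi), Real.log ‖ev c (circleMap 0 1 θ)‖) := by
    ext c
    rw [mahlerMeasure_def_of_ne_zero (monicPoly_ne_zero c)]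
    rfl
  rw [e]
  refine Real.measurable_exp.comp (Measurable.const_mul ?_ _)
  simp only [intervalIntegral.integral_of_le Real.two_pi_pos.le]
  refine StronglyMeasurable.measurable (StronglyMeasurable.integral_prod_right ?_)
  refine Measurable.stronglyMeasurable ?_
  simp only [Function.uncurry_def, ev_eq]
  have : Measurable (circleMap 0 1) := (continuous_circleMap 0 1).measurable
  fun_prop

theorem norm_le_mahlerMeasure {d : ℕ} (c : Fin d → ℝ) :
    ‖c‖ ≤ 2 ^ d * (monicPoly c).mahlerMeasure := by
  have h0 := one_le_mahlerMeasure c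
  refine (pi_norm_le_iff_of_nonneg (by positivity)).2 fun i => ?_
  have h1 := norm_coeff_le_choose_mul_mahlerMeasure (i : ℕ) (monicPoly c)
  rw [natDegree_monicPoly, monicPoly_eq, coeff_map, coeff_polyR, Complex.coe_algebraMap,
    Complex.norm_real] at h1
  refine h1.trans ?_
  gcongr
  · exact_mod_cast Nat.choose_le_two_pow d i
  · exact le_of_eq rfl

theorem invPow_le_rpow {s : ℝ≥0∞} {r : ℝ} (hr : ENNReal.ofReal r ≤ s) {a : ℝ} (ha : 1 ≤ a) :
    invPow s a ≤ a ^ (-r) := by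
  unfold invPow
  split_ifs with h h1
  · rw [le_antisymm h1 ha, Real.one_rpow]
  · positivity
  · refine Real.rpow_le_rpow_of_exponent_le ha (neg_le_neg ?_)
    exact (ENNReal.ofReal_le_iff_le_toReal h).1 hr

/-- A finite exponent r replaces s in all decay estimates, so that s = ∞ needs no separate
treatment. -/
theorem exists_real_between {n : ℕ} {s : ℝ≥0∞} (h : (n : ℝ≥0∞) < s) :
    ∃ r : ℝ, (n : ℝ) < r ∧ ENNReal.ofReal r ≤ s := by
  rcases eq_or_ne s ⊤ with rfl | hs
  · exact ⟨n + 1, by linarith, le_top⟩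
  · refine ⟨s.toReal, ?_, ENNReal.ofReal_toReal_le⟩
    have := (ENNReal.toReal_lt_toReal (ENNReal.natCast_ne_top n) hs).2 h
    simpa using this

/-- Coefficients are bounded by 2^d times the Mahler measure, so the density decays like ‖c‖^(-r),
and d + k < r suffices in dimension d. -/
theorem integrable_pow_mul_dens {s : ℝ≥0∞} {d k : ℕ} (h : ((d + k : ℕ) : ℝ≥0∞) < s) :
    Integrable fun c : Fin d → ℝ => (1 + ‖c‖) ^ k * dens s c := by
  obtain ⟨r, hr, hrs⟩ := exists_real_between h
  have hr' : (d : ℝ) < r - k := by push_cast at hr; linarith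
  have hr0 : 0 ≤ r := le_trans (by positivity) hr.le
  have h1 := integrable_one_add_norm (E := Fin d → ℝ) (μ := volume) (r := r - k)
    (by simpa using hr')
  refine (h1.const_mul ((1 + 2 ^ d) ^ r)).mono'
    (Measurable.aestronglyMeasurable (by have := measurable_dens s d; fun_prop))
    (Eventually.of_forall fun c => ?_)
  have hM := one_le_mahlerMeasure c
  have hn : 0 < 1 + ‖c‖ := by positivity
  rw [Real.norm_of_nonneg (mul_nonneg (by positivity) (dens_nonneg s c))]
  have h2 : 1 + ‖c‖ ≤ (1 + 2 ^ d) * (monicPoly c).mahlerMeasure := by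
    have := norm_le_mahlerMeasure c
    linarith
  have h3 : dens s c ≤ (1 + 2 ^ d) ^ r * (1 + ‖c‖) ^ (-r) := by
    refine (invPow_le_rpow hrs hM).trans ?_
    rw [Real.rpow_neg (by positivity), Real.rpow_neg (by positivity), ← div_eq_mul_inv,
      ← one_div, div_le_div_iff₀ (by positivity) (by positivity), one_mul,
      ← Real.mul_rpow (by positivity) (by positivity)]
    exact Real.rpow_le_rpow hn.le h2 hr0
  calc (1 + ‖c‖) ^ k * dens s c ≤ (1 + ‖c‖) ^ k * ((1 + 2 ^ d) ^ r * (1 + ‖c‖) ^ (-r)) := by gcongr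
    _ = (1 + 2 ^ d) ^ r * (1 + ‖c‖) ^ (-(r - k)) := by
      rw [← Real.rpow_natCast (1 + ‖c‖) k, mul_left_comm, ← Real.rpow_add hn]
      congr 2; ring

theorem integrable_dens {s : ℝ≥0∞} {d : ℕ} (h : (d : ℝ≥0∞) < s) :
    Integrable (dens s : (Fin d → ℝ) → ℝ) := by
  have := integrable_pow_mul_dens (d := d) (k := 0) (s := s) (by simpa using h)
  simpa using this

/-- Small coefficients keep all roots in the closed unit disk, where the Mahler measure is 1. Hence
the normalising integral is positive. -/
theorem dens_eq_one_of_norm_lt (s : ℝ≥0∞) {d : ℕ} {c : Fin d → ℝ} (hc : ‖c‖ < 1 / (d + 1)) :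
    dens s c = 1 := by
  have key : ∀ z ∈ (monicPoly c).roots, max 1 ‖z‖ = 1 := by
    intro z hz
    refine max_eq_left ?_
    by_contra! hz1
    rw [mem_roots (monicPoly_ne_zero c), IsRoot.def, ← ev, ev_eq] at hz
    have h1 : ‖z‖ ^ d ≤ ∑ i : Fin d, ‖c‖ * ‖z‖ ^ d := by
      have h0 : ‖z‖ ^ d = ‖∑ i : Fin d, (c i : ℂ) * z ^ (i : ℕ)‖ := by
        rw [← norm_pow, eq_neg_of_add_eq_zero_left hz, norm_neg]
      refine h0.trans_le ?_
      refine (norm_sum_le _ _).trans (Finset.sum_le_sum fun i _ => ?_)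
      rw [norm_mul, norm_pow, Complex.norm_real]
      gcongr
      · exact norm_le_pi_norm c i
      · exact hz1.le
      · exact i.2.le
    rw [Finset.sum_const, Finset.card_univ, Fintype.card_fin, nsmul_eq_mul] at h1
    have h2 : 0 < ‖z‖ ^ d := by positivity
    have h3 : (d : ℝ) * ‖c‖ < 1 := by
      rw [lt_div_iff₀ (by positivity)] at hc
      nlinarith [norm_nonneg c]
    nlinarith
  rw [dens, mahlerMeasure_eq_leadingCoeff_mul_prod_roots, (monic_monicPoly c).leadingCoeff,
    Multiset.map_congr rfl key]
  simp [invPow_one]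

theorem integral_dens_pos {s : ℝ≥0∞} {d : ℕ} (h : (d : ℝ≥0∞) < s) :
    0 < ∫ c : Fin d → ℝ, dens s c := by
  refine (integral_pos_iff_support_of_nonneg (fun c => dens_nonneg s c) (integrable_dens h)).2 ?_
  refine (Metric.measure_ball_pos volume (0 : Fin d → ℝ)
    (show (0 : ℝ) < 1 / (d + 1) by positivity)).trans_le (measure_mono fun c hc => ?_)
  rw [mem_ball_zero_iff] at hc
  rw [Function.mem_support, dens_eq_one_of_norm_lt s hc]
  exact one_ne_zero

theorem norm_ev_le {d : ℕ} (c : Fin d → ℝ) (z : ℂ) :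
    ‖ev c z‖ ≤ (d + 1) * max 1 ‖z‖ ^ d * (1 + ‖c‖) := by
  have hm := le_max_left 1 ‖z‖
  have hz := le_max_right 1 ‖z‖
  have h1 : ‖∑ i : Fin d, (c i : ℂ) * z ^ (i : ℕ)‖ ≤ ∑ _i : Fin d, ‖c‖ * max 1 ‖z‖ ^ d := by
    refine (norm_sum_le _ _).trans (Finset.sum_le_sum fun i _ => ?_)
    rw [norm_mul, norm_pow, Complex.norm_real]
    have h2 : ‖z‖ ^ (i : ℕ) ≤ max 1 ‖z‖ ^ d :=
      (pow_le_pow_left₀ (norm_nonneg _) hz _).trans (pow_le_pow_right₀ hm i.2.le)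
    exact mul_le_mul (norm_le_pi_norm c i) h2 (by positivity) (norm_nonneg _)
  rw [Finset.sum_const, Finset.card_univ, Fintype.card_fin, nsmul_eq_mul] at h1
  have h3 : ‖z ^ d‖ ≤ max 1 ‖z‖ ^ d := by
    rw [norm_pow]; exact pow_le_pow_left₀ (norm_nonneg _) hz _
  rw [ev_eq]
  refine (norm_add_le _ _).trans ?_
  have h4 : 0 ≤ max 1 ‖z‖ ^ d := by positivity
  have h5 := norm_nonneg c
  have h6 : 0 ≤ (d : ℝ) := by positivity
  nlinarith [mul_nonneg h4 h5, mul_nonneg h6 h4]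

theorem measurable_ev {d : ℕ} : Measurable fun p : (Fin d → ℝ) × ℂ => ev p.1 p.2 := by
  simp only [ev_eq]
  fun_prop

theorem max_one_norm_pow_mul_weight_le {s : ℝ≥0∞} {r : ℝ} (hr : ENNReal.ofReal r ≤ s) {k : ℕ}
    (hk : (k : ℝ) ≤ r) (z : ℂ) :
    max 1 ‖z‖ ^ k * weight s z ≤ 2 ^ (r - k) * (1 + ‖z‖) ^ (-(r - k)) := by
  have hm := le_max_left 1 ‖z‖
  have hm' : 0 < max 1 ‖z‖ := by positivity
  have h1 : 1 + ‖z‖ ≤ 2 * max 1 ‖z‖ := by linarith [le_max_right 1 ‖z‖]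
  calc max 1 ‖z‖ ^ k * weight s z ≤ max 1 ‖z‖ ^ k * max 1 ‖z‖ ^ (-r) := by
        gcongr; exact invPow_le_rpow hr hm
    _ = max 1 ‖z‖ ^ (-(r - k)) := by
        rw [← Real.rpow_natCast, ← Real.rpow_add hm']; congr 1; ring
    _ ≤ ((1 + ‖z‖) / 2) ^ (-(r - k)) :=
        Real.rpow_le_rpow_of_nonpos (by positivity) (by linarith) (by linarith)
    _ = 2 ^ (r - k) * (1 + ‖z‖) ^ (-(r - k)) := by
        rw [Real.div_rpow (by positivity) (by positivity), Real.rpow_neg zero_le_two, div_inv_eq_mul,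
          mul_comm]

theorem integrable_max_pow_mul_weight {s : ℝ≥0∞} {k : ℕ} (h : ((k + 1 : ℕ) : ℝ≥0∞) < s) :
    Integrable fun x : ℝ => max 1 ‖(x : ℂ)‖ ^ k * weight s x := by
  obtain ⟨r, hr, hrs⟩ := exists_real_between h
  push_cast at hr
  have h1 := integrable_one_add_norm (E := ℝ) (μ := volume) (r := r - k) (by simp; linarith)
  refine (h1.const_mul (2 ^ (r - k))).mono' (Measurable.aestronglyMeasurable
    (by have := measurable_weight s; fun_prop)) (Eventually.of_forall fun x => ?_)
  rw [Real.norm_of_nonneg (mul_nonneg (by positivity) (weight_nonneg s _))]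
  have := max_one_norm_pow_mul_weight_le hrs (k := k) (by linarith) (x : ℂ)
  simpa only [Complex.norm_real] using this

theorem integrable_max_pow_mul_weight_sq {s : ℝ≥0∞} {k : ℕ} (h : ((k + 1 : ℕ) : ℝ≥0∞) < s) :
    Integrable fun z : ℂ => (max 1 ‖z‖ ^ k * weight s z) ^ 2 := by
  obtain ⟨r, hr, hrs⟩ := exists_real_between h
  push_cast at hr
  have h1 := integrable_one_add_norm (E := ℂ) (μ := volume) (r := 2 * (r - k))
    (by simp; linarith)
  refine (h1.const_mul ((2 ^ (r - k)) ^ 2)).mono' (Measurable.aestronglyMeasurable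
    (by have := measurable_weight s; fun_prop)) (Eventually.of_forall fun z => ?_)
  have h0 : 0 ≤ max 1 ‖z‖ ^ k * weight s z := mul_nonneg (by positivity) (weight_nonneg s _)
  rw [Real.norm_of_nonneg (by positivity)]
  have h2 := max_one_norm_pow_mul_weight_le hrs (k := k) (by linarith) z
  refine (pow_le_pow_left₀ h0 h2 2).trans (le_of_eq ?_)
  rw [mul_pow, ← Real.rpow_natCast ((1 + ‖z‖) ^ (-(r - k))) 2, ← Real.rpow_mul (by positivity)]
  congr 2; push_cast; ring

/-! ### Signs at the simple real roots -/

theorem sign_mul (a b : ℝ) : Real.sign (a * b) = Real.sign a * Real.sign b := by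
  rcases lt_trichotomy a 0 with ha | rfl | ha <;> rcases lt_trichotomy b 0 with hb | rfl | hb
  · simp [Real.sign_of_neg ha, Real.sign_of_neg hb, Real.sign_of_pos (mul_pos_of_neg_of_neg ha hb)]
  · simp
  · simp [Real.sign_of_neg ha, Real.sign_of_pos hb, Real.sign_of_neg (mul_neg_of_neg_of_pos ha hb)]
  · simp
  · simp
  · simp
  · simp [Real.sign_of_pos ha, Real.sign_of_neg hb, Real.sign_of_neg (mul_neg_of_pos_of_neg ha hb)]
  · simp
  · simp [Real.sign_of_pos ha, Real.sign_of_pos hb, Real.sign_of_pos (mul_pos ha hb)]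

theorem sign_prod {ι : Type*} (s : Finset ι) (f : ι → ℝ) :
    Real.sign (∏ i ∈ s, f i) = ∏ i ∈ s, Real.sign (f i) := by
  classical
  induction s using Finset.induction_on with
  | empty => simp
  | insert a s ha ih => rw [Finset.prod_insert ha, Finset.prod_insert ha, sign_mul, ih]

theorem sign_mul_self (a : ℝ) : Real.sign a * a = |a| := by
  rcases lt_trichotomy a 0 with h | rfl | h
  · rw [Real.sign_of_neg h, abs_of_neg h]; ring
  · simp
  · rw [Real.sign_of_pos h, abs_of_pos h, one_mul]

theorem abs_mul_sign (a : ℝ) : |a| * Real.sign a = a := by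
  rcases lt_trichotomy a 0 with h | rfl | h
  · rw [Real.sign_of_neg h, abs_of_neg h]; ring
  · simp
  · rw [Real.sign_of_pos h, abs_of_pos h, mul_one]

theorem abs_sign_le (a : ℝ) : |Real.sign a| ≤ 1 := by
  rcases Real.sign_apply_eq a with h | h | h <;> rw [h] <;> norm_num

/-- In increasing order the summands alternate in sign and end with +1 at the maximum. -/
theorem sum_prod_sign (Y : Finset ℝ) :
    ∑ y ∈ Y, ∏ y' ∈ Y.erase y, Real.sign (y - y') = if Odd Y.card then 1 else 0 := by
  induction Y using Finset.induction_on_max with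
  | empty => simp
  | insert m Y hm ih =>
    have hmY : m ∉ Y := fun h => lt_irrefl _ (hm m h)
    rw [Finset.sum_insert hmY, Finset.erase_insert hmY, Finset.card_insert_of_notMem hmY]
    have h1 : ∏ y' ∈ Y, Real.sign (m - y') = 1 :=
      Finset.prod_eq_one fun y hy => Real.sign_of_pos (sub_pos.2 (hm y hy))
    have h2 : ∑ y ∈ Y, ∏ y' ∈ (insert m Y).erase y, Real.sign (y - y')
        = -∑ y ∈ Y, ∏ y' ∈ Y.erase y, Real.sign (y - y') := by
      rw [← Finset.sum_neg_distrib]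
      refine Finset.sum_congr rfl fun y hy => ?_
      rw [Finset.erase_insert_of_ne (hm y hy).ne', Finset.prod_insert (by simp [hmY]),
        Real.sign_of_neg (sub_neg.2 (hm y hy))]
      ring
    rw [h1, h2, ih]
    by_cases h : Odd Y.card <;> simp [h, Nat.odd_add_one]

/-- The sign of a real-rooted polynomial is a step function whose jump at a simple root y is twice
the sign of the derivative there; the constant is fixed by the behaviour at infinity. -/
theorem prod_sign_eq (Y : Finset ℝ) (x : ℝ) :
    ∏ y ∈ Y, Real.sign (x - y) = (if Even Y.card then 1 else 0) +
      ∑ y ∈ Y, Real.sign (x - y) * ∏ y' ∈ Y.erase y, Real.sign (y - y') := by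
  induction Y using Finset.induction_on_max with
  | empty => simp
  | insert m Y hm ih =>
    have hmY : m ∉ Y := fun h => lt_irrefl _ (hm m h)
    rw [Finset.sum_insert hmY, Finset.prod_insert hmY, Finset.erase_insert hmY,
      Finset.card_insert_of_notMem hmY]
    have h1 : ∏ y' ∈ Y, Real.sign (m - y') = 1 :=
      Finset.prod_eq_one fun y hy => Real.sign_of_pos (sub_pos.2 (hm y hy))
    have h2 : ∑ y ∈ Y, Real.sign (x - y) * ∏ y' ∈ (insert m Y).erase y, Real.sign (y - y')
        = -∑ y ∈ Y, Real.sign (x - y) * ∏ y' ∈ Y.erase y, Real.sign (y - y') := by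
      rw [← Finset.sum_neg_distrib]
      refine Finset.sum_congr rfl fun y hy => ?_
      rw [Finset.erase_insert_of_ne (hm y hy).ne', Finset.prod_insert (by simp [hmY]),
        Real.sign_of_neg (sub_neg.2 (hm y hy))]
      ring
    have h3 : ∑ y ∈ Y, Real.sign (x - y) * ∏ y' ∈ Y.erase y, Real.sign (y - y')
        = ∏ y ∈ Y, Real.sign (x - y) - if Even Y.card then 1 else 0 := by rw [ih]; ring
    have h4 : (if Even (Y.card + 1) then (1 : ℝ) else 0) = 1 - if Even Y.card then 1 else 0 := by
      by_cases h : Even Y.card <;> simp [h, Nat.even_add_one]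
    rw [h1, h2, h3, h4]
    rcases lt_or_ge x m with h | h
    · rw [Real.sign_of_neg (sub_neg.2 h)]; ring
    · have h5 : ∏ y' ∈ Y, Real.sign (x - y') = 1 :=
        Finset.prod_eq_one fun y hy => Real.sign_of_pos (sub_pos.2 ((hm y hy).trans_le h))
      rw [h5]; ring

theorem eval_pos_of_no_roots {q : ℝ[X]} (hq : q.Monic) (h : ∀ x, q.eval x ≠ 0) (x : ℝ) :
    0 < q.eval x := by
  by_contra! hx
  have hd : 0 < q.degree := by
    by_contra! hd
    rw [(Monic.natDegree_eq_zero hq).1 (natDegree_eq_zero_iff_degree_le_zero.2 hd)] at hx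
    simp at hx
    linarith
  obtain ⟨y, hy⟩ := ((q.tendsto_atTop_of_leadingCoeff_nonneg hd
    (by rw [hq.leadingCoeff]; exact zero_le_one)).eventually_ge_atTop 0).exists
  obtain ⟨w, hw⟩ := mem_range_of_exists_le_of_exists_ge q.continuous ⟨x, hx⟩ ⟨y, hy⟩
  exact h w hw

/-- For odd degree -q(-X) would also be monic without roots; both would be positive at 0, with
opposite values. -/
theorem even_natDegree_of_no_roots {q : ℝ[X]} (hq : q.Monic) (h : ∀ x, q.eval x ≠ 0) :
    Even q.natDegree := by
  by_contra hodd
  rw [Nat.not_even_iff_odd] at hodd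
  have hX : (-X : ℝ[X]).natDegree = 1 := by rw [natDegree_neg, natDegree_X]
  have hl : (-q.comp (-X)).leadingCoeff = 1 := by
    rw [leadingCoeff_neg, leadingCoeff_comp (by rw [hX]; exact one_ne_zero), hq.leadingCoeff,
      leadingCoeff_neg, leadingCoeff_X, hodd.neg_one_pow]
    norm_num
  have hm : (-q.comp (-X)).Monic := hl
  have h1 := eval_pos_of_no_roots hm (fun x => by
    rw [eval_neg, eval_comp, eval_neg, eval_X]; exact neg_ne_zero.2 (h _)) 0
  have h2 := eval_pos_of_no_roots hq h 0
  rw [eval_neg, eval_comp, eval_neg, eval_X, neg_zero] at h1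
  linarith

/-! ### Simplicity of the roots and the sign expansion of a real polynomial -/

/-- The quotient of the monic polynomial by `X - z`, at `u`. -/
noncomputable def quot {d : ℕ} (b : Fin d → ℝ) (z u : ℂ) : ℂ := (monicPoly b /ₘ (X - C z)).eval u

theorem quot_of_eq_mul {d : ℕ} {b : Fin d → ℝ} {z : ℂ} {p : ℂ[X]}
    (h : monicPoly b = (X - C z) * p) (u : ℂ) : quot b z u = p.eval u := by
  rw [quot, h, mul_divByMonic_cancel_left _ (monic_X_sub_C z)]

theorem quot_mulVec_one (x : ℝ) {d : ℕ} (h : Fin d → ℝ) (u : ℂ) :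
    quot (mulVec 1 (linFactor x) h) x u = ev h u := by
  refine quot_of_eq_mul ?_ u
  rw [monicPoly_eq, polyR_mulVec (monic_linFactor x) (natDegree_linFactor x), Polynomial.map_mul,
    linFactor, Polynomial.map_sub, map_X, map_C]
  rfl

theorem quot_mulVec_two (z : ℂ) {d : ℕ} (c : Fin d → ℝ) (u : ℂ) :
    quot (mulVec 2 (quadFactor z) c) z u = (u - conj z) * ev c u := by
  rw [quot_of_eq_mul (p := (X - C (conj z)) * monicPoly c)]
  · simp [ev]
  · rw [monicPoly_eq, polyR_mulVec (monic_quadFactor z) (natDegree_quadFactor z),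
      Polynomial.map_mul, map_quadFactor, mul_assoc]
    rfl

theorem quadFactor_conj (z : ℂ) : quadFactor (conj z) = quadFactor z := by
  simp [quadFactor, Complex.normSq_conj]

theorem quot_conj_mulVec_two (z : ℂ) {d : ℕ} (c : Fin d → ℝ) (u : ℂ) :
    quot (mulVec 2 (quadFactor z) c) (conj z) u = (u - z) * ev c u := by
  rw [← quadFactor_conj, quot_mulVec_two, Complex.conj_conj]

theorem quot_self {d : ℕ} (b : Fin d → ℝ) {z : ℂ} (hz : ev b z = 0) :
    quot b z z = (derivative (monicPoly b)).eval z := by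
  have h : (X - C z) * (monicPoly b /ₘ (X - C z)) = monicPoly b := mul_divByMonic_eq_iff_isRoot.2 hz
  conv_rhs => rw [← h]
  rw [derivative_mul, derivative_X_sub_C]
  simp [quot]

/-- The real roots. -/
noncomputable def realRoots {d : ℕ} (b : Fin d → ℝ) : Finset ℝ := (polyR b).roots.toFinset

theorem mem_realRoots {d : ℕ} {b : Fin d → ℝ} {x : ℝ} : x ∈ realRoots b ↔ ev b x = 0 := by
  rw [realRoots, Multiset.mem_toFinset, mem_roots (monic_polyR b).ne_zero, IsRoot.def, ev_ofReal,
    Complex.ofReal_eq_zero]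

/-- The root formula is applied to the indicator of a multiple root. Its Jacobian |h(x)| vanishes
exactly at multiple roots, so their number integrates to 0. -/
theorem ae_quot_realRoots_ne_zero (d : ℕ) :
    ∀ᵐ b : Fin (d + 1) → ℝ, ∀ x ∈ realRoots b, quot b x x ≠ 0 := by
  classical
  have hzero : (fun p : ℝ × (Fin d → ℝ) => |(polyR p.2).eval p.1| •
      (if quot (mulVec 1 (linFactor p.1) p.2) p.1 p.1 = 0 then (1 : ℂ) else 0)) = fun _ => 0 := by
    ext p
    rw [quot_mulVec_one, ev_ofReal]
    split_ifs with h
    · rw [Complex.ofReal_eq_zero] at h; simp [h]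
    · simp
  obtain ⟨h1, h2⟩ := integral_sum_real_roots
    (ψ := fun x b => if quot b x x = 0 then (1 : ℂ) else 0) (d := d) (by
      rw [hzero]; exact integrable_zero _ _ _)
  rw [hzero, integral_zero] at h2
  have e : (fun b : Fin (d + 1) → ℝ => ∑ x ∈ (polyR b).roots.toFinset,
      if quot b x x = 0 then (1 : ℂ) else 0) = fun b => ((∑ x ∈ (polyR b).roots.toFinset,
      if quot b x x = 0 then (1 : ℝ) else 0 : ℝ) : ℂ) := by
    ext b; push_cast
    exact Finset.sum_congr rfl fun x _ => by split_ifs <;> simp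
  rw [e] at h1 h2
  rw [integral_complex_ofReal, Complex.ofReal_eq_zero, integral_eq_zero_iff_of_nonneg
    (fun b => Finset.sum_nonneg fun x _ => by split_ifs <;> simp) (by simpa using h1.re)] at h2
  filter_upwards [h2] with b hb x hx h0
  have := (Finset.sum_eq_zero_iff_of_nonneg (fun x _ => by split_ifs <;> simp)).1 hb x hx
  rw [if_pos h0] at this
  exact one_ne_zero this

theorem ae_quot_nonrealRoots_ne_zero (d : ℕ) :
    ∀ᵐ b : Fin (d + 2) → ℝ, ∀ z ∈ nonrealRoots b, quot b z z ≠ 0 := by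
  classical
  have hzero : (fun p : ℂ × (Fin d → ℝ) => (4 * |p.1.im| * ‖ev p.2 p.1‖ ^ 2) •
      (if quot (mulVec 2 (quadFactor p.1) p.2) p.1 p.1 = 0 then (1 : ℂ) else 0)) = fun _ => 0 := by
    ext p
    rw [quot_mulVec_two]
    split_ifs with h
    · rcases mul_eq_zero.1 h with h | h
      · have : p.1.im = 0 := by
          have := congrArg Complex.im h
          simp at this
          linarith
        simp [this]
      · simp [h]
    · simp
  obtain ⟨h1, h2⟩ := integral_sum_nonreal_roots
    (ψ := fun x b => if quot b x x = 0 then (1 : ℂ) else 0) (d := d) (by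
      rw [hzero]; exact integrable_zero _ _ _)
  rw [hzero, integral_zero] at h2
  have e : (fun b : Fin (d + 2) → ℝ => ∑ x ∈ nonrealRoots b,
      if quot b x x = 0 then (1 : ℂ) else 0) = fun b => ((∑ x ∈ nonrealRoots b,
      if quot b x x = 0 then (1 : ℝ) else 0 : ℝ) : ℂ) := by
    ext b; push_cast
    exact Finset.sum_congr rfl fun x _ => by split_ifs <;> simp
  rw [e] at h1 h2
  rw [integral_complex_ofReal, Complex.ofReal_eq_zero, integral_eq_zero_iff_of_nonneg
    (fun b => Finset.sum_nonneg fun x _ => by split_ifs <;> simp) (by simpa using h1.re)] at h2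
  filter_upwards [h2] with b hb x hx h0
  have := (Finset.sum_eq_zero_iff_of_nonneg (fun x _ => by split_ifs <;> simp)).1 hb x hx
  rw [if_pos h0] at this
  exact one_ne_zero this

/-- With simple real roots the cofactor has no real root, hence is positive and of even degree; this
transfers the parity of d to the number of real roots. -/
theorem exists_eq_prod_mul {d : ℕ} {b : Fin d → ℝ} (hb : ∀ x ∈ realRoots b, quot b x x ≠ 0) :
    ∃ q : ℝ[X], q.Monic ∧ (∀ x, 0 < q.eval x) ∧ (Even d ↔ Even (realRoots b).card) ∧
      polyR b = (∏ y ∈ realRoots b, (X - C y)) * q := by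
  obtain ⟨q, h1, h2, h3⟩ := exists_prod_multiset_X_sub_C_mul (polyR b)
  have hnodup : (polyR b).roots.Nodup := by
    rw [Multiset.nodup_iff_count_le_one]
    intro x
    rw [count_roots]
    by_contra! hx
    have hx' : x ∈ realRoots b := by
      rw [realRoots, Multiset.mem_toFinset, ← Multiset.count_pos, count_roots]; omega
    refine hb x hx' ?_
    rw [quot_self b (mem_realRoots.1 hx'), monicPoly_eq, derivative_map, ← Complex.coe_algebraMap,
      eval_map_apply]
    have h4 := one_lt_rootMultiplicity_iff_isRoot (monic_polyR b).ne_zero |>.1 hx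
    rw [h4.2]
    simp
  have hprod : ((polyR b).roots.map fun a => X - C a).prod = ∏ y ∈ realRoots b, (X - C y) := by
    rw [realRoots, Finset.prod, Multiset.toFinset_val, hnodup.dedup]
  rw [hprod] at h1
  have hmon : q.Monic := by
    refine Monic.of_mul_monic_left (monic_prod_of_monic (realRoots b) (fun y => X - C y) fun y _ => monic_X_sub_C y) ?_
    rw [h1]; exact monic_polyR b
  have hne : ∀ x, q.eval x ≠ 0 := by
    intro x hx
    have : x ∈ q.roots := (mem_roots hmon.ne_zero).2 hx
    rw [h3] at this
    exact absurd this (Multiset.notMem_zero x)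
  refine ⟨q, hmon, eval_pos_of_no_roots hmon hne, ?_, h1.symm⟩
  have h4 := even_natDegree_of_no_roots hmon hne
  rw [natDegree_polyR] at h2
  have h5 : (realRoots b).card = (polyR b).roots.card := by
    rw [realRoots, Multiset.toFinset_card_of_nodup hnodup]
  have h6 := congrArg Even h2
  rw [Nat.even_add] at h6
  rw [h5, ← h6]
  simp [h4]

theorem quot_eq_prod_mul {d : ℕ} {b : Fin d → ℝ} {q : ℝ[X]}
    (h : polyR b = (∏ y ∈ realRoots b, (X - C y)) * q) {y : ℝ} (hy : y ∈ realRoots b) :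
    quot b y y = ((∏ y' ∈ (realRoots b).erase y, (y - y')) * q.eval y : ℝ) := by
  rw [quot_of_eq_mul (p := (((∏ y' ∈ (realRoots b).erase y, (X - C y')) * q).map (algebraMap ℝ ℂ)))]
  · rw [← Complex.coe_algebraMap, eval_map_apply]
    simp [eval_mul, eval_prod]
  · rw [monicPoly_eq, h, ← Finset.mul_prod_erase _ _ hy, mul_assoc, Polynomial.map_mul,
      Polynomial.map_sub, map_X, map_C, Complex.coe_algebraMap]

theorem sum_sign_quot {d : ℕ} {b : Fin d → ℝ} (hb : ∀ x ∈ realRoots b, quot b x x ≠ 0) :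
    ∑ y ∈ realRoots b, Real.sign (quot b y y).re = if Odd d then 1 else 0 := by
  obtain ⟨q, _, h2, h3, h4⟩ := exists_eq_prod_mul hb
  have h5 : (if Odd d then (1 : ℝ) else 0) = if Odd (realRoots b).card then 1 else 0 := by
    simp only [← Nat.not_even_iff_odd, h3]
  rw [h5, ← sum_prod_sign]
  refine Finset.sum_congr rfl fun y hy => ?_
  rw [quot_eq_prod_mul h4 hy, Complex.ofReal_re, sign_mul, Real.sign_of_pos (h2 y), mul_one,
    sign_prod]

theorem sign_eval_eq {d : ℕ} {b : Fin d → ℝ} (hb : ∀ x ∈ realRoots b, quot b x x ≠ 0) (x : ℝ) :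
    Real.sign ((polyR b).eval x) = (if Even d then 1 else 0) +
      ∑ y ∈ realRoots b, Real.sign (x - y) * Real.sign (quot b y y).re := by
  obtain ⟨q, _, h2, h3, h4⟩ := exists_eq_prod_mul hb
  have h5 : (if Even d then (1 : ℝ) else 0) = if Even (realRoots b).card then 1 else 0 := by
    simp only [h3]
  have h6 : (polyR b).eval x = (∏ y ∈ realRoots b, (x - y)) * q.eval x := by
    conv_lhs => rw [h4]
    simp [eval_mul, eval_prod]
  rw [h5, h6, sign_mul, Real.sign_of_pos (h2 x), mul_one, sign_prod, prod_sign_eq]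
  congr 1
  refine Finset.sum_congr rfl fun y hy => ?_
  rw [quot_eq_prod_mul h4 hy, Complex.ofReal_re, sign_mul, Real.sign_of_pos (h2 y), mul_one,
    sign_prod]

/-! ### Lagrange interpolation at the roots -/

theorem sum_roots_toFinset {d : ℕ} (b : Fin d → ℝ) (f : ℂ → ℂ) :
    ∑ z ∈ (monicPoly b).roots.toFinset, f z =
      ∑ x ∈ realRoots b, f x + ∑ z ∈ nonrealRoots b, f z := by
  classical
  rw [← Finset.sum_filter_not_add_sum_filter _ (fun z : ℂ => z.im ≠ 0)]
  congr 1
  symm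
  refine Finset.sum_bij (fun (x : ℝ) _ => (x : ℂ)) (fun x hx => ?_) (fun x _ y _ h => ?_)
    (fun z hz => ?_) (fun x _ => rfl)
  · rw [Finset.mem_filter, Multiset.mem_toFinset, mem_roots (monicPoly_ne_zero b)]
    exact ⟨mem_realRoots.1 hx, by simp⟩
  · exact Complex.ofReal_injective h
  · rw [Finset.mem_filter, Multiset.mem_toFinset, mem_roots (monicPoly_ne_zero b), not_not] at hz
    have e : ((z.re : ℝ) : ℂ) = z := Complex.ext rfl (by simp [hz.2])
    refine ⟨z.re, mem_realRoots.2 ?_, e⟩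
    rw [e]; exact hz.1

theorem nodup_roots {d : ℕ} {b : Fin d → ℝ} (hr : ∀ x ∈ realRoots b, quot b x x ≠ 0)
    (hn : ∀ z ∈ nonrealRoots b, quot b z z ≠ 0) : (monicPoly b).roots.Nodup := by
  rw [Multiset.nodup_iff_count_le_one]
  intro z
  rw [count_roots]
  by_contra! hz
  obtain ⟨h1, h2⟩ := one_lt_rootMultiplicity_iff_isRoot (monicPoly_ne_zero b) |>.1 hz
  have h3 : quot b z z = 0 := by rw [quot_self b h1]; exact h2
  by_cases h : z.im = 0
  · have e : ((z.re : ℝ) : ℂ) = z := Complex.ext rfl (by simp [h])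
    rw [← e] at h1 h3
    exact hr z.re (mem_realRoots.2 h1) h3
  · exact hn z (mem_nonrealRoots.2 ⟨h1, h⟩) h3

/-- Lagrange interpolation at d distinct roots reproduces every power below d; the basis polynomial
at z is the quotient by X - z, normalised at z. -/
theorem sum_pow_mul_quot {d : ℕ} {b : Fin d → ℝ} (hb : (monicPoly b).roots.Nodup) {l : ℕ}
    (hl : l < d) (u : ℂ) :
    ∑ z ∈ (monicPoly b).roots.toFinset, z ^ l * (quot b z u / quot b z z) = u ^ l := by
  classical
  set S := (monicPoly b).roots.toFinset with hS
  have hcard : S.card = d := by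
    rw [hS, Multiset.toFinset_card_of_nodup hb,
      splits_iff_card_roots.1 (IsAlgClosed.splits (monicPoly b)), natDegree_monicPoly]
  have hprod : monicPoly b = ∏ z ∈ S, (X - C z) := by
    rw [Finset.prod, hS, Multiset.toFinset_val, hb.dedup]
    exact (IsAlgClosed.splits (monicPoly b)).eq_prod_roots_of_monic (monic_monicPoly b)
  have hquot : ∀ z ∈ S, ∀ v, quot b z v = ∏ z' ∈ S.erase z, (v - z') := by
    intro z hz v
    rw [quot_of_eq_mul (p := ∏ z' ∈ S.erase z, (X - C z'))]
    · simp [eval_prod]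
    · rw [hprod, Finset.mul_prod_erase S (fun z => X - C z) hz]
  have h := Lagrange.eq_interpolate (s := S) (v := id) (f := (X ^ l : ℂ[X]))
    Function.injective_id.injOn (by
      rw [degree_X_pow, hcard]; exact_mod_cast hl)
  have h2 := congrArg (fun p => p.eval u) h
  simp only [eval_pow, eval_X, Lagrange.interpolate_apply, eval_finsetSum, eval_mul, eval_C, id]
    at h2
  rw [h2]
  refine Finset.sum_congr rfl fun z hz => ?_
  rw [hquot z hz, hquot z hz, ← Finset.prod_div_distrib, Lagrange.basis, eval_prod]
  congr 1
  refine Finset.prod_congr rfl fun w _ => ?_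
  simp [Lagrange.basisDivisor, div_eq_inv_mul]

theorem sum_nonrealRoots_conj {d : ℕ} (b : Fin d → ℝ) (f : ℂ → ℂ) :
    ∑ z ∈ nonrealRoots b, f (conj z) = ∑ z ∈ nonrealRoots b, f z := by
  have h : ∀ z ∈ nonrealRoots b, conj z ∈ nonrealRoots b := by
    intro z hz
    rw [mem_nonrealRoots] at hz ⊢
    rw [ev_conj, hz.1]
    simpa using hz.2
  exact Finset.sum_nbij' (fun z => conj z) (fun z => conj z) h h (fun z _ => Complex.conj_conj z)
    (fun z _ => Complex.conj_conj z) (fun z _ => rfl)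

/-! ### Moments of the characteristic polynomials -/

/-- The unnormalised second moment of the values of a random polynomial. -/
noncomputable def mom (s : ℝ≥0∞) (d : ℕ) (u v : ℂ) : ℂ :=
  ∫ c : Fin d → ℝ, ev c v * ev c u * (dens s c : ℂ)

/-- The unnormalised mean of the values of a random polynomial. -/
noncomputable def mean (s : ℝ≥0∞) (d : ℕ) (u : ℂ) : ℂ := ∫ h : Fin d → ℝ, ev h u * (dens s h : ℂ)

/-- The mean of `sgn h(x) * h(u)`. -/
noncomputable def signMean (s : ℝ≥0∞) (d : ℕ) (x : ℝ) (u : ℂ) : ℂ :=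
  ∫ h : Fin d → ℝ, (Real.sign ((polyR h).eval x) : ℂ) * (ev h u * (dens s h : ℂ))

theorem integrable_of_norm_le_mul {α β : Type*} [MeasureSpace α] [MeasureSpace β]
    [SFinite (volume : Measure α)] [SFinite (volume : Measure β)] {f : α × β → ℂ}
    {g : α → ℝ} {h : β → ℝ} (hf : Measurable f) (hg : Integrable g) (hh : Integrable h)
    (hle : ∀ p, ‖f p‖ ≤ g p.1 * h p.2) : Integrable f :=
  (hg.mul_prod hh).mono' hf.aestronglyMeasurable (Eventually.of_forall hle)

theorem measurable_ev_left {d : ℕ} (u : ℂ) : Measurable fun c : Fin d → ℝ => ev c u := by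
  simp only [ev_eq]
  fun_prop

theorem measurable_ev_swap {d : ℕ} : Measurable fun p : ℂ × (Fin d → ℝ) => ev p.2 p.1 :=
  measurable_ev.comp measurable_swap

theorem measurable_ev_real {d : ℕ} : Measurable fun p : ℝ × (Fin d → ℝ) => ev p.2 p.1 :=
  measurable_ev_swap.comp ((Complex.measurable_ofReal.comp measurable_fst).prodMk measurable_snd)

theorem measurable_eval_polyR {d : ℕ} :
    Measurable fun p : ℝ × (Fin d → ℝ) => (polyR p.2).eval p.1 := by
  simp only [eval_polyR]
  fun_prop

theorem exists_norm_ev_le (d : ℕ) (u : ℂ) :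
    ∃ K : ℝ, 0 ≤ K ∧ ∀ c : Fin d → ℝ, ‖ev c u‖ ≤ K * (1 + ‖c‖) :=
  ⟨(d + 1) * max 1 ‖u‖ ^ d, by positivity, fun c => norm_ev_le c u⟩

theorem norm_sub_le_mul_max (u z : ℂ) : ‖u - z‖ ≤ (1 + ‖u‖) * max 1 ‖z‖ := by
  have h1 := le_max_left 1 ‖z‖
  have h2 := le_max_right 1 ‖z‖
  have h3 := norm_sub_le u z
  nlinarith [norm_nonneg u]

theorem integrable_ev_mul_dens {s : ℝ≥0∞} {d : ℕ} (h : ((d + 1 : ℕ) : ℝ≥0∞) < s) (u : ℂ) :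
    Integrable fun c : Fin d → ℝ => ev c u * (dens s c : ℂ) := by
  obtain ⟨K, _, hK⟩ := exists_norm_ev_le d u
  refine ((integrable_pow_mul_dens h).const_mul K).mono' (Measurable.aestronglyMeasurable
    ((measurable_ev_left u).mul (Complex.measurable_ofReal.comp (measurable_dens s d))))
    (Eventually.of_forall fun c => ?_)
  rw [norm_mul, Complex.norm_real, Real.norm_of_nonneg (dens_nonneg s c), pow_one, ← mul_assoc]
  exact mul_le_mul_of_nonneg_right (hK c) (dens_nonneg s c)

/-- The sign of the derivative at a root turns the Jacobian |c(y)| into c(y). Absolute values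
disappear and a polynomial moment of degree d remains. -/
theorem integral_sum_real_roots_sign {s : ℝ≥0∞} {d : ℕ} (h : ((d + 2 : ℕ) : ℝ≥0∞) < s)
    {θ : ℝ → ℝ} (hθ : Measurable θ) (hθ1 : ∀ y, |θ y| ≤ 1) (u : ℂ) :
    Integrable (fun h : Fin (d + 1) → ℝ => ∑ y ∈ realRoots h,
        ((θ y * Real.sign (quot h y y).re : ℝ) : ℂ) * (ev h u * (dens s h : ℂ))) ∧
      ∫ h : Fin (d + 1) → ℝ, ∑ y ∈ realRoots h,
        ((θ y * Real.sign (quot h y y).re : ℝ) : ℂ) * (ev h u * (dens s h : ℂ)) =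
      ∫ y : ℝ, ((weight s y * θ y : ℝ) : ℂ) * ((u - y) * mom s d u y) := by
  set F : ℝ × (Fin d → ℝ) → ℂ := fun p => ((weight s p.1 * θ p.1 : ℝ) : ℂ) * ((u - p.1) *
    (ev p.2 p.1 * ev p.2 u * (dens s p.2 : ℂ))) with hF
  have hpull : (fun p : ℝ × (Fin d → ℝ) => |(polyR p.2).eval p.1| •
      (((θ p.1 * Real.sign (quot (mulVec 1 (linFactor p.1) p.2) p.1 p.1).re : ℝ) : ℂ) *
        (ev (mulVec 1 (linFactor p.1) p.2) u * (dens s (mulVec 1 (linFactor p.1) p.2) : ℂ)))) = F := by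
    ext p
    have h1 : ev (mulVec 1 (linFactor p.1) p.2) u = (u - p.1) * ev p.2 u := by
      rw [ev, monicPoly_eq, polyR_mulVec (monic_linFactor _) (natDegree_linFactor _),
        Polynomial.map_mul, linFactor]
      simp [ev, monicPoly_eq]
    rw [quot_mulVec_one, dens_mulVec_one, h1, ev_ofReal, Complex.ofReal_re, Complex.real_smul, hF]
    simp only
    rw [ev_ofReal]
    have h2 := congrArg (fun t : ℝ => (t : ℂ)) (abs_mul_sign ((polyR p.2).eval p.1))
    push_cast at h2 ⊢
    rw [← h2]
    ring
  have hint : Integrable F := by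
    obtain ⟨K, hK0, hK⟩ := exists_norm_ev_le d u
    have hw := integrable_max_pow_mul_weight (s := s) (k := d + 1) h
    refine integrable_of_norm_le_mul (g := fun y => ((1 + ‖u‖) * (d + 1) * K) *
      (max 1 ‖(y : ℂ)‖ ^ (d + 1) * weight s y)) (h := fun c => (1 + ‖c‖) ^ 2 * dens s c) ?_
      (hw.const_mul _) (integrable_pow_mul_dens h) (fun p => ?_)
    · have h1 := measurable_weight s
      have h2 := measurable_dens s d
      have h3 := measurable_ev_real (d := d)
      have h4 := measurable_ev_left (d := d) u
      have h5 : Measurable fun p : ℝ × (Fin d → ℝ) => weight s (p.1 : ℂ) * θ p.1 := by fun_prop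
      refine (Complex.measurable_ofReal.comp h5).mul (Measurable.mul (by fun_prop) ?_)
      exact (h3.mul (h4.comp measurable_snd)).mul (by fun_prop)
    · have hw0 := weight_nonneg s (p.1 : ℂ)
      have hd0 := dens_nonneg s p.2
      simp only [hF, norm_mul, Complex.norm_real, Real.norm_eq_abs, abs_of_nonneg hw0,
        abs_of_nonneg hd0]
      calc weight s p.1 * |θ p.1| * (‖u - p.1‖ * (‖ev p.2 p.1‖ * ‖ev p.2 u‖ * dens s p.2))
          ≤ weight s p.1 * 1 * (((1 + ‖u‖) * max 1 ‖(p.1 : ℂ)‖) *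
            (((d + 1) * max 1 ‖(p.1 : ℂ)‖ ^ d * (1 + ‖p.2‖)) * (K * (1 + ‖p.2‖)) * dens s p.2)) := by
            gcongr
            · exact hθ1 _
            · exact norm_sub_le_mul_max u p.1
            · exact norm_ev_le p.2 p.1
            · exact hK p.2
        _ = _ := by rw [Complex.norm_real, Real.norm_eq_abs]; ring
  obtain ⟨h1, h2⟩ := integral_sum_real_roots (d := d) (ψ := fun y h =>
    ((θ y * Real.sign (quot h y y).re : ℝ) : ℂ) * (ev h u * (dens s h : ℂ)))
    (by rw [hpull]; exact hint)
  refine ⟨h1, h2.trans ?_⟩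
  rw [hpull, Measure.volume_eq_prod, integral_prod _ hint]
  refine integral_congr_ae (Eventually.of_forall fun y => ?_)
  simp only [hF, integral_const_mul]
  rfl

/-- The sign at x is expanded over the real roots by `sign_eval_eq`, and each root is integrated
out. -/
theorem signMean_eq {s : ℝ≥0∞} {d : ℕ} (h : ((d + 2 : ℕ) : ℝ≥0∞) < s) (x : ℝ) (u : ℂ) :
    signMean s (d + 1) x u = (if Even (d + 1) then mean s (d + 1) u else 0) +
      ∫ y : ℝ, ((weight s y * Real.sign (x - y) : ℝ) : ℂ) * ((u - y) * mom s d u y) := by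
  obtain ⟨h1, h2⟩ := integral_sum_real_roots_sign h (θ := fun y => Real.sign (x - y))
    (measurable_sign.comp (measurable_const.sub measurable_id)) (fun y => abs_sign_le _) u
  have h3 : Integrable fun h : Fin (d + 1) → ℝ => if Even (d + 1) then ev h u * (dens s h : ℂ) else 0 := by
    split_ifs
    · exact integrable_ev_mul_dens h u
    · exact integrable_zero _ _ _
  have h4 : (if Even (d + 1) then mean s (d + 1) u else 0) =
      ∫ h : Fin (d + 1) → ℝ, if Even (d + 1) then ev h u * (dens s h : ℂ) else 0 := by
    split_ifs
    · rfl
    · simp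
  rw [← h2, h4, ← integral_add h3 h1, signMean]
  refine integral_congr_ae ?_
  filter_upwards [ae_quot_realRoots_ne_zero d] with h hh
  rw [sign_eval_eq hh x, ← Finset.sum_mul]
  push_cast
  split_ifs <;> simp [add_mul]

/-- The same computation with the total sum of the signs, which is 1 in odd degree and 0 in even
degree. The vanishing in even degree becomes the last row of the bordered system. -/
theorem mean_eq {s : ℝ≥0∞} {d : ℕ} (h : ((d + 2 : ℕ) : ℝ≥0∞) < s) (u : ℂ) :
    (if Odd (d + 1) then mean s (d + 1) u else 0) =
      ∫ y : ℝ, (weight s y : ℂ) * ((u - y) * mom s d u y) := by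
  obtain ⟨h1, h2⟩ := integral_sum_real_roots_sign h (θ := fun y => 1) measurable_const
    (fun y => by simp) u
  simp only [mul_one, one_mul] at h2
  rw [← h2]
  have h4 : (if Odd (d + 1) then mean s (d + 1) u else 0) =
      ∫ h : Fin (d + 1) → ℝ, if Odd (d + 1) then ev h u * (dens s h : ℂ) else 0 := by
    split_ifs
    · rfl
    · simp
  rw [h4]
  refine integral_congr_ae ?_
  filter_upwards [ae_quot_realRoots_ne_zero d] with h hh
  have h5 := congrArg (fun t : ℝ => (t : ℂ)) (sum_sign_quot hh)
  push_cast at h5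
  rw [← Finset.sum_mul, h5]
  split_ifs <;> simp

/-- The Jacobian |h(x)| over the Lagrange denominator h(x) leaves sgn h(x). -/
theorem integral_sum_real_roots_lagrange {s : ℝ≥0∞} {d : ℕ} (h : ((d + 2 : ℕ) : ℝ≥0∞) < s)
    {l : ℕ} (hl : l < d + 2) (u : ℂ) :
    Integrable (fun b : Fin (d + 2) → ℝ => ∑ x ∈ realRoots b,
        (x : ℂ) ^ l * (quot b x u / quot b x x) * (dens s b : ℂ)) ∧
      ∫ b : Fin (d + 2) → ℝ, ∑ x ∈ realRoots b,
        (x : ℂ) ^ l * (quot b x u / quot b x x) * (dens s b : ℂ) =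
      ∫ x : ℝ, wMon s l x * signMean s (d + 1) x u := by
  set F : ℝ × (Fin (d + 1) → ℝ) → ℂ := fun p => wMon s l p.1 *
    ((Real.sign ((polyR p.2).eval p.1) : ℂ) * (ev p.2 u * (dens s p.2 : ℂ))) with hF
  have hpull : (fun p : ℝ × (Fin (d + 1) → ℝ) => |(polyR p.2).eval p.1| •
      ((p.1 : ℂ) ^ l * (quot (mulVec 1 (linFactor p.1) p.2) p.1 u /
        quot (mulVec 1 (linFactor p.1) p.2) p.1 p.1) *
        (dens s (mulVec 1 (linFactor p.1) p.2) : ℂ))) = F := by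
    ext p
    rw [quot_mulVec_one, quot_mulVec_one, dens_mulVec_one, ev_ofReal, Complex.real_smul, hF]
    simp only [wMon]
    rcases eq_or_ne ((polyR p.2).eval p.1) 0 with h0 | h0
    · simp [h0]
    · have h2 := congrArg (fun t : ℝ => (t : ℂ)) (sign_mul_self ((polyR p.2).eval p.1))
      have h3 : (((polyR p.2).eval p.1 : ℝ) : ℂ) ≠ 0 := by exact_mod_cast h0
      push_cast at h2 ⊢
      rw [← h2]
      field_simp
  have hint : Integrable F := by
    obtain ⟨K, hK0, hK⟩ := exists_norm_ev_le (d + 1) u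
    have hw := integrable_max_pow_mul_weight (s := s) (k := d + 1) h
    refine integrable_of_norm_le_mul (g := fun y => K *
      (max 1 ‖(y : ℂ)‖ ^ (d + 1) * weight s y)) (h := fun c => (1 + ‖c‖) ^ 1 * dens s c) ?_
      (hw.const_mul _) (integrable_pow_mul_dens h) (fun p => ?_)
    · have h1 := measurable_weight s
      have h2 := measurable_dens s (d + 1)
      have h3 := measurable_eval_polyR (d := d + 1)
      have h4 := measurable_ev_left (d := d + 1) u
      have h5 := measurable_sign.comp h3
      simp only [hF, wMon]
      refine Measurable.mul (by fun_prop) ((Complex.measurable_ofReal.comp h5).mul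
        ((h4.comp measurable_snd).mul (by fun_prop)))
    · have hw0 := weight_nonneg s (p.1 : ℂ)
      have hd0 := dens_nonneg s p.2
      have hm := le_max_left 1 ‖(p.1 : ℂ)‖
      simp only [hF, wMon, norm_mul, norm_pow, Complex.norm_real (weight _ _),
        Complex.norm_real (dens _ _), Complex.norm_real (Real.sign _), Real.norm_eq_abs,
        abs_of_nonneg hw0, abs_of_nonneg hd0]
      calc ‖(p.1 : ℂ)‖ ^ l * weight s p.1 * (|Real.sign ((polyR p.2).eval p.1)| *
            (‖ev p.2 u‖ * dens s p.2))
          ≤ max 1 ‖(p.1 : ℂ)‖ ^ (d + 1) * weight s p.1 * (1 * ((K * (1 + ‖p.2‖)) * dens s p.2)) := by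
            gcongr
            · exact (pow_le_pow_left₀ (norm_nonneg _) (le_max_right _ _) l).trans
                (pow_le_pow_right₀ hm (by omega))
            · exact abs_sign_le _
            · exact hK p.2
        _ = _ := by ring
  obtain ⟨h1, h2⟩ := integral_sum_real_roots (d := d + 1) (ψ := fun x b =>
    (x : ℂ) ^ l * (quot b x u / quot b x x) * (dens s b : ℂ)) (by rw [hpull]; exact hint)
  refine ⟨h1, h2.trans ?_⟩
  rw [hpull, Measure.volume_eq_prod, integral_prod _ hint]
  refine integral_congr_ae (Eventually.of_forall fun y => ?_)
  simp only [hF, integral_const_mul]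
  rfl

/-- Conjugate roots are used so that z̄^l appears as in `skewComplex`. The Jacobian 4|Im z||c(z)|²
over the denominator (z̄ - z) times the conjugate of c(z) equals 2i sgn(Im z) c(z). -/
theorem integral_sum_nonreal_roots_lagrange {s : ℝ≥0∞} {d : ℕ} (h : ((d + 2 : ℕ) : ℝ≥0∞) < s)
    {l : ℕ} (hl : l < d + 2) (u : ℂ) :
    Integrable (fun b : Fin (d + 2) → ℝ => ∑ z ∈ nonrealRoots b,
        (conj z) ^ l * (quot b (conj z) u / quot b (conj z) (conj z)) * (dens s b : ℂ)) ∧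
      ∫ b : Fin (d + 2) → ℝ, ∑ z ∈ nonrealRoots b,
        (conj z) ^ l * (quot b (conj z) u / quot b (conj z) (conj z)) * (dens s b : ℂ) =
      -2 * Complex.I * ∫ z : ℂ, (weight s z ^ 2 : ℝ) * (conj z) ^ l * ((z - u) * mom s d u z) *
        (Real.sign z.im : ℝ) := by
  set F : ℂ × (Fin d → ℝ) → ℂ := fun p => (-2 * Complex.I) * ((weight s p.1 ^ 2 : ℝ) *
    (conj p.1) ^ l * ((p.1 - u) * (ev p.2 p.1 * ev p.2 u * (dens s p.2 : ℂ))) *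
        (Real.sign p.1.im : ℝ)) with hF
  have hpull : (fun p : ℂ × (Fin d → ℝ) => (4 * |p.1.im| * ‖ev p.2 p.1‖ ^ 2) •
      ((conj p.1) ^ l * (quot (mulVec 2 (quadFactor p.1) p.2) (conj p.1) u /
        quot (mulVec 2 (quadFactor p.1) p.2) (conj p.1) (conj p.1)) *
        (dens s (mulVec 2 (quadFactor p.1) p.2) : ℂ))) = F := by
    ext p
    rw [quot_conj_mulVec_two, quot_conj_mulVec_two, dens_mulVec_two, ev_conj, Complex.real_smul, hF]
    simp only
    rcases eq_or_ne p.1.im 0 with hy | hy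
    · simp [hy]
    rcases eq_or_ne (ev p.2 p.1) 0 with h0 | h0
    · simp [h0]
    · have h1 : conj p.1 - p.1 = -2 * Complex.I * p.1.im := by
        have := Complex.sub_conj p.1
        push_cast at this
        linear_combination -this
      have h2 := congrArg (fun t : ℝ => (t : ℂ)) (sign_mul_self p.1.im)
      have h3 : (p.1.im : ℂ) ≠ 0 := by exact_mod_cast hy
      have h4 : conj (ev p.2 p.1) ≠ 0 := by simpa using h0
      have h5 : ((‖ev p.2 p.1‖ : ℝ) : ℂ) ^ 2 = ev p.2 p.1 * conj (ev p.2 p.1) := by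
        rw [Complex.mul_conj, Complex.normSq_eq_norm_sq]; push_cast; rfl
      push_cast at h2 ⊢
      rw [h1, h5, ← h2]
      have hI := Complex.I_ne_zero
      field_simp
      rw [Complex.I_sq]
      ring
  have hint : Integrable F := by
    obtain ⟨K, hK0, hK⟩ := exists_norm_ev_le d u
    have hw := integrable_max_pow_mul_weight_sq (s := s) (k := d + 1) h
    refine integrable_of_norm_le_mul (g := fun z => (2 * (1 + ‖u‖) * (d + 1) * K) *
      (max 1 ‖z‖ ^ (d + 1) * weight s z) ^ 2) (h := fun c => (1 + ‖c‖) ^ 2 * dens s c) ?_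
      (hw.const_mul _) (integrable_pow_mul_dens h) (fun p => ?_)
    · have h1 := measurable_weight s
      have h2 := measurable_dens s d
      have h3 := measurable_ev_swap (d := d)
      have h4 := measurable_ev_left (d := d) u
      have h5 : Measurable fun p : ℂ × (Fin d → ℝ) => Real.sign p.1.im :=
        measurable_sign.comp (Complex.measurable_im.comp measurable_fst)
      have h6 : Measurable fun p : ℂ × (Fin d → ℝ) => conj p.1 :=
        Complex.continuous_conj.measurable.comp measurable_fst
      have h7 : Measurable fun p : ℂ × (Fin d → ℝ) => ev p.2 u := h4.comp measurable_snd
      refine measurable_const.mul (Measurable.mul (Measurable.mul (Measurable.mul (by fun_prop)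
        (h6.pow_const l)) (Measurable.mul (by fun_prop) ((h3.mul h7).mul (by fun_prop))))
        (Complex.measurable_ofReal.comp h5))
    · have hw0 := weight_nonneg s p.1
      have hd0 := dens_nonneg s p.2
      have hm := le_max_left 1 ‖p.1‖
      simp only [hF, norm_mul, norm_pow, norm_neg, Complex.norm_real, Real.norm_eq_abs,
        abs_of_nonneg hw0, abs_of_nonneg hd0, RCLike.norm_conj, Complex.norm_I,
        Complex.norm_ofNat, mul_one]
      calc 2 * (weight s p.1 ^ 2 * ‖p.1‖ ^ l * (‖p.1 - u‖ *
            (‖ev p.2 p.1‖ * ‖ev p.2 u‖ * dens s p.2)) * |Real.sign p.1.im|)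
          ≤ 2 * (weight s p.1 ^ 2 * max 1 ‖p.1‖ ^ (d + 1) * (((1 + ‖u‖) * max 1 ‖p.1‖) *
            (((d + 1) * max 1 ‖p.1‖ ^ d * (1 + ‖p.2‖)) * (K * (1 + ‖p.2‖)) * dens s p.2)) * 1) := by
            gcongr
            · exact (pow_le_pow_left₀ (norm_nonneg _) (le_max_right _ _) l).trans
                (pow_le_pow_right₀ hm (by omega))
            · rw [norm_sub_rev]; exact norm_sub_le_mul_max u p.1
            · exact norm_ev_le p.2 p.1
            · exact hK p.2
            · exact abs_sign_le _
        _ = _ := by ring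
  obtain ⟨h1, h2⟩ := integral_sum_nonreal_roots (d := d) (ψ := fun z b =>
    (conj z) ^ l * (quot b (conj z) u / quot b (conj z) (conj z)) * (dens s b : ℂ))
    (by rw [hpull]; exact hint)
  refine ⟨h1, h2.trans ?_⟩
  rw [hpull, Measure.volume_eq_prod, integral_prod _ hint, ← integral_const_mul]
  refine integral_congr_ae (Eventually.of_forall fun y => ?_)
  simp only [hF, integral_const_mul, integral_mul_const]
  rfl

/-- Lagrange interpolation of X^l at the almost surely simple roots, integrated against the density.
This single identity, for all l and u, determines the moments. -/
theorem pow_mul_integral_dens {s : ℝ≥0∞} {d : ℕ} (h : ((d + 2 : ℕ) : ℝ≥0∞) < s)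
    {l : ℕ} (hl : l < d + 2) (u : ℂ) :
    u ^ l * ((∫ b : Fin (d + 2) → ℝ, dens s b : ℝ) : ℂ) =
      (∫ x : ℝ, wMon s l x * signMean s (d + 1) x u) +
      -2 * Complex.I * ∫ z : ℂ, (weight s z ^ 2 : ℝ) * (conj z) ^ l * ((z - u) * mom s d u z) *
        (Real.sign z.im : ℝ) := by
  obtain ⟨h1, h2⟩ := integral_sum_real_roots_lagrange h hl u
  obtain ⟨h3, h4⟩ := integral_sum_nonreal_roots_lagrange h hl u
  rw [← h2, ← h4, ← integral_add h1 h3, ← integral_complex_ofReal, ← integral_const_mul]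
  refine integral_congr_ae ?_
  filter_upwards [ae_quot_realRoots_ne_zero (d + 1), ae_quot_nonrealRoots_ne_zero d] with b hr hn
  rw [sum_nonrealRoots_conj b (fun z => z ^ l * (quot b z u / quot b z z) * (dens s b : ℂ)),
    ← sum_roots_toFinset b (fun z => z ^ l * (quot b z u / quot b z z) * (dens s b : ℂ)),
    ← Finset.sum_mul, sum_pow_mul_quot (nodup_roots hr hn) hl]

/-! ### The coefficients of the kernel as moments -/

/-- All coefficients of the monic polynomial with lower coefficients `c`. -/
noncomputable def allCoeff {d : ℕ} (c : Fin d → ℝ) : Fin (d + 1) → ℝ := Fin.snoc (α := fun _ => ℝ) c 1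

theorem ev_eq_sum_allCoeff {d : ℕ} (c : Fin d → ℝ) (z : ℂ) :
    ev c z = ∑ i : Fin (d + 1), (allCoeff c i : ℂ) * z ^ (i : ℕ) := by
  rw [ev_eq, Fin.sum_univ_castSucc, add_comm]
  simp [allCoeff]

theorem abs_allCoeff_le {d : ℕ} (c : Fin d → ℝ) (i : Fin (d + 1)) : |allCoeff c i| ≤ 1 + ‖c‖ := by
  refine Fin.lastCases ?_ (fun j => ?_) i
  · simp [allCoeff]
  · simp only [allCoeff, Fin.snoc_castSucc]
    have := norm_le_pi_norm c j
    rw [Real.norm_eq_abs] at this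
    linarith

theorem measurable_allCoeff {d : ℕ} (i : Fin (d + 1)) :
    Measurable fun c : Fin d → ℝ => allCoeff c i := by
  refine Fin.lastCases ?_ (fun j => ?_) i
  · simp [allCoeff]
  · simp only [allCoeff, Fin.snoc_castSucc]
    exact measurable_pi_apply j

theorem integrable_allCoeff_mul_dens {s : ℝ≥0∞} {d : ℕ} (h : ((d + 1 : ℕ) : ℝ≥0∞) < s)
    (i : Fin (d + 1)) : Integrable fun c : Fin d → ℝ => allCoeff c i * dens s c := by
  refine (integrable_pow_mul_dens h).mono' (Measurable.aestronglyMeasurable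
    ((measurable_allCoeff i).mul (measurable_dens s d))) (Eventually.of_forall fun c => ?_)
  rw [norm_mul, Real.norm_of_nonneg (dens_nonneg s c), pow_one]
  exact mul_le_mul_of_nonneg_right (abs_allCoeff_le c i) (dens_nonneg s c)

theorem integrable_allCoeff_mul_allCoeff_mul_dens {s : ℝ≥0∞} {d : ℕ}
    (h : ((d + 2 : ℕ) : ℝ≥0∞) < s) (i j : Fin (d + 1)) :
    Integrable fun c : Fin d → ℝ => allCoeff c i * allCoeff c j * dens s c := by
  refine (integrable_pow_mul_dens h).mono' (Measurable.aestronglyMeasurable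
    (((measurable_allCoeff i).mul (measurable_allCoeff j)).mul (measurable_dens s d)))
    (Eventually.of_forall fun c => ?_)
  rw [norm_mul, Real.norm_of_nonneg (dens_nonneg s c), norm_mul, sq]
  exact mul_le_mul_of_nonneg_right (mul_le_mul (abs_allCoeff_le c i) (abs_allCoeff_le c j)
    (abs_nonneg _) (by positivity)) (dens_nonneg s c)

theorem mean_eq_sum {s : ℝ≥0∞} {d : ℕ} (h : ((d + 1 : ℕ) : ℝ≥0∞) < s) (u : ℂ) :
    mean s d u = ∑ i : Fin (d + 1), ((∫ c : Fin d → ℝ, allCoeff c i * dens s c : ℝ) : ℂ) *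
      u ^ (i : ℕ) := by
  have e : ∀ c : Fin d → ℝ, ev c u * (dens s c : ℂ) =
      ∑ i : Fin (d + 1), ((allCoeff c i * dens s c : ℝ) : ℂ) * u ^ (i : ℕ) := by
    intro c
    rw [ev_eq_sum_allCoeff, Finset.sum_mul]
    refine Finset.sum_congr rfl fun i _ => ?_
    push_cast; ring
  simp only [mean, e]
  rw [integral_finsetSum _ fun i _ => ((integrable_allCoeff_mul_dens h i).ofReal).mul_const _]
  refine Finset.sum_congr rfl fun i _ => ?_
  rw [integral_mul_const, integral_complex_ofReal]

theorem mom_eq_sum {s : ℝ≥0∞} {d : ℕ} (h : ((d + 2 : ℕ) : ℝ≥0∞) < s) (u z : ℂ) :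
    mom s d u z = ∑ p : Fin (d + 1) × Fin (d + 1),
      ((∫ c : Fin d → ℝ, allCoeff c p.1 * allCoeff c p.2 * dens s c : ℝ) : ℂ) *
      (z ^ (p.1 : ℕ) * u ^ (p.2 : ℕ)) := by
  have e : ∀ c : Fin d → ℝ, ev c z * ev c u * (dens s c : ℂ) =
      ∑ p : Fin (d + 1) × Fin (d + 1), ((allCoeff c p.1 * allCoeff c p.2 * dens s c : ℝ) : ℂ) *
      (z ^ (p.1 : ℕ) * u ^ (p.2 : ℕ)) := by
    intro c
    rw [ev_eq_sum_allCoeff, ev_eq_sum_allCoeff, Finset.sum_mul_sum, Fintype.sum_prod_type,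
      Finset.sum_mul]
    refine Finset.sum_congr rfl fun i _ => ?_
    rw [Finset.sum_mul]
    refine Finset.sum_congr rfl fun j _ => ?_
    push_cast; ring
  simp only [mom, e]
  rw [integral_finsetSum _ fun p _ =>
    ((integrable_allCoeff_mul_allCoeff_mul_dens h p.1 p.2).ofReal).mul_const _]
  refine Finset.sum_congr rfl fun p _ => ?_
  rw [integral_mul_const, integral_complex_ofReal]

theorem mom_comm (s : ℝ≥0∞) (d : ℕ) (u v : ℂ) : mom s d u v = mom s d v u := by
  simp only [mom, mul_comm (ev _ v)]

/-- The moment has degree at most d in each variable, and the factor z - u raises this to d + 1, so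
monomials of degree below d + 2 suffice. -/
theorem exists_sum_eq_sub_mul_mom {s : ℝ≥0∞} {d : ℕ} (h : ((d + 2 : ℕ) : ℝ≥0∞) < s) :
    ∃ q : Fin (d + 2) → Fin (d + 2) → ℂ, ∀ z u : ℂ, (z - u) * mom s d u z =
      ∑ n : Fin (d + 2), ∑ m : Fin (d + 2), q n m * (z ^ (n : ℕ) * u ^ (m : ℕ)) := by
  set V := Submodule.span ℂ (Set.range fun (p : Fin (d + 2) × Fin (d + 2)) =>
    fun (z u : ℂ) => z ^ (p.1 : ℕ) * u ^ (p.2 : ℕ)) with hV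
  have hmem : (fun z u : ℂ => (z - u) * mom s d u z) ∈ V := by
    have e : (fun z u : ℂ => (z - u) * mom s d u z) = ∑ p : Fin (d + 1) × Fin (d + 1),
        ((∫ c : Fin d → ℝ, allCoeff c p.1 * allCoeff c p.2 * dens s c : ℝ) : ℂ) •
        ((fun z u : ℂ => z ^ ((p.1.succ : Fin (d + 2)) : ℕ) * u ^ ((p.2.castSucc : Fin (d + 2)) : ℕ)) -
        (fun z u : ℂ => z ^ ((p.1.castSucc : Fin (d + 2)) : ℕ) * u ^ ((p.2.succ : Fin (d + 2)) : ℕ))) := by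
      ext z u
      rw [mom_eq_sum h, Finset.mul_sum]
      simp only [Finset.sum_apply, Pi.smul_apply, Pi.sub_apply, smul_eq_mul, Fin.val_succ,
        Fin.val_castSucc]
      refine Finset.sum_congr rfl fun p _ => ?_
      ring
    rw [e]
    refine Submodule.sum_mem _ fun p _ => Submodule.smul_mem _ _ (Submodule.sub_mem _
      (Submodule.subset_span ⟨(p.1.succ, p.2.castSucc), rfl⟩)
      (Submodule.subset_span ⟨(p.1.castSucc, p.2.succ), rfl⟩))
  obtain ⟨c, hc⟩ := (Submodule.mem_span_range_iff_exists_fun ℂ).1 hmem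
  refine ⟨fun n m => c (n, m), fun z u => ?_⟩
  have := congrFun (congrFun hc z) u
  rw [Finset.sum_apply, Finset.sum_apply, Fintype.sum_prod_type] at this
  exact this.symm

theorem coeff_unique {N : ℕ} {a b : Fin N → ℂ}
    (h : ∀ u : ℂ, ∑ m : Fin N, a m * u ^ (m : ℕ) = ∑ m : Fin N, b m * u ^ (m : ℕ)) : a = b := by
  have h1 : (∑ m : Fin N, C (a m) * X ^ (m : ℕ) : ℂ[X]) = ∑ m : Fin N, C (b m) * X ^ (m : ℕ) := by
    refine Polynomial.funext fun u => ?_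
    simpa [eval_finsetSum] using h u
  ext m
  have h2 := congrArg (fun p => p.coeff (m : ℕ)) h1
  simpa [finsetSum_coeff, coeff_C_mul_X_pow, Fin.val_inj] using h2

theorem skewReal_monomial_eq (s : ℝ≥0∞) (l n : ℕ) :
    skewReal s (fun z => z ^ l) (fun z => z ^ n) =
      ∫ x : ℝ, wMon s l x * ∫ y : ℝ, wMon s n y * (Real.sign (y - x) : ℝ) := by
  rw [skewReal]
  congr 1
  ext x
  rw [← integral_const_mul]
  congr 1
  ext y
  simp only [wMon]
  push_cast
  ring

theorem integrable_wMon_mul_integral {s : ℝ≥0∞} (hs : s ≠ 0) {l n : ℕ}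
    (hl : (l + 1) * tinv s < 1) :
    Integrable fun x : ℝ => wMon s l x * ∫ y : ℝ, wMon s n y * (Real.sign (y - x) : ℝ) := by
  refine (integrable_wMon s hs l hl).mul_bdd (c := ∫ y : ℝ, ‖wMon s n y‖) ?_
    (ae_of_all _ fun x => ?_)
  · refine StronglyMeasurable.aestronglyMeasurable (StronglyMeasurable.integral_prod_right
      (Measurable.stronglyMeasurable ?_))
    have h1 := measurable_weight s
    have h2 : Measurable fun p : ℝ × ℝ => Real.sign (p.2 - p.1) :=
      measurable_sign.comp (measurable_snd.sub measurable_fst)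
    simp only [Function.uncurry_def, wMon]
    fun_prop
  · refine (norm_integral_le_integral_norm _).trans ?_
    by_cases hn : Integrable fun y : ℝ => ‖wMon s n y‖
    · refine integral_mono_of_nonneg (Eventually.of_forall fun y => norm_nonneg _) hn
        (Eventually.of_forall fun y => ?_)
      simp only [norm_mul, Complex.norm_real, Real.norm_eq_abs]
      exact mul_le_of_le_one_right (norm_nonneg _) (abs_sign_le _)
    -- Without integrability both norm integrals take the default value 0; the sign has modulus 1
    -- off one point, so the two cases of non-integrability coincide.
    · have h2 : ¬ Integrable fun y : ℝ => ‖wMon s n y * (Real.sign (y - x) : ℝ)‖ := by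
        intro h
        refine hn (h.congr ?_)
        have : ∀ᵐ y : ℝ, y ≠ x := by
          rw [ae_iff]; simp
        filter_upwards [this] with y hy
        rcases Real.sign_apply_eq_of_ne_zero (y - x) (sub_ne_zero.2 hy) with h | h <;> rw [h] <;> simp
      rw [integral_undef h2, integral_undef hn]

theorem integrable_skewComplex {s : ℝ≥0∞} {N l n : ℕ} (hs : (N : ℝ≥0∞) < s) (hl : l < N)
    (hn : n < N) : Integrable fun z : ℂ => (weight s z ^ 2 : ℝ) * (conj z) ^ l * z ^ n *
      (Real.sign z.im : ℝ) := by
  obtain ⟨k, rfl⟩ : ∃ k, N = k + 1 := ⟨N - 1, by omega⟩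
  refine (integrable_max_pow_mul_weight_sq hs).mono' (Measurable.aestronglyMeasurable ?_)
    (Eventually.of_forall fun z => ?_)
  · have h1 := measurable_weight s
    have h2 : Measurable fun z : ℂ => Real.sign z.im := measurable_sign.comp Complex.measurable_im
    have h3 : Measurable fun z : ℂ => conj z := Complex.continuous_conj.measurable
    fun_prop
  · have hw0 := weight_nonneg s z
    have hm := le_max_left 1 ‖z‖
    have hb : ∀ j, j < k + 1 → ‖z‖ ^ j ≤ max 1 ‖z‖ ^ k := fun j hj =>
      (pow_le_pow_left₀ (norm_nonneg _) (le_max_right _ _) j).trans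
        (pow_le_pow_right₀ hm (by omega))
    simp only [norm_mul, norm_pow, Complex.norm_real, Real.norm_eq_abs, abs_of_nonneg hw0,
      RCLike.norm_conj]
    calc weight s z ^ 2 * ‖z‖ ^ l * ‖z‖ ^ n * |Real.sign z.im|
        ≤ weight s z ^ 2 * max 1 ‖z‖ ^ k * max 1 ‖z‖ ^ k * 1 := by
          gcongr
          · exact hb l hl
          · exact hb n hn
          · exact abs_sign_le _
      _ = _ := by ring

/-- Comparing coefficients of u in `pow_mul_integral_dens` yields U q + σ a = Z·1. The sign kernel
inside `signMean` makes the real part of U appear, the non-real roots give its complex part, and the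
mean contributes the border when d is odd. -/
theorem moment_equation {s : ℝ≥0∞} {d : ℕ} (h : ((d + 2 : ℕ) : ℝ≥0∞) < s)
    {q : Fin (d + 2) → Fin (d + 2) → ℂ} (hq : ∀ z u : ℂ, (z - u) * mom s d u z =
      ∑ n : Fin (d + 2), ∑ m : Fin (d + 2), q n m * (z ^ (n : ℕ) * u ^ (m : ℕ)))
    {a : Fin (d + 2) → ℂ} (ha : ∀ u, (if Even (d + 1) then mean s (d + 1) u else 0) =
      ∑ m : Fin (d + 2), a m * u ^ (m : ℕ)) (l m : Fin (d + 2)) :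
    (∑ n : Fin (d + 2), skewGram (d + 2) s l n * q n m) + (∫ x : ℝ, wMon s l x) * a m =
      if l = m then ((∫ b : Fin (d + 2) → ℝ, dens s b : ℝ) : ℂ) else 0 := by
  have hs0 : s ≠ 0 := (pos_of_gt h).ne'
  have ht : ∀ n : Fin (d + 2), ((n : ℕ) + 1) * tinv s < 1 := fun n => succ_mul_tinv_lt_one h n.2
  have key : ∀ u : ℂ, ∑ m : Fin (d + 2), ((∑ n : Fin (d + 2), skewGram (d + 2) s l n * q n m) +
      (∫ x : ℝ, wMon s l x) * a m) * u ^ (m : ℕ) =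
      ∑ m : Fin (d + 2), (if l = m then ((∫ b : Fin (d + 2) → ℝ, dens s b : ℝ) : ℂ) else 0) *
        u ^ (m : ℕ) := by
    intro u
    have hsign : ∀ x : ℝ, signMean s (d + 1) x u = ∑ m : Fin (d + 2), a m * u ^ (m : ℕ) +
        ∑ n : Fin (d + 2), (∑ m : Fin (d + 2), q n m * u ^ (m : ℕ)) *
          ∫ y : ℝ, wMon s n y * (Real.sign (y - x) : ℝ) := by
      intro x
      rw [signMean_eq h, ha]
      congr 1
      have e : ∀ y : ℝ, ((weight s y * Real.sign (x - y) : ℝ) : ℂ) * ((u - y) * mom s d u y) =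
          ∑ n : Fin (d + 2), (∑ m : Fin (d + 2), q n m * u ^ (m : ℕ)) *
            (wMon s n y * (Real.sign (y - x) : ℝ)) := by
        intro y
        have e1 : Real.sign (x - y) = -Real.sign (y - x) := by
          rw [← Real.sign_neg, neg_sub]
        have e2 : (u - y) * mom s d u y = -((y - u) * mom s d u y) := by ring
        rw [e1, e2, hq]
        push_cast
        rw [mul_neg, mul_neg, neg_mul, neg_neg, Finset.mul_sum]
        refine Finset.sum_congr rfl fun n _ => ?_
        rw [Finset.mul_sum, Finset.sum_mul]
        refine Finset.sum_congr rfl fun m _ => ?_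
        rw [wMon]; ring
      simp only [e]
      rw [integral_finsetSum _ fun (n : Fin (d + 2)) _ =>
        (integrable_wMon_mul_sign s hs0 n (ht n) x).const_mul _]
      simp only [integral_const_mul]
    have hreal : ∫ x : ℝ, wMon s l x * signMean s (d + 1) x u =
        (∫ x : ℝ, wMon s l x) * (∑ m : Fin (d + 2), a m * u ^ (m : ℕ)) +
        ∑ n : Fin (d + 2), (∑ m : Fin (d + 2), q n m * u ^ (m : ℕ)) *
          skewReal s (fun z => z ^ (l : ℕ)) (fun z => z ^ (n : ℕ)) := by
      simp only [hsign, mul_add, Finset.mul_sum (s := Finset.univ)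
        (f := fun n : Fin (d + 2) => (∑ m : Fin (d + 2), q n m * u ^ (m : ℕ)) * _),
        mul_left_comm (wMon s l _) (∑ m : Fin (d + 2), q _ m * u ^ (m : ℕ))]
      rw [integral_add ((integrable_wMon s hs0 l (ht l)).mul_const _)
        (integrable_finsetSum _ fun n _ => (integrable_wMon_mul_integral hs0 (ht l)).const_mul _),
        integral_mul_const, integral_finsetSum _ fun n _ =>
          (integrable_wMon_mul_integral hs0 (ht l)).const_mul _]
      simp only [integral_const_mul, skewReal_monomial_eq]
    have hcomplex : -2 * Complex.I * ∫ z : ℂ, (weight s z ^ 2 : ℝ) * (conj z) ^ (l : ℕ) *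
          ((z - u) * mom s d u z) * (Real.sign z.im : ℝ) =
        ∑ n : Fin (d + 2), (∑ m : Fin (d + 2), q n m * u ^ (m : ℕ)) *
          skewComplex s (fun z => z ^ (l : ℕ)) (fun z => z ^ (n : ℕ)) := by
      have e : ∀ z : ℂ, (weight s z ^ 2 : ℝ) * (conj z) ^ (l : ℕ) *
          ((z - u) * mom s d u z) * (Real.sign z.im : ℝ) = ∑ n : Fin (d + 2),
          (∑ m : Fin (d + 2), q n m * u ^ (m : ℕ)) *
          ((weight s z ^ 2 : ℝ) * (conj z) ^ (l : ℕ) * z ^ (n : ℕ) * (Real.sign z.im : ℝ)) := by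
        intro z
        rw [hq, Finset.mul_sum, Finset.sum_mul]
        refine Finset.sum_congr rfl fun n _ => ?_
        rw [Finset.mul_sum, Finset.sum_mul, Finset.sum_mul]
        refine Finset.sum_congr rfl fun m _ => ?_
        ring
      simp only [e]
      rw [integral_finsetSum _ fun n _ => (integrable_skewComplex h l.2 n.2).const_mul _,
        Finset.mul_sum]
      refine Finset.sum_congr rfl fun n _ => ?_
      rw [integral_const_mul, skewComplex]
      simp only [map_pow]
      ring
    have := pow_mul_integral_dens h l.2 u
    rw [hreal, hcomplex, add_assoc, ← Finset.sum_add_distrib] at this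
    simp only [ite_mul, zero_mul, Finset.sum_ite_eq, Finset.mem_univ, if_true]
    simp only [← mul_add] at this
    rw [mul_comm _ (u ^ (l : ℕ)), this]
    simp only [add_mul, Finset.sum_add_distrib]
    refine (add_comm _ _).trans (congrArg₂ (· + ·) ?_ ?_)
    · rw [Finset.mul_sum]
      refine Finset.sum_congr rfl fun m _ => ?_
      ring
    · simp only [Finset.sum_mul]
      rw [Finset.sum_comm]
      refine Finset.sum_congr rfl fun n _ => Finset.sum_congr rfl fun m _ => ?_
      rw [skewGram, Matrix.of_apply]; ring
  exact congrFun (coeff_unique key) m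

theorem orthogonality_equation {s : ℝ≥0∞} {d : ℕ} (h : ((d + 2 : ℕ) : ℝ≥0∞) < s)
    (hd : Even (d + 1)) {q : Fin (d + 2) → Fin (d + 2) → ℂ} (hq : ∀ z u : ℂ, (z - u) * mom s d u z =
      ∑ n : Fin (d + 2), ∑ m : Fin (d + 2), q n m * (z ^ (n : ℕ) * u ^ (m : ℕ))) (m : Fin (d + 2)) :
    ∑ n : Fin (d + 2), (∫ x : ℝ, wMon s n x) * q n m = 0 := by
  have hs0 : s ≠ 0 := (pos_of_gt h).ne'
  have ht : ∀ n : Fin (d + 2), ((n : ℕ) + 1) * tinv s < 1 := fun n => succ_mul_tinv_lt_one h n.2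
  have key : ∀ u : ℂ, ∑ m : Fin (d + 2), (∑ n : Fin (d + 2), (∫ x : ℝ, wMon s n x) * q n m) *
      u ^ (m : ℕ) = ∑ m : Fin (d + 2), (0 : Fin (d + 2) → ℂ) m * u ^ (m : ℕ) := by
    intro u
    have h1 := mean_eq h u
    rw [if_neg (Nat.not_odd_iff_even.2 hd)] at h1
    have e : ∀ y : ℝ, (weight s y : ℂ) * ((u - y) * mom s d u y) =
        -∑ n : Fin (d + 2), (∑ m : Fin (d + 2), q n m * u ^ (m : ℕ)) * wMon s n y := by
      intro y
      have e2 : (u - y) * mom s d u y = -((y - u) * mom s d u y) := by ring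
      rw [e2, hq, mul_neg, Finset.mul_sum]
      congr 1
      refine Finset.sum_congr rfl fun n _ => ?_
      rw [Finset.mul_sum, Finset.sum_mul]
      refine Finset.sum_congr rfl fun m _ => ?_
      rw [wMon]; ring
    simp only [e] at h1
    rw [integral_neg, integral_finsetSum _ fun (n : Fin (d + 2)) _ =>
      (integrable_wMon s hs0 n (ht n)).const_mul _, zero_eq_neg] at h1
    simp only [Pi.zero_apply, zero_mul, Finset.sum_const_zero]
    rw [← h1]
    simp only [integral_const_mul]
    simp only [Finset.sum_mul]
    rw [Finset.sum_comm]
    refine Finset.sum_congr rfl fun n _ => Finset.sum_congr rfl fun m _ => ?_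
    ring
  exact congrFun (coeff_unique key) m

/-- The moment equations, completed for odd N = d + 2 by the orthogonality relation, state that the
moment coefficients solve the system with matrix U or its bordered form; invertibility identifies
them with Z times the kernel coefficients. The minus sign at the border comes from the antisymmetry
of the inverse. -/
theorem moments_eq {s : ℝ≥0∞} {d : ℕ} (h : ((d + 2 : ℕ) : ℝ≥0∞) < s) :
    (∀ z u : ℂ, (z - u) * mom s d u z = ((∫ b : Fin (d + 2) → ℝ, dens s b : ℝ) : ℂ) *
      ∑ n : Fin (d + 2), ∑ m : Fin (d + 2),
        coeff (d + 2) s n m * (z ^ (n : ℕ) * u ^ (m : ℕ))) ∧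
    ∀ u : ℂ, (if Even (d + 1) then mean s (d + 1) u else 0) =
      -(((∫ b : Fin (d + 2) → ℝ, dens s b : ℝ) : ℂ) *
        ∑ m : Fin (d + 2), borderCoeff (d + 2) s m * u ^ (m : ℕ)) := by
  obtain ⟨q, hq⟩ := exists_sum_eq_sub_mul_mom h
  set Z : ℂ := ((∫ b : Fin (d + 2) → ℝ, dens s b : ℝ) : ℂ) with hZ
  obtain ⟨a, ha⟩ : ∃ a : Fin (d + 2) → ℂ, ∀ u,
      (if Even (d + 1) then mean s (d + 1) u else 0) = ∑ m : Fin (d + 2), a m * u ^ (m : ℕ) := by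
    by_cases hd : Even (d + 1)
    · exact ⟨_, fun u => by rw [if_pos hd]; exact mean_eq_sum h u⟩
    · exact ⟨0, fun u => by rw [if_neg hd]; simp⟩
  have hmat := moment_equation h hq ha
  have main : (∀ n m, q n m = Z * coeff (d + 2) s n m) ∧
      ∀ m, a m = -(Z * borderCoeff (d + 2) s m) := by
    by_cases hd : Even (d + 1)
    · have hN : Odd (d + 2) := hd.add_one
      have hinv := mul_eq_one_comm.1 (borderedGram_mul_eq_one h hN)
      have hB : borderedGram (d + 2) s * Matrix.fromBlocks (Matrix.of q) 0
          (Matrix.of fun _ m => a m) 0 = Matrix.fromBlocks (Matrix.of fun l m =>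
            if l = m then Z else 0) 0 0 (0 : Matrix Unit Unit ℂ) := by
        rw [borderedGram, Matrix.fromBlocks_multiply]
        congr 1
        · ext l m
          rw [Matrix.add_apply, Matrix.mul_apply, Matrix.mul_apply, Matrix.of_apply, ← hmat l m]
          simp
        · simp
        · ext _ m
          have := orthogonality_equation h hd hq m
          rw [Matrix.add_apply, Matrix.mul_apply]
          simp [this]
        · simp
      have hB2 := congrArg (fun M => borderedInv (d + 2) (tinv s) * M) hB
      simp only [← Matrix.mul_assoc] at hB2
      rw [hinv, Matrix.one_mul, borderedInv, Matrix.fromBlocks_multiply, Matrix.fromBlocks_inj] at hB2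
      refine ⟨fun n m => ?_, fun m => ?_⟩
      · have := congrFun (congrFun hB2.1 n) m
        rw [coeff_eq h]
        simpa [Matrix.mul_apply, mul_comm] using this
      · have := congrFun (congrFun hB2.2.2.1 ()) m
        rw [borderCoeff_eq h]
        simpa [Matrix.mul_apply, mul_comm] using this
    · have hN : Even (d + 2) := (Nat.not_even_iff_odd.1 hd).add_one
      have ha0 : a = 0 := coeff_unique fun u => by rw [← ha, if_neg hd]; simp
      have hinv := mul_eq_one_comm.1 (skewGram_mul_eq_one h hN)
      have hB : skewGram (d + 2) s * Matrix.of q = Matrix.of fun l m => if l = m then Z else 0 := by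
        ext l m
        rw [Matrix.mul_apply, Matrix.of_apply, ← hmat l m, ha0]
        simp
      have hB2 := congrArg (fun M => (Matrix.of fun m n : Fin (d + 2) =>
        (coeffEntry (d + 2) (tinv s) m n : ℂ)) * M) hB
      simp only [← Matrix.mul_assoc] at hB2
      rw [hinv, Matrix.one_mul] at hB2
      refine ⟨fun n m => ?_, fun m => ?_⟩
      · have := congrFun (congrFun hB2 n) m
        rw [coeff_eq h]
        simpa [Matrix.mul_apply, mul_comm] using this
      · rw [ha0, borderCoeff, if_pos hN]
        simp
  refine ⟨fun z u => ?_, fun u => ?_⟩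
  · rw [hq, Finset.mul_sum]
    refine Finset.sum_congr rfl fun n _ => ?_
    rw [Finset.mul_sum]
    refine Finset.sum_congr rfl fun m _ => ?_
    rw [main.1, mul_assoc]
  · rw [ha, Finset.mul_sum, ← Finset.sum_neg_distrib]
    refine Finset.sum_congr rfl fun m _ => ?_
    rw [main.2]; ring

/-! ### The densities of the roots -/

theorem integral_dens_mul_kappa {s : ℝ≥0∞} {d : ℕ} (h : ((d + 2 : ℕ) : ℝ≥0∞) < s) (u v : ℂ) :
    ((∫ b : Fin (d + 2) → ℝ, dens s b : ℝ) : ℂ) * kappa (d + 2) s u v =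
      -2 * (weight s u * weight s v : ℝ) * ((u - v) * mom s d u v) := by
  rw [mom_comm, (moments_eq h).1, kappa]
  simp only [Finset.mul_sum, wMon]
  refine Finset.sum_congr rfl fun n _ => Finset.sum_congr rfl fun m _ => ?_
  push_cast
  ring

/-- The ε-term and the border term of the entry are exactly the two terms of `signMean_eq` at u = x.
-/
theorem integral_dens_mul_kernel_real {s : ℝ≥0∞} {d : ℕ} (h : ((d + 2 : ℕ) : ℝ≥0∞) < s) (x : ℝ) :
    ((∫ b : Fin (d + 2) → ℝ, dens s b : ℝ) : ℂ) * kernel (d + 2) s x x 0 1 =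
      weight s x * signMean s (d + 1) x x := by
  set Z : ℂ := ((∫ b : Fin (d + 2) → ℝ, dens s b : ℝ) : ℂ) with hZ
  have h1 : kernel (d + 2) s x x 0 1 = 1 / 2 * (∫ t : ℝ, kappa (d + 2) s x t *
      (Real.sign (t - x) : ℝ)) + border (d + 2) s x := by
    simp [kernel, eps, chiReal]
  have h2 : Z * border (d + 2) s x =
      weight s x * if Even (d + 1) then mean s (d + 1) x else 0 := by
    rw [(moments_eq h).2, border, ← hZ]
    simp only [wMon, ← mul_assoc, ← Finset.sum_mul]
    ring
  have h3 : Z * ∫ t : ℝ, kappa (d + 2) s x t * (Real.sign (t - x) : ℝ) =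
      2 * (weight s x * ∫ y : ℝ, ((weight s y * Real.sign (x - y) : ℝ) : ℂ) *
        ((x - y) * mom s d x y)) := by
    rw [← integral_const_mul, ← integral_const_mul, ← integral_const_mul]
    congr 1
    ext t
    have e1 : Real.sign (x - t) = -Real.sign (t - x) := by
      rw [← Real.sign_neg, neg_sub]
    rw [← mul_assoc, integral_dens_mul_kappa h, e1]
    push_cast
    ring
  rw [h1, signMean_eq h, mul_add, mul_add, h2, ← mul_assoc, mul_comm Z, mul_assoc, h3]
  ring

/-- Here ε evaluates ϰ_N at (z, z̄), and the factor z - z̄ supplies the Jacobian factor |Im z|. -/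
theorem integral_dens_mul_kernel_nonreal {s : ℝ≥0∞} {d : ℕ} (h : ((d + 2 : ℕ) : ℝ≥0∞) < s) {z : ℂ}
    (hz : z.im ≠ 0) :
    ((∫ b : Fin (d + 2) → ℝ, dens s b : ℝ) : ℂ) * kernel (d + 2) s z z 0 1 =
      (4 * |z.im| * weight s z ^ 2 : ℝ) * mom s d z (conj z) := by
  set Z : ℂ := ((∫ b : Fin (d + 2) → ℝ, dens s b : ℝ) : ℂ) with hZ
  have h1 : kernel (d + 2) s z z 0 1 = iota z * kappa (d + 2) s z (conj z) := by
    simp [kernel, eps, chiReal, hz]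
  have h2 : z - conj z = 2 * Complex.I * z.im := by
    have := Complex.sub_conj z
    push_cast at this
    linear_combination this
  have h3 := congrArg (fun t : ℝ => (t : ℂ)) (sign_mul_self z.im)
  push_cast at h3
  rw [h1, mul_left_comm, integral_dens_mul_kappa h, weight_conj, h2, iota]
  push_cast
  rw [← h3]
  have hI := Complex.I_mul_I
  linear_combination (-4 * (weight s z : ℂ) ^ 2 * (Real.sign z.im : ℂ) * z.im *
    mom s d z (conj z)) * hI

/-! ### The expected number of roots -/

theorem rootCount_eq_sum {d : ℕ} (B : Set ℂ) {b : Fin d → ℝ} (hb : (monicPoly b).roots.Nodup) :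
    (rootCount B b : ℂ) = ∑ x ∈ realRoots b, B.indicator 1 (x : ℂ) +
      ∑ z ∈ nonrealRoots b, B.indicator 1 z := by
  classical
  rw [← sum_roots_toFinset b (fun z => B.indicator 1 z), Finset.sum, Multiset.toFinset_val,
    hb.dedup, rootCount, ← Multiset.countP_eq_card_filter]
  induction (monicPoly b).roots using Multiset.induction_on with
  | empty => simp
  | cons a t ih =>
    rw [Multiset.countP_cons, Multiset.map_cons, Multiset.sum_cons, Nat.cast_add, ih, add_comm]
    by_cases h : a ∈ B <;> simp [h]

theorem integral_sum_real_roots_indicator {s : ℝ≥0∞} {d : ℕ} (h : ((d + 2 : ℕ) : ℝ≥0∞) < s)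
    {B : Set ℂ} (hB : MeasurableSet B) :
    Integrable (fun b : Fin (d + 2) → ℝ => ∑ x ∈ realRoots b,
        B.indicator (1 : ℂ → ℂ) x * (dens s b : ℂ)) ∧
      Integrable (fun x : ℝ => B.indicator (1 : ℂ → ℂ) x *
        (weight s x * signMean s (d + 1) x x)) ∧
      ∫ b : Fin (d + 2) → ℝ, ∑ x ∈ realRoots b, B.indicator (1 : ℂ → ℂ) x * (dens s b : ℂ) =
      ∫ x : ℝ, B.indicator (1 : ℂ → ℂ) x * (weight s x * signMean s (d + 1) x x) := by
  set F : ℝ × (Fin (d + 1) → ℝ) → ℂ := fun p => B.indicator (1 : ℂ → ℂ) p.1 * (weight s p.1 *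
    ((Real.sign ((polyR p.2).eval p.1) : ℂ) * (ev p.2 p.1 * (dens s p.2 : ℂ)))) with hF
  have hpull : (fun p : ℝ × (Fin (d + 1) → ℝ) => |(polyR p.2).eval p.1| •
      (B.indicator (1 : ℂ → ℂ) p.1 * (dens s (mulVec 1 (linFactor p.1) p.2) : ℂ))) = F := by
    ext p
    rw [dens_mulVec_one, Complex.real_smul, hF]
    simp only [ev_ofReal]
    have h2 := congrArg (fun t : ℝ => (t : ℂ)) (sign_mul_self ((polyR p.2).eval p.1))
    push_cast at h2 ⊢
    rw [← h2]
    ring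
  have hind : Measurable (B.indicator (1 : ℂ → ℂ)) := measurable_one.indicator hB
  have hint : Integrable F := by
    have hw := integrable_max_pow_mul_weight (s := s) (k := d + 1) h
    refine integrable_of_norm_le_mul (g := fun y => (d + 2) *
      (max 1 ‖(y : ℂ)‖ ^ (d + 1) * weight s y)) (h := fun c => (1 + ‖c‖) ^ 1 * dens s c) ?_
      (hw.const_mul _) (integrable_pow_mul_dens h) (fun p => ?_)
    · have h1 := measurable_weight s
      have h2 := measurable_dens s (d + 1)
      have h5 := Complex.measurable_ofReal.comp (measurable_sign.comp (measurable_eval_polyR (d := d + 1)))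
      have h6 := measurable_ev_real (d := d + 1)
      refine Measurable.mul (by fun_prop) (Measurable.mul (by fun_prop) (h5.mul (h6.mul (by fun_prop))))
    · have hw0 := weight_nonneg s (p.1 : ℂ)
      have hd0 := dens_nonneg s p.2
      have hi : ‖B.indicator (1 : ℂ → ℂ) p.1‖ ≤ 1 := by
        by_cases hp : (p.1 : ℂ) ∈ B <;> simp [hp]
      have hev := norm_ev_le p.2 p.1
      push_cast at hev
      simp only [hF, norm_mul, Complex.norm_real (weight _ _), Complex.norm_real (dens _ _),
        Complex.norm_real (Real.sign _), Real.norm_eq_abs, abs_of_nonneg hw0, abs_of_nonneg hd0]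
      calc ‖B.indicator (1 : ℂ → ℂ) p.1‖ * (weight s p.1 * (|Real.sign ((polyR p.2).eval p.1)| *
            (‖ev p.2 p.1‖ * dens s p.2)))
          ≤ 1 * (weight s p.1 * (1 * (((d + 1 + 1) * max 1 ‖(p.1 : ℂ)‖ ^ (d + 1) * (1 + ‖p.2‖)) *
            dens s p.2))) := by
            gcongr
            exact abs_sign_le _
        _ = _ := by ring
  obtain ⟨h1, h2⟩ := integral_sum_real_roots (d := d + 1) (ψ := fun x b =>
    B.indicator (1 : ℂ → ℂ) x * (dens s b : ℂ)) (by rw [hpull]; exact hint)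
  have e : (fun x : ℝ => B.indicator (1 : ℂ → ℂ) x * (weight s x * signMean s (d + 1) x x)) =
      fun x => ∫ h, F (x, h) := by
    ext x
    simp only [hF, integral_const_mul]
    rfl
  rw [hpull, Measure.volume_eq_prod, integral_prod _ hint] at h2
  refine ⟨h1, ?_, ?_⟩
  · rw [e]; exact Integrable.integral_prod_left hint
  · rw [e]; exact h2

theorem integral_sum_nonreal_roots_indicator {s : ℝ≥0∞} {d : ℕ} (h : ((d + 2 : ℕ) : ℝ≥0∞) < s)
    {B : Set ℂ} (hB : MeasurableSet B) :
    Integrable (fun b : Fin (d + 2) → ℝ => ∑ z ∈ nonrealRoots b,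
        B.indicator (1 : ℂ → ℂ) z * (dens s b : ℂ)) ∧
      Integrable (fun z : ℂ => B.indicator (1 : ℂ → ℂ) z *
        ((4 * |z.im| * weight s z ^ 2 : ℝ) * mom s d z (conj z))) ∧
      ∫ b : Fin (d + 2) → ℝ, ∑ z ∈ nonrealRoots b, B.indicator (1 : ℂ → ℂ) z * (dens s b : ℂ) =
      ∫ z : ℂ, B.indicator (1 : ℂ → ℂ) z *
        ((4 * |z.im| * weight s z ^ 2 : ℝ) * mom s d z (conj z)) := by
  set F : ℂ × (Fin d → ℝ) → ℂ := fun p => B.indicator (1 : ℂ → ℂ) p.1 *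
    ((4 * |p.1.im| * weight s p.1 ^ 2 : ℝ) * (ev p.2 (conj p.1) * ev p.2 p.1 * (dens s p.2 : ℂ)))
    with hF
  have hpull : (fun p : ℂ × (Fin d → ℝ) => (4 * |p.1.im| * ‖ev p.2 p.1‖ ^ 2) •
      (B.indicator (1 : ℂ → ℂ) p.1 * (dens s (mulVec 2 (quadFactor p.1) p.2) : ℂ))) = F := by
    ext p
    rw [dens_mulVec_two, Complex.real_smul, hF]
    simp only [ev_conj]
    have h5 : ((‖ev p.2 p.1‖ : ℝ) : ℂ) ^ 2 = conj (ev p.2 p.1) * ev p.2 p.1 := by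
      rw [mul_comm, Complex.mul_conj, Complex.normSq_eq_norm_sq]; push_cast; rfl
    push_cast
    rw [h5]
    ring
  have hind : Measurable (B.indicator (1 : ℂ → ℂ)) := measurable_one.indicator hB
  have hint : Integrable F := by
    have hw := integrable_max_pow_mul_weight_sq (s := s) (k := d + 1) h
    refine integrable_of_norm_le_mul (g := fun z => (4 * (d + 1) ^ 2) *
      (max 1 ‖z‖ ^ (d + 1) * weight s z) ^ 2) (h := fun c => (1 + ‖c‖) ^ 2 * dens s c) ?_
      (hw.const_mul _) (integrable_pow_mul_dens h) (fun p => ?_)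
    · have h1 := measurable_weight s
      have h2 := measurable_dens s d
      have h3 := measurable_ev_swap (d := d)
      have h4 : Measurable fun p : ℂ × (Fin d → ℝ) => |p.1.im| := by fun_prop
      have h5 : Measurable fun p : ℂ × (Fin d → ℝ) => ev p.2 (conj p.1) := by
        simp only [ev_conj]
        exact Complex.continuous_conj.measurable.comp h3
      refine Measurable.mul (by fun_prop) (Measurable.mul (by fun_prop)
        ((h5.mul h3).mul (by fun_prop)))
    · have hw0 := weight_nonneg s p.1
      have hd0 := dens_nonneg s p.2
      have hm := le_max_left 1 ‖p.1‖
      have hi : ‖B.indicator (1 : ℂ → ℂ) p.1‖ ≤ 1 := by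
        by_cases hp : p.1 ∈ B <;> simp [hp]
      have him : |p.1.im| ≤ max 1 ‖p.1‖ ^ 2 :=
        (Complex.abs_im_le_norm _).trans ((le_max_right 1 _).trans (le_self_pow₀ hm two_ne_zero))
      simp only [hF, norm_mul, Complex.norm_real (dens _ _), Complex.norm_real (_ * _), ev_conj,
        RCLike.norm_conj, Real.norm_eq_abs, abs_of_nonneg hd0, abs_abs, abs_pow,
        abs_of_nonneg hw0, Nat.abs_ofNat]
      calc ‖B.indicator (1 : ℂ → ℂ) p.1‖ * (4 * |p.1.im| * weight s p.1 ^ 2 *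
            (‖ev p.2 p.1‖ * ‖ev p.2 p.1‖ * dens s p.2))
          ≤ 1 * (4 * max 1 ‖p.1‖ ^ 2 * weight s p.1 ^ 2 *
            (((d + 1) * max 1 ‖p.1‖ ^ d * (1 + ‖p.2‖)) * ((d + 1) * max 1 ‖p.1‖ ^ d * (1 + ‖p.2‖)) *
              dens s p.2)) := by
            gcongr
            · exact norm_ev_le _ _
            · exact norm_ev_le _ _
        _ = _ := by ring
  obtain ⟨h1, h2⟩ := integral_sum_nonreal_roots (d := d) (ψ := fun z b =>
    B.indicator (1 : ℂ → ℂ) z * (dens s b : ℂ)) (by rw [hpull]; exact hint)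
  have e : (fun z : ℂ => B.indicator (1 : ℂ → ℂ) z *
      ((4 * |z.im| * weight s z ^ 2 : ℝ) * mom s d z (conj z))) = fun z => ∫ c, F (z, c) := by
    ext z
    simp only [hF, integral_const_mul]
    rfl
  rw [hpull, Measure.volume_eq_prod, integral_prod _ hint] at h2
  refine ⟨h1, ?_, ?_⟩
  · rw [e]; exact Integrable.integral_prod_left hint
  · rw [e]; exact h2

/-- The density of the roots: the diagonal of the upper right entry of the kernel. -/
noncomputable def rootDensity (N : ℕ) (s : ℝ≥0∞) (z : ℂ) : ℝ := (kernel N s z z 0 1).re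

/-- The set of real numbers belonging to a set of complex numbers. -/
def realPart (B : Set ℂ) : Set ℝ := {x | (x : ℂ) ∈ B}

/-- The set of non-real elements of a set of complex numbers. -/
def nonrealPart (B : Set ℂ) : Set ℂ := {z | z ∈ B ∧ z.im ≠ 0}

theorem measurableSet_realPart {B : Set ℂ} (hB : MeasurableSet B) : MeasurableSet (realPart B) :=
  hB.preimage Complex.measurable_ofReal

theorem measurableSet_nonrealPart {B : Set ℂ} (hB : MeasurableSet B) :
    MeasurableSet (nonrealPart B) :=
  hB.inter ((measurableSet_singleton (0 : ℝ)).compl.preimage Complex.measurable_im)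

theorem signMean_self (s : ℝ≥0∞) (d : ℕ) (x : ℝ) :
    signMean s d x x = ((∫ h : Fin d → ℝ, |(polyR h).eval x| * dens s h : ℝ) : ℂ) := by
  rw [signMean, ← integral_complex_ofReal]
  congr 1
  ext h
  have h2 := congrArg (fun t : ℝ => (t : ℂ)) (sign_mul_self ((polyR h).eval x))
  rw [ev_ofReal]
  push_cast at h2 ⊢
  rw [← h2]
  ring

theorem rootDensity_real {s : ℝ≥0∞} {d : ℕ} (h : ((d + 2 : ℕ) : ℝ≥0∞) < s) (x : ℝ) :
    0 ≤ rootDensity (d + 2) s x ∧ ((∫ b : Fin (d + 2) → ℝ, dens s b : ℝ) : ℂ) *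
      (rootDensity (d + 2) s x : ℂ) = weight s x * signMean s (d + 1) x x := by
  have h0 := integral_dens_pos h
  have h1 := integral_dens_mul_kernel_real h x
  rw [signMean_self] at h1 ⊢
  have h2 := congrArg Complex.re h1
  rw [Complex.re_ofReal_mul, ← Complex.ofReal_mul, Complex.ofReal_re] at h2
  constructor
  · have h3 : 0 ≤ weight s x * ∫ h : Fin (d + 1) → ℝ, |(polyR h).eval x| * dens s h :=
      mul_nonneg (weight_nonneg s _) (integral_nonneg fun h =>
        mul_nonneg (abs_nonneg _) (dens_nonneg s h))
    rw [← h2] at h3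
    exact nonneg_of_mul_nonneg_right h3 h0
  · rw [← Complex.ofReal_mul, ← Complex.ofReal_mul, rootDensity, h2]

theorem rootDensity_nonreal {s : ℝ≥0∞} {d : ℕ} (h : ((d + 2 : ℕ) : ℝ≥0∞) < s) {z : ℂ}
    (hz : z.im ≠ 0) : ((∫ b : Fin (d + 2) → ℝ, dens s b : ℝ) : ℂ) *
      (rootDensity (d + 2) s z : ℂ) = (4 * |z.im| * weight s z ^ 2 : ℝ) * mom s d z (conj z) := by
  have h1 := integral_dens_mul_kernel_nonreal h hz
  have h3 : mom s d z (conj z) = ((∫ c : Fin d → ℝ, ‖ev c z‖ ^ 2 * dens s c : ℝ) : ℂ) := by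
    rw [mom, ← integral_complex_ofReal]
    congr 1
    ext c
    have h5 : ((‖ev c z‖ : ℝ) : ℂ) ^ 2 = conj (ev c z) * ev c z := by
      rw [mul_comm, Complex.mul_conj, Complex.normSq_eq_norm_sq]; push_cast; rfl
    rw [ev_conj]
    push_cast
    rw [h5]
  rw [h3] at h1 ⊢
  have h2 := congrArg Complex.re h1
  rw [Complex.re_ofReal_mul, ← Complex.ofReal_mul, Complex.ofReal_re] at h2
  rw [← Complex.ofReal_mul, ← Complex.ofReal_mul, rootDensity, h2]

/-- For almost every b the roots are simple, so the count with multiplicity is the sum of indicators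
over the finite root sets; the two root formulas then produce the kernel densities. The function g
is the real part of the complex-valued sum and agrees with the weighted count almost everywhere. -/
theorem integrableOn_rootDensity {s : ℝ≥0∞} {d : ℕ} (h : ((d + 2 : ℕ) : ℝ≥0∞) < s) {B : Set ℂ}
    (hB : MeasurableSet B) :
    IntegrableOn (fun x : ℝ => rootDensity (d + 2) s x) (realPart B) ∧
    IntegrableOn (rootDensity (d + 2) s) (nonrealPart B) ∧
    ∃ g : (Fin (d + 2) → ℝ) → ℝ, Integrable g ∧ (∀ᵐ b, g b = rootCount B b * dens s b) ∧
      ∫ b, g b = (∫ b : Fin (d + 2) → ℝ, dens s b) *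
        ((∫ x in realPart B, rootDensity (d + 2) s x) + ∫ z in nonrealPart B, rootDensity (d + 2) s z) := by
  have hZ := integral_dens_pos h
  set Z : ℝ := ∫ b : Fin (d + 2) → ℝ, dens s b with hZdef
  have hZ' : (Z : ℂ) ≠ 0 := by exact_mod_cast hZ.ne'
  obtain ⟨r1, r2, r3⟩ := integral_sum_real_roots_indicator h hB
  obtain ⟨c1, c2, c3⟩ := integral_sum_nonreal_roots_indicator h hB
  have er : (fun x : ℝ => B.indicator (1 : ℂ → ℂ) x * (weight s x * signMean s (d + 1) x x)) =
      fun x => (Z : ℂ) * (((realPart B).indicator (fun x : ℝ => rootDensity (d + 2) s x) x : ℝ) : ℂ) := by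
    ext x
    rw [← (rootDensity_real h x).2]
    by_cases hx : (x : ℂ) ∈ B
    · rw [Set.indicator_of_mem hx, Set.indicator_of_mem (show x ∈ realPart B from hx)]
      simp [hZdef]
    · rw [Set.indicator_of_notMem hx, Set.indicator_of_notMem (show x ∉ realPart B from hx)]
      simp
  have ec : (fun z : ℂ => B.indicator (1 : ℂ → ℂ) z *
      ((4 * |z.im| * weight s z ^ 2 : ℝ) * mom s d z (conj z))) =
      fun z => (Z : ℂ) * (((nonrealPart B).indicator (rootDensity (d + 2) s) z : ℝ) : ℂ) := by
    ext z
    by_cases hz : z ∈ nonrealPart B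
    · rw [← rootDensity_nonreal h hz.2, Set.indicator_of_mem hz.1, Set.indicator_of_mem hz]
      simp [hZdef]
    · rw [Set.indicator_of_notMem hz]
      by_cases hz1 : z ∈ B
      · have : z.im = 0 := by
          by_contra h0
          exact hz ⟨hz1, h0⟩
        simp [this]
      · simp [hz1]
  rw [er] at r2 r3
  rw [ec] at c2 c3
  have hr : Integrable ((realPart B).indicator fun x : ℝ => rootDensity (d + 2) s x) := by
    have := (r2.const_mul (Z : ℂ)⁻¹).re
    simpa [hZ', ← mul_assoc] using this
  have hc : Integrable ((nonrealPart B).indicator (rootDensity (d + 2) s)) := by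
    have := (c2.const_mul (Z : ℂ)⁻¹).re
    simpa [hZ', ← mul_assoc] using this
  refine ⟨(integrable_indicator_iff (measurableSet_realPart hB)).1 hr,
    (integrable_indicator_iff (measurableSet_nonrealPart hB)).1 hc, ?_⟩
  have hsum := r1.add c1
  have hI := integral_add r1 c1
  rw [r3, c3, integral_const_mul, integral_const_mul, integral_complex_ofReal,
    integral_complex_ofReal, integral_indicator (measurableSet_realPart hB),
    integral_indicator (measurableSet_nonrealPart hB)] at hI
  refine ⟨_, hsum.re, ?_, ?_⟩
  · filter_upwards [ae_quot_realRoots_ne_zero (d + 1), ae_quot_nonrealRoots_ne_zero d] with b hr hn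
    have h1 := rootCount_eq_sum B (nodup_roots hr hn)
    rw [Pi.add_apply, ← Finset.sum_mul, ← Finset.sum_mul, ← add_mul, ← h1]
    simp
  · have h2 := integral_re hsum
    simp only [Pi.add_apply] at h2 ⊢
    rw [h2, hI]
    simp [mul_add]

theorem expectedRoots_eq {s : ℝ≥0∞} {d : ℕ} (h : ((d + 2 : ℕ) : ℝ≥0∞) < s) {B : Set ℂ}
    (hB : MeasurableSet B) :
    expectedRoots (d + 2) s B = ENNReal.ofReal
      ((∫ x in realPart B, rootDensity (d + 2) s x) + ∫ z in nonrealPart B, rootDensity (d + 2) s z) := by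
  obtain ⟨-, -, g, hg, hge, hgi⟩ := integrableOn_rootDensity h hB
  have hZ := integral_dens_pos h
  have hdens : ∫⁻ b : Fin (d + 2) → ℝ, density (d + 2) s b =
      ENNReal.ofReal (∫ b : Fin (d + 2) → ℝ, dens s b) :=
    (ofReal_integral_eq_lintegral_ofReal (integrable_dens h)
      (Eventually.of_forall fun b => dens_nonneg s b)).symm
  have hmeas : Measurable (density (d + 2) s) := (measurable_dens s (d + 2)).ennreal_ofReal
  have hcount : ∫⁻ b, density (d + 2) s b * (rootCount B b : ℝ≥0∞) = ENNReal.ofReal (∫ b, g b) := by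
    rw [ofReal_integral_eq_lintegral_ofReal hg]
    · refine lintegral_congr_ae ?_
      filter_upwards [hge] with b hb
      rw [hb, mul_comm (rootCount B b : ℝ), ENNReal.ofReal_mul (dens_nonneg s b),
        ENNReal.ofReal_natCast]
      rfl
    · filter_upwards [hge] with b hb
      rw [hb]
      exact mul_nonneg (Nat.cast_nonneg _) (dens_nonneg s b)
  -- Measurability of the root count is bypassed: the density is measurable and finite, and the
  -- count is only known to agree almost everywhere with an integrable function.
  rw [expectedRoots, polyLaw, lintegral_smul_measure,
    lintegral_withDensity_eq_lintegral_mul_non_measurable _ hmeas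
      (Eventually.of_forall fun b => ENNReal.ofReal_lt_top)]
  simp only [Pi.mul_apply]
  rw [hcount, hdens, hgi, smul_eq_mul, ENNReal.ofReal_mul hZ.le, ← mul_assoc,
    ENNReal.inv_mul_cancel (by simpa using hZ) ENNReal.ofReal_ne_top, one_mul]

/-! ### The limit of the expected number of roots -/

/-- Locally uniform convergence on the product is uniform on K × K and is then restricted to the
diagonal. -/
theorem tendstoUniformlyOn_rootDensity {s : ℕ → ℝ≥0∞} (hs : ∀ N : ℕ, (N : ℝ≥0∞) < s N) {K : Set ℂ}
    (hK : IsCompact K) (hK1 : K ⊆ Metric.ball 0 1) :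
    TendstoUniformlyOn (fun (N : ℕ) z => rootDensity N (s N) z)
      (fun z => (kernelOf diskA z z 0 1).re) atTop K := by
  have h1 := (tendstoLocallyUniformlyOn_iff_tendstoUniformlyOn_of_compact (hK.prod hK)).1
    ((tendsto_kernel hs).mono (Set.prod_mono hK1 hK1))
  have h2 : UniformContinuous fun M : Matrix (Fin 2) (Fin 2) ℂ => (M 0 1).re :=
    Complex.reCLM.uniformContinuous.comp ((Pi.uniformContinuous_proj _ (1 : Fin 2)).comp
      (Pi.uniformContinuous_proj _ (0 : Fin 2)))
  have h3 := (h2.comp_tendstoUniformlyOn h1).comp (fun z : ℂ => (z, z))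
  exact h3.mono fun z hz => ⟨hz, hz⟩

theorem tendsto_integral_of_tendstoUniformlyOn {α : Type*} [MeasurableSpace α] {μ : Measure α}
    {E : Set α} (hE : MeasurableSet E) (hμ : μ E < ⊤) {f : ℕ → α → ℝ} {g : α → ℝ}
    (h : TendstoUniformlyOn f g atTop E) (hf : ∀ᶠ N in atTop, IntegrableOn (f N) E μ) :
    IntegrableOn g E μ ∧ Tendsto (fun N => ∫ x in E, f N x ∂μ) atTop (𝓝 (∫ x in E, g x ∂μ)) := by
  have h1 := Metric.tendstoUniformlyOn_iff.1 h 1 one_pos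
  obtain ⟨N0, hN0⟩ := eventually_atTop.1 (h1.and hf)
  -- From some N0 on all f N lie within 1 of g, so |g| ≤ |f N0| + 1 and |f N| ≤ |f N0| + 2.
  have hbound : IntegrableOn (fun x => |f N0 x| + 2) E μ :=
    (hN0 N0 le_rfl).2.abs.add (integrableOn_const hμ.ne)
  have hlim : ∀ᵐ x ∂μ.restrict E, Tendsto (fun N => f N x) atTop (𝓝 (g x)) :=
    (ae_restrict_iff' hE).2 (Eventually.of_forall fun x hx => h.tendsto_at hx)
  have hgb : ∀ x ∈ E, |g x| ≤ |f N0 x| + 1 := by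
    intro x hx
    have := (hN0 N0 le_rfl).1 x hx
    rw [Real.dist_eq] at this
    have h3 := abs_sub_abs_le_abs_sub (g x) (f N0 x)
    linarith
  refine ⟨hbound.mono' ?_ ?_, ?_⟩
  · refine aestronglyMeasurable_of_tendsto_ae atTop (f := fun N => f (N + N0)) (fun N =>
      (hN0 _ (by omega)).2.aestronglyMeasurable) ?_
    filter_upwards [hlim] with x hx
    exact hx.comp (tendsto_add_atTop_nat N0)
  · refine (ae_restrict_iff' hE).2 (Eventually.of_forall fun x hx => ?_)
    rw [Real.norm_eq_abs]
    linarith [hgb x hx]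
  · refine tendsto_integral_filter_of_dominated_convergence (fun x => |f N0 x| + 2) ?_ ?_ hbound hlim
    · filter_upwards [hf] with N hN using hN.aestronglyMeasurable
    · filter_upwards [h1] with N hN
      refine (ae_restrict_iff' hE).2 (Eventually.of_forall fun x hx => ?_)
      have h2 := hN x hx
      rw [dist_comm, Real.dist_eq] at h2
      have h3 := abs_sub_abs_le_abs_sub (f N x) (g x)
      rw [Real.norm_eq_abs]
      linarith [hgb x hx]

theorem volume_nonrealPart_pos {B : Set ℂ} (hi : (interior B).Nonempty) :
    0 < volume (nonrealPart B) := by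
  have hopen : IsOpen (interior B ∩ {z : ℂ | z.im ≠ 0}) :=
    isOpen_interior.inter (isOpen_ne_fun Complex.continuous_im continuous_const)
  have hne : (interior B ∩ {z : ℂ | z.im ≠ 0}).Nonempty := by
    obtain ⟨z, hz⟩ := hi
    by_cases h : z.im = 0
    · obtain ⟨ε, hε, hb⟩ := Metric.isOpen_iff.1 isOpen_interior z hz
      refine ⟨z + (ε / 2 : ℝ) * Complex.I, hb ?_, ?_⟩
      · rw [Metric.mem_ball, dist_eq_norm, add_sub_cancel_left, norm_mul, Complex.norm_I, mul_one,
          Complex.norm_real, Real.norm_of_nonneg (by positivity)]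
        linarith
      · show (z + (ε / 2 : ℝ) * Complex.I).im ≠ 0
        rw [Complex.add_im, h, Complex.im_ofReal_mul, Complex.I_im]
        linarith
    · exact ⟨z, hz, h⟩
  refine (hopen.measure_pos volume hne).trans_le (measure_mono fun z hz => ?_)
  exact ⟨interior_subset hz.1, hz.2⟩

/-- Both parts of B have finite measure and lie in a compact subset of the disk, so uniform
convergence of the densities gives convergence of the integrals. -/
theorem tendsto_expectedRoots {s : ℕ → ℝ≥0∞} (hs : ∀ N : ℕ, (N : ℝ≥0∞) < s N) {B : Set ℂ}
    (hB : MeasurableSet B) (hi : (interior B).Nonempty) (hc : closure B ⊆ Metric.ball (0 : ℂ) 1) :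
    ∃ L : ℝ≥0∞, 0 < L ∧ L < ⊤ ∧
      Tendsto (fun N : ℕ => expectedRoots N (s N) B) atTop (𝓝 L) := by
  have hK : IsCompact (closure B) := Metric.isCompact_of_isClosed_isBounded isClosed_closure
    (Metric.isBounded_ball.subset hc)
  have hU := tendstoUniformlyOn_rootDensity hs hK hc
  have hint : ∀ᶠ N in atTop, IntegrableOn (fun x : ℝ => rootDensity N (s N) x) (realPart B) ∧
      IntegrableOn (rootDensity N (s N)) (nonrealPart B) ∧
      (∀ x : ℝ, 0 ≤ rootDensity N (s N) x) ∧
      expectedRoots N (s N) B = ENNReal.ofReal ((∫ x in realPart B, rootDensity N (s N) x) +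
        ∫ z in nonrealPart B, rootDensity N (s N) z) := by
    filter_upwards [eventually_ge_atTop 2] with N hN
    obtain ⟨d, rfl⟩ : ∃ d, N = d + 2 := ⟨N - 2, by omega⟩
    obtain ⟨h1, h2, -⟩ := integrableOn_rootDensity (hs (d + 2)) hB
    exact ⟨h1, h2, fun x => (rootDensity_real (hs (d + 2)) x).1, expectedRoots_eq (hs (d + 2)) hB⟩
  have hsub : ∀ z ∈ nonrealPart B, z ∈ closure B := fun z hz => subset_closure hz.1
  have hvC : volume (nonrealPart B) < ⊤ :=
    (measure_mono hsub).trans_lt hK.measure_lt_top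
  have hvR : volume (realPart B) < ⊤ := by
    refine lt_of_le_of_lt (measure_mono (t := Metric.ball (0 : ℝ) 1) fun x hx => ?_)
      measure_ball_lt_top
    have := hc (subset_closure (show (x : ℂ) ∈ B from hx))
    rw [mem_ball_zero_iff, Complex.norm_real] at this
    rwa [mem_ball_zero_iff]
  obtain ⟨c1, c2⟩ := tendsto_integral_of_tendstoUniformlyOn (measurableSet_nonrealPart hB) hvC
    (hU.mono hsub) (hint.mono fun N h => h.2.1)
  obtain ⟨-, r2⟩ := tendsto_integral_of_tendstoUniformlyOn (f := fun N (x : ℝ) => rootDensity N (s N) x)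
    (g := fun x : ℝ => (kernelOf diskA x x 0 1).re) (measurableSet_realPart hB) hvR
    ((hU.comp (fun x : ℝ => (x : ℂ))).mono fun x hx => subset_closure hx)
    (hint.mono fun N h => h.1)
  -- The real contribution is non-negative as a limit of non-negative integrals; strict positivity
  -- comes from the non-real part, which has positive area.
  have hRnonneg : 0 ≤ ∫ x in realPart B, (kernelOf diskA (x : ℝ) (x : ℝ) 0 1).re :=
    ge_of_tendsto r2 (hint.mono fun N h => integral_nonneg h.2.2.1)
  have hCpos : 0 < ∫ z in nonrealPart B, (kernelOf diskA z z 0 1).re := by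
    have hp : ∀ z ∈ nonrealPart B, 0 < (kernelOf diskA z z 0 1).re := fun z hz =>
      kernelOf_diskA_pos (by simpa using hc (hsub z hz)) hz.2
    rw [setIntegral_pos_iff_support_of_nonneg_ae ((ae_restrict_iff' (measurableSet_nonrealPart hB)).2
      (Eventually.of_forall fun z hz => (hp z hz).le)) c1]
    refine (volume_nonrealPart_pos hi).trans_le (measure_mono fun z hz => ⟨?_, hz⟩)
    exact (hp z hz).ne'
  refine ⟨ENNReal.ofReal ((∫ x in realPart B, (kernelOf diskA (x : ℝ) (x : ℝ) 0 1).re) +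
    ∫ z in nonrealPart B, (kernelOf diskA z z 0 1).re), ENNReal.ofReal_pos.2 (by linarith),
    ENNReal.ofReal_lt_top, ?_⟩
  refine ((ENNReal.continuous_ofReal.tendsto _).comp (r2.add c2)).congr' ?_
  filter_upwards [hint] with N hN
  exact hN.2.2.2.symm

end RealMahler

theorem theorem2p5 (s : ℕ → ℝ≥0∞) (hs : ∀ N : ℕ, (N : ℝ≥0∞) < s N) (lam : ℝ≥0∞)
    (hlam : Tendsto (fun N : ℕ => (N : ℝ≥0∞) / s N) atTop (𝓝 lam)) :
    TendstoLocallyUniformlyOn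
        (fun (N : ℕ) (p : ℂ × ℂ) => RealMahler.kernel N (s N) p.1 p.2)
        (fun p : ℂ × ℂ => RealMahler.kernelOf RealMahler.diskA p.1 p.2)
        atTop (Metric.ball (0 : ℂ) 1 ×ˢ Metric.ball (0 : ℂ) 1) ∧
      ∀ B : Set ℂ, MeasurableSet B → (interior B).Nonempty →
        closure B ⊆ Metric.ball (0 : ℂ) 1 →
        ∃ L : ℝ≥0∞, 0 < L ∧ L < ⊤ ∧
          Tendsto (fun N : ℕ => RealMahler.expectedRoots N (s N) B) atTop (𝓝 L) := by
  exact ⟨RealMahler.tendsto_kernel hs,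
    fun _ hB hi hc => RealMahler.tendsto_expectedRoots hs hB hi hc⟩
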